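/- Let $\Omega=\{x\in\mathbb{R}^2 : |x|>1\}$, $x^\perp=(-x_2,x_1)$, and for $\alpha,\gamma\in\mathbb{R}$ let $$V(x)=\alpha\Big(\frac{x^\perp}{|x|^2},0\Big)-\gamma\Big(\frac{x}{|x|^2},0\Big).$$ All fields below are vertically uniform, that is, functions of $x\in\Omega$ alone, with $\nabla=(\partial_1,\partial_2,\partial_z)$ and $\partial_z=0$ on them. For $s\ge 0$ let $\|f\|_{L^\infty_s}=\operatorname{ess\,sup}_{x\in\Omega}|x|^s|f(x)|$, and let $L^\infty_s(\Omega)$ be the space of measurable $f$ with $\|f\|_{L^\infty_s}<\infty$. For $n\in\mathbb{Z}$ let $\mathcal{P}_n$ be the projection on the $n$-th Fourier mode of the components in the cylindrical frame $e_r=(x/|x|,0)$, $e_\theta=(x^\perp/|x|,0)$, $e_3=(0,0,1)$: $$\mathcal{P}_n v=\sum_{k\in\{r,\theta,3\}}v_{k,n}(r)e^{in\theta}e_k,\qquad \mathcal{P}_nF=\sum_{k,l}F_{kl,n}(r)e^{in\theta}e_k\otimes e_l,\qquad s_n(r)=\frac1{2\pi}\int_0^{2\pi}s(r,t)e^{-int}\,dt.$$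 Let $\|f\|_{l^1L^\infty_s}=\sum_{n\in\mathbb{Z}}\|\mathcal{P}_nf\|_{L^\infty_s}$, and let $l^1(L^\infty_s(\Omega))$ be the space of $f=\sum_n\mathcal{P}_nf$ for which this is finite. Let $C^\infty_{0,\sigma}(\Omega)$ be the divergence-free fields in $C^\infty_0(\Omega)^2$, $L^2_\sigma(\Omega)$ its closure in $L^2$, and $\widehat W^{1,2}(\Omega)=\{\chi\in L^2_{\rm loc}(\overline\Omega):\nabla\chi\in L^2(\Omega)\}$. For $\rho>2$ and $\delta>0$ let $\mathcal{B}_\rho(\delta)$ be the set of $w\in W^{1,2}_0(\Omega)^3\cap l^1(L^\infty_{\rho-1}(\Omega))$ with $(w_1,w_2)\in L^2_\sigma(\Omega)$, $\nabla w\in l^1(L^\infty_\rho(\Omega))$ and $$\|w\|_{l^1L^\infty_{\rho-1}}+\|\nabla w\|_{l^1L^\infty_\rho}\le\delta.$$ For data $b$ on $\partial\Omega$ and a force $f=g+\operatorname{div}F$, where $(\operatorname{div}F)_j=\sum_i\partial_iF_{ij}$, a weak solution of $$-\Delta u+\nabla p=-u\cdot\nabla u+f,\quad \operatorname{div}u=0\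 \text{ in }\Omega\times\mathbb{R},\qquad u=b\ \text{ on }\partial\Omega\times\mathbb{R}$$ is a $u\in\widehat W^{1,2}(\Omega)^3$ with $\partial_1u_1+\partial_2u_2=0$ in the sense of distributions, with trace $b$ on $\partial\Omega$, and with $$\int_\Omega\nabla u\cdot\nabla\varphi=\int_\Omega(u\otimes u)\cdot\nabla\varphi+\int_\Omega g\cdot\varphi-\int_\Omega F\cdot\nabla\varphi\qquad\text{for all }\varphi\in C^\infty_{0,\sigma}(\Omega)\times C^\infty_0(\Omega),$$ where $(\nabla\varphi)_{ij}=\partial_i\varphi_j$. **Theorem.** Let $\alpha\in\mathbb{R}$, $\gamma>2$ and $2<\rho<3$ with $\rho\le\gamma$. There are $\varepsilon>0$ and $\delta>0$, depending only on $\alpha,\gamma,\rho$, such that the following holds. Let $b(x)=(\alpha x^\perp-\gamma x,0)$, and let $g\in L^\infty_{2\rho-1}(\Omega)^3$ and $F\in L^\infty_{2(\rho-1)}(\Omega)^{3\times3}$ be real-valued with $$\sum_{n\in\mathbb{Z}}\big(\|\mathcal{P}_ng\|_{L^\infty_{2\rho-1}}+\|\mathcal{P}_nF\|_{L^\infty_{2(\rho-1)}}\big)\le\varepsilon.$$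 Then there is a weak solution $u$ of the above system with $f=g+\operatorname{div}F$ and $u-V\in\mathcal{B}_\rho(\delta)$; every weak solution $u'$ with $u'-V\in\mathcal{B}_\rho(\delta)$ equals $u$ almost everywhere in $\Omega$; and $$u(x)=\alpha\Big(\frac{x^\perp}{|x|^2},0\Big)-\gamma\Big(\frac{x}{|x|^2},0\Big)+O(|x|^{-\rho+1})\qquad\text{as }|x|\to\infty.$$ -/

import Mathlib

open MeasureTheory Filter Topology
open scoped ENNReal ContDiff

namespace ExtNS

noncomputable section

/-- The horizontal plane `ℝ²` with its Euclidean norm. -/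
abbrev Plane : Type := EuclideanSpace ℝ (Fin 2)

/-- Three-component vectors with entries in `𝕜`, with the Euclidean norm. -/
abbrev Vec (𝕜 : Type) : Type := EuclideanSpace 𝕜 (Fin 3)

/-- `3 × 3` tensors with entries in `𝕜`, with the Frobenius norm. -/
abbrev Ten (𝕜 : Type) : Type := EuclideanSpace 𝕜 (Fin 3 × Fin 3)

/-- The exterior disk `Ω = {x ∈ ℝ² : |x| > 1}`. Fields on `Ω × ℝ` that do not depend on the
vertical variable `z` are functions of `x ∈ Ω`. -/
def Ω : Set Plane := {x | 1 < ‖x‖}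

/-- Lebesgue measure on `Ω`. -/
def vol : Measure Plane := volume.restrict Ω

/-- The point of the plane with polar coordinates `(r, θ)`. -/
def polarPt (r θ : ℝ) : Plane := !₂[r * Real.cos θ, r * Real.sin θ]

/-- The azimuth of a point of the plane (a choice of `θ`, determined modulo `2π`). -/
def azimuth (x : Plane) : ℝ := Complex.arg ⟨x 0, x 1⟩

/-- The rows are the orthonormal frame `e_r, e_θ, e_3` at azimuth `θ`. -/
def frame (θ : ℝ) : Matrix (Fin 3) (Fin 3) ℝ :=
  !![Real.cos θ, Real.sin θ, 0;
     -Real.sin θ, Real.cos θ, 0;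
     0, 0, 1]

/-- The `n`-th Fourier coefficient `s_n(r) = (2π)⁻¹ ∫₀^{2π} s(r, t) e^{-int} dt` of a scalar
function `s` of the polar coordinates. -/
def fourierMode (n : ℤ) (s : ℝ → ℝ → ℝ) (r : ℝ) : ℂ :=
  (1 / (2 * Real.pi) : ℝ) *
    ∫ t in (0 : ℝ)..(2 * Real.pi), (s r t : ℂ) * Complex.exp (-(Complex.I * n * t))

/-- The cylindrical components `(v_r, v_θ, v_3)` of a vector field. -/
def cylVec (v : Plane → Vec ℝ) (k : Fin 3) (r θ : ℝ) : ℝ :=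
  ∑ j, frame θ k j * v (polarPt r θ) j

/-- The cylindrical components `F_{kl}`, `k, l ∈ {r, θ, 3}`, of a tensor field
`F = ∑ F_{kl} e_k ⊗ e_l`. -/
def cylTen (F : Plane → Ten ℝ) (k l : Fin 3) (r θ : ℝ) : ℝ :=
  ∑ i, ∑ j, frame θ k i * frame θ l j * F (polarPt r θ) (i, j)

/-- `𝒫_n v = ∑_k v_{k,n}(r) e^{inθ} e_k` for a vector field `v`. -/
def projVec (n : ℤ) (v : Plane → Vec ℝ) (x : Plane) : Vec ℂ :=
  WithLp.toLp 2 fun j => ∑ k, fourierMode n (cylVec v k) ‖x‖ *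
    Complex.exp (Complex.I * n * azimuth x) * (frame (azimuth x) k j : ℂ)

/-- `𝒫_n F = ∑_{k,l} F_{kl,n}(r) e^{inθ} e_k ⊗ e_l` for a tensor field `F`. -/
def projTen (n : ℤ) (F : Plane → Ten ℝ) (x : Plane) : Ten ℂ :=
  WithLp.toLp 2 fun p => ∑ k, ∑ l, fourierMode n (cylTen F k l) ‖x‖ *
    Complex.exp (Complex.I * n * azimuth x) *
      (frame (azimuth x) k p.1 : ℂ) * (frame (azimuth x) l p.2 : ℂ)

/-- The weighted norm `‖f‖_{L^∞_s} = ess sup_{x ∈ Ω} |x|^s |f(x)|`, as an extended number. -/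
def wnorm {E : Type} [NormedAddCommGroup E] (s : ℝ) (f : Plane → E) : ℝ≥0∞ :=
  essSup (fun x => ENNReal.ofReal (‖x‖ ^ s) * ‖f x‖ₑ) vol

/-- Membership in `L^∞_s(Ω)`. -/
def MemWeighted {E : Type} [NormedAddCommGroup E] (s : ℝ) (f : Plane → E) : Prop :=
  AEStronglyMeasurable f vol ∧ wnorm s f < ⊤

/-- `‖v‖_{l¹L^∞_s} = ∑_n ‖𝒫_n v‖_{L^∞_s}` for vector fields. -/
def l1normVec (s : ℝ) (v : Plane → Vec ℝ) : ℝ≥0∞ := ∑' n : ℤ, wnorm s (projVec n v)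

/-- `‖F‖_{l¹L^∞_s} = ∑_n ‖𝒫_n F‖_{L^∞_s}` for tensor fields. -/
def l1normTen (s : ℝ) (F : Plane → Ten ℝ) : ℝ≥0∞ := ∑' n : ℤ, wnorm s (projTen n F)

/-- Membership in `l¹(L^∞_s(Ω))` for vector fields: `v = ∑_n 𝒫_n v` with finite norm. -/
def MemL1Vec (s : ℝ) (v : Plane → Vec ℝ) : Prop :=
  AEStronglyMeasurable v vol ∧
  (∀ᵐ x ∂vol, HasSum (fun n : ℤ => projVec n v x) (WithLp.toLp 2 fun j => (v x j : ℂ))) ∧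
  l1normVec s v < ⊤

/-- Membership in `l¹(L^∞_s(Ω))` for tensor fields: `F = ∑_n 𝒫_n F` with finite norm. -/
def MemL1Ten (s : ℝ) (F : Plane → Ten ℝ) : Prop :=
  AEStronglyMeasurable F vol ∧
  (∀ᵐ x ∂vol, HasSum (fun n : ℤ => projTen n F x) (WithLp.toLp 2 fun p => (F x p : ℂ))) ∧
  l1normTen s F < ⊤

/-- Test functions: smooth with compact support in `Ω`. -/
def IsTest {E : Type} [NormedAddCommGroup E] [NormedSpace ℝ E] (φ : Plane → E) : Prop :=
  ContDiff ℝ ∞ φ ∧ HasCompactSupport φ ∧ tsupport φ ⊆ Ω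

/-- The coordinate directions in which `∂₁, ∂₂, ∂_z` differentiate a function of `x` alone;
`∂_z` of such a function is `0`. -/
def dir : Fin 3 → Plane := ![EuclideanSpace.single 0 1, EuclideanSpace.single 1 1, 0]

/-- The partial derivatives `∂₁, ∂₂, ∂_z` (indices `0, 1, 2`) of a function of `x`. -/
def pd {E : Type} [NormedAddCommGroup E] [NormedSpace ℝ E] (i : Fin 3) (φ : Plane → E)
    (x : Plane) : E :=
  fderiv ℝ φ x (dir i)

/-- The gradient tensor `(∇φ)_{ij} = ∂_i φ_j` of a smooth vertically uniform vector field. -/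
def grad (φ : Plane → Vec ℝ) (x : Plane) : Ten ℝ :=
  WithLp.toLp 2 fun p => pd p.1 φ x p.2

/-- `Du` is the weak gradient of `u` on `Ω`: `(Du)_{ij} = ∂_i u_j` in the sense of distributions.
The row `i = 2` (the vertical derivative) is then zero almost everywhere. -/
def IsWeakGrad (u : Plane → Vec ℝ) (Du : Plane → Ten ℝ) : Prop :=
  LocallyIntegrableOn u Ω ∧ LocallyIntegrableOn Du Ω ∧
  ∀ φ : Plane → ℝ, IsTest φ → ∀ i j : Fin 3,
    ∫ x, u x j * pd i φ x ∂vol = - ∫ x, Du x (i, j) * φ x ∂vol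

/-- The horizontal divergence of a vector field `φ`, which is its full divergence if `φ` does not
depend on `z`. -/
def divh (φ : Plane → Vec ℝ) (x : Plane) : ℝ := pd 0 φ x 0 + pd 1 φ x 1

/-- `∂₁ u₁ + ∂₂ u₂ = 0` on `Ω` in the sense of distributions. -/
def WeakDivFree (u : Plane → Vec ℝ) : Prop :=
  ∀ φ : Plane → ℝ, IsTest φ → ∫ x, (u x 0 * pd 0 φ x + u x 1 * pd 1 φ x) ∂vol = 0

/-- `u`, with weak gradient `Du`, has the trace `b` on `∂Ω = {|x| = 1}`: it is approximated in
`W^{1,2}` near the circle by functions that are smooth up to the boundary and whose restrictions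
to the circle converge to `b` in `L²(∂Ω)`. -/
def HasTrace (u : Plane → Vec ℝ) (Du : Plane → Ten ℝ) (b : Plane → Vec ℝ) : Prop :=
  ∃ φ : ℕ → Plane → Vec ℝ, (∀ k, ContDiff ℝ ∞ (φ k)) ∧
    Tendsto (fun k => eLpNorm (fun x => φ k x - u x) 2
      (volume.restrict (Ω ∩ Metric.ball 0 2))) atTop (𝓝 0) ∧
    Tendsto (fun k => eLpNorm (fun x => grad (φ k) x - Du x) 2
      (volume.restrict (Ω ∩ Metric.ball 0 2))) atTop (𝓝 0) ∧
    Tendsto (fun k => eLpNorm (fun t : ℝ => φ k (polarPt 1 t) - b (polarPt 1 t)) 2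
      (volume.restrict (Set.Ioc 0 (2 * Real.pi)))) atTop (𝓝 0)

/-- The tensor `u ⊗ u`. -/
def tensorSq (a : Vec ℝ) : Ten ℝ := WithLp.toLp 2 fun p => a p.1 * a p.2

/-- `u ∈ Ŵ^{1,2}(Ω)³` is a weak solution of the steady Navier–Stokes system on `Ω × ℝ` with
boundary data `b` and force `f = g + div F`, where `(div F)_j = ∑_i ∂_i F_{ij}`. The test fields
are `φ ∈ C^∞_{0,σ}(Ω) × C^∞_0(Ω)`. -/
def IsWeakSolution (b g : Plane → Vec ℝ) (F : Plane → Ten ℝ) (u : Plane → Vec ℝ) : Prop :=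
  ∃ Du : Plane → Ten ℝ, IsWeakGrad u Du ∧
    (∀ R : ℝ, MemLp u 2 (volume.restrict (Ω ∩ Metric.ball 0 R))) ∧
    MemLp Du 2 vol ∧
    WeakDivFree u ∧
    HasTrace u Du b ∧
    ∀ φ : Plane → Vec ℝ, IsTest φ → (∀ x, divh φ x = 0) →
      ∫ x, inner ℝ (Du x) (grad φ x) ∂vol =
        ∫ x, inner ℝ (tensorSq (u x)) (grad φ x) ∂vol
          + ∫ x, inner ℝ (g x) (φ x) ∂vol - ∫ x, inner ℝ (F x) (grad φ x) ∂vol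

/-- `w`, with weak gradient `Dw`, belongs to `W^{1,2}_0(Ω)³`, the closure of `C^∞_0(Ω)³` in
`W^{1,2}(Ω)³`. -/
def MemW120 (w : Plane → Vec ℝ) (Dw : Plane → Ten ℝ) : Prop :=
  IsWeakGrad w Dw ∧ MemLp w 2 vol ∧ MemLp Dw 2 vol ∧
  ∃ φ : ℕ → Plane → Vec ℝ, (∀ k, IsTest (φ k)) ∧
    Tendsto (fun k => eLpNorm (fun x => φ k x - w x) 2 vol) atTop (𝓝 0) ∧
    Tendsto (fun k => eLpNorm (fun x => grad (φ k) x - Dw x) 2 vol) atTop (𝓝 0)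

/-- The horizontal part `(w₁, w₂)`, as a vector with third component zero. -/
def horiz (a : Vec ℝ) : Vec ℝ := !₂[a 0, a 1, 0]

/-- `w_h ∈ L²_σ(Ω)`, the closure of `C^∞_{0,σ}(Ω)` in `L²`. -/
def HorizMemL2sigma (w : Plane → Vec ℝ) : Prop :=
  MemLp (fun x => horiz (w x)) 2 vol ∧
  ∃ ψ : ℕ → Plane → Vec ℝ, (∀ k, IsTest (ψ k) ∧ ∀ x, divh (ψ k) x = 0) ∧
    Tendsto (fun k => eLpNorm (fun x => horiz (ψ k x) - horiz (w x)) 2 vol) atTop (𝓝 0)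

/-- The closed ball `ℬ_ρ(δ)` of radius `δ` about `0` in the space `𝒳_ρ` of the
`w ∈ W^{1,2}_0(Ω)³ ∩ l¹(L^∞_{ρ-1}(Ω))³` with `w_h ∈ L²_σ(Ω)` and `∇w ∈ l¹(L^∞_ρ(Ω))`, normed by
`‖w‖_{l¹L^∞_{ρ-1}} + ‖∇w‖_{l¹L^∞_ρ}`. -/
def InBall (ρ δ : ℝ) (w : Plane → Vec ℝ) : Prop :=
  ∃ Dw : Plane → Ten ℝ, MemW120 w Dw ∧ HorizMemL2sigma w ∧
    MemL1Vec (ρ - 1) w ∧ MemL1Ten ρ Dw ∧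
    l1normVec (ρ - 1) w + l1normTen ρ Dw ≤ ENNReal.ofReal δ

/-- The boundary data `(α x^⊥ - γ x, 0)`, where `x^⊥ = (-x₂, x₁)`. -/
def bdry (α γ : ℝ) (x : Plane) : Vec ℝ :=
  !₂[α * (-x 1) - γ * x 0, α * x 0 - γ * x 1, 0]

/-- The Hamel flow `V = α (x^⊥/|x|², 0) - γ (x/|x|², 0)`. -/
def hamel (α γ : ℝ) (x : Plane) : Vec ℝ :=
  !₂[α * (-x 1 / ‖x‖ ^ 2) - γ * (x 0 / ‖x‖ ^ 2), α * (x 0 / ‖x‖ ^ 2) - γ * (x 1 / ‖x‖ ^ 2), 0]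

end

end ExtNS

/-!
The perturbation `w = u - V` of the flow `V` vanishes on the boundary. Expand it in Fourier modes in the azimuth and put
`t = log |x|`. The linearized equation becomes, on each mode `n`, a system of ordinary differential equations with
constant coefficients on the half-line `t > 0` (`ModeSol`). The transport by `V` splits these equations into first
order factors, with the exponents `λ±` that solve `λ² + γλ = n² + iαn` (`exists_exponents`). The inflow `γ > 2` makes
`Re λ₋ ≤ -γ` while `Re λ₊ ≥ 0`: the factor of `λ₊` is integrated from infinity and that of `λ₋` from the boundary,
with decay `|x|^{-(ρ-1)}` since `ρ ≤ γ`. For the vertical component this gives the solution at once (`exists_vertical`). The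
horizontal components are treated through the vorticity; the multiple of `e^{λ₋t}` that is free in it is used to satisfy
the second boundary condition, for the angular component if `n = 0` (`exists_angular_zero`) and for the stream function
if `n ≠ 0` (`exists_stream`). The bounds are uniform in `n`, including one for `n w` (`exists_modeSol`), and the same
factors give uniqueness on a mode (`ModeSol.eq_zero`).

Products of fields are convolutions of modes, and `w ⊗ w` decays like `|x|^{-2(ρ-1)}`, the decay that is required of
`F`. The nonlinear problem is therefore a contraction in `ℓ¹` over the modes (`exists_nonlinSol`).

It remains to translate. Parseval's identity (`hasSum_pairing`) turns the equations on the modes into the weak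
formulation (`RealModes.integral_pairing_eq_zero`), and approximation by test fields on each mode, followed by truncation
of the series, shows that the field is in `W^{1,2}_0` and `L²_σ` (`ModeSol.exists_approx`,
`RealModes.exists_test_approx`). Conversely, the modes of a weak solution near `V`, tested with fields on a single mode
(`modeField`), solve the equations on the modes (`MemW120.modes`, `IsWeakSolution.exists_nonlinSol`), so that uniqueness
on the modes yields uniqueness of the field.
-/

namespace ExtNS

open Set
open scoped ComplexConjugate Complex Real
open Complex (I norm_real continuous_ofReal re_ofReal_mul)
open Real (log exp_pos exp_log norm_eq_abs two_pi_pos abs_exp exp_le_one_iff smoothTransition sin_sq_add_cos_sq)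
open Finset (sum_congr mul_sum sum_nonneg sum_le_sum sum_comm aestronglyMeasurable_fun_sum single_le_sum sum_sq_le_sq_sum_of_nonneg)
open ENNReal (ofReal)

/-! ### Functions on the half-line -/

/-- The components `w_k(t)` of a vector field on a mode, in the cylindrical frame, where `t = log |x|`. -/
abbrev ModeVec : Type := Fin 3 → ℝ → ℂ

/-- Real vector fields in the plane with three components. -/
abbrev VecField : Type := Plane → Vec ℝ

/-- Real `3 × 3` tensor fields in the plane. -/
abbrev TenField : Type := Plane → Ten ℝ

/-- The components `F_{kl}(t)` of a tensor field on a mode, in the cylindrical frame. -/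
abbrev ModeTen : Type := Fin 3 → Fin 3 → ℝ → ℂ

/-- Lebesgue measure on the half-line `t > 0`, where `t = log |x|`. -/
noncomputable abbrev hl : Measure ℝ := volume.restrict (Ioi 0)

/-- `|f(t)| ≤ A e^{-st}` for almost every `t > 0`. -/
def Bd (s A : ℝ) (f : ℝ → ℂ) : Prop :=
  AEStronglyMeasurable f hl ∧ ∀ᵐ t ∂hl, ‖f t‖ ≤ A * rexp (-s * t)

/-- At most exponential growth on the half-line. -/
def Gr (f : ℝ → ℂ) : Prop := ∃ s A, Bd s A f

/-- Complex test functions on the half-line. -/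
structure Tst (η : ℝ → ℂ) : Prop where
  smooth : ContDiff ℝ ∞ η
  compact : HasCompactSupport η
  supp : tsupport η ⊆ Ioi 0

lemma tendsto_zero_of_le {f g : ℕ → ℝ≥0∞} (hg : Tendsto g atTop (𝓝 0)) (h : ∀ k, f k ≤ g k) :
    Tendsto f atTop (𝓝 0) :=
  tendsto_of_tendsto_of_tendsto_of_le_of_le tendsto_const_nhds hg (fun _ => zero_le) h

lemma hl_ae {p : ℝ → Prop} (h : ∀ t, 0 < t → p t) : ∀ᵐ t ∂hl, p t :=
  (ae_restrict_iff' measurableSet_Ioi).2 (ae_of_all _ h)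

lemma hl_pos : ∀ᵐ t ∂hl, 0 < t := hl_ae fun _ h => h

lemma Bd.mono {s A s' A' : ℝ} {f : ℝ → ℂ} (h : Bd s A f) (hs : s' ≤ s) (hA : A ≤ A') (hA' : 0 ≤ A') :
    Bd s' A' f := by
  refine ⟨h.1, ?_⟩
  filter_upwards [h.2, hl_pos] with t ht h0
  refine ht.trans ((mul_le_mul_of_nonneg_right hA (exp_pos _).le).trans
    (mul_le_mul_of_nonneg_left (Real.exp_le_exp.2 (by nlinarith)) hA'))

lemma Bd.nonneg {s A : ℝ} {f : ℝ → ℂ} (h : Bd s A f) : 0 ≤ A := by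
  have : (ae hl).NeBot := by
    rw [ae_neBot]; intro h0
    have := congrArg (fun μ : Measure ℝ => μ univ) h0
    simp at this
  obtain ⟨t, ht⟩ := h.2.exists
  have := (norm_nonneg _).trans ht
  exact nonneg_of_mul_nonneg_left this (exp_pos _)

lemma Bd.add {s A B : ℝ} {f g : ℝ → ℂ} (hf : Bd s A f) (hg : Bd s B g) :
    Bd s (A + B) (fun t => f t + g t) := by
  refine ⟨hf.1.add hg.1, ?_⟩
  filter_upwards [hf.2, hg.2] with t h1 h2
  rw [add_mul]; exact (norm_add_le _ _).trans (add_le_add h1 h2)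

lemma Bd.const_mul {s A : ℝ} {f : ℝ → ℂ} (c : ℂ) (hf : Bd s A f) :
    Bd s (‖c‖ * A) (fun t => c * f t) := by
  refine ⟨hf.1.const_mul c, ?_⟩
  filter_upwards [hf.2] with t h1
  rw [norm_mul, mul_assoc]; gcongr

lemma Bd.neg {s A : ℝ} {f : ℝ → ℂ} (hf : Bd s A f) : Bd s A (fun t => - f t) := by
  simpa using hf.const_mul (-1)

lemma Bd.sub {s A B : ℝ} {f g : ℝ → ℂ} (hf : Bd s A f) (hg : Bd s B g) :
    Bd s (A + B) (fun t => f t - g t) := by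
  simpa [sub_eq_add_neg] using hf.add hg.neg

lemma Bd.congr {s A : ℝ} {f g : ℝ → ℂ} (hf : Bd s A f) (h : f =ᵐ[hl] g) : Bd s A g := by
  refine ⟨hf.1.congr h, ?_⟩
  filter_upwards [hf.2, h] with t h1 h2
  rwa [← h2]

lemma continuous_cexp_mul (c : ℂ) : Continuous fun t : ℝ => cexp (c * t) := by fun_prop

lemma norm_cexp_mul (c : ℂ) (t : ℝ) : ‖cexp (c * t)‖ = rexp (c.re * t) := by
  rw [Complex.norm_exp]; simp

lemma contDiff_cexp_mul (c : ℂ) : ContDiff ℝ ∞ fun t : ℝ => cexp (c * t) := by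
  have : ContDiff ℝ ∞ fun t : ℝ => (t : ℂ) := Complex.ofRealCLM.contDiff
  exact Complex.contDiff_exp.comp (contDiff_const.mul this)

lemma hasDerivAt_cexp_mul (c : ℂ) (t : ℝ) :
    HasDerivAt (fun t : ℝ => cexp (c * t)) (c * cexp (c * t)) t := by
  have h : HasDerivAt (fun t : ℝ => c * (t : ℂ)) (c * 1) t :=
    (Complex.ofRealCLM.hasDerivAt (x := t)).const_mul c
  have := h.cexp
  simpa [mul_comm] using this

lemma Bd.exp_mul {s A : ℝ} {f : ℝ → ℂ} (c : ℂ) (hf : Bd s A f) :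
    Bd (s - c.re) A (fun t => cexp (c * t) * f t) := by
  refine ⟨(continuous_cexp_mul c).aestronglyMeasurable.mul hf.1, ?_⟩
  filter_upwards [hf.2] with t h1
  rw [norm_mul, norm_cexp_mul]
  calc _ ≤ rexp (c.re * t) * (A * rexp (-s * t)) := by gcongr
    _ = A * (rexp (c.re * t) * rexp (-s * t)) := by ring
    _ = _ := by rw [← Real.exp_add]; congr 2; ring

lemma Bd.cexp (c : ℂ) (a : ℂ) : Bd (-a.re) ‖c‖ (fun t => c * cexp (a * t)) := by
  refine ⟨(continuous_cexp_mul a).aestronglyMeasurable.const_mul c, ?_⟩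
  refine ae_of_all _ fun t => ?_
  rw [norm_mul, norm_cexp_mul, neg_neg]

lemma Bd.gr {s A : ℝ} {f : ℝ → ℂ} (h : Bd s A f) : Gr f := ⟨s, A, h⟩

lemma Gr.add {f g : ℝ → ℂ} (hf : Gr f) (hg : Gr g) : Gr (fun t => f t + g t) := by
  obtain ⟨s, A, h1⟩ := hf
  obtain ⟨s', A', h2⟩ := hg
  exact ⟨_, _, (h1.mono (min_le_left s s') le_rfl h1.nonneg).add
    (h2.mono (min_le_right s s') le_rfl h2.nonneg)⟩

lemma Gr.const_mul {f : ℝ → ℂ} (c : ℂ) (hf : Gr f) : Gr (fun t => c * f t) := by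
  obtain ⟨s, A, h1⟩ := hf
  exact ⟨_, _, h1.const_mul c⟩

lemma Gr.neg {f : ℝ → ℂ} (hf : Gr f) : Gr (fun t => - f t) := by
  simpa using hf.const_mul (-1)

lemma Gr.sub {f g : ℝ → ℂ} (hf : Gr f) (hg : Gr g) : Gr (fun t => f t - g t) := by
  simpa [sub_eq_add_neg] using hf.add hg.neg

lemma Gr.exp_mul {f : ℝ → ℂ} (c : ℂ) (hf : Gr f) : Gr (fun t => cexp (c * t) * f t) := by
  obtain ⟨s, A, h1⟩ := hf
  exact ⟨_, _, h1.exp_mul c⟩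

lemma Gr.cexp (a : ℂ) : Gr (fun t => cexp (a * t)) := by
  have := (Bd.cexp 1 a).gr; simpa using this

lemma Gr.zero : Gr (fun _ => 0) := by simpa using (Gr.cexp 0).const_mul 0

lemma Gr.congr {f g : ℝ → ℂ} (hf : Gr f) (h : f =ᵐ[hl] g) : Gr g := by
  obtain ⟨s, A, h1⟩ := hf
  exact ⟨s, A, h1.congr h⟩

lemma Gr.integrableOn {f : ℝ → ℂ} (hf : Gr f) (b : ℝ) : IntegrableOn f (Ioc 0 b) := by
  obtain ⟨s, A, h⟩ := hf
  have hm : AEStronglyMeasurable f (volume.restrict (Ioc 0 b)) :=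
    h.1.mono_measure (Measure.restrict_mono Ioc_subset_Ioi_self le_rfl)
  have hb : ∀ᵐ t ∂(volume.restrict (Ioc 0 b)), ‖f t‖ ≤ A * rexp (|s| * |b|) := by
    have h2 : Ioc 0 b ⊆ Ioi (0:ℝ) := fun t ht => ht.1
    have := ae_mono (Measure.restrict_mono h2 le_rfl) h.2
    filter_upwards [this, ae_restrict_mem measurableSet_Ioc] with t ht h0
    refine ht.trans (mul_le_mul_of_nonneg_left (Real.exp_le_exp.2 ?_) h.nonneg)
    calc -s * t ≤ |s| * t := mul_le_mul_of_nonneg_right (neg_le_abs s) h0.1.le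
      _ ≤ |s| * |b| := mul_le_mul_of_nonneg_left (h0.2.trans (le_abs_self b)) (abs_nonneg s)
  exact Integrable.of_bound hm _ hb

lemma Gr.intervalIntegrable {f : ℝ → ℂ} (hf : Gr f) {t : ℝ} (ht : 0 ≤ t) :
    IntervalIntegrable f volume 0 t := by
  rw [intervalIntegrable_iff, uIoc_of_le ht]; exact hf.integrableOn t

lemma Gr.integrable_mul {f η : ℝ → ℂ} (hf : Gr f) (hη : Continuous η) (hc : HasCompactSupport η) :
    Integrable (fun t => f t * η t) hl := by
  obtain ⟨b, hb⟩ := hc.isCompact.bddAbove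
  obtain ⟨C, hC⟩ := hc.exists_bound_of_continuous hη
  have h1 : IntegrableOn (fun t => f t * η t) (Ioc 0 b) :=
    (hf.integrableOn b).mul_bdd (c := C) hη.aestronglyMeasurable (ae_of_all _ hC)
  have h2 : IntegrableOn (fun t => f t * η t) (Ioi b) := by
    refine (integrableOn_zero (s := Ioi b) (μ := volume)).congr_fun (fun t ht => ?_) measurableSet_Ioi
    have : t ∉ tsupport η := fun h => absurd (hb h) (not_le.2 ht)
    simp [image_eq_zero_of_notMem_tsupport this]
  refine (h1.union h2).mono_set fun t ht => ?_
  rcases le_or_gt t b with h | h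
  · exact Or.inl ⟨ht, h⟩
  · exact Or.inr h

lemma Tst.integrable_mul {f η : ℝ → ℂ} (hη : Tst η) (hf : Gr f) :
    Integrable (fun t => f t * η t) hl :=
  hf.integrable_mul hη.smooth.continuous hη.compact

lemma Tst.deriv {η : ℝ → ℂ} (h : Tst η) : Tst (deriv η) :=
  ⟨(contDiff_infty_iff_deriv.1 h.smooth).2, h.compact.deriv,
    (closure_minimal support_deriv_subset (isClosed_tsupport η)).trans h.supp⟩

lemma Tst.differentiable {η : ℝ → ℂ} (h : Tst η) : Differentiable ℝ η :=
  h.smooth.differentiable (by simp)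

lemma Tst.hasDerivAt {η : ℝ → ℂ} (h : Tst η) (t : ℝ) : HasDerivAt η (_root_.deriv η t) t :=
  (h.differentiable t).hasDerivAt

lemma Tst.mul_left {η g : ℝ → ℂ} (h : Tst η) (hg : ContDiff ℝ ∞ g) : Tst (fun t => g t * η t) :=
  ⟨hg.mul h.smooth, h.compact.mul_left, (tsupport_mul_subset_right).trans h.supp⟩

lemma Tst.const_mul {η : ℝ → ℂ} (h : Tst η) (c : ℂ) : Tst (fun t => c * η t) :=
  h.mul_left contDiff_const

lemma Tst.exp_mul {η : ℝ → ℂ} (h : Tst η) (c : ℂ) : Tst (fun t => cexp (c * t) * η t) :=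
  h.mul_left (contDiff_cexp_mul c)

lemma Tst.add {η χ : ℝ → ℂ} (h : Tst η) (h' : Tst χ) : Tst (fun t => η t + χ t) :=
  ⟨h.smooth.add h'.smooth, h.compact.add h'.compact,
    (tsupport_add η χ).trans (union_subset h.supp h'.supp)⟩

lemma Tst.neg {η : ℝ → ℂ} (h : Tst η) : Tst (fun t => - η t) := by simpa using h.const_mul (-1)

lemma Tst.sub {η χ : ℝ → ℂ} (h : Tst η) (h' : Tst χ) : Tst (fun t => η t - χ t) := by
  simpa [sub_eq_add_neg] using h.add h'.neg

lemma Tst.zero : Tst (fun _ => 0) :=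
  ⟨contDiff_const, HasCompactSupport.zero, by simp [tsupport]⟩

lemma Tst.of_Icc {η : ℝ → ℂ} (h : ContDiff ℝ ∞ η) {a b : ℝ} (ha : 0 < a)
    (h0 : ∀ t, t ∉ Icc a b → η t = 0) : Tst η := by
  have : tsupport η ⊆ Icc a b := closure_minimal
    (fun t ht => by by_contra hh; exact ht (h0 t hh)) isClosed_Icc
  exact ⟨h, HasCompactSupport.intro isCompact_Icc h0, this.trans fun t ht => ha.trans_le ht.1⟩

lemma Tst.exists_Icc {η : ℝ → ℂ} (h : Tst η) :
    ∃ a b, 0 < a ∧ a < b ∧ ∀ t, t ∉ Icc a b → η t = 0 := by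
  rcases (tsupport η).eq_empty_or_nonempty with he | hne
  · refine ⟨1, 2, one_pos, one_lt_two, fun t _ => ?_⟩
    exact image_eq_zero_of_notMem_tsupport (by simp [he])
  · obtain ⟨b, hb⟩ := h.compact.isCompact.bddAbove
    obtain ⟨a, ha, ha'⟩ := h.compact.isCompact.exists_isLeast hne
    refine ⟨a, max b (a + 1), h.supp ha, lt_max_of_lt_right (by linarith), fun t ht => ?_⟩
    refine image_eq_zero_of_notMem_tsupport fun hh => ht ⟨ha' hh, le_max_of_le_left (hb hh)⟩

lemma Tst.eq_zero_of_nonpos {η : ℝ → ℂ} (h : Tst η) {t : ℝ} (ht : t ≤ 0) : η t = 0 :=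
  image_eq_zero_of_notMem_tsupport fun hh => absurd (h.supp hh) (not_lt.2 ht)

lemma Tst.integrable {η : ℝ → ℂ} (hη : Tst η) : Integrable η hl := by
  have := hη.integrable_mul (Gr.cexp 0); simpa using this

lemma Tst.integral_deriv {η : ℝ → ℂ} (hη : Tst η) : ∫ t, _root_.deriv η t ∂hl = 0 := by
  have h : Tendsto η atTop (𝓝 0) := by
    obtain ⟨a, b, _, _, h⟩ := hη.exists_Icc
    refine tendsto_const_nhds.congr' ?_
    filter_upwards [eventually_gt_atTop b] with t ht
    exact (h t fun hh => absurd hh.2 (not_le.2 ht)).symm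
  have := integral_Ioi_of_hasDerivAt_of_tendsto (a := 0) (f := η) hη.smooth.continuous.continuousWithinAt
    (fun t _ => hη.hasDerivAt t) hη.deriv.integrable h
  rw [this, hη.eq_zero_of_nonpos le_rfl, sub_zero]

/-- A test function of zero mean is the derivative of a test function. -/
lemma Tst.exists_primitive {η : ℝ → ℂ} (hη : Tst η) (h0 : ∫ t, η t ∂hl = 0) :
    ∃ χ, Tst χ ∧ ∀ t, _root_.deriv χ t = η t := by
  obtain ⟨a, b, ha, hab, h⟩ := hη.exists_Icc
  have hc := hη.smooth.continuous
  have hd : ∀ t, HasDerivAt (fun t => ∫ s in (0:ℝ)..t, η s) (η t) t := fun t =>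
    intervalIntegral.integral_hasDerivAt_right (hc.intervalIntegrable _ _)
      (hc.stronglyMeasurableAtFilter _ _) hc.continuousAt
  have hd' : _root_.deriv (fun t => ∫ s in (0:ℝ)..t, η s) = η := funext fun t => (hd t).deriv
  refine ⟨fun t => ∫ s in (0:ℝ)..t, η s, Tst.of_Icc (a := a) (b := b) ?_ ha ?_, fun t => (hd t).deriv⟩
  · rw [contDiff_infty_iff_deriv, hd']
    exact ⟨fun t => (hd t).differentiableAt, hη.smooth⟩
  · intro t ht
    rcases lt_or_ge t a with h1 | h1
    · refine intervalIntegral.integral_zero_ae (ae_of_all _ fun s hs => h s fun hh => ?_)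
      rcases hs with ⟨_, h4⟩
      exact absurd (hh.1.trans h4) (not_le.2 (max_lt ha h1))
    · have h2 : b < t := by by_contra hh; exact ht ⟨h1, not_lt.1 hh⟩
      have h3 : (0:ℝ) ≤ t := (ha.trans_le h1).le
      have : ∫ s in Ioi t, η s = 0 :=
        setIntegral_eq_zero_of_forall_eq_zero fun s hs => h s fun hh =>
          absurd (hh.2.trans_lt h2) (not_lt.2 (le_of_lt hs))
      have h5 := intervalIntegral.integral_interval_add_Ioi (f := η) (μ := volume) (a := 0) (b := t)
        hη.integrable (hη.integrable.mono_measure (Measure.restrict_mono (Ioi_subset_Ioi h3) le_rfl))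
      rw [this, add_zero] at h5
      exact h5.trans h0

lemma exists_tst_integral_one : ∃ θ, Tst θ ∧ ∫ t, θ t ∂hl = 1 := by
  let φ : ContDiffBump (2 : ℝ) := ⟨1/2, 1, by norm_num, by norm_num⟩
  refine ⟨fun t => ((φ.normed volume t : ℝ) : ℂ), Tst.of_Icc (a := 1) (b := 3) ?_ one_pos ?_, ?_⟩
  · exact Complex.ofRealCLM.contDiff.comp φ.contDiff_normed
  · intro t ht
    have : t ∉ Function.support (φ.normed volume) := by
      rw [φ.support_normed_eq, Real.ball_eq_Ioo]
      intro hh; apply ht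
      have h1 := hh.1; have h2 := hh.2
      simp only [φ] at h1 h2
      constructor <;> linarith
    simpa using this
  · rw [integral_complex_ofReal, setIntegral_eq_integral_of_forall_compl_eq_zero, φ.integral_normed]
    · simp
    · intro t ht
      by_contra hh
      have : t ∈ Function.support (φ.normed volume) := hh
      rw [φ.support_normed_eq, Real.ball_eq_Ioo] at this
      have h1 := this.1
      simp only [φ] at h1
      exact ht (show (0:ℝ) < t by linarith)

/-- A linear functional on test functions that vanishes on derivatives is a multiple of the
integral. -/
lemma functional_eq_integral (Λ : (ℝ → ℂ) → ℂ)
    (hadd : ∀ η χ, Tst η → Tst χ → Λ (fun t => η t + χ t) = Λ η + Λ χ)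
    (hmul : ∀ (c : ℂ) η, Tst η → Λ (fun t => c * η t) = c * Λ η)
    (h0 : ∀ χ, Tst χ → Λ (deriv χ) = 0) :
    ∃ c, ∀ η, Tst η → Λ η = c * ∫ t, η t ∂hl := by
  obtain ⟨θ, hθ, h1⟩ := exists_tst_integral_one
  refine ⟨Λ θ, fun η hη => ?_⟩
  have h2 : Tst (fun t => η t + (-∫ t, η t ∂hl) * θ t) := hη.add (hθ.const_mul _)
  obtain ⟨χ, hχ, h3⟩ := h2.exists_primitive (by
    rw [integral_add hη.integrable (hθ.const_mul _).integrable, integral_const_mul, h1]; ring)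
  have h4 := h0 χ hχ
  rw [funext h3, hadd _ _ hη (hθ.const_mul _), hmul _ _ hθ] at h4
  linear_combination h4

lemma Gr.locallyIntegrableOn {f : ℝ → ℂ} (hf : Gr f) : LocallyIntegrableOn f (Ioi 0) := by
  rw [locallyIntegrableOn_iff isOpen_Ioi.isLocallyClosed]
  intro k hk hc
  obtain ⟨b, hb⟩ := hc.bddAbove
  exact (hf.integrableOn b).mono_set fun t ht => ⟨hk ht, hb ht⟩

lemma ae_zero_of_integral_tst {f : ℝ → ℂ} (hf : Gr f)
    (h : ∀ η, Tst η → ∫ t, f t * η t ∂hl = 0) : f =ᵐ[hl] 0 := by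
  have := IsOpen.ae_eq_zero_of_integral_contDiff_smul_eq_zero isOpen_Ioi hf.locallyIntegrableOn
    (fun g hg hc hs => ?_)
  · rw [EventuallyEq, ae_restrict_iff' measurableSet_Ioi]; exact this
  · have hT : Tst (fun t => (g t : ℂ)) := by
      refine ⟨Complex.ofRealCLM.contDiff.comp hg, hc.comp_left (g := fun x : ℝ => (x:ℂ)) rfl, ?_⟩
      refine (closure_mono ?_).trans hs
      intro t ht; simpa using ht
    have h1 := h _ hT
    rw [setIntegral_eq_integral_of_forall_compl_eq_zero] at h1
    · rw [← h1]; congr 1; ext t; simp [mul_comm]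
    · intro t ht; simp [image_eq_zero_of_notMem_tsupport fun hh => ht (hs hh)]

/-- `f'` is the weak derivative of `f` on the half-line. -/
structure WD (f f' : ℝ → ℂ) : Prop where
  gr : Gr f
  gr' : Gr f'
  eq : ∀ η, Tst η → ∫ t, (f t * deriv η t + f' t * η t) ∂hl = 0

lemma WD.add {f f' g g' : ℝ → ℂ} (hf : WD f f') (hg : WD g g') :
    WD (fun t => f t + g t) (fun t => f' t + g' t) := by
  refine ⟨hf.gr.add hg.gr, hf.gr'.add hg.gr', fun η hη => ?_⟩
  have h1 := (hη.deriv.integrable_mul hf.gr).add (hη.integrable_mul hf.gr')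
  have h2 := (hη.deriv.integrable_mul hg.gr).add (hη.integrable_mul hg.gr')
  have := integral_add h1 h2
  simp only [Pi.add_apply] at this
  rw [hf.eq η hη, hg.eq η hη, add_zero] at this
  rw [← this]; congr 1; ext t; ring

lemma WD.const_mul {f f' : ℝ → ℂ} (c : ℂ) (hf : WD f f') :
    WD (fun t => c * f t) (fun t => c * f' t) := by
  refine ⟨hf.gr.const_mul c, hf.gr'.const_mul c, fun η hη => ?_⟩
  have := hf.eq η hη
  rw [← mul_zero c, ← this, ← integral_const_mul]; congr 1; ext t; ring

lemma WD.neg {f f' : ℝ → ℂ} (hf : WD f f') : WD (fun t => - f t) (fun t => - f' t) := by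
  simpa using hf.const_mul (-1)

lemma WD.sub {f f' g g' : ℝ → ℂ} (hf : WD f f') (hg : WD g g') :
    WD (fun t => f t - g t) (fun t => f' t - g' t) := by
  simpa [sub_eq_add_neg] using hf.add hg.neg

lemma WD.congr {f f' g g' : ℝ → ℂ} (hf : WD f f') (h : f =ᵐ[hl] g) (h' : f' =ᵐ[hl] g') :
    WD g g' := by
  refine ⟨hf.gr.congr h, hf.gr'.congr h', fun η hη => ?_⟩
  rw [← hf.eq η hη]
  refine integral_congr_ae ?_
  filter_upwards [h, h'] with t h1 h2
  rw [h1, h2]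

lemma WD.exp_mul {f f' : ℝ → ℂ} (c : ℂ) (hf : WD f f') :
    WD (fun t => cexp (c * t) * f t)
      (fun t => cexp (c * t) * (f' t + c * f t)) := by
  refine ⟨hf.gr.exp_mul c, (hf.gr'.add (hf.gr.const_mul c)).exp_mul c, fun η hη => ?_⟩
  rw [← hf.eq _ (hη.exp_mul c)]
  congr 1; ext t
  rw [((hasDerivAt_cexp_mul c t).fun_mul (hη.hasDerivAt t)).deriv]; ring

/-- Primitives are weakly differentiable. -/
lemma WD.primitive {h : ℝ → ℂ} (hh : Gr h) (hp : Gr fun t => ∫ s in (0:ℝ)..t, h s) :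
    WD (fun t => ∫ s in (0:ℝ)..t, h s) h := by
  refine ⟨hp, hh, fun η hη => ?_⟩
  obtain ⟨a, b, ha, hab, h0⟩ := hη.exists_Icc
  rw [integral_add (hη.deriv.integrable_mul hp) (hη.integrable_mul hh)]
  have hd0 : ∀ t, t ∉ Icc a b → deriv η t = 0 := by
    intro t ht
    have : η =ᶠ[𝓝 t] fun _ => 0 := by
      filter_upwards [isClosed_Icc.isOpen_compl.mem_nhds ht] with s hs using h0 s hs
    rw [this.deriv_eq]; simp
  let S : Set (ℝ × ℝ) := {z | z.2 < z.1}
  have hS : MeasurableSet S := measurableSet_lt measurable_snd measurable_fst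
  have hint : Integrable (S.indicator fun z : ℝ × ℝ => deriv η z.1 * h z.2)
      (hl.prod (volume.restrict (Ioc 0 b))) :=
    (hη.deriv.integrable.mul_prod (hh.integrableOn b)).indicator hS
  have hswap := integral_integral_swap (f := fun t s => S.indicator (fun z : ℝ × ℝ => deriv η z.1 * h z.2) (t, s)) hint
  have e1 : ∀ t ∈ Ioi (0:ℝ), (∫ s in (0:ℝ)..t, h s) * deriv η t =
      ∫ s in Ioc 0 b, S.indicator (fun z : ℝ × ℝ => deriv η z.1 * h z.2) (t, s) := by
    intro t ht
    by_cases htb : t ∈ Icc a b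
    · have : (fun s => S.indicator (fun z : ℝ × ℝ => deriv η z.1 * h z.2) (t, s)) =
          (Iio t).indicator fun s => deriv η t * h s := by
        ext s; simp [S, indicator]
      rw [this, setIntegral_indicator measurableSet_Iio, integral_const_mul,
        intervalIntegral.integral_of_le (le_of_lt ht), mul_comm]
      congr 1
      rw [← integral_Ioc_eq_integral_Ioo.symm.trans rfl]
      congr 2
      ext s; simp only [mem_Ioo, mem_inter_iff, mem_Ioc, mem_Iio]
      exact ⟨fun h => ⟨⟨h.1, h.2.le.trans htb.2⟩, h.2⟩, fun h => ⟨h.1.1, h.2⟩⟩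
    · rw [hd0 t htb, mul_zero, integral_eq_zero_of_ae]
      refine ae_of_all _ fun s => ?_
      simp [S, indicator, hd0 t htb]
  have e2 : ∀ s ∈ Ioc 0 b, ∫ t in Ioi (0:ℝ), S.indicator (fun z : ℝ × ℝ => deriv η z.1 * h z.2) (t, s)
      = - (h s * η s) := by
    intro s hs
    have : (fun t => S.indicator (fun z : ℝ × ℝ => deriv η z.1 * h z.2) (t, s)) =
          (Ioi s).indicator fun t => deriv η t * h s := by
        ext t; simp [S, indicator]
    rw [this, setIntegral_indicator measurableSet_Ioi, inter_eq_self_of_subset_right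
      (Ioi_subset_Ioi hs.1.le), integral_mul_const]
    have h1 : Tendsto η atTop (𝓝 0) := by
      refine tendsto_const_nhds.congr' ?_
      filter_upwards [eventually_gt_atTop b] with t ht
      exact (h0 t fun hh => absurd hh.2 (not_le.2 ht)).symm
    rw [integral_Ioi_of_hasDerivAt_of_tendsto (a := s) (f := η)
      hη.smooth.continuous.continuousWithinAt (fun t _ => hη.hasDerivAt t)
      (hη.deriv.integrable.mono_measure (Measure.restrict_mono (Ioi_subset_Ioi hs.1.le) le_rfl)) h1]
    ring
  rw [setIntegral_congr_fun measurableSet_Ioi e1, hswap, setIntegral_congr_fun measurableSet_Ioc e2,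
    integral_neg, neg_add_eq_zero]
  refine (setIntegral_eq_of_subset_of_forall_sdiff_eq_zero measurableSet_Ioi
    (fun t ht => ht.1 : Ioc 0 b ⊆ Ioi 0) fun t ht => ?_).symm
  rw [h0 t fun hh => ht.2 ⟨ht.1, hh.2⟩, mul_zero]

lemma hasDerivAt_const_mul_exp (c k u : ℝ) :
    HasDerivAt (fun u => c * rexp (k * u)) (c * k * rexp (k * u)) u := by
  have := ((hasDerivAt_id' u).const_mul k).exp.const_mul c
  exact this.congr_deriv (by ring)

lemma Gr.primitive {h : ℝ → ℂ} (hh : Gr h) (hm : Continuous fun t => ∫ u in (0:ℝ)..t, h u) :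
    Gr fun t => ∫ u in (0:ℝ)..t, h u := by
  obtain ⟨s, A, h1⟩ := hh
  have h2 := h1.mono (min_le_left s (-1)) le_rfl h1.nonneg
  set r := min s (-1) with hr
  have hr0 : r ≤ -1 := min_le_right _ _
  refine ⟨r, A, hm.aestronglyMeasurable, hl_ae fun t ht => ?_⟩
  have h3 : ∀ᵐ u, u ∈ Ioc 0 t → ‖h u‖ ≤ A * rexp (-r * u) := by
    have := (ae_restrict_iff' measurableSet_Ioi).1 h2.2
    filter_upwards [this] with u hu hu' using hu hu'.1
  have hc : Continuous fun u => A * rexp (-r * u) := by fun_prop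
  refine (intervalIntegral.norm_integral_le_of_norm_le ht.le h3 (hc.intervalIntegrable _ _)).trans ?_
  have hd : ∀ u ∈ uIcc 0 t, HasDerivAt (fun u => A / (-r) * rexp (-r * u))
      (A * rexp (-r * u)) u := by
    intro u _
    have hr' : r ≠ 0 := by linarith
    exact (hasDerivAt_const_mul_exp (A / (-r)) (-r) u).congr_deriv (by field_simp)
  rw [intervalIntegral.integral_eq_sub_of_hasDerivAt hd (hc.intervalIntegrable _ _)]
  have hA := h1.nonneg
  have h5 : A / (-r) ≤ A := div_le_self hA (by linarith)
  have h6 : 0 ≤ A / (-r) := div_nonneg hA (by linarith)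
  have := exp_pos (-r * t)
  simp only [mul_zero, Real.exp_zero, mul_one]
  nlinarith

/-- A function with vanishing weak derivative is constant. -/
lemma WD.const {f : ℝ → ℂ} (h : WD f fun _ => 0) : ∃ c, f =ᵐ[hl] fun _ => c := by
  obtain ⟨c, hc⟩ := functional_eq_integral (fun η => ∫ t, f t * η t ∂hl)
    (fun η χ hη hχ => by
      rw [← integral_add (hη.integrable_mul h.gr) (hχ.integrable_mul h.gr)]
      congr 1; ext t; ring)
    (fun c η hη => by rw [← integral_const_mul]; congr 1; ext t; ring)
    (fun χ hχ => by simpa using h.eq χ hχ)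
  refine ⟨c, ?_⟩
  have : (fun t => f t - c * cexp ((0:ℂ) * t)) =ᵐ[hl] 0 := by
    refine ae_zero_of_integral_tst (h.gr.sub ((Gr.cexp 0).const_mul c)) fun η hη => ?_
    have h1 := hc η hη
    rw [← integral_const_mul, ← sub_eq_zero, ← integral_sub (hη.integrable_mul h.gr)
      (hη.integrable.const_mul c)] at h1
    refine Eq.trans ?_ h1; congr 1; ext t; rw [zero_mul, Complex.exp_zero]; ring
  filter_upwards [this] with t ht
  have ht' : f t - c * cexp ((0:ℂ) * t) = 0 := ht
  simpa [sub_eq_zero] using ht'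

/-- The solutions of `f' = lam f` are the multiples of `e^{lam t}`. -/
lemma WD.eq_exp {f : ℝ → ℂ} {lam : ℂ} (h : WD f fun t => lam * f t) :
    ∃ c, f =ᵐ[hl] fun t => c * cexp (lam * t) := by
  have h1 := h.exp_mul (-lam)
  have h2 : (fun t : ℝ => cexp (-lam * t) * (lam * f t + -lam * f t)) = fun _ => (0:ℂ) := by
    ext t; ring
  rw [h2] at h1
  obtain ⟨c, hc⟩ := h1.const
  refine ⟨c, ?_⟩
  filter_upwards [hc] with t ht
  rw [← ht, mul_comm, ← mul_assoc, ← Complex.exp_add]; simp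

/-- The multiple of `e^{lam t}` can decay only if it vanishes. -/
lemma exp_coeff_zero {f : ℝ → ℂ} {lam c : ℂ} {s A : ℝ} (hf : Bd s A f) (hs : 0 < lam.re + s)
    (h : f =ᵐ[hl] fun t => c * cexp (lam * t)) : c = 0 := by
  by_contra hc
  have h1 : ∀ᵐ t ∂hl, ‖c‖ ≤ A * rexp (-(lam.re + s) * t) := by
    filter_upwards [hf.2, h] with t h1 h2
    rw [h2, norm_mul, norm_cexp_mul] at h1
    calc ‖c‖ = ‖c‖ * rexp (lam.re * t) * rexp (-(lam.re * t)) := by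
          rw [mul_assoc, ← Real.exp_add]; simp
      _ ≤ A * rexp (-s * t) * rexp (-(lam.re * t)) := by gcongr
      _ = _ := by rw [mul_assoc, ← Real.exp_add]; congr 2; ring
  have h2 : Tendsto (fun t : ℝ => A * rexp (-(lam.re + s) * t)) atTop (𝓝 (A * 0)) := by
    refine Tendsto.const_mul A (Real.tendsto_exp_atBot.comp ?_)
    exact tendsto_id.const_mul_atTop_of_neg (by linarith)
  rw [mul_zero] at h2
  obtain ⟨N, hN⟩ := eventually_atTop.1 (h2.eventually (gt_mem_nhds (norm_pos_iff.2 hc)))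
  have h3 : volume {t : ℝ | t ∈ Ioi 0 ∧ N ≤ t} = 0 := by
    rw [ae_restrict_iff' measurableSet_Ioi] at h1
    refine measure_mono_null (fun t ht => ?_) h1
    intro hh
    exact absurd (hh ht.1) (not_le.2 (hN t ht.2))
  have h4 : Ioi (max 0 N) ⊆ {t : ℝ | t ∈ Ioi 0 ∧ N ≤ t} := fun t ht =>
    ⟨lt_of_le_of_lt (le_max_left 0 N) ht, (lt_of_le_of_lt (le_max_right 0 N) ht).le⟩
  have := measure_mono_null h4 h3
  simp at this

lemma WD.eq_zero {f : ℝ → ℂ} {lam : ℂ} {s A : ℝ} (h : WD f fun t => lam * f t) (hf : Bd s A f)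
    (hs : 0 < lam.re + s) : f =ᵐ[hl] 0 := by
  obtain ⟨c, hc⟩ := h.eq_exp
  rw [exp_coeff_zero hf hs hc] at hc
  filter_upwards [hc] with t ht using by simpa using ht

/-! ### First order equations on the half-line -/

/-- A pointwise bound for a continuous function follows from the almost everywhere bound. -/
lemma Bd.le_of_continuous {s A : ℝ} {f : ℝ → ℂ} (h : Bd s A f) (hf : Continuous f) {t : ℝ}
    (ht : 0 ≤ t) : ‖f t‖ ≤ A * rexp (-s * t) := by
  have hc : Continuous fun t => A * rexp (-s * t) := by fun_prop
  have hU : IsOpen {t | A * rexp (-s * t) < ‖f t‖} := isOpen_lt hc hf.norm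
  by_contra hcon
  have hmem : t ∈ {t | A * rexp (-s * t) < ‖f t‖} := not_le.1 hcon
  have hne : ({t | A * rexp (-s * t) < ‖f t‖} ∩ Ioi 0).Nonempty := by
    have : t ∈ closure (Ioi (0:ℝ)) := by rw [closure_Ioi]; exact ht
    exact mem_closure_iff.1 this _ hU hmem
  have hpos := (hU.inter isOpen_Ioi).measure_pos volume hne
  have h2 := (ae_restrict_iff' measurableSet_Ioi).1 h.2
  refine hpos.ne' (measure_mono_null (fun t ht => ?_) h2)
  intro hh
  exact absurd (hh ht.2) (not_le.2 ht.1)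

lemma continuous_primitive_indicator {h : ℝ → ℂ} (hh : Gr h) :
    Continuous fun t => ∫ s in (0:ℝ)..t, (Ioi (0:ℝ)).indicator h s := by
  refine intervalIntegral.continuous_primitive (fun a b => ?_) 0
  rw [intervalIntegrable_iff]
  have : IntegrableOn ((Ioi (0:ℝ)).indicator h) (Ioc (min a b) (max a b)) := by
    rw [IntegrableOn, integrable_indicator_iff measurableSet_Ioi, IntegrableOn, Measure.restrict_restrict measurableSet_Ioi]
    exact (hh.integrableOn (max a b)).mono_set fun t ht => ⟨ht.1, ht.2.2⟩
  exact this

lemma indicator_ae (h : ℝ → ℂ) : (Ioi (0:ℝ)).indicator h =ᵐ[hl] h :=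
  hl_ae fun t ht => by simp [indicator, ht]

/-- The solution of `f' = lam f + h`, `f(0) = c`. -/
noncomputable def solveFwd (lam c : ℂ) (h : ℝ → ℂ) (t : ℝ) : ℂ :=
  cexp (lam * t) *
    (c + ∫ s in (0:ℝ)..t, (Ioi (0:ℝ)).indicator (fun s => cexp (-lam * s) * h s) s)

lemma solveFwd_continuous {lam c : ℂ} {h : ℝ → ℂ} (hh : Gr h) : Continuous (solveFwd lam c h) :=
  (continuous_cexp_mul lam).mul (continuous_const.add (continuous_primitive_indicator (hh.exp_mul _)))

lemma solveFwd_zero (lam c : ℂ) (h : ℝ → ℂ) : solveFwd lam c h 0 = c := by simp [solveFwd]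

lemma solveFwd_wd {lam c : ℂ} {h : ℝ → ℂ} (hh : Gr h) :
    WD (solveFwd lam c h) (fun t => lam * solveFwd lam c h t + h t) := by
  have hi := (hh.exp_mul (-lam)).congr (indicator_ae _).symm
  have h1 := WD.primitive hi (hi.primitive (continuous_primitive_indicator (hh.exp_mul _)))
  have h0 : WD (fun _ => c) (fun _ => 0) := by
    refine ⟨by simpa using (Gr.cexp 0).const_mul c, Gr.zero, fun η hη => ?_⟩
    simp only [zero_mul, add_zero]
    rw [integral_const_mul, hη.integral_deriv, mul_zero]
  refine ((h0.add h1).exp_mul lam).congr (EventuallyEq.rfl) ?_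
  filter_upwards [indicator_ae (fun s => cexp (-lam * s) * h s)] with t ht
  rw [ht, solveFwd, zero_add, mul_add, ← mul_assoc, ← Complex.exp_add]
  simp; ring

lemma exp_integral_le {d t : ℝ} (hd : 0 < d) : ∫ s in (0:ℝ)..t, rexp (d * s) ≤ rexp (d * t) / d := by
  have hd' : ∀ u ∈ uIcc 0 t, HasDerivAt (fun u => rexp (d * u) / d) (rexp (d * u)) u := by
    intro u _
    have h4 := hasDerivAt_const_mul_exp (1 / d) d u
    exact (h4.congr_deriv (by field_simp)).congr_of_eventuallyEq (Eventually.of_forall fun u => by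
      ring)
  have hc : Continuous fun u => rexp (d * u) := by fun_prop
  rw [intervalIntegral.integral_eq_sub_of_hasDerivAt hd' (hc.intervalIntegrable _ _)]
  simp only [mul_zero, Real.exp_zero]
  have : 0 < 1 / d := by positivity
  linarith

lemma exp_neg_integral_le {d t : ℝ} (hd : 0 < d) : ∫ s in (0:ℝ)..t, rexp (-d * s) ≤ 1 / d := by
  have hd' : ∀ u ∈ uIcc 0 t, HasDerivAt (fun u => -rexp (-d * u) / d) (rexp (-d * u)) u := by
    intro u _
    have h4 := hasDerivAt_const_mul_exp (-1 / d) (-d) u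
    exact (h4.congr_deriv (by field_simp)).congr_of_eventuallyEq (Eventually.of_forall fun u => by
      ring)
  have hc : Continuous fun u => rexp (-d * u) := by fun_prop
  rw [intervalIntegral.integral_eq_sub_of_hasDerivAt hd' (hc.intervalIntegrable _ _)]
  simp only [mul_zero, Real.exp_zero]
  have : 0 < rexp (-d * t) / d := by positivity
  have e : -rexp (-d * t) / d = - (rexp (-d * t) / d) := by ring
  have e' : (-1:ℝ) / d = - (1 / d) := by ring
  linarith

lemma norm_primitive_le {lam : ℂ} {h : ℝ → ℂ} {b A t : ℝ} (hh : Bd b A h) (ht : 0 ≤ t) {g : ℝ → ℝ}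
    (hg : Continuous g) (hle : ∀ s, 0 ≤ s → s ≤ t → rexp (-lam.re * s) * (A * rexp (-b * s)) ≤ g s) :
    ‖∫ s in (0:ℝ)..t, (Ioi (0:ℝ)).indicator (fun s => cexp (-lam * s) * h s) s‖
      ≤ ∫ s in (0:ℝ)..t, g s := by
  refine intervalIntegral.norm_integral_le_of_norm_le ht ?_ (hg.intervalIntegrable _ _)
  have := (ae_restrict_iff' measurableSet_Ioi).1 hh.2
  filter_upwards [this] with u hu hu'
  have h0 : u ∈ Ioi (0:ℝ) := hu'.1
  rw [indicator_of_mem h0, norm_mul, norm_cexp_mul]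
  refine le_trans ?_ (hle u hu'.1.le hu'.2)
  simp only [Complex.neg_re]
  gcongr
  exact hu h0

lemma solveFwd_le {lam c : ℂ} {h : ℝ → ℂ} {σ b d A : ℝ} (hh : Bd b A h) (hd : 0 < d) (hσ : lam.re + σ ≤ 0)
    (hc : lam.re + σ ≤ -d ∧ σ ≤ b ∨ σ + d ≤ b) : Bd σ (‖c‖ + A / d) (solveFwd lam c h) := by
  refine ⟨(solveFwd_continuous hh.gr).aestronglyMeasurable, hl_ae fun t ht => ?_⟩
  have hA := hh.nonneg
  have key : rexp (lam.re * t) *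
      ‖∫ s in (0:ℝ)..t, (Ioi (0:ℝ)).indicator (fun s => cexp (-lam * s) * h s) s‖
      ≤ A / d * rexp (-σ * t) := by
    rcases hc with ⟨h1, h2⟩ | h1
    · have := norm_primitive_le (lam := lam) hh ht.le (g := fun s => A * rexp ((-lam.re - σ) * s)) (by fun_prop)
        (fun s hs _ => by
          rw [mul_left_comm, ← Real.exp_add]
          refine mul_le_mul_of_nonneg_left (Real.exp_le_exp.2 ?_) hA
          nlinarith)
      rw [intervalIntegral.integral_const_mul] at this
      have h3 := exp_integral_le (d := -lam.re - σ) (t := t) (by linarith)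
      calc _ ≤ rexp (lam.re * t) * (A * (rexp ((-lam.re - σ) * t) / (-lam.re - σ))) := by
            gcongr; exact this.trans (by gcongr)
        _ = A / (-lam.re - σ) * rexp (-σ * t) := by
            rw [show -σ * t = lam.re * t + (-lam.re - σ) * t by ring, Real.exp_add]; ring
        _ ≤ _ := by gcongr; linarith
    · have := norm_primitive_le (lam := lam) hh ht.le
        (g := fun s => A * rexp ((-lam.re - σ) * t) * rexp (-d * s)) (by fun_prop)
        (fun s hs hs' => by
          rw [mul_left_comm, ← Real.exp_add, mul_assoc, ← Real.exp_add]
          refine mul_le_mul_of_nonneg_left (Real.exp_le_exp.2 ?_) hA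
          nlinarith)
      rw [intervalIntegral.integral_const_mul] at this
      have h3 := exp_neg_integral_le (d := d) (t := t) hd
      calc _ ≤ rexp (lam.re * t) * (A * rexp ((-lam.re - σ) * t) * (1 / d)) := by
            gcongr; exact this.trans (by gcongr)
        _ = A / d * rexp (-σ * t) := by
            rw [show -σ * t = lam.re * t + (-lam.re - σ) * t by ring, Real.exp_add]; ring
        _ ≤ _ := le_rfl
  rw [solveFwd, norm_mul, norm_cexp_mul, add_mul]
  calc _ ≤ rexp (lam.re * t) * (‖c‖ + ‖∫ s in (0:ℝ)..t,
        (Ioi (0:ℝ)).indicator (fun s => cexp (-lam * s) * h s) s‖) := by gcongr; exact norm_add_le _ _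
    _ = ‖c‖ * rexp (lam.re * t) + rexp (lam.re * t) * ‖∫ s in (0:ℝ)..t,
        (Ioi (0:ℝ)).indicator (fun s => cexp (-lam * s) * h s) s‖ := by ring
    _ ≤ _ := by
        gcongr
        nlinarith

/-- Existence of a decaying solution of `f' = lam f + h` that has a given value at `0`. -/
lemma exists_forward {lam : ℂ} (c : ℂ) {h : ℝ → ℂ} {σ b d A : ℝ} (hh : Bd b A h) (hd : 0 < d)
    (hσ : lam.re + σ ≤ 0) (hc : lam.re + σ ≤ -d ∧ σ ≤ b ∨ σ + d ≤ b) :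
    ∃ f, Continuous f ∧ f 0 = c ∧ WD f (fun t => lam * f t + h t) ∧ Bd σ (‖c‖ + A / d) f :=
  ⟨_, solveFwd_continuous hh.gr, solveFwd_zero _ _ _, solveFwd_wd hh.gr, solveFwd_le hh hd hσ hc⟩

/-- Existence of a decaying solution of `f' = lam f + h` when `e^{lam t}` does not decay. -/
lemma exists_backward {lam : ℂ} {h : ℝ → ℂ} {b d A : ℝ} (hh : Bd b A h) (hd : 0 < d)
    (hb : d ≤ lam.re + b) :
    ∃ f, Continuous f ∧ WD f (fun t => lam * f t + h t) ∧ Bd b (A / d) f := by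
  set k : ℝ → ℂ := fun s => cexp (-lam * s) * h s with hk
  have hkB : Bd (b + lam.re) A k := by
    have := hh.exp_mul (-lam)
    rwa [Complex.neg_re, sub_neg_eq_add] at this
  have hbint : ∀ t, IntegrableOn (fun s => A * rexp (-(b + lam.re) * s)) (Ioi t) := fun t =>
    (integrableOn_exp_mul_Ioi (by linarith) t).const_mul A
  have hint : IntegrableOn k (Ioi 0) := Integrable.mono' (hbint 0) hkB.1 hkB.2
  refine ⟨solveFwd lam (-∫ s in Ioi (0:ℝ), k s) h, solveFwd_continuous hh.gr, solveFwd_wd hh.gr,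
    (solveFwd_continuous hh.gr).aestronglyMeasurable, hl_ae fun t ht => ?_⟩
  have e1 : ∫ s in (0:ℝ)..t, (Ioi (0:ℝ)).indicator k s = ∫ s in (0:ℝ)..t, k s := by
    refine intervalIntegral.integral_congr_ae (ae_of_all _ fun s hs => ?_)
    rw [uIoc_of_le ht.le] at hs
    exact indicator_of_mem hs.1 _
  have e2 := intervalIntegral.integral_interval_add_Ioi (f := k) (μ := volume) (a := 0) (b := t)
        hint (hint.mono_set (Ioi_subset_Ioi ht.le))
  have e3 : solveFwd lam (-∫ s in Ioi (0:ℝ), k s) h t =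
      - (cexp (lam * t) * ∫ s in Ioi t, k s) := by
    rw [solveFwd, ← hk, e1, ← e2]; ring
  rw [e3, norm_neg, norm_mul, norm_cexp_mul]
  have e4 : ‖∫ s in Ioi t, k s‖ ≤ ∫ s in Ioi t, A * rexp (-(b + lam.re) * s) := by
    refine norm_integral_le_of_norm_le (hbint t) ?_
    exact ae_mono (Measure.restrict_mono (Ioi_subset_Ioi ht.le) le_rfl) hkB.2
  rw [integral_const_mul, integral_exp_mul_Ioi (by linarith)] at e4
  have hA := hh.nonneg
  calc _ ≤ rexp (lam.re * t) * (A * (-rexp (-(b + lam.re) * t) / -(b + lam.re))) := by gcongr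
    _ = A / (b + lam.re) * rexp (-b * t) := by
        rw [show -b * t = lam.re * t + -(b + lam.re) * t by ring, Real.exp_add, neg_div_neg_eq]; ring
    _ ≤ _ := by gcongr; linarith

/-- The characteristic exponents `λ₊, λ₋`, roots of `λ² + γ λ = n² + iαn`, of the transport operator on
the `n`-th mode, with the spectral gaps that make the estimates uniform in `n`. -/
lemma exists_exponents (α γ : ℝ) (hγ : 2 < γ) (n : ℤ) : ∃ a b : ℂ,
    a + b = -γ ∧ a * b = -(-(I * n) ^ 2 + α * (I * n)) ∧
    |(n:ℝ)| / (1 + γ) ≤ a.re ∧ b.re ≤ -γ - |(n:ℝ)| / (1 + γ) ∧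
    ‖a‖ ≤ (γ + (1 + γ + |α|)) * (1 + |(n:ℝ)|) ∧ ‖b‖ ≤ (γ + (1 + γ + |α|)) * (1 + |(n:ℝ)|) := by
  obtain ⟨ξ', hξ'⟩ := IsAlgClosed.exists_pow_nat_eq
    ((γ:ℂ)^2/4 + (-(I * n) ^ 2 + α * (I * n))) (n := 2) two_pos
  obtain ⟨ξ, hξ, hξ0⟩ : ∃ ξ : ℂ, ξ ^ 2 = (γ:ℂ)^2/4 + (-(I * n) ^ 2 + α * (I * n)) ∧ 0 ≤ ξ.re := by
    rcases le_total 0 ξ'.re with h | h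
    · exact ⟨ξ', hξ', h⟩
    · exact ⟨-ξ', by rw [neg_sq, hξ'], by simpa using h⟩
  have hz : (γ:ℂ)^2/4 + (-(I * n) ^ 2 + α * (I * n)) = ((γ^2/4 + (n:ℝ)^2 : ℝ) : ℂ) + ((α * n : ℝ) : ℂ) * I := by
    push_cast; ring_nf; simp
  have hre : ξ.re ^ 2 - ξ.im ^ 2 = γ ^ 2 / 4 + (n:ℝ) ^ 2 := by
    have := congrArg Complex.re (hξ.trans hz)
    rw [Complex.add_re, Complex.ofReal_re, re_ofReal_mul, sq, Complex.mul_re] at this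
    simp at this; nlinarith
  have hn : ‖ξ‖ ^ 2 ≤ γ ^ 2 / 4 + |(n:ℝ)| ^ 2 + |α| * |(n:ℝ)| := by
    rw [← norm_pow, hξ, hz]
    refine (norm_add_le _ _).trans ?_
    rw [norm_mul, Complex.norm_I, norm_real, norm_real, mul_one, norm_eq_abs,
      norm_eq_abs, abs_mul, abs_of_nonneg (by positivity : 0 ≤ γ ^ 2 / 4 + (n:ℝ) ^ 2), sq_abs]
  set m := |(n:ℝ)| with hm
  have hm0 : 0 ≤ m := abs_nonneg _
  have hm1 : m ≤ m ^ 2 := by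
    rcases eq_or_ne n 0 with h | h
    · simp [hm, h]
    · have : (1:ℝ) ≤ m := by rw [hm]; exact_mod_cast Int.one_le_abs h
      nlinarith
  have hlow : γ / 2 + m / (1 + γ) ≤ ξ.re := by
    refine abs_le_of_sq_le_sq' ?_ hξ0 |>.2
    have h1 : ξ.re ^ 2 ≥ γ ^ 2 / 4 + m ^ 2 := by rw [hm, sq_abs]; nlinarith [sq_nonneg ξ.im]
    refine le_trans ?_ h1
    have h2 : (γ / 2 + m / (1 + γ)) ^ 2 = γ ^ 2 / 4 + (γ * (1 + γ) * m + m ^ 2) / (1 + γ) ^ 2 := by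
      field_simp; ring
    rw [h2, add_le_add_iff_left, div_le_iff₀ (by positivity)]
    nlinarith [mul_nonneg (by positivity : 0 ≤ γ * (1 + γ)) (sub_nonneg.2 hm1), mul_nonneg (by linarith : 0 ≤ γ) (sq_nonneg m)]
  have hup : ‖ξ‖ ≤ (1 + γ + |α|) * (1 + m) := by
    have ha := abs_nonneg α
    refine abs_le_of_sq_le_sq' (hn.trans ?_) (by positivity) |>.2
    have e : ((1 + γ + |α|) * (1 + m)) ^ 2 = (1 + γ + |α|) ^ 2 * (1 + 2 * m + m ^ 2) := by ring
    rw [e]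
    have h1 : 1 + γ ^ 2 + |α| ≤ (1 + γ + |α|) ^ 2 := by nlinarith [mul_nonneg (by linarith : 0 ≤ γ) ha]
    have h2 : (1 + γ ^ 2 + |α|) * (1 + 2 * m + m ^ 2) ≤ (1 + γ + |α|) ^ 2 * (1 + 2 * m + m ^ 2) := by gcongr
    nlinarith [mul_nonneg ha hm0, mul_nonneg ha (sq_nonneg m), mul_nonneg (sq_nonneg γ) hm0, mul_nonneg (sq_nonneg γ) (sq_nonneg m), sq_nonneg γ, sq_nonneg m]
  have hγn : ‖(γ:ℂ)/2‖ ≤ γ * (1 + m) := by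
    rw [norm_div, norm_real, Real.norm_of_nonneg (by linarith)]
    simp; nlinarith
  have hg : ((γ:ℂ)/2).re = γ / 2 := by
    rw [show (γ:ℂ)/2 = ((γ/2 : ℝ) : ℂ) by push_cast; rfl, Complex.ofReal_re]
  refine ⟨-(γ/2) + ξ, -(γ/2) - ξ, by ring, by linear_combination -hξ, ?_, ?_, ?_, ?_⟩
  · rw [Complex.add_re, Complex.neg_re, hg]; linarith
  · rw [Complex.sub_re, Complex.neg_re, hg]; linarith
  · refine (norm_add_le _ _).trans ?_
    rw [norm_neg, add_mul]; exact add_le_add hγn hup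
  · refine (norm_sub_le _ _).trans ?_
    rw [norm_neg, add_mul]; exact add_le_add hγn hup

/-! ### Solvability of the scalar equations of a mode -/

lemma norm_I_mul_int (n : ℤ) : ‖I * (n:ℂ)‖ = |(n:ℝ)| := by simp

lemma I_mul_int_sq (n : ℤ) : (I * (n:ℂ)) ^ 2 = -((|(n:ℝ)| : ℝ) : ℂ) ^ 2 := by
  rw [← Complex.ofReal_pow, sq_abs, mul_pow, Complex.I_sq]; push_cast; ring

lemma WD.cexp (c b : ℂ) : WD (fun t => c * cexp (b * t)) (fun t => b * (c * cexp (b * t))) := by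
  have h := (solveFwd_wd (lam := b) (c := c) Gr.zero)
  have e : ∀ t, solveFwd b c (fun _ => 0) t = c * cexp (b * t) := fun t => by
    simp [solveFwd, mul_comm]
  simpa only [funext e, add_zero] using h

/-- Existence for the vertical component of a mode: a factorized second order equation with zero
initial value, whose solution gains a factor `1 + |n|`. -/
lemma exists_vertical (α γ ρ : ℝ) (hγ : 2 < γ) (hρ : 2 < ρ) (hργ : ρ ≤ γ) : ∃ C : ℝ, 0 ≤ C ∧
    ∀ (n : ℤ) (g h₀ h₁ : ℝ → ℂ) (A : ℝ), Bd (2 * ρ - 3) A g → Bd (2 * ρ - 3) A h₀ →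
      Bd (2 * ρ - 3) A h₁ → ∃ w p : ℝ → ℂ, Continuous w ∧ w 0 = 0 ∧ WD w p ∧
        Bd (ρ - 1) (C * A / (1 + |(n:ℝ)|)) w ∧ Bd (ρ - 1) (C * A) p ∧
        ∀ η, Tst η → ∫ t, (p t * deriv η t - (I * n) ^ 2 * w t * η t + γ * w t * deriv η t
          + α * (I * n) * w t * η t + h₀ t * deriv η t - I * n * h₁ t * η t
          - g t * η t) ∂hl = 0 := by
  set L := γ + (1 + γ + |α|) with hL
  have hL0 : 0 < L := by positivity
  set K := (1 + 1 + L) * (1 + γ) + 1 with hK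
  have hK0 : 0 < K := by positivity
  refine ⟨K * (1 + γ) + (L * (K * (1 + γ)) + K), by positivity, fun n g h₀ h₁ A hg hh₀ hh₁ => ?_⟩
  obtain ⟨a, b, hab, hab', ha, hb, ha', hb'⟩ := exists_exponents α γ hγ n
  rw [← hL] at ha' hb'
  set m := |(n:ℝ)| with hm
  have hm0 : 0 ≤ m := abs_nonneg _
  have hA := hg.nonneg
  set N := I * (n:ℂ) with hN
  have hNn : ‖N‖ = m := norm_I_mul_int n
  -- The equation is `(∂ - a)(w' - b w + h₀) = f`. The factor `y` is integrated from infinity, as `e^{at}`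
  -- does not decay, and `w` from `0`, as `e^{bt}` decays at least like `e^{-ρt}`.
  set f : ℝ → ℂ := fun t => -(g t + N * h₁ t) - a * h₀ t with hf
  have hfB : Bd (2 * ρ - 3) ((1 + 1 + L) * (1 + m) * A) f :=
    ((hg.add (hh₁.const_mul N)).neg.sub (hh₀.const_mul a)).mono le_rfl (by
      rw [hNn]; nlinarith) (by positivity)
  -- Each integration gains the distance of the exponent from the decay rate, which is at least `d ~ 1 + |n|`;
  -- the first gain makes up for the factor `1 + |n|` in the bound of `f`.
  set d := (1 + m) / (1 + γ) with hd
  have hd0 : 0 < d := by positivity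
  have hdle : d ≤ 1 + m / (1 + γ) := by
    rw [hd, add_div]; gcongr; rw [div_le_one (by positivity)]; linarith
  obtain ⟨y, -, hy, hyB⟩ := exists_backward (lam := a) hfB hd0 (by linarith)
  have e1 : (1 + 1 + L) * (1 + m) * A / d = (1 + 1 + L) * (1 + γ) * A := by rw [hd]; field_simp
  rw [e1] at hyB
  have hy1 : Bd (ρ - 1) (K * A) (fun t => y t - h₀ t) :=
    (hyB.sub hh₀).mono (by linarith) (by rw [hK]; linarith) (by positivity)
  obtain ⟨w, hwc, hw0, hw, hwB⟩ := exists_forward (lam := b) 0 (σ := ρ - 1) (b := ρ - 1) hy1 hd0 (by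
    have : 0 ≤ m / (1 + γ) := by positivity
    linarith) (Or.inl ⟨by linarith, le_rfl⟩)
  rw [norm_zero, zero_add] at hwB
  have e2 : K * A / d = K * (1 + γ) * A / (1 + m) := by rw [hd]; field_simp
  rw [e2] at hwB
  refine ⟨w, _, hwc, hw0, hw, hwB.mono le_rfl ?_ (by positivity), ((hwB.const_mul b).add hy1).mono le_rfl ?_ (by positivity), fun η hη => ?_⟩
  · gcongr; have : 0 ≤ L * (K * (1 + γ)) + K := by positivity
    linarith
  · have : ‖b‖ * (K * (1 + γ) * A / (1 + m)) ≤ L * (1 + m) * (K * (1 + γ) * A / (1 + m)) := by gcongr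
    have e3 : L * (1 + m) * (K * (1 + γ) * A / (1 + m)) = L * (K * (1 + γ)) * A := by field_simp
    have : 0 ≤ K * (1 + γ) * A := by positivity
    nlinarith
  · have h1 := hy.eq η hη
    have h2 := hw.eq η hη
    have h3 := (hη.deriv.integrable_mul hy.gr).add (hη.integrable_mul hy.gr')
    have h4 := ((hη.deriv.integrable_mul hw.gr).add (hη.integrable_mul hw.gr')).const_mul a
    have h5 := integral_sub h3 h4
    simp only [Pi.add_apply, integral_const_mul] at h5
    rw [h1, h2, mul_zero, sub_zero] at h5
    rw [← h5]
    congr 1; ext t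
    have e : (γ:ℂ) = -(a + b) := by rw [hab]; ring
    have e' : N ^ 2 = a * b + α * N := by rw [hab']; ring
    rw [e, e', hf]; ring

/-- Existence for the angular component of the mode `n = 0`. The free constant of the vorticity
equation makes the initial value vanish, which is possible since `γ ≠ 2`. -/
lemma exists_angular_zero (γ ρ : ℝ) (hγ : 2 < γ) (hρ : 2 < ρ) (hργ : ρ ≤ γ) : ∃ C : ℝ, 0 ≤ C ∧
    ∀ (g h₀ h₁ : ℝ → ℂ) (A : ℝ), Bd (2 * ρ - 3) A g → Bd (2 * ρ - 3) A h₀ →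
      Bd (2 * ρ - 3) A h₁ → ∃ w p : ℝ → ℂ, Continuous w ∧ w 0 = 0 ∧ WD w p ∧
        Bd (ρ - 1) (C * A) w ∧ Bd (ρ - 1) (C * A) p ∧
        ∀ η, Tst η → ∫ t, (p t * deriv η t + w t * η t + γ * w t * (deriv η t - η t)
          + h₀ t * deriv η t - h₁ t * η t - g t * η t) ∂hl = 0 := by
  have hρ2 : 0 < ρ - 2 := by linarith
  set K := (2 + γ) / (ρ - 2) with hK
  have hK0 : 0 < K := by positivity
  set K' := (K + 1) / (ρ - 2) with hK'
  have hK0' : 0 < K' := by positivity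
  refine ⟨2 * K' + (2 * K' + (K + 1 + K' * γ)), by positivity, fun g h₀ h₁ A hg hh₀ hh₁ => ?_⟩
  have hA := hg.nonneg
  set f : ℝ → ℂ := fun t => -(g t + h₁ t) + (-(1 - γ)) * h₀ t with hf
  have hn1 : ‖(-(1 - γ) : ℂ)‖ = γ - 1 := by
    rw [show (-(1 - γ) : ℂ) = ((γ - 1 : ℝ) : ℂ) by push_cast; ring, norm_real,
      Real.norm_of_nonneg (by linarith)]
  have hfB : Bd (2 * ρ - 3) ((2 + γ) * A) f :=
    ((hg.add hh₁).neg.add (hh₀.const_mul (-(1 - γ) : ℂ))).mono le_rfl (by rw [hn1]; nlinarith)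
      (by positivity)
  have hre : (1 - γ : ℂ).re = 1 - γ := by simp
  obtain ⟨z, -, -, hz, hzB⟩ := exists_forward (lam := 1 - γ) 0 (σ := ρ - 1) hfB hρ2 (by
    rw [hre]; linarith) (Or.inr (by linarith))
  rw [norm_zero, zero_add, show (2 + γ) * A / (ρ - 2) = K * A by rw [hK]; ring] at hzB
  have hzB' : Bd (ρ - 1) ((K + 1) * A) (fun t => z t - h₀ t) :=
    (hzB.sub (hh₀.mono (by linarith) le_rfl hA)).mono le_rfl (by linarith) (by positivity)
  obtain ⟨v, hvc, hv, hvB⟩ := exists_backward (lam := -1) hzB' hρ2 (by simp; linarith)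
  rw [show (K + 1) * A / (ρ - 2) = K' * A by rw [hK']; ring] at hvB
  -- `v` need not vanish at `0`; the homogeneous solution `c e^{(1-γ)t}` corrects this. Its decay is enough as `ρ ≤ γ`.
  set c := v 0 with hc
  have hcB : ‖c‖ ≤ K' * A := by simpa using hvB.le_of_continuous hvc le_rfl
  have hE := WD.cexp c (1 - γ)
  have hEB : ∀ k : ℂ, Bd (ρ - 1) (‖k‖ * (K' * A)) (fun t => k * (c * cexp ((1 - γ) * t))) := fun k =>
    ((Bd.cexp c (1 - γ)).const_mul k).mono (by rw [hre]; linarith) (by gcongr) (by positivity)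
  have hn2 : ‖(2 - γ : ℂ)‖ ≤ γ := by
    rw [show (2 - γ : ℂ) = ((2 - γ : ℝ) : ℂ) by push_cast; ring, norm_real,
      Real.norm_of_nonpos (by linarith)]; linarith
  have hw := hv.sub hE
  have hwB : Bd (ρ - 1) (2 * K' * A) (fun t => v t - c * cexp ((1 - γ) * t)) :=
    (hvB.sub (by simpa using hEB 1)).mono le_rfl (by linarith) (by positivity)
  refine ⟨fun t => v t - c * cexp ((1 - γ) * t), _, hvc.sub (continuous_const.mul (continuous_cexp_mul _)), by simp [← hc], hw,
    hwB.mono le_rfl (by gcongr; have : 0 ≤ 2 * K' + (K + 1 + K' * γ) := by positivity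
                        linarith) (by positivity), ?_, fun η hη => ?_⟩
  · refine ((hwB.neg.add (hzB'.sub (hEB (2 - γ)))).congr (ae_of_all _ fun t => ?_)).mono le_rfl ?_ (by positivity)
    · simp; ring
    · have : ‖(2 - γ : ℂ)‖ * (K' * A) ≤ γ * (K' * A) := by gcongr
      have : 0 ≤ K' * A := by positivity
      nlinarith
  · have hz' := hz.sub (hE.const_mul (2 - γ))
    have h1 := hz'.eq η hη
    have h2 := hw.eq η hη
    have h3 := (hη.deriv.integrable_mul hz'.gr).add (hη.integrable_mul hz'.gr')
    have h4 := ((hη.deriv.integrable_mul hw.gr).add (hη.integrable_mul hw.gr')).const_mul (γ - 1 : ℂ)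
    have h5 := integral_add h3 h4
    simp only [Pi.add_apply, integral_const_mul] at h5
    rw [h1, h2, mul_zero, add_zero] at h5
    rw [← h5]
    congr 1; ext t
    rw [hf]; ring

set_option maxHeartbeats 1000000 in
/-- Existence for the stream function of a mode `n ≠ 0`: the vorticity `om = e^{-2t}(ψ'' - n²ψ)`
solves the factorized transport equation, and the free multiple of `e^{λ₋t}` in it makes both
`ψ` and `ψ'` vanish at `t = 0`. -/
lemma exists_stream (α γ ρ : ℝ) (hγ : 2 < γ) (hρ : 2 < ρ) (hρ3 : ρ < 3) (hργ : ρ ≤ γ) :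
    ∃ C : ℝ, 0 ≤ C ∧ ∀ (n : ℤ) (f₀ f₁ f₂ : ℝ → ℂ) (A : ℝ), n ≠ 0 →
      Bd ρ (4 * |(n:ℝ)| ^ 2 * A) f₀ → Bd ρ (5 * |(n:ℝ)| * A) f₁ → Bd ρ A f₂ →
      ∃ ψ q s : ℝ → ℂ, Continuous ψ ∧ Continuous q ∧ ψ 0 = 0 ∧ q 0 = 0 ∧ WD ψ q ∧ WD q s ∧
        Bd (ρ - 2) (C * A / |(n:ℝ)| ^ 2) ψ ∧ Bd (ρ - 2) (C * A / |(n:ℝ)|) q ∧ Bd (ρ - 2) (C * A) s ∧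
        ∀ χ, Tst χ → ∫ t : ℝ, (cexp ((-2:ℂ) * t) * (s t + (I * n) ^ 2 * ψ t) *
          (deriv (deriv χ) t - γ * deriv χ t
            - (-(I * n) ^ 2 + α * (I * n)) * χ t)
          - f₀ t * χ t + f₁ t * deriv χ t - f₂ t * deriv (deriv χ) t) ∂hl = 0 := by
  set L := γ + (1 + γ + |α|) with hL
  have hL0 : 0 < L := by positivity
  have hα := abs_nonneg α
  set K₀ := 5 + |α| + 2 * L * (5 + γ) with hK₀
  have hK₀0 : 0 < K₀ := by positivity
  set K₁ := K₀ * (1 + γ) + (5 + γ) with hK₁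
  have hK₁0 : 0 < K₁ := by positivity
  set K₂ := K₁ * (1 + γ) + 1 with hK₂
  have hK₂0 : 0 < K₂ := by positivity
  set K₃ := K₂ * (1 + (3 + 2 * L)) with hK₃
  have hK₃0 : 0 < K₃ := by positivity
  have h3 : 0 < 3 - ρ := by linarith
  set K₄ := 2 * K₂ / (3 - ρ) with hK₄
  have hK₄0 : 0 < K₄ := by positivity
  refine ⟨K₄ + (2 * K₂ + K₄) + (2 * K₂ + K₃ + (2 * K₂ + K₄)), by positivity,
    fun n f₀ f₁ f₂ A hn hf₀ hf₁ hf₂ => ?_⟩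
  obtain ⟨a, b, hab, hab', ha, hb, ha', hb'⟩ := exists_exponents α γ hγ n
  rw [← hL] at ha' hb'
  have hNn : ‖I * (n:ℂ)‖ = |(n:ℝ)| := norm_I_mul_int n
  have hNsq := I_mul_int_sq n
  have hm1 : (1:ℝ) ≤ |(n:ℝ)| := by exact_mod_cast Int.one_le_abs hn
  set m := |(n:ℝ)| with hm
  have hm0 : 0 < m := by linarith
  have hA := hf₂.nonneg
  set N := I * (n:ℂ) with hN
  set μ := -N ^ 2 + α * N with hμ
  have hμn : ‖μ‖ ≤ (1 + |α|) * m ^ 2 := by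
    refine (norm_add_le _ _).trans ?_
    rw [norm_neg, norm_pow, norm_mul (α:ℂ) N, hNn, norm_real, norm_eq_abs]
    nlinarith [mul_nonneg hα hm0.le]
  have haL : ‖a‖ ≤ 2 * L * m := ha'.trans (by nlinarith)
  have hbL : ‖b‖ ≤ 2 * L * m := hb'.trans (by nlinarith)
  have hγn : ‖(γ:ℂ)‖ = γ := by rw [norm_real, Real.norm_of_nonneg (by linarith)]
  -- The vorticity equation is `(∂ - a)(om' - b om - F₁) = F₀ + a F₁` for `om = e^{-2t}(ψ'' - n²ψ) - f₂`.
  set F₀ : ℝ → ℂ := fun t => f₀ t + μ * f₂ t with hF₀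
  set F₁ : ℝ → ℂ := fun t => f₁ t - γ * f₂ t with hF₁
  have hF₀B : Bd ρ ((5 + |α|) * m ^ 2 * A) F₀ := (hf₀.add (hf₂.const_mul μ)).mono le_rfl (by
    have := mul_le_mul_of_nonneg_right hμn hA
    nlinarith) (by positivity)
  have hF₁B : Bd ρ ((5 + γ) * m * A) F₁ := (hf₁.sub (hf₂.const_mul γ)).mono le_rfl (by
    rw [hγn]
    have : γ * A ≤ γ * A * m := le_mul_of_one_le_right (by positivity) hm1
    linarith) (by positivity)
  have hFB : Bd ρ (K₀ * m ^ 2 * A) (fun t => F₀ t + a * F₁ t) :=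
    (hF₀B.add (hF₁B.const_mul a)).mono le_rfl (by
      have := mul_le_mul_of_nonneg_right haL hF₁B.nonneg
      rw [hK₀]; nlinarith) (by positivity)
  have hd0 : 0 < m / (1 + γ) := by positivity
  obtain ⟨y, -, hy, hyB⟩ := exists_backward (lam := a) hFB hd0 (by linarith)
  rw [show K₀ * m ^ 2 * A / (m / (1 + γ)) = K₀ * (1 + γ) * m * A by field_simp] at hyB
  have hyB' : Bd ρ (K₁ * m * A) (fun t => y t + F₁ t) :=
    (hyB.add hF₁B).mono le_rfl (by rw [hK₁]; linarith) (by positivity)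
  obtain ⟨om, -, -, hom, homB⟩ := exists_forward (lam := b) 0 (σ := ρ) hyB' hd0 (by linarith)
    (Or.inl ⟨by linarith, le_rfl⟩)
  rw [norm_zero, zero_add, show K₁ * m * A / (m / (1 + γ)) = K₁ * (1 + γ) * A by field_simp] at homB
  have homB' : Bd ρ (K₂ * A) (fun t => om t + f₂ t) :=
    (homB.add hf₂).mono le_rfl (by rw [hK₂]; linarith) (by positivity)
  -- The stream function solves `(∂ - m)(∂ + m)ψ = h`. The decaying solution `Y` of the first factor need not
  -- vanish at `0`, as `ψ'(0) = 0` requires; adding a multiple of the free vorticity `e^{bt}` corrects this.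
  have hhB := homB'.exp_mul 2
  rw [show (2:ℂ).re = 2 from rfl] at hhB
  obtain ⟨Y, hYc, hY, hYB⟩ := exists_backward (lam := (m:ℂ)) hhB hm0 (by simp; linarith)
  set c := Y 0 with hc
  have hcB : ‖c‖ ≤ K₂ * A / m := by simpa using hYB.le_of_continuous hYc le_rfl
  have hre : (2 + b).re ≤ -(ρ - 2) := by simp; linarith
  have hE := WD.cexp c (2 + b)
  have hEB : Bd (ρ - 2) (K₂ * A / m) (fun t => c * cexp ((2 + b) * t)) :=
    (Bd.cexp c (2 + b)).mono (by linarith) hcB (by positivity)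
  set h : ℝ → ℂ := fun t => cexp ((2:ℂ) * t) * (om t + f₂ t)
    - (2 + b - m) * (c * cexp ((2 + b) * t)) with hh
  have hkn : ‖(2 + b - m : ℂ)‖ ≤ (3 + 2 * L) * m := by
    refine (norm_sub_le _ _).trans ((add_le_add_left (norm_add_le _ _) _).trans ?_)
    rw [norm_real, Real.norm_of_nonneg hm0.le]
    norm_num; nlinarith
  have hhB' : Bd (ρ - 2) (K₃ * A) h := (hhB.sub (hEB.const_mul _)).mono le_rfl (by
    have := mul_le_mul_of_nonneg_right hkn hEB.nonneg
    have e : (3 + 2 * L) * m * (K₂ * A / m) = (3 + 2 * L) * K₂ * A := by field_simp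
    rw [hK₃]; nlinarith) (by positivity)
  set Z : ℝ → ℂ := fun t => Y t - c * cexp ((2 + b) * t) with hZ
  have hZc : Continuous Z := hYc.sub (continuous_const.mul (continuous_cexp_mul _))
  have hZ0 : Z 0 = 0 := by simp [hZ, hc]
  have hZw : WD Z (fun t => m * Z t + h t) := by
    refine (hY.sub hE).congr (EventuallyEq.rfl) (ae_of_all _ fun t => ?_)
    simp only [hZ, hh]; ring
  have hZB : Bd (ρ - 2) (2 * K₂ * A / m) Z := (hYB.sub hEB).mono le_rfl (by ring_nf; rfl) (by positivity)
  have hd1 : 0 < (3 - ρ) * m := by positivity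
  -- `e^{-mt}` decays faster than `e^{-(ρ-2)t}`, since `ρ < 3` and `m ≥ 1`.
  obtain ⟨ψ, hψc, hψ0, hψ, hψB⟩ := exists_forward (lam := (-m:ℂ)) 0 (σ := ρ - 2) hZB hd1
    (by simp; nlinarith) (Or.inl ⟨by simp; nlinarith, le_rfl⟩)
  rw [norm_zero, zero_add, show 2 * K₂ * A / m / ((3 - ρ) * m) = K₄ * A / m ^ 2 by
    rw [hK₄]; field_simp] at hψB
  have hmn : ‖(m:ℂ)‖ = m := by rw [norm_real, Real.norm_of_nonneg hm0.le]
  set q : ℝ → ℂ := fun t => -m * ψ t + Z t with hq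
  have hqB : Bd (ρ - 2) ((2 * K₂ + K₄) * A / m) q :=
    ((hψB.const_mul (-m)).add hZB).mono le_rfl (by
      rw [norm_neg, hmn]; apply le_of_eq; field_simp; ring) (by positivity)
  have hqw : WD q (fun t => m * Z t + h t - m * q t) := by
    refine ((hψ.const_mul (-m)).add hZw).congr (EventuallyEq.rfl) (ae_of_all _ fun t => ?_)
    simp only [hq]; ring
  refine ⟨ψ, q, _, hψc, by fun_prop, hψ0, by simp [hq, hψ0, hZ0], hψ, hqw,
    hψB.mono le_rfl ?_ (by positivity), hqB.mono le_rfl ?_ (by positivity),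
    (((hZB.const_mul m).add hhB').sub (hqB.const_mul m)).mono le_rfl ?_ (by positivity), fun χ hχ => ?_⟩
  · refine div_le_div_of_nonneg_right (mul_le_mul_of_nonneg_right ?_ hA) (by positivity)
    have : 0 ≤ 2 * K₂ + K₄ + (2 * K₂ + K₃ + (2 * K₂ + K₄)) := by positivity
    linarith
  · refine div_le_div_of_nonneg_right (mul_le_mul_of_nonneg_right ?_ hA) (by positivity)
    have : 0 ≤ K₄ + (2 * K₂ + K₃ + (2 * K₂ + K₄)) := by positivity
    linarith
  · rw [hmn]
    have e : m * (2 * K₂ * A / m) + K₃ * A + m * ((2 * K₂ + K₄) * A / m)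
      = (2 * K₂ + K₃ + (2 * K₂ + K₄)) * A := by field_simp
    rw [e]
    have : 0 ≤ K₄ + (2 * K₂ + K₄) := by positivity
    exact mul_le_mul_of_nonneg_right (by linarith) hA
  · have hom' := hom.sub (WD.cexp ((2 + b - m) * c) b)
    have hθ : Tst (fun t => deriv χ t + a * χ t) := hχ.deriv.add (hχ.const_mul a)
    have hθ' : ∀ t, deriv (fun t => deriv χ t + a * χ t) t = deriv (deriv χ) t + a * deriv χ t := fun t =>
      ((hχ.deriv.hasDerivAt t).add ((hχ.hasDerivAt t).const_mul a)).deriv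
    -- The weak form is that of the two first order equations, tested with `χ' + aχ` and `χ`.
    have h1 := hom'.eq _ hθ
    have h2 := hy.eq χ hχ
    have h5 := integral_sub ((hθ.deriv.integrable_mul hom'.gr).add (hθ.integrable_mul hom'.gr'))
      ((hχ.deriv.integrable_mul hy.gr).add (hχ.integrable_mul hy.gr'))
    simp only [Pi.add_apply] at h5
    rw [h1, h2, sub_zero] at h5
    rw [← h5]
    congr 1; ext t
    have e0 : cexp ((-2:ℂ) * t) * cexp ((2:ℂ) * t) = 1 := by
      rw [← Complex.exp_add]; simp
    have e1 : cexp ((-2:ℂ) * t) * cexp ((2 + b) * t) = cexp (b * t) := by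
      rw [← Complex.exp_add]; ring_nf
    have e2 : cexp ((-2:ℂ) * t) * ((m * Z t + h t - m * q t) + N ^ 2 * ψ t)
        = om t + f₂ t - (2 + b - m) * c * cexp (b * t) := by
      have : (m * Z t + h t - m * q t) + N ^ 2 * ψ t = h t := by rw [hNsq, hq]; ring
      rw [this, hh]
      linear_combination (om t + f₂ t) * e0 - (2 + b - m) * c * e1
    have e : (γ:ℂ) = -(a + b) := by rw [hab]; ring
    have e' : μ = -(a * b) := by rw [hab', hμ]; ring
    rw [e2, hθ']
    simp only [hF₀, hF₁, e, e']
    ring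

/-! ### The linearized equations on a mode -/

lemma integral_add_of_integral_eq_zero {f g : ℝ → ℂ} (hg : Integrable g hl) (h0 : ∫ t, g t ∂hl = 0) :
    ∫ t, (f t + g t) ∂hl = ∫ t, f t ∂hl := by
  by_cases hf : Integrable f hl
  · rw [integral_add hf hg, h0, add_zero]
  · rw [integral_undef hf, integral_undef]
    intro h
    exact hf ((h.sub hg).congr (ae_of_all _ fun t => by simp))

/-- The cylindrical components `(∇w)_{kl}` of the gradient of the field `∑_k w_k e^{inθ} e_k`, where
`p_k` stands for `dw_k/dt` and `t = log |x|`. -/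
noncomputable def gradMode (n : ℤ) (w p : ModeVec) (k l : Fin 3) (t : ℝ) : ℂ :=
  cexp ((-1:ℂ) * t) * (![![p 0 t, p 1 t, p 2 t],
    ![I * n * w 0 t - w 1 t, I * n * w 1 t + w 0 t, I * n * w 2 t],
    ![0, 0, 0]] : Fin 3 → Fin 3 → ℂ) k l

/-- The cylindrical components of the Hamel flow. -/
noncomputable def hamelMode (α γ : ℝ) (k : Fin 3) (t : ℝ) : ℂ :=
  cexp ((-1:ℂ) * t) * (![-γ, α, 0] : Fin 3 → ℂ) k

/-- The integrand of the weak form of the linearized equation on the `n`-th mode, tested with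
`∑_k η_k e^{-inθ} e_k`. -/
noncomputable def modeInt (α γ : ℝ) (n : ℤ) (G : ModeVec) (H : ModeTen)
    (w p η : ModeVec) (t : ℝ) : ℂ :=
  cexp ((2:ℂ) * t) * (∑ k, ∑ l, (gradMode n w p k l t - hamelMode α γ k t * w l t
    - w k t * hamelMode α γ l t + H k l t) * gradMode (-n) η (fun k => deriv (η k)) k l t
    - ∑ k, G k t * η k t)

/-- Weak decaying solutions, vanishing at `t = 0`, of the linearized equation on the `n`-th mode with
force `G - div H`. -/
structure ModeSol (α γ ρ : ℝ) (n : ℤ) (G : ModeVec) (H : ModeTen)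
    (w p : ModeVec) : Prop where
  grG : ∀ k, Gr (G k)
  grH : ∀ k l, Gr (H k l)
  cont : ∀ k, Continuous (w k)
  zero : ∀ k t, t ≤ 0 → w k t = 0
  wd : ∀ k, WD (w k) (p k)
  div : ∀ᵐ t ∂hl, p 0 t + w 0 t + I * n * w 1 t = 0
  bd : ∃ A, ∀ k, Bd (ρ - 1) A (w k) ∧ Bd (ρ - 1) A (p k)
  eq : ∀ η : ModeVec, (∀ k, Tst (η k)) →
    (∀ t, deriv (η 0) t + η 0 t - I * n * η 1 t = 0) →
    ∫ t, modeInt α γ n G H w p η t ∂hl = 0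

/-- The horizontal part of `modeInt`. -/
noncomputable def horInt (α γ : ℝ) (n : ℤ) (G : ModeVec) (H : ModeTen)
    (w p η : ModeVec) (t : ℝ) : ℂ :=
  p 0 t * deriv (η 0) t + p 1 t * deriv (η 1) t
  + (I * n * w 0 t - w 1 t) * (-(I * n) * η 0 t - η 1 t)
  + (I * n * w 1 t + w 0 t) * (-(I * n) * η 1 t + η 0 t)
  + 2 * γ * w 0 t * deriv (η 0) t
  - (-γ * w 1 t + α * w 0 t) * (deriv (η 1) t - I * n * η 0 t - η 1 t)
  - 2 * α * w 1 t * (-(I * n) * η 1 t + η 0 t)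
  + cexp ((1:ℂ) * t) * (H 0 0 t * deriv (η 0) t + H 0 1 t * deriv (η 1) t
    + H 1 0 t * (-(I * n) * η 0 t - η 1 t) + H 1 1 t * (-(I * n) * η 1 t + η 0 t))
  - cexp ((2:ℂ) * t) * (G 0 t * η 0 t + G 1 t * η 1 t)

/-- The vertical part of `modeInt`. -/
noncomputable def verInt (α γ : ℝ) (n : ℤ) (G : ModeVec) (H : ModeTen)
    (w p : ℝ → ℂ) (η : ℝ → ℂ) (t : ℝ) : ℂ :=
  p t * deriv η t - (I * n) ^ 2 * w t * η t + γ * w t * deriv η t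
    + α * (I * n) * w t * η t + cexp ((1:ℂ) * t) * H 0 2 t * deriv η t
    - I * n * (cexp ((1:ℂ) * t) * H 1 2 t) * η t
    - cexp ((2:ℂ) * t) * G 2 t * η t

lemma modeInt_eq (α γ : ℝ) (n : ℤ) (G : ModeVec) (H : ModeTen)
    (w p η : ModeVec) (t : ℝ) : modeInt α γ n G H w p η t =
      horInt α γ n G H w p η t + verInt α γ n G H (w 2) (p 2) (η 2) t := by
  have e2 : cexp ((2:ℂ) * t) = (cexp ((-1:ℂ) * t))⁻¹ ^ 2 := by
    rw [← Complex.exp_neg, ← Complex.exp_nat_mul]; congr 1; push_cast; ring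
  have e1 : cexp ((1:ℂ) * t) = (cexp ((-1:ℂ) * t))⁻¹ := by
    rw [← Complex.exp_neg]; congr 1; ring
  have hE := Complex.exp_ne_zero ((-1:ℂ) * t)
  simp only [modeInt, horInt, verInt, gradMode, hamelMode, Fin.sum_univ_three, e1, e2]
  generalize cexp ((-1:ℂ) * t) = E at *
  simp only [Matrix.cons_val_zero, Matrix.cons_val_one, Matrix.cons_val, Int.cast_neg]
  field_simp
  ring

lemma verInt_integrable {α γ : ℝ} {n : ℤ} {G : ModeVec} {H : ModeTen}
    {w p η : ℝ → ℂ} (hG : ∀ k, Gr (G k)) (hH : ∀ k l, Gr (H k l)) (hw : Gr w) (hp : Gr p) (hη : Tst η) :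
    Integrable (verInt α γ n G H w p η) hl := by
  have h1 := hη.deriv.integrable_mul ((hp.add (hw.const_mul γ)).add ((hH 0 2).exp_mul 1))
  have h2 := hη.integrable_mul (((hw.const_mul (-(I * n) ^ 2 + α * (I * n))).sub
    (((hH 1 2).exp_mul 1).const_mul (I * n))).sub ((hG 2).exp_mul 2))
  refine (h1.add h2).congr (ae_of_all _ fun t => ?_)
  simp only [Pi.add_apply, verInt]; ring

lemma gradMode_tst {n : ℤ} {η : ModeVec} (hη : ∀ k, Tst (η k)) (k l : Fin 3) :
    Tst (gradMode n η (fun k => deriv (η k)) k l) := by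
  have h : ∀ f, Tst f → Tst (fun t => cexp ((-1:ℂ) * t) * f t) := fun f hf => hf.exp_mul _
  have h00 := h _ (hη 0).deriv
  have h01 := h _ (hη 1).deriv
  have h02 := h _ (hη 2).deriv
  have h10 := h _ (((hη 0).const_mul (I * n)).sub (hη 1))
  have h11 := h _ (((hη 1).const_mul (I * n)).add (hη 0))
  have h12 := h _ ((hη 2).const_mul (I * n))
  have h2 := h _ Tst.zero
  fin_cases k <;> fin_cases l <;> assumption

lemma gradMode_gr {n : ℤ} {w p : ModeVec} (hw : ∀ k, Gr (w k)) (hp : ∀ k, Gr (p k)) (k l : Fin 3) :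
    Gr (gradMode n w p k l) := by
  have h : ∀ f, Gr f → Gr (fun t => cexp ((-1:ℂ) * t) * f t) := fun f hf => hf.exp_mul _
  have h00 := h _ (hp 0)
  have h01 := h _ (hp 1)
  have h02 := h _ (hp 2)
  have h10 := h _ (((hw 0).const_mul (I * n)).sub (hw 1))
  have h11 := h _ (((hw 1).const_mul (I * n)).add (hw 0))
  have h12 := h _ ((hw 2).const_mul (I * n))
  have h2 := h _ Gr.zero
  fin_cases k <;> fin_cases l <;> assumption

lemma modeInt_integrable {α γ : ℝ} {n : ℤ} {G : ModeVec} {H : ModeTen}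
    {w p η : ModeVec} (hG : ∀ k, Gr (G k)) (hH : ∀ k l, Gr (H k l)) (hw : ∀ k, Gr (w k))
    (hp : ∀ k, Gr (p k)) (hη : ∀ k, Tst (η k)) :
    Integrable (modeInt α γ n G H w p η) hl := by
  have hV : ∀ k l, Gr fun t => hamelMode α γ k t * w l t := fun k l => by
    refine ((((hw l).const_mul ((![-γ, α, 0] : Fin 3 → ℂ) k))).exp_mul (-1)).congr
      (ae_of_all _ fun t => ?_)
    simp only [hamelMode]; ring
  have hV' : ∀ k l, Gr fun t => w k t * hamelMode α γ l t := fun k l => by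
    simpa only [mul_comm] using hV l k
  have h1 : ∀ k l, Integrable (fun t : ℝ => (cexp ((2:ℂ) * t) * (gradMode n w p k l t -
      hamelMode α γ k t * w l t - w k t * hamelMode α γ l t + H k l t)) *
      gradMode (-n) η (fun k => deriv (η k)) k l t) hl := fun k l =>
    (gradMode_tst hη k l).integrable_mul
      (((((gradMode_gr hw hp k l).sub (hV k l)).sub (hV' k l)).add (hH k l)).exp_mul 2)
  have h2 : ∀ k, Integrable (fun t : ℝ => (cexp ((2:ℂ) * t) * G k t) * η k t) hl := fun k =>
    (hη k).integrable_mul ((hG k).exp_mul 2)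
  refine ((integrable_finsetSum Finset.univ fun k _ => integrable_finsetSum Finset.univ fun l _ =>
    h1 k l).sub (integrable_finsetSum Finset.univ fun k _ => h2 k)).congr (ae_of_all _ fun t => ?_)
  simp only [modeInt, Pi.sub_apply, mul_sub, mul_sum]
  simp only [mul_assoc]

lemma hasDerivAt_exp_mul {f : ℝ → ℂ} {f' : ℂ} {t : ℝ} (c : ℂ) (h : HasDerivAt f f' t) :
    HasDerivAt (fun t : ℝ => cexp (c * t) * f t) (cexp (c * t) * (f' + c * f t)) t :=
  ((hasDerivAt_cexp_mul c t).fun_mul h).congr_deriv (by ring)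

/-- In terms of stream functions `ψ` of the field and `χ` of the test field, the weak form of the
momentum equation is the weak form of the vorticity equation, up to total derivatives. -/
lemma integral_horInt_stream {α γ : ℝ} {n : ℤ} (G : ModeVec) (H : ModeTen)
    {w p : ModeVec} {ψ q s χ : ℝ → ℂ} (hψ : WD ψ q) (hq : WD q s) (hχ : Tst χ)
    (hw0 : w 0 =ᵐ[hl] fun t => -(I * n) * (cexp ((-1:ℂ) * t) * ψ t))
    (hw1 : w 1 =ᵐ[hl] fun t => cexp ((-1:ℂ) * t) * q t)
    (hp0 : p 0 =ᵐ[hl] fun t => -(I * n) * (cexp ((-1:ℂ) * t) * (q t - ψ t)))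
    (hp1 : p 1 =ᵐ[hl] fun t => cexp ((-1:ℂ) * t) * (s t - q t)) {η : ModeVec}
    (hη0 : η 0 = fun t : ℝ => I * n * (cexp ((-1:ℂ) * t) * χ t))
    (hη1 : η 1 = fun t : ℝ => cexp ((-1:ℂ) * t) * deriv χ t) :
    ∫ t, horInt α γ n G H w p η t ∂hl = ∫ t : ℝ, (cexp ((-2:ℂ) * t) * (s t + (I * n) ^ 2 * ψ t) *
          (deriv (deriv χ) t - γ * deriv χ t
            - (-(I * n) ^ 2 + α * (I * n)) * χ t)
          - (I * n * (cexp ((1:ℂ) * t) * G 0 t) + I * n * (H 0 0 t - H 1 1 t)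
            + (I * n) ^ 2 * H 1 0 t) * χ t
          + (-(cexp ((1:ℂ) * t) * G 1 t) + I * n * (H 0 0 t - H 1 1 t) - H 0 1 t - H 1 0 t) * deriv χ t
          - (-H 0 1 t) * deriv (deriv χ) t) ∂hl := by
  set N := I * (n:ℂ) with hN
  set μ := -N ^ 2 + α * N with hμ
  -- The two sides differ by the identities `∫ (qθ₁' + sθ₁) = 0` and `∫ (ψθ₂' + qθ₂) = 0`, which define the weak
  -- derivatives of `q` and `ψ`.
  have hθ₁ : Tst fun t => cexp ((-2:ℂ) * t) * ((γ - 1) * deriv χ t + μ * χ t) :=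
    ((hχ.deriv.const_mul _).add (hχ.const_mul _)).exp_mul _
  have hθ₂ : Tst fun t => cexp ((-2:ℂ) * t) * (μ * deriv χ t + (1 - γ) * N ^ 2 * χ t) :=
    ((hχ.deriv.const_mul _).add (hχ.const_mul _)).exp_mul _
  have hd : ∀ (c d : ℂ) (t : ℝ), deriv (fun t : ℝ => cexp ((-2:ℂ) * t) * (c * deriv χ t + d * χ t)) t =
      cexp ((-2:ℂ) * t) * ((c * deriv (deriv χ) t + d * deriv χ t) + (-2) * (c * deriv χ t + d * χ t)) :=
    fun c d t => (hasDerivAt_exp_mul _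
      (((hχ.deriv.hasDerivAt t).const_mul c).add ((hχ.hasDerivAt t).const_mul d))).deriv
  have h1 := hq.eq _ hθ₁
  have h2 := hψ.eq _ hθ₂
  have i1 := (hθ₁.deriv.integrable_mul hq.gr).add (hθ₁.integrable_mul hq.gr')
  have i2 := (hθ₂.deriv.integrable_mul hψ.gr).add (hθ₂.integrable_mul hψ.gr')
  have h3 := integral_add i1 i2
  simp only [Pi.add_apply] at h3
  rw [h1, h2, add_zero] at h3
  refine Eq.trans ?_ (integral_add_of_integral_eq_zero (i1.add i2) (by simpa only [Pi.add_apply] using h3))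
  refine integral_congr_ae ?_
  filter_upwards [hw0, hw1, hp0, hp1] with t a0 a1 b0 b1
  have d0 : deriv (η 0) t = N * (cexp ((-1:ℂ) * t) * (deriv χ t + (-1) * χ t)) := by
    rw [hη0]; exact ((hasDerivAt_exp_mul _ (hχ.hasDerivAt t)).const_mul N).deriv
  have d1 : deriv (η 1) t = cexp ((-1:ℂ) * t) * (deriv (deriv χ) t + (-1) * deriv χ t) := by
    rw [hη1]; exact (hasDerivAt_exp_mul _ (hχ.deriv.hasDerivAt t)).deriv
  simp only [Pi.add_apply]
  rw [hd, hd]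
  have c0 : η 0 t = N * (cexp ((-1:ℂ) * t) * χ t) := by rw [hη0]
  have c1 : η 1 t = cexp ((-1:ℂ) * t) * deriv χ t := by rw [hη1]
  unfold horInt
  rw [← hN, a0, a1, b0, b1, d0, d1, c0, c1]
  have e2 : cexp ((2:ℂ) * t) = (cexp ((-1:ℂ) * t))⁻¹ ^ 2 := by
    rw [← Complex.exp_neg, ← Complex.exp_nat_mul]; congr 1; push_cast; ring
  have e1 : cexp ((1:ℂ) * t) = (cexp ((-1:ℂ) * t))⁻¹ := by
    rw [← Complex.exp_neg]; congr 1; ring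
  have e3 : cexp ((-2:ℂ) * t) = (cexp ((-1:ℂ) * t)) ^ 2 := by
    rw [← Complex.exp_nat_mul]; congr 1; push_cast; ring
  have hE := Complex.exp_ne_zero ((-1:ℂ) * t)
  rw [e1, e2, e3]
  generalize cexp ((-1:ℂ) * t) = E at hE ⊢
  rw [hμ]
  clear_value N
  field_simp
  ring

/-- A test field with `n ≠ 0` that satisfies the divergence condition has a stream function. -/
lemma exists_test_stream {n : ℤ} (hn : n ≠ 0) {η : ModeVec} (hη : ∀ k, Tst (η k))
    (hd : ∀ t, deriv (η 0) t + η 0 t - I * n * η 1 t = 0) :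
    ∃ χ, Tst χ ∧ (η 0 = fun t : ℝ => I * n * (cexp ((-1:ℂ) * t) * χ t)) ∧
      (η 1 = fun t : ℝ => cexp ((-1:ℂ) * t) * deriv χ t) := by
  have hN : I * (n:ℂ) ≠ 0 := mul_ne_zero Complex.I_ne_zero (by exact_mod_cast hn)
  set N := I * (n:ℂ)
  have e0 : ∀ t : ℝ, cexp ((-1:ℂ) * t) * cexp ((1:ℂ) * t) = 1 := fun t => by
    rw [← Complex.exp_add]; simp
  refine ⟨fun t => N⁻¹ * (cexp ((1:ℂ) * t) * η 0 t), ((hη 0).exp_mul 1).const_mul _, ?_, ?_⟩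
  · ext t
    have := e0 t
    beta_reduce
    generalize cexp ((-1:ℂ) * t) = E, cexp ((1:ℂ) * t) = E' at *
    field_simp
    linear_combination (- η 0 t) * this
  · ext t
    rw [((hasDerivAt_exp_mul 1 ((hη 0).hasDerivAt t)).const_mul N⁻¹).deriv]
    have := e0 t
    have h := hd t
    have h' : deriv (η 0) t + 1 * η 0 t = N * η 1 t := by linear_combination h
    rw [h']
    generalize cexp ((-1:ℂ) * t) = E, cexp ((1:ℂ) * t) = E' at *
    field_simp
    linear_combination (- η 1 t) * this

lemma test_radial_zero {n : ℤ} (hn : n = 0) {η : ModeVec} (hη : ∀ k, Tst (η k))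
    (hd : ∀ t, deriv (η 0) t + η 0 t - I * n * η 1 t = 0) (t : ℝ) : η 0 t = 0 := by
  have hT := (hη 0).exp_mul 1
  have h := is_const_of_deriv_eq_zero hT.differentiable (fun t => by
    rw [(hasDerivAt_exp_mul 1 ((hη 0).hasDerivAt t)).deriv]
    have := hd t
    rw [hn] at this
    simp at this
    rw [one_mul (η 0 t), this, mul_zero]) t 0
  rw [(hη 0).eq_zero_of_nonpos le_rfl, mul_zero] at h
  exact (mul_eq_zero.1 h).resolve_left (Complex.exp_ne_zero _)

lemma WD.of_eqOn {f f' g : ℝ → ℂ} (h : WD f f') (hg : ∀ t, 0 < t → g t = f t) : WD g f' :=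
  h.congr (hl_ae fun t ht => (hg t ht).symm) (EventuallyEq.rfl)

/-- Replacing the velocity by `0` for `t ≤ 0`. -/
lemma ModeSol.of_halfLine {α γ ρ : ℝ} {n : ℤ} {G : ModeVec} {H : ModeTen}
    {w p : ModeVec} (hG : ∀ k, Gr (G k)) (hH : ∀ k l, Gr (H k l)) (hc : ∀ k, Continuous (w k))
    (h0 : ∀ k, w k 0 = 0) (hwd : ∀ k, WD (w k) (p k))
    (hdiv : ∀ᵐ t ∂hl, p 0 t + w 0 t + I * n * w 1 t = 0)
    {A : ℝ} (hB : ∀ k, Bd (ρ - 1) A (w k) ∧ Bd (ρ - 1) A (p k))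
    (heq : ∀ η : ModeVec, (∀ k, Tst (η k)) →
      (∀ t, deriv (η 0) t + η 0 t - I * n * η 1 t = 0) →
      ∫ t, modeInt α γ n G H w p η t ∂hl = 0) :
    ModeSol α γ ρ n G H (fun k t => w k (max t 0)) p := by
  have hm : ∀ t : ℝ, 0 < t → max t 0 = t := fun t ht => max_eq_left ht.le
  have hae : ∀ k, w k =ᵐ[hl] fun t => w k (max t 0) := fun k => hl_ae fun t ht =>
    by simp only [hm t ht]
  refine ⟨hG, hH, fun k => (hc k).comp (continuous_id.max continuous_const), fun k t ht => ?_,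
    fun k => (hwd k).of_eqOn fun t ht => by rw [hm t ht], ?_, ⟨A, fun k => ⟨(hB k).1.congr (hae k), (hB k).2⟩⟩,
    fun η hη hd => ?_⟩
  · rw [max_eq_right ht, h0]
  · filter_upwards [hdiv, hl_pos] with t h ht
    rw [hm t ht]; exact h
  · rw [← heq η hη hd]
    refine integral_congr_ae (hl_ae fun t ht => ?_)
    simp only [modeInt, gradMode, hm t ht]

/-! ### Existence on a mode -/

lemma Bd.of_exp {s s' A : ℝ} {f : ℝ → ℂ} (c : ℂ) (h : Bd s A f) (hs : s - c.re = s') :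
    Bd s' A (fun t => cexp (c * t) * f t) := hs ▸ h.exp_mul c

lemma Bd.le_mul {s A B C : ℝ} {f : ℝ → ℂ} (h : Bd s (B * A) f) (hBC : B ≤ C) (hA : 0 ≤ A) (hC : 0 ≤ C) :
    Bd s (C * A) f := h.mono le_rfl (mul_le_mul_of_nonneg_right hBC hA) (by positivity)

lemma integral_modeInt_eq_zero {α γ : ℝ} {n : ℤ} {G : ModeVec} {H : ModeTen}
    {w p η : ModeVec} (hG : ∀ k, Gr (G k)) (hH : ∀ k l, Gr (H k l)) (hw : Gr (w 2))
    (hp : Gr (p 2)) (hη : Tst (η 2)) (h1 : ∫ t, horInt α γ n G H w p η t ∂hl = 0)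
    (h2 : ∫ t, verInt α γ n G H (w 2) (p 2) (η 2) t ∂hl = 0) : ∫ t, modeInt α γ n G H w p η t ∂hl = 0 := by
  simp only [modeInt_eq]
  rw [integral_add_of_integral_eq_zero (verInt_integrable hG hH hw hp hη) h2, h1]

/-- The linearized equation on a mode has a solution, with bounds uniform in the mode. -/
lemma exists_modeSol (α γ ρ : ℝ) (hγ : 2 < γ) (hρ : 2 < ρ) (hρ3 : ρ < 3) (hργ : ρ ≤ γ) :
    ∃ C : ℝ, 0 ≤ C ∧ ∀ (n : ℤ) (G : ModeVec) (H : ModeTen) (A : ℝ),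
      (∀ k, Bd (2 * ρ - 1) A (G k)) → (∀ k l, Bd (2 * (ρ - 1)) A (H k l)) →
      ∃ w p, ModeSol α γ ρ n G H w p ∧ ∀ k, Bd (ρ - 1) (C * A) (w k) ∧
        Bd (ρ - 1) (C * A) (fun t => n * w k t) ∧ Bd (ρ - 1) (C * A) (p k) := by
  obtain ⟨C₁, hC₁, hver⟩ := exists_vertical α γ ρ hγ hρ hργ
  obtain ⟨C₂, hC₂, hang⟩ := exists_angular_zero γ ρ hγ hρ hργ
  obtain ⟨C₃, hC₃, hstr⟩ := exists_stream α γ ρ hγ hρ hρ3 hργ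
  refine ⟨C₁ + C₂ + 2 * C₃, by positivity, fun n G H A hG hH => ?_⟩
  have hA := (hG 0).nonneg
  have hGg : ∀ k, Gr (G k) := fun k => (hG k).gr
  have hHg : ∀ k l, Gr (H k l) := fun k l => (hH k l).gr
  have hG2 : ∀ k, Bd (2 * ρ - 3) A (fun t => cexp ((2:ℂ) * t) * G k t) := fun k =>
    (hG k).of_exp 2 (by norm_num; ring)
  have hH1 : ∀ k l, Bd (2 * ρ - 3) A (fun t => cexp ((1:ℂ) * t) * H k l t) := fun k l =>
    (hH k l).of_exp 1 (by norm_num; ring)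
  obtain ⟨w₂, p₂, hc₂, h0₂, hwd₂, hB₂, hB₂', hweak₂⟩ := hver n _ _ _ A (hG2 2) (hH1 0 2) (hH1 1 2)
  have hm0 : 0 ≤ |(n:ℝ)| := abs_nonneg _
  have hnn : ‖(n:ℂ)‖ = |(n:ℝ)| := by simp
  have hCA : C₁ ≤ C₁ + C₂ + 2 * C₃ := by linarith
  have hC0 : 0 ≤ C₁ + C₂ + 2 * C₃ := by positivity
  have hle2 : C₁ * A / (1 + |(n:ℝ)|) ≤ C₁ * A := div_le_self (by positivity) (by linarith)
  have hw₂ : Bd (ρ - 1) ((C₁ + C₂ + 2 * C₃) * A) w₂ :=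
    (hB₂.mono le_rfl hle2 (by positivity)).le_mul hCA hA hC0
  have hnw₂ : Bd (ρ - 1) ((C₁ + C₂ + 2 * C₃) * A) (fun t => n * w₂ t) := by
    refine Bd.le_mul ((hB₂.const_mul n).mono le_rfl ?_ (by positivity)) hCA hA hC0
    rw [hnn, mul_div_assoc', div_le_iff₀ (by positivity), mul_comm]
    exact mul_le_mul_of_nonneg_left (by linarith) (by positivity)
  have hp₂ := hB₂'.le_mul hCA hA hC0
  -- it remains to find the horizontal components
  suffices h : ∃ w₀ w₁ p₀ p₁ : ℝ → ℂ, Continuous w₀ ∧ Continuous w₁ ∧ w₀ 0 = 0 ∧ w₁ 0 = 0 ∧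
      WD w₀ p₀ ∧ WD w₁ p₁ ∧ (∀ t, p₀ t + w₀ t + I * n * w₁ t = 0) ∧
      (∀ f ∈ ({w₀, w₁, p₀, p₁, fun t => n * w₀ t, fun t => n * w₁ t} : Set (ℝ → ℂ)),
        Bd (ρ - 1) ((C₁ + C₂ + 2 * C₃) * A) f) ∧
      ∀ η : ModeVec, (∀ k, Tst (η k)) →
      (∀ t, deriv (η 0) t + η 0 t - I * n * η 1 t = 0) →
      ∫ t, horInt α γ n G H ![w₀, w₁, w₂] ![p₀, p₁, p₂] η t ∂hl = 0 by
    obtain ⟨w₀, w₁, p₀, p₁, hc0, hc1, h00, h01, hd0, hd1, hdiv, hB, hweak⟩ := h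
    have hb : ∀ k, Bd (ρ - 1) ((C₁ + C₂ + 2 * C₃) * A) ((![w₀, w₁, w₂] : ModeVec) k) ∧
        Bd (ρ - 1) ((C₁ + C₂ + 2 * C₃) * A) (fun t => n * (![w₀, w₁, w₂] : ModeVec) k t) ∧
        Bd (ρ - 1) ((C₁ + C₂ + 2 * C₃) * A) ((![p₀, p₁, p₂] : ModeVec) k) := by
      intro k
      fin_cases k
      · exact ⟨hB _ (by simp), hB (fun t => n * w₀ t) (by simp), hB _ (by simp)⟩
      · exact ⟨hB _ (by simp), hB (fun t => n * w₁ t) (by simp), hB _ (by simp)⟩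
      · exact ⟨hw₂, hnw₂, hp₂⟩
    refine ⟨_, _, ModeSol.of_halfLine (w := ![w₀, w₁, w₂]) (p := ![p₀, p₁, p₂]) hGg hHg ?_ ?_ ?_
      (ae_of_all _ hdiv) (fun k => ⟨(hb k).1, (hb k).2.2⟩) (fun η hη hd => ?_), fun k => ?_⟩
    · intro k; fin_cases k <;> assumption
    · intro k; fin_cases k <;> assumption
    · intro k; fin_cases k <;> assumption
    · refine integral_modeInt_eq_zero hGg hHg hwd₂.gr hwd₂.gr' (hη 2) (hweak η hη hd) ?_
      exact hweak₂ (η 2) (hη 2)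
    · have hae : ∀ t : ℝ, 0 < t → max t 0 = t := fun t ht => max_eq_left ht.le
      refine ⟨(hb k).1.congr (hl_ae fun t ht => ?_), (hb k).2.1.congr (hl_ae fun t ht => ?_), (hb k).2.2⟩ <;>
      simp only [hae t ht]
  rcases eq_or_ne n 0 with hn | hn
  -- For `n = 0` the radial component of the solution and of the test field vanish.
  · obtain ⟨v, p, hvc, hv0, hv, hvB, hpB, hvw⟩ := hang _ _ _ A (hG2 1) (hH1 0 1) (hH1 1 0)
    have hCA' : C₂ ≤ C₁ + C₂ + 2 * C₃ := by linarith
    have hz : Bd (ρ - 1) ((C₁ + C₂ + 2 * C₃) * A) (fun _ => 0) :=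
      (by simpa using hvB.const_mul 0 : Bd (ρ - 1) 0 (fun _ => 0)).mono le_rfl (by positivity) (by positivity)
    refine ⟨fun _ => 0, v, fun _ => 0, p, continuous_const, hvc, rfl, hv0,
      by simpa using WD.cexp 0 0, hv, fun t => by simp [hn], ?_, fun η hη hd => ?_⟩
    · rintro f (rfl | rfl | rfl | rfl | rfl | rfl)
      · exact hz
      · exact hvB.le_mul hCA' hA hC0
      · exact hz
      · exact hpB.le_mul hCA' hA hC0
      · simpa using hz
      · simpa [hn] using hz
    · have h0 := test_radial_zero hn hη hd
      have h0' : ∀ t, deriv (η 0) t = 0 := fun t => by rw [funext h0]; simp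
      refine Eq.trans ?_ (hvw (η 1) (hη 1))
      refine integral_congr_ae (ae_of_all _ fun t => ?_)
      simp only [horInt, h0, h0', hn, Matrix.cons_val_zero, Matrix.cons_val_one]
      push_cast
      ring
  · have hNn : ‖I * (n:ℂ)‖ = |(n:ℝ)| := norm_I_mul_int n
    have hm1 : (1:ℝ) ≤ |(n:ℝ)| := by exact_mod_cast Int.one_le_abs hn
    have hG1 : ∀ k, Bd ρ A (fun t => cexp ((1:ℂ) * t) * G k t) := fun k =>
      ((hG k).exp_mul 1).mono (by norm_num; linarith) le_rfl hA
    have hH0 : ∀ k l, Bd ρ A (H k l) := fun k l => (hH k l).mono (by linarith) le_rfl hA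
    set N := I * (n:ℂ) with hN
    set m := |(n:ℝ)| with hm
    have hmm : m ≤ m ^ 2 := by nlinarith
    have hN2 : ‖N ^ 2‖ = m ^ 2 := by rw [norm_pow, hNn]
    -- Sources of the vorticity equation that are produced by `G` and `H`.
    have hf₀ : Bd ρ (4 * m ^ 2 * A) (fun t => N * (cexp ((1:ℂ) * t) * G 0 t) + N * (H 0 0 t - H 1 1 t)
            + N ^ 2 * H 1 0 t) :=
      ((((hG1 0).const_mul N).add (((hH0 0 0).sub (hH0 1 1)).const_mul N)).add
        ((hH0 1 0).const_mul (N ^ 2))).mono le_rfl (by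
          rw [hNn, hN2]; have := mul_le_mul_of_nonneg_right hmm hA; nlinarith) (by positivity)
    have hf₁ : Bd ρ (5 * m * A) (fun t => -(cexp ((1:ℂ) * t) * G 1 t) + N * (H 0 0 t - H 1 1 t)
        - H 0 1 t - H 1 0 t) :=
      ((((hG1 1).neg.add (((hH0 0 0).sub (hH0 1 1)).const_mul N)).sub (hH0 0 1)).sub (hH0 1 0)).mono le_rfl
        (by rw [hNn]; have := mul_le_mul_of_nonneg_right hm1 hA; nlinarith) (by positivity)
    obtain ⟨ψ, q, s, hψc, hqc, hψ0, hq0, hψ, hq, hψB, hqB, hsB, hweak⟩ :=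
      hstr n _ _ _ A hn hf₀ hf₁ (hH0 0 1).neg
    have hE : ∀ {f : ℝ → ℂ} {B : ℝ}, Bd (ρ - 2) B f → Bd (ρ - 1) B (fun t => cexp ((-1:ℂ) * t) * f t) :=
      fun h => h.of_exp (-1) (by norm_num; ring)
    have hm0' : 0 < m := by linarith
    have hCA' : 2 * C₃ ≤ C₁ + C₂ + 2 * C₃ := by linarith
    have e1 : m * (C₃ * A / m ^ 2) = C₃ * A / m := by field_simp
    have e2 : m * (C₃ * A / m) = C₃ * A := by field_simp
    have l1 : C₃ * A / m ≤ C₃ * A := div_le_self (by positivity) hm1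
    have l2 : C₃ * A / m ^ 2 ≤ C₃ * A / m := div_le_div_of_nonneg_left (by positivity) hm0' hmm
    have hCA0 : 0 ≤ C₃ * A := by positivity
    have fin : ∀ {f : ℝ → ℂ} {B : ℝ}, Bd (ρ - 1) B f → B ≤ 2 * C₃ * A →
        Bd (ρ - 1) ((C₁ + C₂ + 2 * C₃) * A) f := fun h hB =>
      (h.mono le_rfl hB (by positivity)).le_mul hCA' hA hC0
    have b0 := (hE hψB).const_mul (-N)
    have b1 := hE hqB
    have b2 := (hE (hqB.sub hψB)).const_mul (-N)
    have b3 := hE (hsB.sub hqB)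
    rw [norm_neg, hNn] at b0 b2
    refine ⟨fun t => -N * (cexp ((-1:ℂ) * t) * ψ t), fun t => cexp ((-1:ℂ) * t) * q t,
      fun t => -N * (cexp ((-1:ℂ) * t) * (q t - ψ t)), fun t => cexp ((-1:ℂ) * t) * (s t - q t),
      by fun_prop, by fun_prop, by simp [hψ0], by simp [hq0], ?_, ?_, fun t => by ring, ?_, fun η hη hd => ?_⟩
    · refine ((hψ.exp_mul (-1)).const_mul (-N)).congr (EventuallyEq.rfl) (ae_of_all _ fun t => ?_)
      ring
    · refine (hq.exp_mul (-1)).congr (EventuallyEq.rfl) (ae_of_all _ fun t => ?_)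
      ring
    · rintro f (rfl | rfl | rfl | rfl | rfl | rfl)
      · exact fin b0 (by rw [e1]; linarith)
      · exact fin b1 (by linarith)
      · exact fin b2 (by rw [mul_add, e1, e2]; linarith)
      · exact fin b3 (by linarith)
      · exact fin (b0.const_mul n) (by rw [hnn, e1, e2]; linarith)
      · exact fin (b1.const_mul n) (by rw [hnn, e2]; linarith)
    · obtain ⟨χ, hχ, h0, h1⟩ := exists_test_stream hn hη hd
      rw [integral_horInt_stream G H hψ hq hχ (EventuallyEq.rfl) (EventuallyEq.rfl)
        (EventuallyEq.rfl) (EventuallyEq.rfl) h0 h1]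
      exact hweak χ hχ

/-! ### Uniqueness on a mode -/

lemma eq_of_ae_eq_continuous {f g : ℝ → ℂ} (h : f =ᵐ[hl] g) (hf : Continuous f) (hg : Continuous g)
    {t : ℝ} (ht : 0 ≤ t) : f t = g t := by
  have hB : Bd 0 0 (fun t => f t - g t) := by
    refine ⟨(hf.sub hg).aestronglyMeasurable, ?_⟩
    filter_upwards [h] with t ht
    simp [ht]
  have := hB.le_of_continuous (hf.sub hg) ht
  rw [zero_mul] at this
  exact sub_eq_zero.1 (norm_le_zero_iff.1 this)

lemma WD.eq_zero_of_initial {f : ℝ → ℂ} {lam : ℂ} (h : WD f fun t => lam * f t) (hf : Continuous f)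
    (h0 : f 0 = 0) {t : ℝ} (ht : 0 ≤ t) : f t = 0 := by
  obtain ⟨c, hc⟩ := h.eq_exp
  have key := fun {s} (hs : 0 ≤ s) => eq_of_ae_eq_continuous hc hf
    (continuous_const.mul (continuous_cexp_mul lam)) (t := s) hs
  have := key le_rfl
  simp [h0] at this
  rw [key ht, ← this, zero_mul]

/-- The stream function of a mode `n ≠ 0`. -/
lemma ModeSol.exists_stream {α γ ρ : ℝ} {n : ℤ} {G : ModeVec} {H : ModeTen}
    {w p : ModeVec} (h : ModeSol α γ ρ n G H w p) (hn : n ≠ 0) :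
    ∃ ψ q s : ℝ → ℂ, Continuous ψ ∧ Continuous q ∧ ψ 0 = 0 ∧ q 0 = 0 ∧ WD ψ q ∧ WD q s ∧
      (∃ A, Bd (ρ - 2) A ψ ∧ Bd (ρ - 2) A q ∧ Bd (ρ - 2) A s) ∧
      (w 0 = fun t : ℝ => -(I * n) * (cexp ((-1:ℂ) * t) * ψ t)) ∧
      (w 1 = fun t : ℝ => cexp ((-1:ℂ) * t) * q t) ∧
      (p 0 =ᵐ[hl] fun t : ℝ => -(I * n) * (cexp ((-1:ℂ) * t) * (q t - ψ t))) ∧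
      (p 1 =ᵐ[hl] fun t : ℝ => cexp ((-1:ℂ) * t) * (s t - q t)) := by
  have hN : I * (n:ℂ) ≠ 0 := mul_ne_zero Complex.I_ne_zero (by exact_mod_cast hn)
  obtain ⟨A, hA⟩ := h.bd
  have hdiv := h.div
  set N := I * (n:ℂ)
  have e0 : ∀ t : ℝ, cexp ((-1:ℂ) * t) * cexp ((1:ℂ) * t) = 1 := fun t => by
    rw [← Complex.exp_add]; simp
  have hB : ∀ {f : ℝ → ℂ} {A : ℝ}, Bd (ρ - 1) A f → Bd (ρ - 2) A (fun t => cexp ((1:ℂ) * t) * f t) :=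
    fun hf => hf.of_exp 1 (by norm_num; ring)
  have b0 := (hB (hA 0).1).const_mul (-N⁻¹)
  have b1 := hB (hA 1).1
  have b2 := hB ((hA 1).2.add (hA 1).1)
  refine ⟨fun t => -N⁻¹ * (cexp ((1:ℂ) * t) * w 0 t), fun t => cexp ((1:ℂ) * t) * w 1 t,
    fun t => cexp ((1:ℂ) * t) * (p 1 t + w 1 t), ?_, ?_, by simp [h.zero 0 0 le_rfl],
    by simp [h.zero 1 0 le_rfl], ?_, ?_, ?_, ?_, ?_, ?_, ?_⟩
  · have := h.cont 0; fun_prop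
  · have := h.cont 1; fun_prop
  · refine (((h.wd 0).exp_mul 1).const_mul (-N⁻¹)).congr (EventuallyEq.rfl) ?_
    filter_upwards [hdiv] with t ht
    have : p 0 t + 1 * w 0 t = - N * w 1 t := by linear_combination ht
    rw [this]; field_simp
  · refine ((h.wd 1).exp_mul 1).congr (EventuallyEq.rfl) (ae_of_all _ fun t => ?_)
    ring
  · refine ⟨max (‖-N⁻¹‖ * A) (A + A), b0.mono le_rfl (le_max_left _ _) (le_max_of_le_left b0.nonneg),
      b1.mono le_rfl ?_ (le_max_of_le_left b0.nonneg), b2.mono le_rfl (le_max_right _ _) (le_max_of_le_left b0.nonneg)⟩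
    have := b1.nonneg
    exact le_max_of_le_right (by linarith)
  · ext t
    have := e0 t
    beta_reduce
    generalize cexp ((-1:ℂ) * t) = E, cexp ((1:ℂ) * t) = E' at *
    field_simp
    linear_combination (- w 0 t) * this
  · ext t
    linear_combination (- w 1 t) * e0 t
  · filter_upwards [hdiv] with t ht
    have := e0 t
    generalize cexp ((-1:ℂ) * t) = E, cexp ((1:ℂ) * t) = E' at *
    field_simp
    linear_combination (N * w 1 t + w 0 t) * this + ht
  · refine ae_of_all _ fun t => ?_
    linear_combination (- p 1 t) * e0 t

/-- A decaying weak solution of the homogeneous vorticity equation is a multiple of `e^{bt}`. -/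
lemma vorticity_eq_exp {a b : ℂ} {ρ A : ℝ} {om : ℝ → ℂ} (hB : Bd ρ A om) (ha : 0 ≤ a.re) (hρ : 0 < ρ)
    (hb : b.re ≤ -ρ) (h : ∀ χ, Tst χ → ∫ t, om t * (deriv (deriv χ) t + (a + b) * deriv χ t + a * b * χ t) ∂hl = 0) :
    ∃ k, om =ᵐ[hl] fun t => k * cexp (b * t) := by
  set M : (ℝ → ℂ) → ℂ := fun θ => ∫ t, om t * (deriv θ t + a * θ t) ∂hl with hM
  have hint : ∀ θ, Tst θ → Integrable (fun t => om t * (deriv θ t + a * θ t)) hl := fun θ hθ =>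
    (hθ.deriv.add (hθ.const_mul a)).integrable_mul hB.gr
  obtain ⟨c, hc⟩ := functional_eq_integral (fun θ => M fun t => cexp (-b * t) * θ t)
    (fun η χ hη hχ => by
      simp only [hM]
      rw [← integral_add (hint _ (hη.exp_mul _)) (hint _ (hχ.exp_mul _))]
      congr 1; ext t
      have h1 := hasDerivAt_exp_mul (-b) (hη.hasDerivAt t)
      have h2 := hasDerivAt_exp_mul (-b) (hχ.hasDerivAt t)
      have h3 := hasDerivAt_exp_mul (-b) ((hη.hasDerivAt t).fun_add (hχ.hasDerivAt t))
      rw [h1.deriv, h2.deriv, h3.deriv]; ring)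
    (fun c η hη => by
      simp only [hM]
      rw [← integral_const_mul]
      congr 1; ext t
      have h1 := hasDerivAt_exp_mul (-b) (hη.hasDerivAt t)
      have h3 := hasDerivAt_exp_mul (-b) ((hη.hasDerivAt t).const_mul c)
      rw [h1.deriv, h3.deriv]; ring)
    (fun χ hχ => by
      have h1 := h _ (hχ.exp_mul (-b))
      simp only [hM]
      rw [← h1]
      congr 1; ext t
      have d1 : deriv (fun t : ℝ => cexp (-b * t) * χ t) = fun t : ℝ => cexp (-b * t) * (deriv χ t + -b * χ t) :=
        funext fun t => (hasDerivAt_exp_mul (-b) (hχ.hasDerivAt t)).deriv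
      have h2 := hasDerivAt_exp_mul (-b) ((hχ.deriv.hasDerivAt t).fun_add ((hχ.hasDerivAt t).const_mul (-b)))
      have h3 := hasDerivAt_exp_mul (-b) (hχ.deriv.hasDerivAt t)
      rw [d1, h2.deriv, h3.deriv]; ring)
  have hw : WD om (fun t => a * om t - c * cexp (b * t)) := by
    refine ⟨hB.gr, (hB.gr.const_mul a).sub ((Gr.cexp b).const_mul c), fun η hη => ?_⟩
    have h1 := hc _ (hη.exp_mul b)
    have e : (fun t : ℝ => cexp (-b * t) * (cexp (b * t) * η t)) = η := by
      ext t; rw [← mul_assoc, ← Complex.exp_add]; simp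
    beta_reduce at h1
    rw [e] at h1
    have h2 := integral_sub (hint η hη) ((hη.exp_mul b).integrable.const_mul c)
    rw [integral_const_mul, ← h1] at h2
    rw [← sub_self (M η), ← h2]
    congr 1; ext t; ring
  have hab : a - b ≠ 0 := by
    intro h0
    have := congrArg Complex.re h0
    simp at this; linarith
  have hw' := hw.sub (WD.cexp (c / (a - b)) b)
  have hw'' := hw'.congr (EventuallyEq.rfl) (g' := fun t => a * (om t - c / (a - b) * cexp (b * t)))
    (ae_of_all _ fun t => by field_simp; ring)
  have hz := hw''.eq_zero (hB.sub ((Bd.cexp (c / (a - b)) b).mono (by linarith) le_rfl (norm_nonneg _))) (by linarith)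
  refine ⟨c / (a - b), ?_⟩
  filter_upwards [hz] with t ht
  exact sub_eq_zero.1 ht

/-- The linearized equation on a mode has at most one solution. -/
lemma ModeSol.eq_zero {α γ ρ : ℝ} (hγ : 2 < γ) (hρ : 2 < ρ) (hργ : ρ ≤ γ) {n : ℤ}
    {w p : ModeVec} (h : ModeSol α γ ρ n (fun _ _ => 0) (fun _ _ _ => 0) w p) (k : Fin 3) (t : ℝ) : w k t = 0 := by
  rcases lt_or_ge t 0 with ht | ht
  · exact h.zero k t ht.le
  obtain ⟨A, hA⟩ := h.bd
  obtain ⟨a, b, hab, hab', ha, hb, -, -⟩ := exists_exponents α γ hγ n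
  have hm0 : 0 ≤ |(n:ℝ)| := abs_nonneg _
  have hmγ : 0 ≤ |(n:ℝ)| / (1 + γ) := by positivity
  have hγ' : (γ:ℂ) = -(a + b) := by rw [hab]; ring
  have hver : ∀ η, Tst η → ∫ t, verInt α γ n (fun _ _ => 0) (fun _ _ _ => 0) (w 2) (p 2) η t ∂hl = 0 := by
    intro η hη
    have := h.eq ![fun _ => 0, fun _ => 0, η] (fun k => by fin_cases k; exacts [Tst.zero, Tst.zero, hη])
      (fun t => by simp)
    simp only [modeInt_eq] at this
    refine Eq.trans ?_ this
    congr 1; ext t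
    simp [horInt]
  have hhor : ∀ η₀ η₁, Tst η₀ → Tst η₁ → (∀ t, deriv η₀ t + η₀ t - I * n * η₁ t = 0) →
      ∫ t, horInt α γ n (fun _ _ => 0) (fun _ _ _ => 0) w p ![η₀, η₁, fun _ => 0] t ∂hl = 0 := by
    intro η₀ η₁ h0 h1 hd
    have := h.eq ![η₀, η₁, fun _ => 0] (fun k => by fin_cases k; exacts [h0, h1, Tst.zero]) hd
    simp only [modeInt_eq] at this
    refine Eq.trans ?_ this
    congr 1; ext t
    simp [verInt]
  have stream0 : n ≠ 0 → w 0 t = 0 ∧ w 1 t = 0 := by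
    intro hn
    obtain ⟨ψ, q, s, hψc, hqc, hψ0, hq0, hψ, hq, ⟨B, hψB, hqB, hsB⟩, hw0, hw1, hp0, hp1⟩ := h.exists_stream hn
    have hm1 : (1:ℝ) ≤ |(n:ℝ)| := by exact_mod_cast Int.one_le_abs hn
    have hNsq := I_mul_int_sq n
    have homB : Bd ρ (B + ‖(I * (n:ℂ)) ^ 2‖ * B) (fun t : ℝ => cexp ((-2:ℂ) * t) * (s t + (I * n) ^ 2 * ψ t)) :=
      (hsB.add (hψB.const_mul _)).of_exp (-2) (by norm_num)
    obtain ⟨k, hk⟩ := vorticity_eq_exp (a := a) (b := b) homB (by linarith) (by linarith) (by linarith)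
      (fun χ hχ => by
        have h0 : Tst fun t : ℝ => I * n * (cexp ((-1:ℂ) * t) * χ t) := (hχ.exp_mul _).const_mul _
        have h1 : Tst fun t : ℝ => cexp ((-1:ℂ) * t) * deriv χ t := hχ.deriv.exp_mul _
        have h2 := hhor _ _ h0 h1 (fun t => by
          rw [((hasDerivAt_exp_mul (-1) (hχ.hasDerivAt t)).const_mul (I * (n:ℂ))).deriv]; ring)
        rw [integral_horInt_stream (fun _ _ => 0) (fun _ _ _ => 0) hψ hq hχ (hw0 ▸ EventuallyEq.rfl)
          (hw1 ▸ EventuallyEq.rfl) hp0 hp1 rfl rfl] at h2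
        refine Eq.trans ?_ h2
        congr 1; ext t
        rw [hab', hγ']; ring)
    set m := |(n:ℝ)| with hm
    -- `k e^{bt}` is the vorticity. `ψ' + mψ + k/(m-2-b) e^{(2+b)t}` solves `f' = mf` and decays, so it vanishes; its
    -- value at `0` gives `k = 0`.
    have hkm : (m:ℂ) - 2 - b ≠ 0 := by
      intro h0
      have := congrArg Complex.re h0
      simp at this; linarith
    have hYw : WD (fun t => q t + m * ψ t + k / (m - 2 - b) * cexp ((2 + b) * t))
        (fun t => m * (q t + m * ψ t + k / (m - 2 - b) * cexp ((2 + b) * t))) := by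
      refine ((hq.add (hψ.const_mul m)).add (WD.cexp (k / (m - 2 - b)) (2 + b))).congr (EventuallyEq.rfl) ?_
      filter_upwards [hk] with t ht
      have e0 : cexp ((-2:ℂ) * t) * cexp ((2:ℂ) * t) = 1 := by
        rw [← Complex.exp_add]; simp
      have e1 : cexp ((2:ℂ) * t) * cexp (b * t) = cexp ((2 + b) * t) := by
        rw [← Complex.exp_add]; ring_nf
      have hs : s t = m ^ 2 * ψ t + k * cexp ((2 + b) * t) := by
        rw [hNsq] at ht
        linear_combination cexp ((2:ℂ) * t) * ht + k * e1 - (s t - m ^ 2 * ψ t) * e0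
      rw [hs]; field_simp; ring
    have hre : (2 + b).re ≤ -(ρ - 2) := by simp; linarith
    have hz := hYw.eq_zero ((hqB.add (hψB.const_mul m)).add ((Bd.cexp (k / (m - 2 - b)) (2 + b)).mono
      (by linarith) le_rfl (norm_nonneg _))) (by simp; linarith)
    have key := fun {s} (hs : 0 ≤ s) => eq_of_ae_eq_continuous hz
      ((hqc.add (continuous_const.mul hψc)).add (continuous_const.mul (continuous_cexp_mul _)))
      continuous_const (t := s) hs
    have k0 : k / (m - 2 - b) = 0 := by simpa [hq0, hψ0] using key le_rfl
    have hq' : ∀ s, 0 ≤ s → q s = -m * ψ s := fun s hs => by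
      have h0 : q s + m * ψ s + k / (m - 2 - b) * cexp ((2 + b) * s) = 0 := key hs
      rw [k0, zero_mul, add_zero] at h0
      linear_combination h0
    have hψ' : WD ψ (fun t => -m * ψ t) :=
      hψ.congr (EventuallyEq.rfl) (hl_ae fun t ht => hq' t ht.le)
    have hψt := hψ'.eq_zero_of_initial hψc hψ0 ht
    rw [hw0, hw1]
    simp [hq' t ht, hψt]
  fin_cases k
  · show w 0 t = 0
    rcases eq_or_ne n 0 with hn | hn
    · have : WD (w 0) (fun t => (-1) * w 0 t) := (h.wd 0).congr (EventuallyEq.rfl) (by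
        filter_upwards [h.div] with t ht
        simp [hn] at ht
        linear_combination ht)
      exact this.eq_zero_of_initial (h.cont 0) (h.zero 0 0 le_rfl) ht
    · exact (stream0 hn).1
  · show w 1 t = 0
    rcases eq_or_ne n 0 with hn | hn
    · have hre : (1 - γ : ℂ).re = 1 - γ := by simp
      have hγ2 : (γ:ℂ) - 2 ≠ 0 := by
        rw [show (γ:ℂ) - 2 = ((γ - 2 : ℝ) : ℂ) by push_cast; ring]
        exact_mod_cast (by linarith : γ - 2 ≠ 0)
      -- For `n = 0` the vorticity `w₁' + w₁` is a multiple of `e^{(1-γ)t}`.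
      have hz : WD (fun t => p 1 t + w 1 t) (fun t => (1 - γ) * (p 1 t + w 1 t)) := by
        have g := (h.wd 1).gr'.add (h.wd 1).gr
        refine ⟨g, g.const_mul _, fun η hη => ?_⟩
        have h1 := hhor (fun _ => 0) η Tst.zero hη (fun t => by simp [hn])
        have h2 := (h.wd 1).eq η hη
        have i2 := ((hη.deriv.integrable_mul (h.wd 1).gr).add (hη.integrable_mul (h.wd 1).gr')).const_mul (1 - γ : ℂ)
        have h3 := integral_add_of_integral_eq_zero (f := horInt α γ n (fun _ _ => 0) (fun _ _ _ => 0) w p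
          ![fun _ => 0, η, fun _ => 0]) i2 (by simp only [Pi.add_apply]; rw [integral_const_mul, h2, mul_zero])
        refine Eq.trans ?_ (h3.trans h1)
        refine integral_congr_ae ?_
        have w0 : w 0 =ᵐ[hl] 0 := by
          have : WD (w 0) (fun t => (-1) * w 0 t) := (h.wd 0).congr (EventuallyEq.rfl) (by
            filter_upwards [h.div] with t ht
            simp [hn] at ht
            linear_combination ht)
          exact hl_ae fun t ht => this.eq_zero_of_initial (h.cont 0) (h.zero 0 0 le_rfl) ht.le
        filter_upwards [w0] with t ht
        have ht' : w 0 t = 0 := ht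
        simp [horInt, Pi.add_apply, hn, ht']
        ring
      obtain ⟨c, hc⟩ := hz.eq_exp
      have hE := WD.cexp (c / (γ - 2)) (1 - γ)
      have hY := ((h.wd 1).add hE).congr (EventuallyEq.rfl)
        (g' := fun t => (-1) * (w 1 t + c / (γ - 2) * cexp ((1 - γ) * t))) (by
          filter_upwards [hc] with t ht
          have : p 1 t = c * cexp ((1 - γ) * t) - w 1 t := by linear_combination ht
          rw [this]; field_simp; ring)
      have hz0 := hY.eq_zero ((hA 1).1.add ((Bd.cexp (c / (γ - 2)) (1 - γ)).mono
        (by rw [hre]; linarith) le_rfl (norm_nonneg _))) (by simp; linarith)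
      have key := fun {s} (hs : 0 ≤ s) => eq_of_ae_eq_continuous hz0
        ((h.cont 1).add (continuous_const.mul (continuous_cexp_mul _))) continuous_const (t := s) hs
      have k0 : c / (γ - 2) = 0 := by simpa [h.zero 1 0 le_rfl] using key le_rfl
      have := key ht
      rw [k0, zero_mul, add_zero] at this
      exact this
    · exact (stream0 hn).2
  · show w 2 t = 0
    have hy : WD (fun t => p 2 t - b * w 2 t) (fun t => a * (p 2 t - b * w 2 t)) := by
      have g := (h.wd 2).gr'.sub ((h.wd 2).gr.const_mul b)
      refine ⟨g, g.const_mul a, fun η hη => ?_⟩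
      have h1 := hver η hη
      have h2 := (h.wd 2).eq η hη
      have i2 := ((hη.deriv.integrable_mul (h.wd 2).gr).add (hη.integrable_mul (h.wd 2).gr')).const_mul a
      have h3 := integral_add_of_integral_eq_zero (f := verInt α γ n (fun _ _ => 0) (fun _ _ _ => 0) (w 2) (p 2) η)
        i2 (by simp only [Pi.add_apply]; rw [integral_const_mul, h2, mul_zero])
      rw [h1] at h3
      rw [← h3]
      congr 1; ext t
      have e' : (I * n) ^ 2 = a * b + α * (I * n) := by rw [hab']; ring
      simp only [verInt, Pi.add_apply]
      rw [e', hγ']; ring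
    have hz := hy.eq_zero ((hA 2).2.sub ((hA 2).1.const_mul b)) (by linarith)
    have : WD (w 2) (fun t => b * w 2 t) := (h.wd 2).congr (EventuallyEq.rfl) (by
        filter_upwards [hz] with t ht
        exact sub_eq_zero.1 ht)
    exact this.eq_zero_of_initial (h.cont 2) (h.zero 2 0 le_rfl) ht

/-- Solutions on a mode depend linearly on the data. -/
lemma ModeSol.sub {α γ ρ : ℝ} {n : ℤ} {G G' : ModeVec} {H H' : ModeTen}
    {w p w' p' : ModeVec} (h : ModeSol α γ ρ n G H w p) (h' : ModeSol α γ ρ n G' H' w' p') :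
    ModeSol α γ ρ n (fun k t => G k t - G' k t) (fun k l t => H k l t - H' k l t)
      (fun k t => w k t - w' k t) (fun k t => p k t - p' k t) := by
  refine ⟨fun k => (h.grG k).sub (h'.grG k), fun k l => (h.grH k l).sub (h'.grH k l),
    fun k => (h.cont k).sub (h'.cont k), fun k t ht => by simp [h.zero k t ht, h'.zero k t ht],
    fun k => (h.wd k).sub (h'.wd k), ?_, ?_, fun η hη hd => ?_⟩
  · filter_upwards [h.div, h'.div] with t h1 h2
    linear_combination h1 - h2
  · obtain ⟨A, hA⟩ := h.bd
    obtain ⟨A', hA'⟩ := h'.bd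
    exact ⟨A + A', fun k => ⟨(hA k).1.sub (hA' k).1, (hA k).2.sub (hA' k).2⟩⟩
  · have h1 := integral_sub (modeInt_integrable (α := α) (γ := γ) (n := n) h.grG h.grH (fun k => (h.wd k).gr) (fun k => (h.wd k).gr') hη)
      (modeInt_integrable (α := α) (γ := γ) (n := n) h'.grG h'.grH (fun k => (h'.wd k).gr) (fun k => (h'.wd k).gr') hη)
    rw [h.eq η hη hd, h'.eq η hη hd, sub_zero] at h1
    refine Eq.trans ?_ h1
    congr 1; ext t
    simp only [modeInt_eq, horInt, verInt]
    ring

lemma ModeSol.unique {α γ ρ : ℝ} (hγ : 2 < γ) (hρ : 2 < ρ) (hργ : ρ ≤ γ) {n : ℤ} {G : ModeVec}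
    {H : ModeTen} {w p w' p' : ModeVec}
    (h : ModeSol α γ ρ n G H w p) (h' : ModeSol α γ ρ n G H w' p') : w = w' := by
  have h1 := h.sub h'
  simp only [sub_self] at h1
  ext k t
  exact sub_eq_zero.1 (h1.eq_zero hγ hρ hργ k t)

lemma Bd.conj {s A : ℝ} {f : ℝ → ℂ} (h : Bd s A f) : Bd s A (fun t => conj (f t)) :=
  ⟨Complex.continuous_conj.comp_aestronglyMeasurable h.1, by simpa using h.2⟩

lemma Gr.conj {f : ℝ → ℂ} (h : Gr f) : Gr (fun t => conj (f t)) := by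
  obtain ⟨s, A, h⟩ := h
  exact ⟨s, A, h.conj⟩

lemma Tst.hasDerivAt_conj {η : ℝ → ℂ} (h : Tst η) (t : ℝ) :
    HasDerivAt (fun t => conj (η t)) (conj (_root_.deriv η t)) t :=
  (Complex.conjCLE.toContinuousLinearMap.hasFDerivAt.comp_hasDerivAt t (h.hasDerivAt t))

lemma Tst.conj {η : ℝ → ℂ} (h : Tst η) : Tst (fun t => conj (η t)) :=
  ⟨Complex.conjCLE.contDiff.comp h.smooth, h.compact.comp_left (map_zero _),
    (closure_mono fun t ht => by simpa using ht).trans h.supp⟩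

lemma WD.conj {f f' : ℝ → ℂ} (h : WD f f') : WD (fun t => conj (f t)) (fun t => conj (f' t)) := by
  refine ⟨h.gr.conj, h.gr'.conj, fun η hη => ?_⟩
  have h1 := congrArg conj (h.eq _ hη.conj)
  rw [← integral_conj, map_zero] at h1
  refine Eq.trans ?_ h1
  congr 1; ext t
  rw [(hη.hasDerivAt_conj t).deriv]; simp

/-- Complex conjugation exchanges the modes `n` and `-n`. -/
lemma ModeSol.conj {α γ ρ : ℝ} {n : ℤ} {G : ModeVec} {H : ModeTen}
    {w p : ModeVec} (h : ModeSol α γ ρ n G H w p) :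
    ModeSol α γ ρ (-n) (fun k t => conj (G k t)) (fun k l t => conj (H k l t))
      (fun k t => conj (w k t)) (fun k t => conj (p k t)) := by
  refine ⟨fun k => (h.grG k).conj, fun k l => (h.grH k l).conj,
    fun k => Complex.continuous_conj.comp (h.cont k), fun k t ht => by simp [h.zero k t ht],
    fun k => (h.wd k).conj, ?_, ?_, fun η hη hd => ?_⟩
  · filter_upwards [h.div] with t h1
    have := congrArg conj h1
    simpa using this
  · obtain ⟨A, hA⟩ := h.bd
    exact ⟨A, fun k => ⟨(hA k).1.conj, (hA k).2.conj⟩⟩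
  · have h1 := congrArg conj (h.eq (fun k t => conj (η k t)) (fun k => (hη k).conj) (fun t => by
      rw [((hη 0).hasDerivAt_conj t).deriv]
      have := congrArg conj (hd t)
      simp only [map_add, map_sub, map_mul, map_zero, Complex.conj_I, map_intCast, Int.cast_neg, map_neg] at this
      linear_combination this))
    rw [← integral_conj, map_zero] at h1
    refine Eq.trans ?_ h1
    congr 1; ext t
    simp only [modeInt_eq, horInt, verInt, ((hη _).hasDerivAt_conj t).deriv]
    simp only [map_add, map_sub, map_mul, map_neg, map_pow, Complex.conj_I, map_intCast, Int.cast_neg,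
      ← Complex.exp_conj, Complex.conj_ofReal, map_one, map_ofNat, Complex.conj_conj]
    ring

/-! ### Approximation by test functions on the half-line -/

/-- Dominated convergence in `L²`. -/
lemma tendsto_eLpNorm_two_of_dominated {X E : Type*} [MeasurableSpace X] {μ : Measure X}
    [NormedAddCommGroup E] {f : ℕ → X → E} {b : X → ℝ} (hf : ∀ n, AEStronglyMeasurable (f n) μ)
    (hb : MemLp b 2 μ) (h : ∀ n, ∀ᵐ x ∂μ, ‖f n x‖ ≤ b x)
    (h0 : ∀ᵐ x ∂μ, Tendsto (fun n => f n x) atTop (𝓝 0)) :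
    Tendsto (fun n => eLpNorm (f n) 2 μ) atTop (𝓝 0) := by
  have e : ∀ g : X → E, eLpNorm g 2 μ = (∫⁻ x, ‖g x‖ₑ ^ (2:ℝ) ∂μ) ^ (1 / (2:ℝ)) := fun g => by
    rw [eLpNorm_eq_lintegral_rpow_enorm_toReal (by norm_num) (by norm_num)]; norm_num
  have e' : eLpNorm b 2 μ = (∫⁻ x, ‖b x‖ₑ ^ (2:ℝ) ∂μ) ^ (1 / (2:ℝ)) := by
    rw [eLpNorm_eq_lintegral_rpow_enorm_toReal (by norm_num) (by norm_num)]; norm_num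
  have hfin : ∫⁻ x, ‖b x‖ₑ ^ (2:ℝ) ∂μ ≠ ⊤ := by
    have := hb.2.ne
    rw [e'] at this
    intro h; rw [h] at this; simp at this
  have key : Tendsto (fun n => ∫⁻ x, ‖f n x‖ₑ ^ (2:ℝ) ∂μ) atTop (𝓝 (∫⁻ _, 0 ∂μ)) := by
    refine tendsto_lintegral_of_dominated_convergence' (fun x => ‖b x‖ₑ ^ (2:ℝ))
      (fun n => (hf n).enorm.pow_const _) (fun n => ?_) hfin ?_
    · filter_upwards [h n] with x hx
      gcongr
      rw [enorm_le_iff_norm_le]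
      exact hx.trans (le_abs_self _)
    · filter_upwards [h0] with x hx
      have := (ENNReal.continuous_rpow_const (y := (2:ℝ))).tendsto (0:ℝ≥0∞)
      rw [ENNReal.zero_rpow_of_pos (by norm_num)] at this
      exact this.comp (by simpa using hx.enorm)
  simp only [e]
  rw [lintegral_zero] at key
  have := (ENNReal.continuous_rpow_const (y := 1 / (2:ℝ))).tendsto (0:ℝ≥0∞)
  rw [ENNReal.zero_rpow_of_pos (by norm_num)] at this
  exact this.comp key

lemma Tst.memLp {η : ℝ → ℂ} (h : Tst η) : MemLp η 2 hl :=
  (h.smooth.continuous.memLp_of_hasCompactSupport h.compact)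

/-- Test functions are dense in `L²` of the half-line. -/
lemma exists_tst_eLpNorm_sub_le {f : ℝ → ℂ} (hf : MemLp f 2 hl) {ε : ℝ≥0∞} (hε : ε ≠ 0) :
    ∃ σ, Tst σ ∧ eLpNorm (fun t => σ t - f t) 2 hl ≤ ε := by
  let K : Submodule ℂ (Lp ℂ 2 hl) :=
    { carrier := {u | ∃ σ, Tst σ ∧ u =ᵐ[hl] σ}
      add_mem' := by
        rintro u v ⟨σ, hσ, hu⟩ ⟨τ, hτ, hv⟩
        exact ⟨_, hσ.add hτ, (Lp.coeFn_add u v).trans (hu.add hv)⟩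
      zero_mem' := ⟨_, Tst.zero, Lp.coeFn_zero _ _ _⟩
      smul_mem' := by
        rintro c u ⟨σ, hσ, hu⟩
        exact ⟨_, hσ.const_mul c, (Lp.coeFn_smul c u).trans (hu.const_smul c)⟩ }
  have hK : K.topologicalClosure = ⊤ := by
    rw [Submodule.topologicalClosure_eq_top_iff, Submodule.eq_bot_iff]
    intro g hg
    have hgm := Lp.memLp g
    have hloc : LocallyIntegrableOn g (Ioi 0) := by
      rw [locallyIntegrableOn_iff isOpen_Ioi.isLocallyClosed]
      intro k hk hc
      have h1 : MemLp g 2 (volume.restrict k) := hgm.mono_measure (Measure.restrict_mono hk le_rfl)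
      have : IsFiniteMeasure (volume.restrict k) := ⟨by simpa using hc.measure_lt_top⟩
      exact h1.integrable (by norm_num)
    have := IsOpen.ae_eq_zero_of_integral_contDiff_smul_eq_zero isOpen_Ioi hloc (fun χ hχ hc hs => ?_)
    · rw [Lp.eq_zero_iff_ae_eq_zero, EventuallyEq, ae_restrict_iff' measurableSet_Ioi]; exact this
    · have hT : Tst (fun t => (χ t : ℂ)) :=
        ⟨Complex.ofRealCLM.contDiff.comp hχ, hc.comp_left (g := fun x : ℝ => (x:ℂ)) rfl,
          (closure_mono fun t ht => by simpa using ht).trans hs⟩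
      have hmem : hT.memLp.toLp ∈ K := ⟨_, hT, hT.memLp.coeFn_toLp⟩
      have h0 := (K.mem_orthogonal g).1 hg _ hmem
      rw [L2.inner_def] at h0
      have h1 : ∫ t, χ t • g t ∂hl = 0 := by
        refine Eq.trans (integral_congr_ae ?_) h0
        filter_upwards [hT.memLp.coeFn_toLp] with t ht
        rw [ht]
        simp [Complex.real_smul, mul_comm]
      refine Eq.trans ?_ h1
      symm
      refine setIntegral_eq_integral_of_forall_compl_eq_zero fun t ht => ?_
      rw [image_eq_zero_of_notMem_tsupport (fun hh => ht (hs hh)), zero_smul]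
  have hmem : hf.toLp ∈ closure (K : Set (Lp ℂ 2 hl)) := by
    have : hf.toLp ∈ K.topologicalClosure := by rw [hK]; trivial
    exact this
  obtain ⟨u, ⟨σ, hσ, hu⟩, hd⟩ := EMetric.mem_closure_iff.1 hmem ε (pos_iff_ne_zero.2 hε)
  refine ⟨σ, hσ, ?_⟩
  rw [edist_comm, Lp.edist_def] at hd
  refine (le_of_eq (eLpNorm_congr_ae ?_)).trans hd.le
  filter_upwards [hu, hf.coeFn_toLp] with t h1 h2
  simp [h1, h2]

lemma enorm_primitive_le {h : ℝ → ℂ} (hh : AEStronglyMeasurable h hl) {t T : ℝ} (ht : 0 ≤ t) (hT : t ≤ T) :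
    ‖∫ s in (0:ℝ)..t, h s‖ₑ ≤ eLpNorm h 2 hl * ofReal T ^ (1 / 2 : ℝ) := by
  rw [intervalIntegral.integral_of_le ht]
  refine (enorm_integral_le_lintegral_enorm _).trans ?_
  have h1 : ∫⁻ s in Ioc 0 t, ‖h s‖ₑ ≤ ∫⁻ s in Ioc 0 T, ‖h s‖ₑ :=
    lintegral_mono_set (Ioc_subset_Ioc_right hT)
  refine h1.trans ?_
  have hle : volume.restrict (Ioc 0 T) ≤ hl := Measure.restrict_mono Ioc_subset_Ioi_self le_rfl
  have h2 := eLpNorm_le_eLpNorm_mul_rpow_measure_univ (μ := volume.restrict (Ioc 0 T)) (p := 1) (q := 2)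
    (by norm_num) (hh.mono_measure hle)
  rw [eLpNorm_one_eq_lintegral_enorm] at h2
  refine h2.trans ?_
  have e : (1 / (1:ℝ≥0∞).toReal - 1 / (2:ℝ≥0∞).toReal) = 1 / 2 := by norm_num
  rw [e]
  gcongr
  · simp

lemma eLpNorm_le_add {X E : Type*} [MeasurableSpace X] {μ : Measure X} [NormedAddCommGroup E]
    {f g h : X → E} {a b : ℝ≥0∞} (hf : AEStronglyMeasurable f μ) (hg : AEStronglyMeasurable g μ)
    (hfa : eLpNorm f 2 μ ≤ a) (hgb : eLpNorm g 2 μ ≤ b) (hh : ∀ᵐ x ∂μ, h x = f x + g x) :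
    eLpNorm h 2 μ ≤ a + b :=
  (le_of_eq (eLpNorm_congr_ae hh)).trans ((eLpNorm_add_le hf hg (by norm_num)).trans (add_le_add hfa hgb))

/-- Multiplying a primitive by a bounded cutoff is bounded in `L²`. -/
lemma eLpNorm_cutoff_primitive_le {c : ℝ → ℝ} {M T : ℝ} (hM : ∀ t, |c t| ≤ M)
    (hT : ∀ t, T ≤ t → c t = 0) : ∃ K : ℝ≥0∞, K ≠ ⊤ ∧ ∀ h : ℝ → ℂ, AEStronglyMeasurable h hl →
      eLpNorm (fun t => c t * ∫ s in (0:ℝ)..t, h s) 2 hl ≤ K * eLpNorm h 2 hl := by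
  refine ⟨ofReal M * ofReal T ^ (1 / 2 : ℝ) * ofReal T ^ (1 / 2 : ℝ), ?_,
    fun h hh => ?_⟩
  · exact ENNReal.mul_ne_top (ENNReal.mul_ne_top ENNReal.ofReal_ne_top
      (ENNReal.rpow_ne_top_of_nonneg (by norm_num) ENNReal.ofReal_ne_top))
      (ENNReal.rpow_ne_top_of_nonneg (by norm_num) ENNReal.ofReal_ne_top)
  · set B := ofReal M * (eLpNorm h 2 hl * ofReal T ^ (1 / 2 : ℝ)) with hB
    have h1 : eLpNorm (fun t => c t * ∫ s in (0:ℝ)..t, h s) 2 hl ≤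
        eLpNorm ((Ioc 0 T).indicator fun _ : ℝ => B) 2 hl := by
      refine eLpNorm_mono_enorm_ae (hl_ae fun t ht => ?_)
      by_cases htT : t ≤ T
      · rw [indicator_of_mem (show t ∈ Ioc 0 T from ⟨ht, htT⟩), enorm_mul, enorm_eq_self, hB]
        refine mul_le_mul' ?_ ?_
        · rw [← ofReal_norm]
          exact ENNReal.ofReal_le_ofReal (by simpa using hM t)
        · exact enorm_primitive_le hh ht.le htT
      · simp [hT t (not_le.1 htT).le]
    refine h1.trans ?_
    have h2 := eLpNorm_indicator_const_le (μ := hl) (s := Ioc 0 T) B 2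
    refine h2.trans ?_
    have h3 : hl (Ioc 0 T) ≤ ofReal T := by
      refine (Measure.restrict_apply_le _ _).trans ?_
      simp
    rw [enorm_eq_self, hB]
    calc _ ≤ ofReal M * (eLpNorm h 2 hl * ofReal T ^ (1 / 2 : ℝ)) *
          ofReal T ^ (1 / (2:ℝ≥0∞).toReal) := by gcongr
      _ = _ := by
        rw [show (1 / (2:ℝ≥0∞).toReal) = (1 / 2 : ℝ) by norm_num]; ring

/-- Multiplying by bounded functions that converge to zero. -/
lemma tendsto_eLpNorm_mul_zero {f : ℝ → ℂ} (hf : MemLp f 2 hl) {c : ℕ → ℝ → ℝ} {M : ℝ}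
    (hc : ∀ m, Continuous (c m)) (hM : ∀ m t, |c m t| ≤ M) (h0 : ∀ t, ∀ᶠ m in atTop, c m t = 0) :
    Tendsto (fun m => eLpNorm (fun t => c m t * f t) 2 hl) atTop (𝓝 0) := by
  refine tendsto_eLpNorm_two_of_dominated (b := fun t => M * ‖f t‖)
    (fun m => ((continuous_ofReal.comp (hc m)).aestronglyMeasurable.mul hf.1))
    (hf.norm.const_mul M) (fun m => ae_of_all _ fun t => ?_) (ae_of_all _ fun t => ?_)
  · rw [norm_mul]
    gcongr
    simpa using hM m t
  · refine tendsto_const_nhds.congr' ?_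
    filter_upwards [h0 t] with m hm
    simp [hm]

/-- Smooth cutoffs of growing support, with their first two derivatives. -/
lemma exists_cutoff : ∃ (c c' c'' : ℕ → ℝ → ℝ) (M : ℝ), (∀ m, ContDiff ℝ ∞ (c m)) ∧
    (∀ m t, HasDerivAt (c m) (c' m t) t) ∧ (∀ m t, HasDerivAt (c' m) (c'' m t) t) ∧
    (∀ m, Continuous (c' m)) ∧ (∀ m, Continuous (c'' m)) ∧
    (∀ m t, |c m t| ≤ M) ∧ (∀ m t, |c' m t| ≤ M) ∧ (∀ m t, |c'' m t| ≤ M) ∧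
    (∀ m, ∃ T, 0 < T ∧ ∀ t, T ≤ t → c m t = 0 ∧ c' m t = 0 ∧ c'' m t = 0) ∧
    ∀ f : ℝ → ℂ, MemLp f 2 hl → Tendsto (fun m => eLpNorm (fun t => ((c m t - 1 : ℝ) : ℂ) * f t) 2 hl) atTop (𝓝 0) ∧
      Tendsto (fun m => eLpNorm (fun t => (c' m t : ℂ) * f t) 2 hl) atTop (𝓝 0) ∧
      Tendsto (fun m => eLpNorm (fun t => (c'' m t : ℂ) * f t) 2 hl) atTop (𝓝 0) := by
  -- The cutoffs are `κ(t / (m + 1))`, where `κ` is `1` on `t ≤ 1` and `0` on `t ≥ 2`.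
  let κ : ℝ → ℝ := fun t => 1 - smoothTransition (t - 1)
  have hκ : ContDiff ℝ ∞ κ :=
    contDiff_const.sub (Real.smoothTransition.contDiff.comp (contDiff_id.sub contDiff_const))
  have hκ1 := (contDiff_infty_iff_deriv.1 hκ)
  have hκ2 := (contDiff_infty_iff_deriv.1 hκ1.2)
  have lo : ∀ t, t ≤ 1 → κ t = 1 := fun t ht => by
    simp [κ, Real.smoothTransition.zero_of_nonpos (by linarith : t - 1 ≤ 0)]
  have hi : ∀ t, 2 ≤ t → κ t = 0 := fun t ht => by
    simp [κ, Real.smoothTransition.one_of_one_le (by linarith : 1 ≤ t - 1)]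
  have d0 : ∀ {f : ℝ → ℝ} {k : ℝ} {U : Set ℝ}, Continuous (deriv f) → IsOpen U → (∀ t ∈ U, f t = k) →
      ∀ t ∈ closure U, deriv f t = 0 := fun {f k U} hc hU hf =>
    EqOn.closure (fun t ht => by
      rw [(eventuallyEq_iff_exists_mem.2 ⟨U, hU.mem_nhds ht, hf⟩ : f =ᶠ[𝓝 t] fun _ => k).deriv_eq]; simp)
      hc continuous_const
  have dlo : ∀ {f : ℝ → ℝ} {k : ℝ}, Continuous (deriv f) → (∀ t, t ≤ 1 → f t = k) →
      ∀ t, t ≤ 1 → deriv f t = 0 := fun hc hf t ht =>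
    d0 hc isOpen_Iio (fun s hs => hf s (le_of_lt hs)) t (closure_Iio (1:ℝ) ▸ ht)
  have dhi : ∀ {f : ℝ → ℝ}, Continuous (deriv f) → (∀ t, 2 ≤ t → f t = 0) →
      ∀ t, 2 ≤ t → deriv f t = 0 := fun hc hf t ht =>
    d0 hc isOpen_Ioi (fun s hs => hf s (le_of_lt hs)) t (closure_Ioi (2:ℝ) ▸ ht)
  have lo1 := dlo hκ1.2.continuous lo
  have lo2 := dlo hκ2.2.continuous lo1
  have hi1 := dhi hκ1.2.continuous hi
  have hi2 := dhi hκ2.2.continuous hi1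
  have bd : ∀ {f : ℝ → ℝ} {k : ℝ}, Continuous f → (∀ t, t ≤ 1 → f t = k) → (∀ t, 2 ≤ t → f t = 0) →
      ∃ M, ∀ t, |f t| ≤ M := by
    intro f k hc h1 h2
    obtain ⟨M, hM⟩ := isCompact_Icc.exists_bound_of_continuousOn (s := Icc 1 2) hc.continuousOn
    refine ⟨max (max M |k|) 0, fun t => ?_⟩
    rcases le_total t 1 with h | h
    · rw [h1 t h]; simp
    · rcases le_total t 2 with h' | h'
      · exact (hM t ⟨h, h'⟩).trans (by simp)
      · rw [h2 t h']; simp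
  obtain ⟨M0, hM0⟩ := bd hκ.continuous lo hi
  obtain ⟨M1, hM1⟩ := bd hκ1.2.continuous lo1 hi1
  obtain ⟨M2, hM2⟩ := bd hκ2.2.continuous lo2 hi2
  have n0 : 0 ≤ M0 := (abs_nonneg _).trans (hM0 0)
  have n1 : 0 ≤ M1 := (abs_nonneg _).trans (hM1 0)
  have n2 : 0 ≤ M2 := (abs_nonneg _).trans (hM2 0)
  have hr : ∀ m : ℕ, (1:ℝ) ≤ m + 1 := fun m => by simp
  have hr1 : ∀ m : ℕ, ((m:ℝ) + 1)⁻¹ ≤ 1 := fun m => inv_le_one_of_one_le₀ (hr m)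
  have hr0 : ∀ m : ℕ, 0 ≤ ((m:ℝ) + 1)⁻¹ := fun m => by positivity
  have hlin : ∀ (m : ℕ) (t : ℝ), HasDerivAt (fun t => t * ((m:ℝ) + 1)⁻¹) ((m:ℝ) + 1)⁻¹ t := fun m t => by
    simpa using (hasDerivAt_id t).mul_const ((m:ℝ) + 1)⁻¹
  have hc1 : ∀ m : ℕ, Continuous fun t => deriv κ (t * ((m:ℝ) + 1)⁻¹) * ((m:ℝ) + 1)⁻¹ := fun m =>
    (hκ1.2.continuous.comp (by fun_prop)).mul continuous_const
  have hc2 : ∀ m : ℕ, Continuous fun t => deriv (deriv κ) (t * ((m:ℝ) + 1)⁻¹) * ((m:ℝ) + 1)⁻¹ * ((m:ℝ) + 1)⁻¹ :=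
    fun m => ((hκ2.2.continuous.comp (by fun_prop)).mul continuous_const).mul continuous_const
  have b0 : ∀ (m : ℕ) t, |κ (t * ((m:ℝ) + 1)⁻¹)| ≤ M0 + M1 + M2 := fun m t => by
    linarith [hM0 (t * ((m:ℝ) + 1)⁻¹)]
  have b1 : ∀ (m : ℕ) t, |deriv κ (t * ((m:ℝ) + 1)⁻¹) * ((m:ℝ) + 1)⁻¹| ≤ M0 + M1 + M2 := fun m t => by
    rw [abs_mul, abs_of_nonneg (hr0 m)]
    have := mul_le_mul (hM1 (t * ((m:ℝ) + 1)⁻¹)) (hr1 m) (hr0 m) n1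
    linarith
  have b2 : ∀ (m : ℕ) t, |deriv (deriv κ) (t * ((m:ℝ) + 1)⁻¹) * ((m:ℝ) + 1)⁻¹ * ((m:ℝ) + 1)⁻¹| ≤ M0 + M1 + M2 :=
    fun m t => by
    rw [abs_mul, abs_mul, abs_of_nonneg (hr0 m)]
    have := mul_le_mul (mul_le_mul (hM2 (t * ((m:ℝ) + 1)⁻¹)) (hr1 m) (hr0 m) n2) (hr1 m) (hr0 m) (by linarith)
    linarith
  have hev : ∀ t, ∀ᶠ m : ℕ in atTop, t * ((m:ℝ) + 1)⁻¹ ≤ 1 := fun t => by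
    filter_upwards [eventually_ge_atTop ⌈t⌉₊] with m hm
    rw [← div_eq_mul_inv, div_le_one (by positivity)]
    have : (⌈t⌉₊:ℝ) ≤ m := by exact_mod_cast hm
    linarith [Nat.le_ceil t]
  refine ⟨fun m t => κ (t * ((m:ℝ) + 1)⁻¹), _, _, M0 + M1 + M2, fun m => hκ.comp (contDiff_id.mul contDiff_const),
    fun m t => ((hκ1.1 _).hasDerivAt).comp t (hlin m t),
    fun m t => (((hκ2.1 _).hasDerivAt).comp t (hlin m t)).mul_const _, hc1, hc2, b0, b1, b2,
    fun m => ?_, fun f hf => ⟨tendsto_eLpNorm_mul_zero hf (c := fun m t => κ (t * ((m:ℝ) + 1)⁻¹) - 1)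
      (M := M0 + M1 + M2 + 1) (fun m => (hκ.continuous.comp (by fun_prop)).sub continuous_const)
      (fun m t => (abs_sub _ _).trans (by simpa using b0 m t)) fun t => ?_,
      tendsto_eLpNorm_mul_zero hf hc1 b1 fun t => ?_, tendsto_eLpNorm_mul_zero hf hc2 b2 fun t => ?_⟩⟩
  · have hm : (0:ℝ) < m + 1 := by positivity
    refine ⟨2 * (m + 1), by positivity, fun t ht => ?_⟩
    have h2 : 2 ≤ t * ((m:ℝ) + 1)⁻¹ := by rw [← div_eq_mul_inv, le_div_iff₀ hm]; exact ht
    beta_reduce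
    rw [hi _ h2, hi1 _ h2, hi2 _ h2]; simp
  · filter_upwards [hev t] with m hm using by simp [lo _ hm]
  · filter_upwards [hev t] with m hm using by simp [lo1 _ hm]
  · filter_upwards [hev t] with m hm using by simp [lo2 _ hm]

lemma Tst.hasDerivAt_primitive {σ : ℝ → ℂ} (h : Tst σ) (t : ℝ) :
    HasDerivAt (fun t => ∫ s in (0:ℝ)..t, σ s) (σ t) t :=
  intervalIntegral.integral_hasDerivAt_right (h.smooth.continuous.intervalIntegrable _ _)
    (h.smooth.continuous.stronglyMeasurableAtFilter _ _) h.smooth.continuous.continuousAt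

lemma aestronglyMeasurable_ofReal {b : ℝ → ℝ} (h : Continuous b) :
    AEStronglyMeasurable (fun t => (b t : ℂ)) hl := (continuous_ofReal.comp h).aestronglyMeasurable

lemma Tst.primitive_sub {σ f f' : ℝ → ℂ} (h : Tst σ) (hf : MemLp f 2 hl)
    (hff : ∀ t, 0 ≤ t → f t = ∫ s in (0:ℝ)..t, f' s) (hi : ∀ t, 0 ≤ t → IntervalIntegrable f' volume 0 t) :
    (∀ t, 0 < t → ∫ s in (0:ℝ)..t, (σ s - f' s) = (∫ s in (0:ℝ)..t, σ s) - f t) ∧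
      AEStronglyMeasurable (fun t => ∫ s in (0:ℝ)..t, (σ s - f' s)) hl := by
  have hp : ∀ t, 0 < t → ∫ s in (0:ℝ)..t, (σ s - f' s) = (∫ s in (0:ℝ)..t, σ s) - f t := fun t ht => by
    rw [intervalIntegral.integral_sub (h.smooth.continuous.intervalIntegrable _ _) (hi t ht.le), hff t ht.le]
  have hc : Continuous fun t => ∫ s in (0:ℝ)..t, σ s :=
    continuous_iff_continuousAt.2 fun t => (h.hasDerivAt_primitive t).continuousAt
  exact ⟨hp, (hc.aestronglyMeasurable.sub hf.1).congr (hl_ae fun t ht => (hp t ht).symm)⟩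

lemma Tst.cutoff_primitive {σ : ℝ → ℂ} (h : Tst σ) {c : ℝ → ℝ} (hc : ContDiff ℝ ∞ c) {T : ℝ}
    (hT : ∀ t, T ≤ t → c t = 0) : Tst fun t => c t * ∫ s in (0:ℝ)..t, σ s := by
  obtain ⟨a, b, ha, -, hab⟩ := h.exists_Icc
  have hP : ContDiff ℝ ∞ fun t => ∫ s in (0:ℝ)..t, σ s := by
    rw [contDiff_infty_iff_deriv]
    refine ⟨fun t => (h.hasDerivAt_primitive t).differentiableAt, ?_⟩
    rw [show _root_.deriv (fun t => ∫ s in (0:ℝ)..t, σ s) = σ from funext fun t => (h.hasDerivAt_primitive t).deriv]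
    exact h.smooth
  refine Tst.of_Icc (a := a) (b := T) ((Complex.ofRealCLM.contDiff.comp hc).mul hP) ha fun t ht => ?_
  by_cases hta : t < a
  · have : ∫ s in (0:ℝ)..t, σ s = 0 := by
      refine (intervalIntegral.integral_congr (g := fun _ => (0:ℂ)) (fun s hs => hab s fun hh => by
      rcases le_total 0 t with h0 | h0
      · rw [uIcc_of_le h0] at hs; linarith [hs.2, hh.1]
      · rw [uIcc_of_ge h0] at hs; linarith [hs.2, hh.1])).trans (by simp)
    rw [this, mul_zero]
  · rw [hT t (by by_contra hh; exact ht ⟨not_lt.1 hta, (not_le.1 hh).le⟩)]; simp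

/-- `H¹` functions on the half-line that vanish at the origin are limits of test functions. -/
lemma exists_tst_approx_one {f f' : ℝ → ℂ} (hf : MemLp f 2 hl) (hf' : MemLp f' 2 hl)
    (h : ∀ t, 0 ≤ t → f t = ∫ s in (0:ℝ)..t, f' s) (hi : ∀ t, 0 ≤ t → IntervalIntegrable f' volume 0 t)
    {ε : ℝ≥0∞} (hε : ε ≠ 0) : ∃ χ, Tst χ ∧ eLpNorm (fun t => χ t - f t) 2 hl ≤ ε ∧
      eLpNorm (fun t => deriv χ t - f' t) 2 hl ≤ ε := by
  obtain ⟨c, c', c'', M, hc, hd, hd', hcc', hcc'', hM, hM', hM'', hT, h1⟩ := exists_cutoff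
  have hcc := fun m => (hc m).continuous
  have hε4 : ε / 4 ≠ 0 := by simp [hε]
  have hε4' : 0 < ε / 4 := pos_iff_ne_zero.2 hε4
  obtain ⟨m, m0, m0', m1⟩ := (((h1 f hf).1.eventually (gt_mem_nhds hε4')).and
    (((h1 f' hf').1.eventually (gt_mem_nhds hε4')).and ((h1 f hf).2.1.eventually (gt_mem_nhds hε4')))).exists
  obtain ⟨T, -, hT⟩ := hT m
  obtain ⟨K, hK, hKb⟩ := eLpNorm_cutoff_primitive_le (hM m) (fun t ht => (hT t ht).1)
  obtain ⟨K', hK', hKb'⟩ := eLpNorm_cutoff_primitive_le (hM' m) (fun t ht => (hT t ht).2.1)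
  set D := K + K' + ofReal M + 1 with hD
  have hDt : D ≠ ⊤ := by simp [hD, hK, hK']
  have hD0 : D ≠ 0 := by simp [hD]
  -- The test function is `c ∫₀ᵗ σ`, where `σ` approximates `f'`; the cutoff is fixed before `σ` is chosen, since
  -- the primitive of `σ - f'` is small only on bounded intervals.
  obtain ⟨σ, hσ, hσe⟩ := exists_tst_eLpNorm_sub_le hf' (ε := ε / 4 / D) (by
    simp [ENNReal.div_eq_zero_iff, hε, hDt])
  have hDe : D * eLpNorm (fun t => σ t - f' t) 2 hl ≤ ε / 4 := by
    calc _ ≤ D * (ε / 4 / D) := by gcongr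
      _ = ε / 4 := ENNReal.mul_div_cancel hD0 hDt
  have hm : AEStronglyMeasurable (fun t => σ t - f' t) hl := hσ.smooth.continuous.aestronglyMeasurable.sub hf'.1
  obtain ⟨hprim, hPm⟩ := hσ.primitive_sub hf h hi
  have e1 : eLpNorm (fun t => c m t * ∫ s in (0:ℝ)..t, (σ s - f' s)) 2 hl ≤ ε / 4 :=
    (hKb _ hm).trans (le_trans (by gcongr; rw [hD, add_assoc, add_assoc]; exact le_self_add) hDe)
  have e2 : eLpNorm (fun t => c' m t * ∫ s in (0:ℝ)..t, (σ s - f' s)) 2 hl ≤ ε / 4 :=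
    (hKb' _ hm).trans (le_trans (by gcongr; rw [hD, add_assoc, add_comm K, add_assoc]; exact le_self_add) hDe)
  have e3 : eLpNorm (fun t => c m t * (σ t - f' t)) 2 hl ≤ ε / 4 := by
    refine le_trans (eLpNorm_le_mul_eLpNorm_of_ae_le_mul (c := M) (g := fun t => σ t - f' t)
      (ae_of_all _ fun t => ?_) 2) ?_
    · rw [norm_mul]; gcongr; simpa using hM m t
    · refine le_trans ?_ hDe
      gcongr
      rw [hD, add_right_comm]; exact le_add_self
  have hcm := aestronglyMeasurable_ofReal (hcc m)
  have hcm' := aestronglyMeasurable_ofReal (hcc' m)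
  have h44 : ε / 4 + ε / 4 + (ε / 4 + ε / 4) ≤ ε := by
    calc _ = 4 * (ε / 4) := by ring
      _ ≤ ε := (ENNReal.mul_div_cancel (by norm_num) (by norm_num)).le
  have hcm1 := aestronglyMeasurable_ofReal (b := fun t => c m t - 1) ((hcc m).sub continuous_const)
  refine ⟨_, hσ.cutoff_primitive (hc m) fun t ht => (hT t ht).1, ?_, ?_⟩
  · refine (eLpNorm_le_add (hcm.mul hPm) (hcm1.mul hf.1) e1 m0.le (hl_ae fun t ht => ?_)).trans (le_self_add.trans h44)
    simp only [Pi.mul_apply]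
    rw [hprim t ht]; push_cast; ring
  · have hder : ∀ t, deriv (fun t => (c m t : ℂ) * ∫ s in (0:ℝ)..t, σ s) t =
        c' m t * (∫ s in (0:ℝ)..t, σ s) + c m t * σ t := fun t =>
      ((hd m t).ofReal_comp.mul (hσ.hasDerivAt_primitive t)).deriv
    refine (eLpNorm_le_add ((hcm'.mul hPm).add (hcm'.mul hf.1)) ((hcm.mul hm).add (hcm1.mul hf'.1))
      (eLpNorm_le_add (hcm'.mul hPm) (hcm'.mul hf.1) e2 m1.le (ae_of_all _ fun _ => rfl))
      (eLpNorm_le_add (hcm.mul hm) (hcm1.mul hf'.1) e3 m0'.le (ae_of_all _ fun _ => rfl))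
      (hl_ae fun t ht => ?_)).trans h44
    simp only [Pi.add_apply, Pi.mul_apply]
    rw [hder, hprim t ht]; push_cast; ring

/-- `H²` functions on the half-line that vanish at the origin with their first derivative are limits of
test functions. -/
lemma exists_tst_approx_two {ψ q s : ℝ → ℂ} (hψ : MemLp ψ 2 hl) (hq : MemLp q 2 hl) (hs : MemLp s 2 hl)
    (h : ∀ t, 0 ≤ t → ψ t = ∫ u in (0:ℝ)..t, q u) (hi : ∀ t, 0 ≤ t → IntervalIntegrable q volume 0 t)
    (h' : ∀ t, 0 ≤ t → q t = ∫ u in (0:ℝ)..t, s u) (hi' : ∀ t, 0 ≤ t → IntervalIntegrable s volume 0 t)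
    {ε : ℝ≥0∞} (hε : ε ≠ 0) : ∃ χ, Tst χ ∧ eLpNorm (fun t => χ t - ψ t) 2 hl ≤ ε ∧
      eLpNorm (fun t => deriv χ t - q t) 2 hl ≤ ε ∧ eLpNorm (fun t => deriv (deriv χ) t - s t) 2 hl ≤ ε := by
  obtain ⟨c, c', c'', M, hc, hd, hd', hcc', hcc'', hM, hM', hM'', hT, h1⟩ := exists_cutoff
  have hcc := fun m => (hc m).continuous
  have hε8 : ε / 8 ≠ 0 := by simp [hε]
  have hε8' : 0 < ε / 8 := pos_iff_ne_zero.2 hε8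
  obtain ⟨m, ⟨m1, m2, m3⟩, ⟨m4, m5⟩, m6⟩ := ((((h1 ψ hψ).1.eventually (gt_mem_nhds hε8')).and
    (((h1 q hq).1.eventually (gt_mem_nhds hε8')).and ((h1 s hs).1.eventually (gt_mem_nhds hε8')))).and
    ((((h1 ψ hψ).2.1.eventually (gt_mem_nhds hε8')).and ((h1 q hq).2.1.eventually (gt_mem_nhds hε8'))).and
      ((h1 ψ hψ).2.2.eventually (gt_mem_nhds hε8')))).exists
  obtain ⟨T, -, hT⟩ := hT m
  obtain ⟨K, hK, hKb⟩ := eLpNorm_cutoff_primitive_le (hM m) (fun t ht => (hT t ht).1)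
  obtain ⟨K', hK', hKb'⟩ := eLpNorm_cutoff_primitive_le (hM' m) (fun t ht => (hT t ht).2.1)
  obtain ⟨K'', hK'', hKb''⟩ := eLpNorm_cutoff_primitive_le (hM'' m) (fun t ht => (hT t ht).2.2)
  set D := K + K' + K'' + ofReal M + 1 with hD
  have hDt : D ≠ ⊤ := by simp [hD, hK, hK', hK'']
  have hD0 : D ≠ 0 := by simp [hD]
  have dK : K ≤ D := by rw [hD]; simp only [add_assoc]; exact le_self_add
  have dK' : K' ≤ D := by rw [hD, add_comm K]; simp only [add_assoc]; exact le_self_add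
  have dK'' : K'' ≤ D := by rw [hD, add_comm (K + K')]; simp only [add_assoc]; exact le_self_add
  have dM : ofReal M ≤ D := by rw [hD, add_right_comm]; exact le_add_self
  obtain ⟨σ, hσ, hσe, hσe'⟩ := exists_tst_approx_one hq hs h' hi' (ε := ε / 8 / D) (by
    simp [ENNReal.div_eq_zero_iff, hε, hDt])
  have hm : AEStronglyMeasurable (fun t => σ t - q t) hl := hσ.smooth.continuous.aestronglyMeasurable.sub hq.1
  have hm' : AEStronglyMeasurable (fun t => deriv σ t - s t) hl :=
    hσ.deriv.smooth.continuous.aestronglyMeasurable.sub hs.1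
  obtain ⟨hprim, hPm⟩ := hσ.primitive_sub hψ h hi
  have hX : ∀ {X L : ℝ≥0∞}, X ≤ D → L ≤ ε / 8 / D → X * L ≤ ε / 8 := fun hX hL =>
    (mul_le_mul' hX hL).trans (ENNReal.mul_div_cancel hD0 hDt).le
  have e0 := (hKb _ hm).trans (hX dK hσe)
  have e1 := (hKb' _ hm).trans (hX dK' hσe)
  have e2 := (hKb'' _ hm).trans (hX dK'' hσe)
  have mulM : ∀ {b : ℝ → ℝ} {f : ℝ → ℂ}, (∀ t, |b t| ≤ M) → eLpNorm f 2 hl ≤ ε / 8 / D →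
      eLpNorm (fun t => b t * f t) 2 hl ≤ ε / 8 := fun {b f} hb hf => by
    refine le_trans (eLpNorm_le_mul_eLpNorm_of_ae_le_mul (c := M) (g := f)
      (ae_of_all _ fun t => ?_) 2) (hX dM hf)
    rw [norm_mul]; gcongr; simpa using hb t
  have e3 := mulM (hM m) hσe
  have e4 := mulM (hM m) hσe'
  have e5 := mulM (hM' m) hσe
  have hcm := aestronglyMeasurable_ofReal (hcc m)
  have hcm' := aestronglyMeasurable_ofReal (hcc' m)
  have hcm'' := aestronglyMeasurable_ofReal (hcc'' m)
  have hcm1 := aestronglyMeasurable_ofReal (b := fun t => c m t - 1) ((hcc m).sub continuous_const)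
  have h88 : ∀ k : ℕ, k ≤ 8 → k * (ε / 8) ≤ ε := fun k hk => by
    calc (k:ℝ≥0∞) * (ε / 8) ≤ 8 * (ε / 8) := by gcongr; exact_mod_cast hk
      _ = ε := ENNReal.mul_div_cancel (by norm_num) (by norm_num)
  have triv : ∀ {f g : ℝ → ℂ}, ∀ᵐ t ∂hl, (fun t => f t + g t) t = f t + g t :=
    ae_of_all _ fun _ => rfl
  have hder : ∀ t, HasDerivAt (fun t => (c m t : ℂ) * ∫ s in (0:ℝ)..t, σ s)
      (c' m t * (∫ s in (0:ℝ)..t, σ s) + c m t * σ t) t := fun t =>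
    ((hd m t).ofReal_comp.mul (hσ.hasDerivAt_primitive t))
  have hder' : ∀ t, HasDerivAt (fun t => c' m t * (∫ s in (0:ℝ)..t, σ s) + c m t * σ t)
      (c'' m t * (∫ s in (0:ℝ)..t, σ s) + c' m t * σ t + (c' m t * σ t + c m t * deriv σ t)) t := fun t =>
    ((hd' m t).ofReal_comp.mul (hσ.hasDerivAt_primitive t)).add ((hd m t).ofReal_comp.mul (hσ.hasDerivAt t))
  have hde := funext fun t => (hder t).deriv
  have hde' := funext fun t => (hder' t).deriv
  refine ⟨_, hσ.cutoff_primitive (hc m) fun t ht => (hT t ht).1, ?_, ?_, ?_⟩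
  · refine (eLpNorm_le_add (hcm.mul hPm) (hcm1.mul hψ.1) e0 m1.le (hl_ae fun t ht => ?_)).trans ?_
    · simp only [Pi.mul_apply]
      rw [hprim t ht]; push_cast; ring
    · simpa [two_mul] using h88 2 (by norm_num)
  · refine (eLpNorm_le_add ((hcm'.mul hPm).add (hcm'.mul hψ.1)) ((hcm.mul hm).add (hcm1.mul hq.1))
      (eLpNorm_le_add (hcm'.mul hPm) (hcm'.mul hψ.1) e1 m4.le triv)
      (eLpNorm_le_add (hcm.mul hm) (hcm1.mul hq.1) e3 m2.le triv) (hl_ae fun t ht => ?_)).trans ?_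
    · simp only [Pi.add_apply, Pi.mul_apply]
      rw [hde]; beta_reduce
      rw [hprim t ht]; push_cast; ring
    · refine le_trans (le_of_eq ?_) (h88 4 (by norm_num)); push_cast; ring
  · refine (eLpNorm_le_add (((hcm''.mul hPm).add (hcm''.mul hψ.1)).add ((hcm'.mul hm).add (hcm'.mul hq.1)))
      (((hcm'.mul hm).add (hcm'.mul hq.1)).add ((hcm.mul hm').add (hcm1.mul hs.1)))
      (eLpNorm_le_add ((hcm''.mul hPm).add (hcm''.mul hψ.1)) ((hcm'.mul hm).add (hcm'.mul hq.1))
        (eLpNorm_le_add (hcm''.mul hPm) (hcm''.mul hψ.1) e2 m6.le triv)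
        (eLpNorm_le_add (hcm'.mul hm) (hcm'.mul hq.1) e5 m5.le triv) triv)
      (eLpNorm_le_add ((hcm'.mul hm).add (hcm'.mul hq.1)) ((hcm.mul hm').add (hcm1.mul hs.1))
        (eLpNorm_le_add (hcm'.mul hm) (hcm'.mul hq.1) e5 m5.le triv)
        (eLpNorm_le_add (hcm.mul hm') (hcm1.mul hs.1) e4 m3.le triv) triv) (hl_ae fun t ht => ?_)).trans ?_
    · simp only [Pi.add_apply, Pi.mul_apply]
      rw [hde, hde']; beta_reduce
      rw [hprim t ht]; push_cast; ring
    · refine le_trans (le_of_eq ?_) (h88 8 (by norm_num)); push_cast; ring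

/-! ### Approximation of the fields on a mode -/

lemma WD.eq_primitive {f f' : ℝ → ℂ} (h : WD f f') (hf : Continuous f) (h0 : f 0 = 0) {t : ℝ}
    (ht : 0 ≤ t) : f t = ∫ s in (0:ℝ)..t, f' s := by
  have h1 := h.sub (solveFwd_wd (lam := 0) (c := 0) h.gr')
  have h2 : WD (fun t => f t - solveFwd 0 0 f' t) (fun t => 0 * (f t - solveFwd 0 0 f' t)) :=
    h1.congr (EventuallyEq.rfl) (ae_of_all _ fun t => by simp)
  have h3 := h2.eq_zero_of_initial (hf.sub (solveFwd_continuous h.gr'))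
    (by rw [h0, solveFwd_zero, sub_zero]) ht
  rw [sub_eq_zero.1 h3, solveFwd]
  simp only [zero_mul, Complex.exp_zero, one_mul, zero_add, neg_zero]
  refine intervalIntegral.integral_congr_ae (ae_of_all _ fun s hs => ?_)
  rw [uIoc_of_le ht] at hs
  exact indicator_of_mem (show s ∈ Ioi 0 from hs.1) _

lemma Bd.memLp {s A : ℝ} {f : ℝ → ℂ} (h : Bd s A f) (hs : 0 < s) : MemLp f 2 hl := by
  have hE : MemLp (fun t => A * rexp (-s * t)) 2 hl := by
    refine (MemLp.const_mul ?_ A)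
    rw [memLp_two_iff_integrable_sq (by fun_prop)]
    have h1 := exp_neg_integrableOn_Ioi 0 (show 0 < 2 * s by linarith)
    refine h1.congr (ae_of_all _ fun t => ?_)
    beta_reduce
    rw [sq, ← Real.exp_add]; congr 1; ring
  refine hE.mono h.1 ?_
  filter_upwards [h.2] with t ht
  exact ht.trans (le_abs_self _)

/-- `H¹` approximation of a component of a field by components of test fields, in the norms of
`L²(e^{2t} dt)`. -/
lemma exists_tst_approx_component {ρ A : ℝ} (hρ : 2 < ρ) {w p : ℝ → ℂ} (hw : Continuous w) (h0 : w 0 = 0)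
    (h : WD w p) (hA : Bd (ρ - 1) A w) (hA' : Bd (ρ - 1) A p) {ε : ℝ≥0∞} (hε : ε ≠ 0) :
    ∃ η, Tst η ∧ eLpNorm (fun t : ℝ => cexp ((1:ℂ) * t) * (η t - w t)) 2 hl ≤ ε ∧
      eLpNorm (fun t => deriv η t - p t) 2 hl ≤ ε := by
  have e0 : ∀ t : ℝ, cexp ((-1:ℂ) * t) * cexp ((1:ℂ) * t) = 1 := fun t => by
    rw [← Complex.exp_add]; simp
  have h1 := h.exp_mul 1
  have b1 := (hA.exp_mul 1).memLp (by simp; linarith)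
  have b2 : MemLp (fun t : ℝ => cexp ((1:ℂ) * t) * (p t + 1 * w t)) 2 hl :=
    (((hA'.add (hA.const_mul 1)).exp_mul 1).memLp (by simp; linarith))
  have hc : Continuous fun t : ℝ => cexp ((1:ℂ) * t) * w t := (continuous_cexp_mul 1).mul hw
  have hε2 : ε / 2 ≠ 0 := by simp [hε]
  obtain ⟨χ, hχ, a1, a2⟩ := exists_tst_approx_one b1 b2
    (fun t ht => h1.eq_primitive hc (by simp [h0]) ht) (fun t ht => h1.gr'.intervalIntegrable ht) hε2
  refine ⟨_, hχ.exp_mul (-1), ?_, ?_⟩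
  · refine le_trans (le_of_eq (eLpNorm_congr_ae (ae_of_all _ fun t => ?_))) (a1.trans ENNReal.half_le_self)
    beta_reduce
    linear_combination χ t * e0 t
  · have m1 : AEStronglyMeasurable (fun t : ℝ => cexp ((-1:ℂ) * t) *
        (deriv χ t - cexp ((1:ℂ) * t) * (p t + 1 * w t))) hl :=
      (continuous_cexp_mul _).aestronglyMeasurable.mul (hχ.deriv.smooth.continuous.aestronglyMeasurable.sub b2.1)
    have m2 : AEStronglyMeasurable (fun t : ℝ => (-cexp ((-1:ℂ) * t)) *
        (χ t - cexp ((1:ℂ) * t) * w t)) hl :=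
      (continuous_cexp_mul _).neg.aestronglyMeasurable.mul (hχ.smooth.continuous.aestronglyMeasurable.sub b1.1)
    have ne : ∀ t : ℝ, 0 < t → ‖cexp ((-1:ℂ) * t)‖ ≤ 1 := fun t ht => by
      rw [norm_cexp_mul]; simp; exact ht.le
    refine (eLpNorm_le_add m1 m2 (le_trans (eLpNorm_mono_ae (hl_ae fun t ht => ?_)) a2)
      (le_trans (eLpNorm_mono_ae (hl_ae fun t ht => ?_)) a1) (ae_of_all _ fun t => ?_)).trans
      (ENNReal.add_halves ε).le
    · rw [norm_mul]; exact mul_le_of_le_one_left (norm_nonneg _) (ne t ht)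
    · rw [norm_mul, norm_neg]; exact mul_le_of_le_one_left (norm_nonneg _) (ne t ht)
    · rw [(hasDerivAt_exp_mul (-1) (hχ.hasDerivAt t)).deriv]
      linear_combination p t * e0 t

set_option maxHeartbeats 1000000 in
/-- Fields on the mode `n` are limits of divergence-free test fields. -/
lemma ModeSol.exists_approx {α γ ρ : ℝ} (hρ : 2 < ρ) {n : ℤ} {G : ModeVec} {H : ModeTen}
    {w p : ModeVec} (h : ModeSol α γ ρ n G H w p) {ε : ℝ≥0∞} (hε : ε ≠ 0) :
    ∃ η : ModeVec, (∀ k, Tst (η k)) ∧ (∀ t, deriv (η 0) t + η 0 t + I * n * η 1 t = 0) ∧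
      ∀ k, eLpNorm (fun t : ℝ => cexp ((1:ℂ) * t) * (η k t - w k t)) 2 hl ≤ ε ∧
        eLpNorm (fun t => deriv (η k) t - p k t) 2 hl ≤ ε := by
  have e0 : ∀ t : ℝ, cexp ((-1:ℂ) * t) * cexp ((1:ℂ) * t) = 1 := fun t => by
    rw [← Complex.exp_add]; simp
  have ne : ∀ t : ℝ, 0 < t → ‖cexp ((-1:ℂ) * t)‖ ≤ 1 := fun t ht => by
    rw [norm_cexp_mul]; simp; exact ht.le
  obtain ⟨A, hA⟩ := h.bd
  have one := fun k => exists_tst_approx_component hρ (h.cont k) (h.zero k 0 le_rfl) (h.wd k) (hA k).1 (hA k).2 hε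
  obtain ⟨η2, t2, a2, b2⟩ := one 2
  rcases eq_or_ne n 0 with hn | hn
  · obtain ⟨η1, t1, a1, b1⟩ := one 1
    have w0 : ∀ t, 0 ≤ t → w 0 t = 0 := by
      have : WD (w 0) (fun t => (-1) * w 0 t) := (h.wd 0).congr (EventuallyEq.rfl) (by
        filter_upwards [h.div] with t ht
        simp [hn] at ht
        linear_combination ht)
      exact fun t ht => this.eq_zero_of_initial (h.cont 0) (h.zero 0 0 le_rfl) ht
    have p0 : p 0 =ᵐ[hl] 0 := by
      filter_upwards [h.div, hl_pos] with t ht h0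
      simpa [hn, w0 t h0.le] using ht
    have z1 : eLpNorm (fun t : ℝ => cexp ((1:ℂ) * t) * ((0:ℂ) - w 0 t)) 2 hl ≤ ε := by
      refine le_trans (le_of_eq ?_) zero_le
      rw [eLpNorm_congr_ae (g := fun _ => (0:ℂ)) (hl_ae fun t ht => by simp [w0 t ht.le])]
      simp
    have z2 : eLpNorm (fun t : ℝ => deriv (fun _ : ℝ => (0:ℂ)) t - p 0 t) 2 hl ≤ ε := by
      refine le_trans (le_of_eq ?_) zero_le
      rw [eLpNorm_congr_ae (g := fun _ => (0:ℂ)) (by filter_upwards [p0] with t ht; simp [ht])]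
      simp
    refine ⟨![fun _ => 0, η1, η2], ?_, fun t => by simp [hn], ?_⟩
    · intro k; fin_cases k
      · exact Tst.zero
      · exact t1
      · exact t2
    · intro k; fin_cases k
      · exact ⟨z1, z2⟩
      · exact ⟨a1, b1⟩
      · exact ⟨a2, b2⟩
  · obtain ⟨ψ, q, s, hψc, hqc, hψ0, hq0, hψ, hq, ⟨B, bψ, bq, bs⟩, hw0, hw1, hp0, hp1⟩ := h.exists_stream hn
    have hr : 0 < ρ - 2 := by linarith
    set N : ℝ≥0∞ := ofReal |(n:ℝ)| with hN
    have hN0 : N ≠ 0 := by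
      rw [hN]; simp [hn]
    have hN1 : 1 ≤ N := by
      rw [hN, ENNReal.one_le_ofReal]
      exact_mod_cast Int.one_le_abs hn
    have hNt : N ≠ ⊤ := ENNReal.ofReal_ne_top
    have hδ : ε / 2 / N ≠ 0 := by simp [ENNReal.div_eq_zero_iff, hε, hNt]
    have hδ' : N * (ε / 2 / N) = ε / 2 := ENNReal.mul_div_cancel hN0 hNt
    have hδ1 : ε / 2 / N ≤ ε / 2 := by
      calc ε / 2 / N ≤ ε / 2 / 1 := by gcongr
        _ = ε / 2 := by simp
    have hhalf : ε / 2 ≤ ε := ENNReal.half_le_self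
    -- The divergence condition is kept by approximating the stream function.
    obtain ⟨χ, hχ, c0, c1, c2⟩ := exists_tst_approx_two (bψ.memLp hr) (bq.memLp hr) (bs.memLp hr)
      (fun t ht => hψ.eq_primitive hψc hψ0 ht) (fun t ht => hψ.gr'.intervalIntegrable ht)
      (fun t ht => hq.eq_primitive hqc hq0 ht) (fun t ht => hq.gr'.intervalIntegrable ht) hδ
    have m0 : AEStronglyMeasurable (fun t => χ t - ψ t) hl :=
      hχ.smooth.continuous.aestronglyMeasurable.sub bψ.1
    have m1 : AEStronglyMeasurable (fun t => deriv χ t - q t) hl :=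
      hχ.deriv.smooth.continuous.aestronglyMeasurable.sub bq.1
    have m2 : AEStronglyMeasurable (fun t => deriv (deriv χ) t - s t) hl :=
      hχ.deriv.deriv.smooth.continuous.aestronglyMeasurable.sub bs.1
    have mulN : ∀ {f : ℝ → ℂ} {c : ℝ → ℂ}, (∀ t, 0 < t → ‖c t‖ ≤ |(n:ℝ)|) → eLpNorm f 2 hl ≤ ε / 2 / N →
        eLpNorm (fun t => c t * f t) 2 hl ≤ ε / 2 := fun {f c} hc hf => by
      refine le_trans (eLpNorm_le_mul_eLpNorm_of_ae_le_mul (c := |(n:ℝ)|) (g := f)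
        (hl_ae fun t ht => ?_) 2) ((mul_le_mul' le_rfl hf).trans hδ'.le)
      rw [norm_mul]; gcongr; exact hc t ht
    have hn1 : (1:ℝ) ≤ |(n:ℝ)| := by exact_mod_cast Int.one_le_abs hn
    have nN : ∀ t : ℝ, 0 < t → ‖-(I * n) * cexp ((-1:ℂ) * t)‖ ≤ |(n:ℝ)| := fun t ht => by
      rw [norm_mul, norm_neg, norm_I_mul_int]
      exact mul_le_of_le_one_right (abs_nonneg _) (ne t ht)
    have d1 := fun t => hasDerivAt_exp_mul (-1) (hχ.hasDerivAt t)
    have d2 := fun t => hasDerivAt_exp_mul (-1) (hχ.deriv.hasDerivAt t)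
    have d3 := fun t => (d1 t).const_mul (-(I * (n:ℂ)))
    have cexpm : ∀ c : ℂ, AEStronglyMeasurable (fun t : ℝ => c * cexp ((-1:ℂ) * t)) hl := fun c =>
      (continuous_const.mul (continuous_cexp_mul _)).aestronglyMeasurable
    refine ⟨![fun t => -(I * n) * (cexp ((-1:ℂ) * t) * χ t),
      fun t => cexp ((-1:ℂ) * t) * deriv χ t, η2], ?_, fun t => ?_, ?_⟩
    · intro k; fin_cases k
      · exact (hχ.exp_mul (-1)).const_mul _
      · exact hχ.deriv.exp_mul (-1)
      · exact t2
    · show deriv (fun t : ℝ => -(I * (n:ℂ)) * (cexp ((-1:ℂ) * t) * χ t)) t + _ + _ = 0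
      rw [(d3 t).deriv]
      simp
      ring
    · intro k; fin_cases k
      · refine ⟨?_, ?_⟩
        · refine le_trans (le_of_eq (eLpNorm_congr_ae (ae_of_all _ fun t => ?_)))
            ((mulN (c := fun _ => -(I * n)) (fun t ht => by rw [norm_neg, norm_I_mul_int]) c0).trans hhalf)
          show cexp ((1:ℂ) * t) * (-(I * n) * (cexp ((-1:ℂ) * t) * χ t) - w 0 t) = _
          rw [hw0]
          linear_combination (-(I * n)) * (χ t - ψ t) * e0 t
        · refine (eLpNorm_le_add ((cexpm (-(I * n))).mul m1) ((cexpm (I * n)).mul m0)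
            (mulN nN c1) (mulN (fun t ht => by have := nN t ht; rwa [neg_mul, norm_neg] at this) c0) ?_).trans
              (ENNReal.add_halves ε).le
          filter_upwards [hp0] with t ht
          show deriv (fun t : ℝ => -(I * (n:ℂ)) * (cexp ((-1:ℂ) * t) * χ t)) t - p 0 t = _
          rw [(d3 t).deriv, ht]
          simp only [Pi.mul_apply]; ring
      · refine ⟨?_, ?_⟩
        · refine le_trans (le_of_eq (eLpNorm_congr_ae (ae_of_all _ fun t => ?_)))
            (c1.trans (hδ1.trans hhalf))
          show cexp ((1:ℂ) * t) * (cexp ((-1:ℂ) * t) * deriv χ t - w 1 t) = _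
          rw [hw1]
          linear_combination (deriv χ t - q t) * e0 t
        · refine (eLpNorm_le_add ((cexpm 1).mul m2) ((cexpm (-1)).mul m1)
            (mulN (fun t ht => by rw [one_mul]; exact (ne t ht).trans hn1) c2)
            (mulN (fun t ht => by rw [neg_one_mul, norm_neg]; exact (ne t ht).trans hn1) c1) ?_).trans
              (ENNReal.add_halves ε).le
          filter_upwards [hp1] with t ht
          show deriv (fun t : ℝ => cexp ((-1:ℂ) * t) * deriv χ t) t - p 1 t = _
          rw [(d2 t).deriv, ht]
          simp only [Pi.mul_apply]; ring
      · exact ⟨a2, b2⟩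

/-! ### The nonlinear problem on the modes -/

/-- The solution of the linearized equation on a mode is bounded by its data. -/
lemma exists_modeSol_bound (α γ ρ : ℝ) (hγ : 2 < γ) (hρ : 2 < ρ) (hρ3 : ρ < 3) (hργ : ρ ≤ γ) :
    ∃ C : ℝ, 0 ≤ C ∧ ∀ (n : ℤ) (G : ModeVec) (H : ModeTen) (A : ℝ),
      (∀ k, Bd (2 * ρ - 1) A (G k)) → (∀ k l, Bd (2 * (ρ - 1)) A (H k l)) →
      (∃ w p, ModeSol α γ ρ n G H w p) ∧ ∀ w p, ModeSol α γ ρ n G H w p → ∀ k, Bd (ρ - 1) (C * A) (w k) ∧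
        Bd (ρ - 1) (C * A) (fun t => n * w k t) ∧ Bd (ρ - 1) (C * A) (p k) := by
  obtain ⟨C, hC, hex⟩ := exists_modeSol α γ ρ hγ hρ hρ3 hργ
  refine ⟨C, hC, fun n G H A hG hH => ?_⟩
  obtain ⟨w, p, h, hb⟩ := hex n G H A hG hH
  refine ⟨⟨w, p, h⟩, fun w' p' h' k => ?_⟩
  have hw := h'.unique hγ hρ hργ h
  subst hw
  refine ⟨(hb k).1, (hb k).2.1, (hb k).2.2.congr ?_⟩
  have h0 := (h.wd k).sub (h'.wd k)
  have h1 : (fun t => p k t - p' k t) =ᵐ[hl] 0 := ae_zero_of_integral_tst h0.gr' fun η hη => by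
    have := h0.eq η hη
    simpa using this
  filter_upwards [h1] with t ht
  exact sub_eq_zero.1 ht

/-- Amplitudes of the components of all modes, as an `ℓ¹` family of bounded continuous functions. -/
abbrev Amp : Type := lp (fun _ : ℤ × Fin 3 => BoundedContinuousFunction ℝ ℂ) 1

lemma Amp.hasSum_norm (a : Amp) : HasSum (fun i => ‖a i‖) ‖a‖ := by
  simpa using lp.hasSum_norm (p := 1) (by norm_num) a

/-- The total size of the amplitudes on the mode `n`. -/
noncomputable def Amp.size (a : Amp) (n : ℤ) : ℝ := ∑ k, ‖a (n, k)‖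

lemma Amp.size_nonneg (a : Amp) (n : ℤ) : 0 ≤ a.size n := sum_nonneg fun _ _ => norm_nonneg _

lemma Amp.norm_le_size (a : Amp) (n : ℤ) (k : Fin 3) : ‖a (n, k)‖ ≤ a.size n :=
  single_le_sum (f := fun k => ‖a (n, k)‖) (fun _ _ => norm_nonneg _) (Finset.mem_univ k)

lemma Amp.hasSum_size (a : Amp) : HasSum a.size ‖a‖ := by
  refine a.hasSum_norm.prod_fiberwise fun n => ?_
  exact hasSum_fintype _

lemma Amp.exists_of_bound {u : ℤ → Fin 3 → BoundedContinuousFunction ℝ ℂ} {B : ℤ → ℝ}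
    (hu : ∀ n k, ‖u n k‖ ≤ B n) (hB : Summable B) : ∃ a : Amp, (∀ n k, a (n, k) = u n k) ∧ ‖a‖ ≤ 3 * ∑' n, B n := by
  have hs : Summable fun i : ℤ × Fin 3 => ‖u i.1 i.2‖ := by
    refine Summable.of_nonneg_of_le (fun _ => norm_nonneg _) (fun i => hu i.1 i.2) ?_
    refine (summable_prod_of_nonneg (f := fun i : ℤ × Fin 3 => B i.1) (fun i => (norm_nonneg _).trans (hu i.1 i.2))).2
      ⟨fun n => Summable.of_finite, ?_⟩
    simpa using hB.mul_left 3
  have hm : Memℓp (fun i : ℤ × Fin 3 => u i.1 i.2) 1 := memℓp_gen (by simpa using hs)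
  refine ⟨⟨_, hm⟩, fun n k => rfl, ?_⟩
  rw [← tsum_mul_left]
  refine hasSum_le (fun n => ?_) (Amp.hasSum_size _) (hB.mul_left 3).hasSum
  calc _ ≤ ∑ _k : Fin 3, B n := sum_le_sum fun k _ => hu n k
    _ = _ := by simp

/-- The modes of a product of two fields. -/
noncomputable def conv (w w' : ℤ → ModeVec) (n : ℤ) (k l : Fin 3) (t : ℝ) : ℂ :=
  ∑' m, w m k t * w' (n - m) l t

/-- The amplitudes of a product. -/
noncomputable def Amp.conv (a b : Amp) (n : ℤ) (k l : Fin 3) (t : ℝ) : ℂ :=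
  ∑' m, a (m, k) t * b (n - m, l) t

/-- A bound for the amplitudes of a product. -/
noncomputable def Amp.convSize (a b : Amp) (n : ℤ) : ℝ := ∑' m, a.size m * b.size (n - m)

lemma Amp.summable_convSize_aux (a b : Amp) :
    HasSum (fun x : ℤ × ℤ => a.size x.2 * b.size (x.1 - x.2)) (‖a‖ * ‖b‖) := by
  have h := a.hasSum_size.mul b.hasSum_size (a.hasSum_size.summable.mul_of_nonneg b.hasSum_size.summable
    a.size_nonneg b.size_nonneg)
  let e : ℤ × ℤ ≃ ℤ × ℤ :=
    ⟨fun x => (x.2, x.1 - x.2), fun y => (y.1 + y.2, y.1), fun x => by simp, fun y => by simp⟩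
  exact (e.hasSum_iff (f := fun y : ℤ × ℤ => a.size y.1 * b.size y.2)).2 h

lemma Amp.summable_convSize (a b : Amp) (n : ℤ) : Summable fun m => a.size m * b.size (n - m) :=
  (a.summable_convSize_aux b).summable.prod_factor n

lemma Amp.hasSum_convSize (a b : Amp) : HasSum (a.convSize b) (‖a‖ * ‖b‖) :=
  (a.summable_convSize_aux b).prod_fiberwise fun n => (a.summable_convSize b n).hasSum

lemma Amp.norm_mul_le (a b : Amp) (n m : ℤ) (k l : Fin 3) (t : ℝ) :
    ‖a (m, k) t * b (n - m, l) t‖ ≤ a.size m * b.size (n - m) := by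
  rw [norm_mul]
  exact mul_le_mul (((a (m, k)).norm_coe_le_norm t).trans (a.norm_le_size m k))
    (((b (n - m, l)).norm_coe_le_norm t).trans (b.norm_le_size _ l)) (norm_nonneg _) (a.size_nonneg m)

lemma Amp.summable_conv (a b : Amp) (n : ℤ) (k l : Fin 3) (t : ℝ) :
    Summable fun m => a (m, k) t * b (n - m, l) t :=
  Summable.of_norm_bounded (a.summable_convSize b n) fun m => a.norm_mul_le b n m k l t

lemma Amp.norm_conv_le (a b : Amp) (n : ℤ) (k l : Fin 3) (t : ℝ) : ‖a.conv b n k l t‖ ≤ a.convSize b n :=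
  tsum_of_norm_bounded (a.summable_convSize b n).hasSum fun m => a.norm_mul_le b n m k l t

lemma Amp.continuous_conv (a b : Amp) (n : ℤ) (k l : Fin 3) : Continuous (a.conv b n k l) :=
  continuous_tsum (fun m => ((a (m, k)).continuous.mul (b (n - m, l)).continuous))
    (a.summable_convSize b n) fun m t => a.norm_mul_le b n m k l t

lemma Amp.conv_sub_conv (a b : Amp) (n : ℤ) (k l : Fin 3) (t : ℝ) :
    a.conv a n k l t - b.conv b n k l t = (a - b).conv a n k l t + b.conv (a - b) n k l t := by
  simp only [Amp.conv]
  rw [← (a.summable_conv a n k l t).tsum_sub (b.summable_conv b n k l t),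
    ← ((a - b).summable_conv a n k l t).tsum_add (b.summable_conv (a - b) n k l t)]
  refine tsum_congr fun m => ?_
  simp only [lp.coeFn_sub, Pi.sub_apply, BoundedContinuousFunction.coe_sub]
  ring

/-- The field with the amplitudes `a` and decay `e^{-st}`. -/
noncomputable def Amp.field (a : Amp) (s : ℝ) (n : ℤ) (k : Fin 3) (t : ℝ) : ℂ :=
  cexp (((-s : ℝ) : ℂ) * t) * a (n, k) t

lemma Amp.conv_field (a b : Amp) (s : ℝ) (n : ℤ) (k l : Fin 3) (t : ℝ) :
    ExtNS.conv (a.field s) (b.field s) n k l t = cexp (((-(2 * s) : ℝ) : ℂ) * t) * a.conv b n k l t := by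
  simp only [ExtNS.conv, Amp.conv, Amp.field]
  rw [← tsum_mul_left]
  refine tsum_congr fun m => ?_
  have : cexp (((-(2 * s) : ℝ) : ℂ) * t) = cexp (((-s : ℝ) : ℂ) * t) * cexp (((-s : ℝ) : ℂ) * t) := by
    rw [← Complex.exp_add]; congr 1; push_cast; ring
  rw [this]; ring

lemma Amp.bd_conv (a b : Amp) (s : ℝ) (n : ℤ) (k l : Fin 3) :
    Bd (2 * s) (a.convSize b n) (fun t => cexp (((-(2 * s) : ℝ) : ℂ) * t) * a.conv b n k l t) := by
  refine ⟨((continuous_cexp_mul _).mul (a.continuous_conv b n k l)).aestronglyMeasurable,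
    ae_of_all _ fun t => ?_⟩
  rw [norm_mul, norm_cexp_mul, Complex.ofReal_re, mul_comm]
  gcongr
  exact a.norm_conv_le b n k l t

/-- A continuous function with the decay `e^{-st}` has a bounded continuous amplitude. -/
lemma exists_amplitude {s B : ℝ} {f : ℝ → ℂ} (hf : Continuous f) (h0 : ∀ t, t ≤ 0 → f t = 0)
    (hB : Bd s B f) : ∃ u : BoundedContinuousFunction ℝ ℂ,
      (∀ t, f t = cexp (((-s : ℝ) : ℂ) * t) * u t) ∧ ‖u‖ ≤ B := by
  have hb : ∀ t : ℝ, ‖cexp ((s : ℂ) * t) * f t‖ ≤ B := fun t => by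
    rcases le_total t 0 with ht | ht
    · rw [h0 t ht, mul_zero, norm_zero]; exact hB.nonneg
    · rw [norm_mul, norm_cexp_mul, Complex.ofReal_re]
      calc _ ≤ rexp (s * t) * (B * rexp (-s * t)) := by
            gcongr; exact hB.le_of_continuous hf ht
        _ = B * (rexp (s * t) * rexp (-s * t)) := by ring
        _ = B := by rw [← Real.exp_add]; simp
  refine ⟨BoundedContinuousFunction.ofNormedAddCommGroup (fun t : ℝ => cexp ((s : ℂ) * t) * f t)
    ((continuous_cexp_mul _).mul hf) B hb, fun t => ?_,
    BoundedContinuousFunction.norm_ofNormedAddCommGroup_le _ hB.nonneg hb⟩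
  rw [BoundedContinuousFunction.coe_ofNormedAddCommGroup, ← mul_assoc, ← Complex.exp_add]
  simp

/-- Weak solutions, mode by mode, of the equation for the perturbation of the Hamel flow. -/
def NonlinSol (α γ ρ : ℝ) (G : ℤ → ModeVec) (F : ℤ → ModeTen)
    (w p : ℤ → ModeVec) : Prop :=
  ∀ n, ModeSol α γ ρ n (G n) (fun k l t => F n k l t - conv w w n k l t) (w n) (p n)

set_option maxHeartbeats 2000000 in
/-- Well-posedness of the nonlinear problem on modes, by the contraction principle. -/
lemma exists_nonlinSol (α γ ρ : ℝ) (hγ : 2 < γ) (hρ : 2 < ρ) (hρ3 : ρ < 3) (hργ : ρ ≤ γ) :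
    ∃ C : ℝ, 1 ≤ C ∧ ∀ r : ℝ, 0 < r → 12 * C * r ≤ 1 →
      ∀ (G : ℤ → ModeVec) (F : ℤ → ModeTen) (A : ℤ → ℝ),
      Summable A → ∑' n, A n ≤ r ^ 2 → (∀ n k, Bd (2 * ρ - 1) (A n) (G n k)) →
      (∀ n k l, Bd (2 * (ρ - 1)) (A n) (F n k l)) →
      (∀ n k t, G (-n) k t = conj (G n k t)) → (∀ n k l t, F (-n) k l t = conj (F n k l t)) →
      (∃ w p : ℤ → ModeVec, NonlinSol α γ ρ G F w p ∧ (∀ n k t, w (-n) k t = conj (w n k t)) ∧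
        ∃ B : ℤ → ℝ, Summable B ∧ ∑' n, B n ≤ 2 * C * r ^ 2 ∧ ∀ n k, Bd (ρ - 1) (B n) (w n k) ∧
          Bd (ρ - 1) (B n) (fun t => n * w n k t) ∧ Bd (ρ - 1) (B n) (p n k)) ∧
      ∀ w p w' p' : ℤ → ModeVec, NonlinSol α γ ρ G F w p → NonlinSol α γ ρ G F w' p' →
        (∃ B : ℤ → ℝ, Summable B ∧ 3 * ∑' n, B n ≤ r ∧ ∀ n k, Bd (ρ - 1) (B n) (w n k)) →
        (∃ B : ℤ → ℝ, Summable B ∧ 3 * ∑' n, B n ≤ r ∧ ∀ n k, Bd (ρ - 1) (B n) (w' n k)) → w = w' := by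
  obtain ⟨C₀, hC₀, hsol⟩ := exists_modeSol_bound α γ ρ hγ hρ hρ3 hργ
  refine ⟨C₀ + 1, by linarith, fun r hr hCr G F A hA hAr hG hF hGc hFc => ?_⟩
  have hC0r : 12 * C₀ * r ≤ 1 := by nlinarith
  -- Solutions with summable bounds have amplitudes in `ℓ¹`.
  have amp : ∀ {G' : ℤ → ModeVec} {H' : ℤ → ModeTen} {w p : ℤ → ModeVec} {B : ℤ → ℝ},
      (∀ n, ModeSol α γ ρ n (G' n) (H' n) (w n) (p n)) → Summable B → (∀ n k, Bd (ρ - 1) (B n) (w n k)) →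
      ∃ b : Amp, w = b.field (ρ - 1) ∧ ‖b‖ ≤ 3 * ∑' n, B n := by
    intro G' H' w p B h hB hw
    choose u hu hub using fun n k => exists_amplitude ((h n).cont k) ((h n).zero k) (hw n k)
    obtain ⟨b, hb, hbn⟩ := Amp.exists_of_bound hub hB
    refine ⟨b, ?_, hbn⟩
    ext n k t
    rw [hu n k t, Amp.field, hb]
  have data : ∀ (a : Amp) (n : ℤ) (k l : Fin 3), Bd (2 * (ρ - 1)) (A n + a.convSize a n)
      (fun t => F n k l t - conv (a.field (ρ - 1)) (a.field (ρ - 1)) n k l t) := fun a n k l => by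
    simp only [Amp.conv_field]
    exact (hF n k l).sub (a.bd_conv a (ρ - 1) n k l)
  have csum : ∀ a b : Amp, Summable (a.convSize b) := fun a b => (a.hasSum_convSize b).summable
  have cnn : ∀ (a b : Amp) n, 0 ≤ a.convSize b n := fun a b n =>
    tsum_nonneg fun m => mul_nonneg (a.size_nonneg m) (b.size_nonneg _)
  have dataG : ∀ (a : Amp) (n : ℤ) (k : Fin 3), Bd (2 * ρ - 1) (A n + a.convSize a n) (G n k) := fun a n k =>
    (hG n k).mono le_rfl (by linarith [cnn a a n]) (add_nonneg (hG n k).nonneg (cnn a a n))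
  have hex : ∀ a : Amp, ∃ b : Amp, (∃ p : ℤ → ModeVec, ∀ n, ModeSol α γ ρ n (G n)
      (fun k l t => F n k l t - conv (a.field (ρ - 1)) (a.field (ρ - 1)) n k l t) (b.field (ρ - 1) n) (p n)) ∧
      ‖b‖ ≤ 3 * (C₀ * (∑' n, A n + ‖a‖ * ‖a‖)) := by
    intro a
    choose w p h using fun n => (hsol n (G n) _ _ (dataG a n) (data a n)).1
    have hB : Summable fun n => C₀ * (A n + a.convSize a n) := (hA.add (csum a a)).mul_left _
    obtain ⟨b, hb, hbn⟩ := amp (w := w) (p := p) h hB fun n k =>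
      ((hsol n (G n) _ _ (dataG a n) (data a n)).2 _ _ (h n) k).1
    subst hb
    refine ⟨b, ⟨p, h⟩, ?_⟩
    rw [tsum_mul_left, hA.tsum_add (csum a a), (a.hasSum_convSize a).tsum_eq] at hbn
    exact hbn
  -- `Φ a` solves the linearized problem with the product of `a` with itself on the right-hand side.
  choose Φ hΦP using hex
  choose P hΦ using fun a => (hΦP a).1
  have hΦn := fun a => (hΦP a).2
  have hlip : ∀ a b : Amp, ‖Φ a - Φ b‖ ≤ 3 * (C₀ * (‖a - b‖ * (‖a‖ + ‖b‖))) := by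
    intro a b
    have hs : Summable fun n => C₀ * ((a - b).convSize a n + b.convSize (a - b) n) :=
      ((csum (a - b) a).add (csum b (a - b))).mul_left _
    have hb : ∀ n k, Bd (ρ - 1) (C₀ * ((a - b).convSize a n + b.convSize (a - b) n))
        (fun t => (Φ a).field (ρ - 1) n k t - (Φ b).field (ρ - 1) n k t) := by
      intro n k
      have h1 := (hΦ a n).sub (hΦ b n)
      have g0 : ∀ k, Bd (2 * ρ - 1) ((a - b).convSize a n + b.convSize (a - b) n)
          ((fun k t => G n k t - G n k t) k) := fun k => by
        simp only [sub_self]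
        refine ⟨aestronglyMeasurable_const, ae_of_all _ fun t => ?_⟩
        rw [norm_zero]
        exact mul_nonneg (add_nonneg (cnn _ _ n) (cnn _ _ n)) (exp_pos _).le
      have f0 : ∀ k l, Bd (2 * (ρ - 1)) ((a - b).convSize a n + b.convSize (a - b) n)
          ((fun k l t => (F n k l t - conv (a.field (ρ - 1)) (a.field (ρ - 1)) n k l t) -
            (F n k l t - conv (b.field (ρ - 1)) (b.field (ρ - 1)) n k l t)) k l) := fun k l => by
        refine (((a - b).bd_conv a (ρ - 1) n k l).add (b.bd_conv (a - b) (ρ - 1) n k l)).neg.congr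
          (ae_of_all _ fun t => ?_)
        simp only [Amp.conv_field]
        linear_combination (-cexp (((-(2 * (ρ - 1)) : ℝ) : ℂ) * t)) * (a.conv_sub_conv b n k l t).symm
      exact ((hsol n _ _ _ g0 f0).2 _ _ h1 k).1
    choose u hu hub using fun n k => exists_amplitude
      (f := fun t => (Φ a).field (ρ - 1) n k t - (Φ b).field (ρ - 1) n k t)
      (((hΦ a n).cont k).sub ((hΦ b n).cont k))
      (fun t ht => by rw [(hΦ a n).zero k t ht, (hΦ b n).zero k t ht, sub_zero]) (hb n k)
    obtain ⟨c, hc, hcn⟩ := Amp.exists_of_bound hub hs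
    have hcs : Φ a - Φ b = c := by
      ext i t
      obtain ⟨n, k⟩ := i
      have : cexp (((-(ρ - 1) : ℝ) : ℂ) * t) * Φ a (n, k) t -
        cexp (((-(ρ - 1) : ℝ) : ℂ) * t) * Φ b (n, k) t = _ := hu n k t
      rw [← mul_sub] at this
      have := mul_left_cancel₀ (Complex.exp_ne_zero _) this
      rw [hc, ← this]; rfl
    rw [hcs]
    refine hcn.trans (le_of_eq ?_)
    rw [tsum_mul_left, (csum (a - b) a).tsum_add (csum b (a - b)), ((a - b).hasSum_convSize a).tsum_eq,
      (b.hasSum_convSize (a - b)).tsum_eq]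
    ring
  have huniq : ∀ a b : Amp, ‖a‖ ≤ r → ‖b‖ ≤ r → Φ a = a → Φ b = b → a = b := by
    intro a b ha hb ea eb
    have h1 := hlip a b
    rw [ea, eb] at h1
    have h2 : 3 * (C₀ * (‖a - b‖ * (‖a‖ + ‖b‖))) ≤ ‖a - b‖ / 2 := by
      have : C₀ * (‖a - b‖ * (‖a‖ + ‖b‖)) ≤ C₀ * (‖a - b‖ * (2 * r)) := by gcongr; linarith
      nlinarith [norm_nonneg (a - b)]
    have h3 : ‖a - b‖ ≤ 0 := by linarith
    exact sub_eq_zero.1 (norm_le_zero_iff.1 h3)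
  have hfix : ∀ (a : Amp) (p : ℤ → ModeVec), NonlinSol α γ ρ G F (a.field (ρ - 1)) p → Φ a = a := by
    intro a p h
    ext i t
    obtain ⟨n, k⟩ := i
    have := congrFun (congrFun ((hΦ a n).unique hγ hρ hργ (h n)) k) t
    exact mul_left_cancel₀ (Complex.exp_ne_zero _) this
  refine ⟨?_, fun w p w' p' h h' ⟨B, hB, hBr, hBw⟩ ⟨B', hB', hBr', hBw'⟩ => ?_⟩
  · have hball : MapsTo Φ (Metric.closedBall 0 r) (Metric.closedBall 0 r) := by
      intro a ha
      rw [mem_closedBall_zero_iff] at ha ⊢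
      refine (hΦn a).trans ?_
      have h1 : ‖a‖ * ‖a‖ ≤ r ^ 2 := by nlinarith [norm_nonneg a]
      have h2 : C₀ * (∑' n, A n + ‖a‖ * ‖a‖) ≤ C₀ * (r ^ 2 + r ^ 2) := by gcongr
      nlinarith
    have hcontr : ContractingWith (1 / 2) (hball.restrict Φ _ _) := by
      refine ⟨by norm_num, LipschitzWith.of_dist_le_mul fun a b => ?_⟩
      have ha := mem_closedBall_zero_iff.1 a.2
      have hb := mem_closedBall_zero_iff.1 b.2
      rw [Subtype.dist_eq, Subtype.dist_eq, dist_eq_norm, dist_eq_norm]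
      refine (hlip a b).trans ?_
      have : C₀ * (‖(a:Amp) - b‖ * (‖(a:Amp)‖ + ‖(b:Amp)‖)) ≤ C₀ * (‖(a:Amp) - b‖ * (2 * r)) := by gcongr; linarith
      have h5 : ((1 / 2 : NNReal) : ℝ) = 1 / 2 := by norm_num
      rw [h5]
      nlinarith [norm_nonneg ((a:Amp) - b)]
    obtain ⟨a, ha, hafix, -⟩ := hcontr.exists_fixedPoint' Metric.isClosed_closedBall.isComplete hball
      (x := 0) (by simp [hr.le]) (edist_ne_top _ _)
    rw [mem_closedBall_zero_iff] at ha
    have hafix' : Φ a = a := hafix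
    have hN : NonlinSol α γ ρ G F (a.field (ρ - 1)) (P a) := fun n => by
      have := hΦ a n; rwa [hafix'] at this
    refine ⟨_, _, hN, ?_, fun n => C₀ * (A n + a.convSize a n), (hA.add (csum a a)).mul_left _, ?_, fun n k =>
      (hsol n (G n) _ _ (dataG a n) (data a n)).2 _ _ (hN n) k⟩
    · -- By uniqueness, the solution agrees with its conjugate reflection, which is a solution of the same size.
      have hN' : NonlinSol α γ ρ G F (fun n k t => conj (a.field (ρ - 1) (-n) k t))
          (fun n k t => conj (P a (-n) k t)) := fun n => by
        have h1 := (hN (-n)).conj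
        rw [neg_neg] at h1
        convert h1 using 1
        · ext k t; rw [hGc]; simp
        · ext k l t
          rw [map_sub, hFc]
          congr 1
          · simp
          · simp only [conv]
            rw [Complex.conj_tsum, ← (Equiv.neg ℤ).tsum_eq]
            refine tsum_congr fun m => ?_
            simp only [Equiv.neg_apply, neg_neg, map_mul]
            rw [show -(n - -m) = -n - m by ring]
      obtain ⟨b, hb, hbn⟩ := amp hN' (B := fun n => a.size (-n))
        ((Equiv.neg ℤ).summable_iff.2 a.hasSum_size.summable) (fun n k => by
          refine Bd.conj ⟨((hN (-n)).cont k).aestronglyMeasurable, ae_of_all _ fun t => ?_⟩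
          rw [Amp.field, norm_mul, norm_cexp_mul, Complex.ofReal_re, mul_comm]
          gcongr
          exact ((a (-n, k)).norm_coe_le_norm t).trans (a.norm_le_size _ k))
      have hbn' : ‖b‖ ≤ r := by
        refine le_trans (hasSum_le (fun i => ?_) b.hasSum_norm
          (((Equiv.prodCongr (Equiv.neg ℤ) (Equiv.refl (Fin 3))).hasSum_iff).2 a.hasSum_norm)) ha
        obtain ⟨n, k⟩ := i
        refine (BoundedContinuousFunction.norm_le (norm_nonneg _)).2 fun t => ?_
        have h1 := congrArg norm (congrFun (congrFun (congrFun hb n) k) t)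
        simp only [RCLike.norm_conj, Amp.field, norm_mul] at h1
        have h2 := mul_left_cancel₀ (norm_ne_zero_iff.2 (Complex.exp_ne_zero _)) h1
        rw [← h2]
        exact (a (-n, k)).norm_coe_le_norm t
      rw [hb] at hN'
      have hab := huniq a b ha hbn' hafix' (hfix b _ hN')
      intro n k t
      have := congrFun (congrFun (congrFun hb n) k) t
      rw [← hab] at this
      have h2 := congrArg conj this
      rw [Complex.conj_conj] at h2
      exact h2
    · rw [tsum_mul_left, hA.tsum_add (csum a a), (a.hasSum_convSize a).tsum_eq]
      have h1 : ‖a‖ * ‖a‖ ≤ r ^ 2 := by nlinarith [norm_nonneg a]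
      have h2 : C₀ * (∑' n, A n + ‖a‖ * ‖a‖) ≤ C₀ * (r ^ 2 + r ^ 2) := by gcongr
      nlinarith
  · obtain ⟨a, rfl, ha⟩ := amp h hB hBw
    obtain ⟨b, rfl, hb⟩ := amp h' hB' hBw'
    rw [huniq a b (ha.trans hBr) (hb.trans hBr') (hfix a _ h) (hfix b _ h')]

/-! ### Logarithmic polar coordinates and the cylindrical frame -/

/-- Logarithmic polar coordinates: `(t, θ)` is sent to the point of modulus `e^t` and azimuth `θ`. -/
noncomputable def pol (p : ℝ × ℝ) : Plane := polarPt (rexp p.1) p.2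

/-- Lebesgue measure on an interval of angles of length `2π`. -/
noncomputable abbrev circ : Measure ℝ := volume.restrict (Ioc 0 (2 * π))

/-- The measure `e^{2t} dt` on the half-line. -/
noncomputable def hlw : Measure ℝ := hl.withDensity fun t => ofReal (rexp (2 * t))

lemma continuous_polarPt : Continuous fun p : ℝ × ℝ => polarPt p.1 p.2 := by
  unfold polarPt
  refine (PiLp.continuous_toLp 2 _).comp (continuous_pi fun i => ?_)
  fin_cases i
  · simp; fun_prop
  · simp; fun_prop

lemma continuous_pol : Continuous pol :=
  continuous_polarPt.comp (by fun_prop : Continuous fun p : ℝ × ℝ => (rexp p.1, p.2))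

lemma norm_polarPt {r : ℝ} (hr : 0 ≤ r) (θ : ℝ) : ‖polarPt r θ‖ = r := by
  rw [EuclideanSpace.norm_eq, Fin.sum_univ_two]
  have : ‖(polarPt r θ) 0‖ ^ 2 + ‖(polarPt r θ) 1‖ ^ 2 = r ^ 2 := by
    simp only [polarPt, norm_eq_abs, sq_abs, Matrix.cons_val_zero, Matrix.cons_val_one,
      PiLp.toLp_apply]
    linear_combination r ^ 2 * sin_sq_add_cos_sq θ
  rw [this, Real.sqrt_sq hr]

lemma neg_polarPt (r θ : ℝ) : -polarPt r θ = polarPt r (θ + π) := by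
  ext i; fin_cases i <;> simp [polarPt]

lemma measurePreserving_toPlane : MeasurePreserving (fun p : ℝ × ℝ => (!₂[p.1, p.2] : Plane)) := by
  have h1 := (volume_preserving_finTwoArrow ℝ).symm
  have h2 := (EuclideanSpace.volume_preserving_symm_measurableEquiv_toLp (Fin 2)).symm
  exact h2.comp h1

lemma lintegral_plane (f : Plane → ℝ≥0∞) (hf : Measurable f) : ∫⁻ x, f x =
    ∫⁻ r in Ioi (0:ℝ), ofReal r * ∫⁻ θ in Ioo (-π) π, f (polarPt r θ) := by
  rw [← measurePreserving_toPlane.lintegral_comp hf, ← lintegral_comp_polarCoord_symm, polarCoord_target,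
    Measure.volume_eq_prod, ← Measure.prod_restrict, lintegral_prod]
  · refine lintegral_congr fun r => ?_
    rw [← lintegral_const_mul]
    · rfl
    · exact hf.comp ((continuous_polarPt.comp (by fun_prop : Continuous fun θ : ℝ => (r, θ))).measurable)
  · have : Measurable fun p : ℝ × ℝ => ofReal p.1 * f (polarPt p.1 p.2) :=
      measurable_fst.ennreal_ofReal.mul (hf.comp continuous_polarPt.measurable)
    exact this.aemeasurable

lemma lintegral_vol (f : Plane → ℝ≥0∞) (hf : Measurable f) :
    ∫⁻ x, f x ∂vol = ∫⁻ t, ∫⁻ θ, f (pol (t, θ)) ∂circ ∂hlw := by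
  have hΩ : MeasurableSet Ω := measurableSet_lt measurable_const measurable_norm
  have hg : Measurable (Ω.indicator f) := hf.indicator hΩ
  have hshift : ∀ r : ℝ, ∫⁻ θ in Ioo (-π) π, Ω.indicator f (-polarPt r θ) =
      ∫⁻ θ, Ω.indicator f (polarPt r θ) ∂circ := by
    intro r
    simp only [neg_polarPt]
    have h1 : MeasurePreserving (fun θ : ℝ => θ + π) := measurePreserving_add_right volume π
    have h2 := h1.setLIntegral_comp_preimage (s := Ioo 0 (2 * π)) measurableSet_Ioo
      (f := fun θ => Ω.indicator f (polarPt r θ))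
      (hg.comp ((continuous_polarPt.comp (by fun_prop : Continuous fun θ : ℝ => (r, θ))).measurable))
    rw [setLIntegral_congr Ioo_ae_eq_Ioc] at h2
    have h3 : (fun θ : ℝ => θ + π) ⁻¹' Ioo 0 (2 * π) = Ioo (-π) π := by
      ext θ; simp only [mem_preimage, mem_Ioo]; constructor <;> rintro ⟨h, h'⟩ <;> constructor <;> linarith
    rw [h3] at h2
    exact h2
  rw [vol, ← lintegral_indicator hΩ, ← (Measure.measurePreserving_neg (volume : Measure Plane)).lintegral_comp hg, lintegral_plane (fun x => Ω.indicator f (-x)) (hg.comp measurable_neg)]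
  simp only [hshift]
  have h1 : ∫⁻ r in Ioi (0:ℝ), ofReal r * ∫⁻ θ, Ω.indicator f (polarPt r θ) ∂circ =
      ∫⁻ r in Ioi (1:ℝ), ofReal r * ∫⁻ θ, f (polarPt r θ) ∂circ := by
    rw [← lintegral_indicator measurableSet_Ioi, ← lintegral_indicator measurableSet_Ioi]
    refine lintegral_congr fun r => ?_
    by_cases hr : r ∈ Ioi (1:ℝ)
    · have hr0 : r ∈ Ioi (0:ℝ) := lt_trans one_pos (mem_Ioi.1 hr)
      rw [indicator_of_mem hr, indicator_of_mem hr0]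
      congr 1
      refine lintegral_congr fun θ => indicator_of_mem ?_ _
      show 1 < ‖polarPt r θ‖
      rw [norm_polarPt (le_of_lt hr0)]; exact hr
    · rw [indicator_of_notMem hr]
      by_cases hr0 : r ∈ Ioi (0:ℝ)
      · rw [indicator_of_mem hr0]
        have : ∀ θ, Ω.indicator f (polarPt r θ) = 0 := fun θ => indicator_of_notMem (by
          show ¬ 1 < ‖polarPt r θ‖
          rw [norm_polarPt (le_of_lt hr0)]; exact hr) _
        simp [this]
      · rw [indicator_of_notMem hr0]
  have himg : rexp '' Ioi 0 = Ioi 1 := by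
    rw [Real.image_exp_Ioi, Real.exp_zero]
  rw [h1, ← himg, lintegral_image_eq_lintegral_abs_deriv_mul measurableSet_Ioi
    (fun t _ => (Real.hasDerivAt_exp t).hasDerivWithinAt) Real.exp_injective.injOn, hlw,
    lintegral_withDensity_eq_lintegral_mul _ (by fun_prop)]
  · refine lintegral_congr fun t => ?_
    rw [Pi.mul_apply, ← mul_assoc, abs_of_pos (exp_pos t), ← ENNReal.ofReal_mul (exp_pos t).le,
      ← Real.exp_add, ← two_mul]
    rfl
  · exact Measurable.lintegral_prod_right' (f := fun p : ℝ × ℝ => f (pol p)) (hf.comp continuous_pol.measurable)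

/-- The measure `dt dθ` on the logarithmic polar coordinates of the exterior disk. -/
noncomputable abbrev hlc : Measure (ℝ × ℝ) := hl.prod circ

/-- Lebesgue measure on the exterior disk in logarithmic polar coordinates. -/
lemma vol_eq_map : vol = (hlc.withDensity fun p => ofReal (rexp (2 * p.1))).map pol := by
  have h : (hlc.withDensity fun p : ℝ × ℝ => ofReal (rexp (2 * p.1))) = hlw.prod circ := by
    rw [hlw, prod_withDensity_left]
    · fun_prop
  rw [h]
  refine Measure.ext_of_lintegral _ fun f hf => ?_
  rw [lintegral_vol f hf, lintegral_map hf continuous_pol.measurable, lintegral_prod]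
  exact (hf.comp continuous_pol.measurable).aemeasurable

lemma measurable_weight : Measurable fun p : ℝ × ℝ => ofReal (rexp (2 * p.1)) := by fun_prop

lemma hlc_ac : hlc ≪ hlc.withDensity fun p : ℝ × ℝ => ofReal (rexp (2 * p.1)) :=
  withDensity_absolutelyContinuous' measurable_weight.aemeasurable
    (ae_of_all _ fun p => by simp [exp_pos])

/-- Null sets of the exterior disk are null in polar coordinates. -/
lemma quasiMeasurePreserving_pol : Measure.QuasiMeasurePreserving pol hlc vol :=
  ⟨continuous_pol.measurable, by rw [vol_eq_map]; exact hlc_ac.map continuous_pol.measurable⟩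

lemma norm_pol (p : ℝ × ℝ) : ‖pol p‖ = rexp p.1 := norm_polarPt (exp_pos _).le _

lemma log_norm_pol (p : ℝ × ℝ) : log ‖pol p‖ = p.1 := by rw [norm_pol, Real.log_exp]

lemma measurable_log_norm : Measurable fun x : Plane => log ‖x‖ :=
  Real.measurable_log.comp measurable_norm

/-- Properties of almost every `t` hold at `t = log |x|` for almost every `x`. -/
lemma quasiMeasurePreserving_log_norm :
    Measure.QuasiMeasurePreserving (fun x : Plane => log ‖x‖) vol hl := by
  refine ⟨measurable_log_norm, ?_⟩
  rw [vol_eq_map, Measure.map_map measurable_log_norm continuous_pol.measurable]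
  have : (fun x : Plane => log ‖x‖) ∘ pol = Prod.fst := funext fun p => log_norm_pol p
  rw [this]
  exact ((withDensity_absolutelyContinuous _ _).map measurable_fst).trans
    Measure.quasiMeasurePreserving_fst.absolutelyContinuous

lemma ae_vol_pos : ∀ᵐ x ∂vol, 0 < log ‖x‖ := quasiMeasurePreserving_log_norm.ae hl_pos

lemma circ_univ : circ univ = ofReal (2 * π) := by simp

instance : (ae circ).NeBot := by
  rw [ae_neBot]
  intro h
  have := congrArg (fun μ : Measure ℝ => μ univ) h
  simp at this
  linarith [Real.pi_pos]

/-- Integrals over the exterior disk in logarithmic polar coordinates. -/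
lemma integrable_pol {f : Plane → ℝ} (hf : Integrable f vol) :
    Integrable (fun p : ℝ × ℝ => rexp (2 * p.1) * f (pol p)) hlc := by
  have hm := hf.1
  rw [vol_eq_map] at hm
  rw [vol_eq_map, integrable_map_measure hm continuous_pol.measurable.aemeasurable,
    integrable_withDensity_iff_integrable_smul' measurable_weight (by simp)] at hf
  refine hf.congr (ae_of_all _ fun p => ?_)
  simp [(exp_pos _).le]

lemma integral_vol {f : Plane → ℝ} (hf : Integrable f vol) :
    ∫ x, f x ∂vol = ∫ t, rexp (2 * t) * ∫ θ, f (pol (t, θ)) ∂circ ∂hl := by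
  have h := integral_prod _ (integrable_pol hf)
  simp only [integral_const_mul] at h
  rw [← h, vol_eq_map, integral_map continuous_pol.measurable.aemeasurable (by rw [← vol_eq_map]; exact hf.1),
    integral_withDensity_eq_integral_toReal_smul measurable_weight (by simp)]
  refine integral_congr_ae (ae_of_all _ fun p => ?_)
  simp [(exp_pos _).le]

lemma azimuth_polarPt {r : ℝ} (hr : 0 < r) (θ : ℝ) :
    ∃ m : ℤ, azimuth (polarPt r θ) = θ + m * (2 * π) := by
  have h := Complex.arg_mul_cos_add_sin_mul_I_sub hr θ
  refine ⟨⌊(π - θ) / (2 * π)⌋, ?_⟩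
  have e : (⟨polarPt r θ 0, polarPt r θ 1⟩ : ℂ) = r * (Complex.cos θ + Complex.sin θ * I) := by
    apply Complex.ext <;> simp [polarPt, ← Complex.ofReal_cos, ← Complex.ofReal_sin]
  rw [azimuth, e, eq_add_of_sub_eq h, add_comm, mul_comm]

lemma frame_add_int_mul (θ : ℝ) (m : ℤ) : frame (θ + m * (2 * π)) = frame θ := by
  simp [frame, Real.cos_add_int_mul_two_pi, Real.sin_add_int_mul_two_pi]

lemma frame_azimuth {r : ℝ} (hr : 0 < r) (θ : ℝ) : frame (azimuth (polarPt r θ)) = frame θ := by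
  obtain ⟨m, hm⟩ := azimuth_polarPt hr θ
  rw [hm, frame_add_int_mul]

lemma cexp_azimuth {r : ℝ} (hr : 0 < r) (θ : ℝ) (n : ℤ) :
    cexp (I * n * azimuth (polarPt r θ)) = cexp (I * n * θ) := by
  obtain ⟨m, hm⟩ := azimuth_polarPt hr θ
  rw [hm, Complex.exp_eq_exp_iff_exists_int]
  exact ⟨n * m, by push_cast; ring⟩

lemma polarPt_azimuth (x : Plane) : polarPt ‖x‖ (azimuth x) = x := by
  have hn : ‖x‖ = ‖(⟨x 0, x 1⟩ : ℂ)‖ := by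
    rw [EuclideanSpace.norm_eq, Fin.sum_univ_two, Complex.norm_eq_sqrt_sq_add_sq]
    simp
  ext i
  fin_cases i
  · simp only [polarPt, azimuth, hn]
    simp
  · simp only [polarPt, azimuth, hn]
    simp

lemma norm_cexp_I (n : ℤ) (θ : ℝ) : ‖cexp (I * n * θ)‖ = 1 := by
  rw [Complex.norm_exp]; simp

/-- The frame is orthonormal. -/
lemma frame_mul_frame' (θ : ℝ) (k l : Fin 3) : ∑ j, frame θ k j * frame θ l j = if k = l then 1 else 0 := by
  have h := sin_sq_add_cos_sq θ
  fin_cases k <;> fin_cases l <;> simp [frame, Fin.sum_univ_three] <;> linarith [h]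

lemma sum_norm_sq_frame (θ : ℝ) (z : Fin 3 → ℂ) :
    ∑ j, ‖∑ k, z k * (frame θ k j : ℂ)‖ ^ 2 = ∑ k, ‖z k‖ ^ 2 := by
  have h := sin_sq_add_cos_sq θ
  simp only [← Complex.normSq_eq_norm_sq, Complex.normSq_apply, Fin.sum_univ_three]
  simp [frame, Complex.cos_ofReal_re, Complex.sin_ofReal_re]
  linear_combination ((z 0).re ^ 2 + (z 0).im ^ 2 + (z 1).re ^ 2 + (z 1).im ^ 2) * h

lemma norm_sq_projVec (n : ℤ) (v : VecField) (x : Plane) :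
    ‖projVec n v x‖ ^ 2 = ∑ k, ‖fourierMode n (cylVec v k) ‖x‖‖ ^ 2 := by
  rw [EuclideanSpace.norm_sq_eq]
  simp only [projVec]
  rw [sum_norm_sq_frame]
  simp only [norm_mul, norm_cexp_I, mul_one]

lemma norm_sq_projTen (n : ℤ) (F : TenField) (x : Plane) :
    ‖projTen n F x‖ ^ 2 = ∑ k, ∑ l, ‖fourierMode n (cylTen F k l) ‖x‖‖ ^ 2 := by
  rw [EuclideanSpace.norm_sq_eq, Fintype.sum_prod_type]
  simp only [projTen]
  have h1 : ∀ i j, ∑ k, ∑ l, fourierMode n (cylTen F k l) ‖x‖ * cexp (I * n * azimuth x) *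
      (frame (azimuth x) k i : ℂ) * (frame (azimuth x) l j : ℂ) =
      ∑ l, (∑ k, (fourierMode n (cylTen F k l) ‖x‖ * cexp (I * n * azimuth x)) *
        (frame (azimuth x) k i : ℂ)) * (frame (azimuth x) l j : ℂ) := fun i j => by
    simp only [Finset.sum_mul]
    exact sum_comm
  simp only [h1, sum_norm_sq_frame]
  rw [sum_comm]
  simp only [sum_norm_sq_frame, norm_mul, norm_cexp_I, mul_one]
  exact sum_comm

lemma norm_fourierMode_le_projVec (n : ℤ) (v : VecField) (x : Plane) (k : Fin 3) :
    ‖fourierMode n (cylVec v k) ‖x‖‖ ≤ ‖projVec n v x‖ := by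
  refine le_of_sq_le_sq ?_ (norm_nonneg _)
  rw [norm_sq_projVec]
  exact single_le_sum (f := fun k => ‖fourierMode n (cylVec v k) ‖x‖‖ ^ 2) (fun _ _ => by positivity)
    (Finset.mem_univ k)

lemma norm_fourierMode_le_projTen (n : ℤ) (F : TenField) (x : Plane) (k l : Fin 3) :
    ‖fourierMode n (cylTen F k l) ‖x‖‖ ≤ ‖projTen n F x‖ := by
  refine le_of_sq_le_sq ?_ (norm_nonneg _)
  rw [norm_sq_projTen]
  refine le_trans ?_ (single_le_sum (f := fun k => ∑ l, ‖fourierMode n (cylTen F k l) ‖x‖‖ ^ 2)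
    (fun _ _ => by positivity) (Finset.mem_univ k))
  exact single_le_sum (f := fun l => ‖fourierMode n (cylTen F k l) ‖x‖‖ ^ 2) (fun _ _ => by positivity)
    (Finset.mem_univ l)

lemma norm_projVec_le (n : ℤ) (v : VecField) (x : Plane) :
    ‖projVec n v x‖ ≤ ∑ k, ‖fourierMode n (cylVec v k) ‖x‖‖ := by
  refine le_of_sq_le_sq ?_ (sum_nonneg fun _ _ => norm_nonneg _)
  rw [norm_sq_projVec]
  exact sum_sq_le_sq_sum_of_nonneg fun _ _ => norm_nonneg _

lemma norm_projTen_le (n : ℤ) (F : TenField) (x : Plane) :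
    ‖projTen n F x‖ ≤ ∑ k, ∑ l, ‖fourierMode n (cylTen F k l) ‖x‖‖ := by
  refine le_of_sq_le_sq ?_ (sum_nonneg fun _ _ => sum_nonneg fun _ _ => norm_nonneg _)
  rw [norm_sq_projTen]
  refine le_trans (sum_le_sum fun k _ => ?_)
    (sum_sq_le_sq_sum_of_nonneg fun _ _ => sum_nonneg fun _ _ => norm_nonneg _)
  exact sum_sq_le_sq_sum_of_nonneg fun _ _ => norm_nonneg _

/-! ### Fourier series in the azimuth -/

/-- The Fourier coefficients of a function of the angle. -/
noncomputable def fc (n : ℤ) (a : ℝ → ℝ) : ℂ :=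
  (1 / (2 * π) : ℝ) * ∫ θ, (a θ : ℂ) * cexp (-(I * n * θ)) ∂circ

lemma fourierMode_eq (n : ℤ) (s : ℝ → ℝ → ℝ) (r : ℝ) : fourierMode n s r = fc n (s r) := by
  rw [fourierMode, fc, intervalIntegral.integral_of_le Real.two_pi_pos.le]

lemma norm_cexp_neg_I (n : ℤ) (θ : ℝ) : ‖cexp (-(I * n * θ))‖ = 1 := by
  rw [Complex.norm_exp]; simp

lemma continuous_cexp_neg_I (n : ℤ) : Continuous fun θ : ℝ => cexp (-(I * n * θ)) := by fun_prop

/-- Bounded measurable functions of the angle. -/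
def BM (M : ℝ) (a : ℝ → ℝ) : Prop := AEStronglyMeasurable a circ ∧ ∀ᵐ θ ∂circ, |a θ| ≤ M

lemma BM.nonneg {M : ℝ} {a : ℝ → ℝ} (h : BM M a) : 0 ≤ M := by
  obtain ⟨θ, h⟩ := h.2.exists
  exact (abs_nonneg _).trans h

lemma BM.add {M N : ℝ} {a b : ℝ → ℝ} (ha : BM M a) (hb : BM N b) : BM (M + N) (fun θ => a θ + b θ) := by
  refine ⟨ha.1.add hb.1, ?_⟩
  filter_upwards [ha.2, hb.2] with θ h1 h2
  exact (abs_add_le _ _).trans (add_le_add h1 h2)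

lemma BM.mul {M N : ℝ} {a b : ℝ → ℝ} (ha : BM M a) (hb : BM N b) : BM (M * N) (fun θ => a θ * b θ) := by
  refine ⟨ha.1.mul hb.1, ?_⟩
  filter_upwards [ha.2, hb.2] with θ h1 h2
  rw [abs_mul]
  exact mul_le_mul h1 h2 (abs_nonneg _) ha.nonneg

lemma BM.const (c : ℝ) : BM |c| (fun _ => c) := ⟨aestronglyMeasurable_const, ae_of_all _ fun _ => le_rfl⟩

lemma BM.integrable {M : ℝ} {a : ℝ → ℝ} (h : BM M a) : Integrable a circ :=
  ⟨h.1, HasFiniteIntegral.of_bounded h.2⟩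

lemma BM.integrable_mul {M : ℝ} {a : ℝ → ℝ} (h : BM M a) {e : ℝ → ℂ} (he : Continuous e) (h1 : ∀ θ, ‖e θ‖ = 1) :
    Integrable (fun θ => (a θ : ℂ) * e θ) circ := by
  refine ⟨(continuous_ofReal.comp_aestronglyMeasurable h.1).mul he.aestronglyMeasurable, ?_⟩
  refine HasFiniteIntegral.of_bounded (C := M) ?_
  filter_upwards [h.2] with θ hθ
  rw [norm_mul, h1, mul_one]; simpa using hθ

lemma fc_add {M N : ℝ} {a b : ℝ → ℝ} (ha : BM M a) (hb : BM N b) (n : ℤ) :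
    fc n (fun θ => a θ + b θ) = fc n a + fc n b := by
  rw [fc, fc, fc, ← mul_add, ← integral_add (ha.integrable_mul (continuous_cexp_neg_I n) (norm_cexp_neg_I n))
    (hb.integrable_mul (continuous_cexp_neg_I n) (norm_cexp_neg_I n))]
  congr 1
  refine integral_congr_ae (ae_of_all _ fun θ => ?_)
  simp only [Complex.ofReal_add]; ring

lemma fc_const_mul (c : ℝ) (a : ℝ → ℝ) (n : ℤ) : fc n (fun θ => c * a θ) = c * fc n a := by
  rw [fc, fc, mul_left_comm (c : ℂ), ← integral_const_mul (c : ℂ)]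
  congr 1
  refine integral_congr_ae (ae_of_all _ fun θ => ?_)
  simp only [Complex.ofReal_mul]; ring

lemma fc_congr {a b : ℝ → ℝ} (h : a =ᵐ[circ] b) (n : ℤ) : fc n a = fc n b := by
  rw [fc, fc]
  congr 1
  refine integral_congr_ae ?_
  filter_upwards [h] with θ hθ
  rw [hθ]

lemma fc_neg (a : ℝ → ℝ) (n : ℤ) : fc (-n) a = conj (fc n a) := by
  rw [fc, fc, map_mul, Complex.conj_ofReal, ← integral_conj]
  congr 2; ext θ
  rw [map_mul, Complex.conj_ofReal, ← Complex.exp_conj]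
  congr 2
  simp

lemma norm_fc_le {M : ℝ} {a : ℝ → ℝ} (h : ∀ᵐ θ ∂circ, |a θ| ≤ M) (n : ℤ) : ‖fc n a‖ ≤ M := by
  have h1 : ‖∫ θ, (a θ : ℂ) * cexp (-(I * n * θ)) ∂circ‖ ≤ M * circ.real univ := by
    refine norm_integral_le_of_norm_le_const ?_
    filter_upwards [h] with θ hθ
    rw [norm_mul, norm_cexp_neg_I, mul_one]; simpa using hθ
  have h2 : circ.real univ = 2 * π := by
    rw [Measure.real, circ_univ, ENNReal.toReal_ofReal Real.two_pi_pos.le]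
  rw [h2] at h1
  rw [fc, norm_mul, norm_real, Real.norm_of_nonneg (by positivity)]
  calc _ ≤ 1 / (2 * π) * (M * (2 * π)) := by gcongr
    _ = M := by field_simp

lemma fc_one (n : ℤ) : fc n (fun _ => 1) = if n = 0 then 1 else 0 := by
  rw [fc]
  split_ifs with h
  · subst h
    have hpi : (π : ℂ) ≠ 0 := by exact_mod_cast Real.pi_ne_zero
    simp [Measure.real, Real.pi_pos.le]
    field_simp
  · have e : ∫ θ : ℝ, ((1:ℝ) : ℂ) * cexp (-(I * n * θ)) ∂circ =
        ∫ θ in (0:ℝ)..(2 * π), cexp (-(I * n) * θ) := by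
      rw [intervalIntegral.integral_of_le Real.two_pi_pos.le]
      congr 1; ext θ; simp
    have hn : -(I * (n:ℂ)) ≠ 0 := neg_ne_zero.2 (mul_ne_zero Complex.I_ne_zero (by exact_mod_cast h))
    rw [e, integral_exp_mul_complex hn]
    have : cexp (-(I * n) * ((2 * π : ℝ) : ℂ)) = 1 := by
      rw [Complex.exp_eq_one_iff]
      exact ⟨-n, by push_cast; ring⟩
    rw [this]; simp

/-- The Fourier coefficients of a product, one factor of which is the sum of its absolutely convergent
Fourier series. -/
lemma hasSum_fc_mul {a b : ℝ → ℝ} {c : ℤ → ℂ} {M : ℝ} (hc : Summable fun m => ‖c m‖)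
    (ha : ∀ᵐ θ : ℝ ∂circ, HasSum (fun m => c m * cexp (I * m * θ)) (a θ : ℂ)) (hb : BM M b) (n : ℤ) :
    HasSum (fun m => c m * fc (n - m) b) (fc n (fun θ => a θ * b θ)) := by
  have h := hasSum_integral_of_dominated_convergence (μ := circ)
    (F := fun (m : ℤ) (θ : ℝ) => (c m * cexp (I * m * θ)) * (b θ * cexp (-(I * n * θ))))
    (f := fun θ : ℝ => (a θ : ℂ) * (b θ * cexp (-(I * n * θ))))
    (fun m _ => ‖c m‖ * M) (fun m => ?_) (fun m => ?_) (ae_of_all _ fun θ => hc.mul_right M)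
    (integrable_const _) ?_
  · have h2 := h.mul_left ((1 / (2 * π) : ℝ) : ℂ)
    have e : fc n (fun θ => a θ * b θ) = ((1 / (2 * π) : ℝ) : ℂ) *
        ∫ θ : ℝ, (a θ : ℂ) * (b θ * cexp (-(I * n * θ))) ∂circ := by
      rw [fc]
      congr 1
      refine integral_congr_ae (ae_of_all _ fun θ => ?_)
      simp only [Complex.ofReal_mul]; ring
    rw [e]
    refine (congrArg (fun f => HasSum f _) (funext fun m => ?_)).mpr h2
    rw [fc, mul_left_comm (c m), ← integral_const_mul (c m)]
    congr 1
    refine integral_congr_ae (ae_of_all _ fun θ => ?_)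
    have : cexp (-(I * (n - m : ℤ) * θ)) =
        cexp (I * m * θ) * cexp (-(I * n * θ)) := by
      rw [← Complex.exp_add]; congr 1; push_cast; ring
    simp only [this]; ring
  · refine AEStronglyMeasurable.mul (by fun_prop) ?_
    exact (hb.integrable_mul (continuous_cexp_neg_I n) (norm_cexp_neg_I n)).1
  · filter_upwards [hb.2] with θ hθ
    rw [norm_mul, norm_mul, norm_mul, norm_cexp_I, norm_cexp_neg_I, mul_one, mul_one]
    gcongr; simpa using hθ
  · filter_upwards [ha] with θ hθ
    exact hθ.mul_right _

lemma fc_of_hasSum {a : ℝ → ℝ} {c : ℤ → ℂ} (hc : Summable fun m => ‖c m‖)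
    (ha : ∀ᵐ θ : ℝ ∂circ, HasSum (fun m => c m * cexp (I * m * θ)) (a θ : ℂ)) (n : ℤ) :
    fc n a = c n := by
  have h := hasSum_fc_mul hc ha (BM.const 1) n
  simp only [mul_one, fc_one] at h
  have h2 := hasSum_ite_eq n (c n)
  refine h.unique ?_
  convert h2 using 2 with m
  by_cases hm : m = n
  · simp [hm]
  · simp [hm, sub_eq_zero, Ne.symm hm]

/-- Parseval's identity. -/
lemma hasSum_fc_mul_fc {M N : ℝ} {a b : ℝ → ℝ} (ha : BM M a) (hb : BM N b) :
    HasSum (fun n => (fc n a * fc (-n) b).re) (1 / (2 * π) * ∫ θ, a θ * b θ ∂circ) := by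
  have key : ∀ {K : ℝ} {f : ℝ → ℝ}, BM K f →
      HasSum (fun n => ‖fc n f‖ ^ 2) (1 / (2 * π) * ∫ θ, f θ ^ 2 ∂circ) := by
    intro K f hf
    have hL : MemLp (fun θ => (f θ : ℂ)) 2 (volume.restrict (Ioc 0 (2 * π))) :=
      MemLp.of_bound (continuous_ofReal.comp_aestronglyMeasurable hf.1) K
        (by filter_upwards [hf.2] with θ hθ; simpa using hθ)
    have h := hasSum_sq_fourierCoeffOn two_pi_pos hL
    convert h using 1
    · ext n
      congr 2
      rw [fourierCoeffOn_eq_integral, fc, intervalIntegral.integral_of_le Real.two_pi_pos.le, sub_zero,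
        Complex.real_smul]
      congr 2; ext θ
      rw [fourier_coe_apply, smul_eq_mul, mul_comm]
      congr 2
      have : (π : ℂ) ≠ 0 := by exact_mod_cast Real.pi_ne_zero
      push_cast
      field_simp
    · rw [intervalIntegral.integral_of_le Real.two_pi_pos.le, sub_zero, smul_eq_mul, one_div]
      simp
  have h := ((key (ha.add hb)).sub ((key ha).add (key hb))).div_const 2
  have hl : (fun n => (fc n a * fc (-n) b).re) = fun n =>
      (‖fc n (fun θ => a θ + b θ)‖ ^ 2 - (‖fc n a‖ ^ 2 + ‖fc n b‖ ^ 2)) / 2 := by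
    ext n
    rw [fc_add ha hb, fc_neg]
    simp only [← Complex.normSq_eq_norm_sq, Complex.normSq_apply]
    simp; ring
  rw [hl]
  have ia : Integrable (fun θ => a θ ^ 2) circ := by simpa only [sq] using (ha.mul ha).integrable
  have ib : Integrable (fun θ => b θ ^ 2) circ := by simpa only [sq] using (hb.mul hb).integrable
  have iab := (ha.mul hb).integrable
  have e : ∫ θ, (a θ + b θ) ^ 2 ∂circ = ∫ θ, a θ ^ 2 ∂circ + ∫ θ, b θ ^ 2 ∂circ + 2 * ∫ θ, a θ * b θ ∂circ := by
    rw [← integral_const_mul, ← integral_add ia ib, ← integral_add (f := fun θ => a θ ^ 2 + b θ ^ 2) (ia.add ib) (iab.const_mul 2)]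
    refine integral_congr_ae (ae_of_all _ fun θ => ?_)
    ring
  rw [e] at h
  have hv : 1 / (2 * π) * ∫ θ, a θ * b θ ∂circ = (1 / (2 * π) * (∫ θ, a θ ^ 2 ∂circ +
      ∫ θ, b θ ^ 2 ∂circ + 2 * ∫ θ, a θ * b θ ∂circ) - (1 / (2 * π) * ∫ θ, a θ ^ 2 ∂circ +
      1 / (2 * π) * ∫ θ, b θ ^ 2 ∂circ)) / 2 := by ring
  rw [hv]
  exact h

/-- The real function with given Fourier coefficients. -/
noncomputable def synth (c : ℤ → ℂ) (θ : ℝ) : ℝ := (∑' n, c n * cexp (I * n * θ)).re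

lemma summable_synth {c : ℤ → ℂ} (hc : Summable fun m => ‖c m‖) (θ : ℝ) :
    Summable fun m : ℤ => c m * cexp (I * m * θ) :=
  Summable.of_norm (by simpa only [norm_mul, norm_cexp_I, mul_one] using hc)

lemma hasSum_synth {c : ℤ → ℂ} (hc : Summable fun m => ‖c m‖) (hr : ∀ n, c (-n) = conj (c n)) (θ : ℝ) :
    HasSum (fun m : ℤ => c m * cexp (I * m * θ)) (synth c θ : ℂ) := by
  have h := (summable_synth hc θ).hasSum
  convert h using 1
  rw [synth]
  rw [← Complex.conj_eq_iff_re, Complex.conj_tsum, ← (Equiv.neg ℤ).tsum_eq]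
  refine tsum_congr fun m => ?_
  rw [Equiv.neg_apply, map_mul, hr, Complex.conj_conj, ← Complex.exp_conj]
  congr 2; simp

lemma abs_synth_le {c : ℤ → ℂ} (hc : Summable fun m => ‖c m‖) (θ : ℝ) : |synth c θ| ≤ ∑' n, ‖c n‖ := by
  refine (Complex.abs_re_le_norm _).trans (tsum_of_norm_bounded hc.hasSum fun n => ?_)
  rw [norm_mul, norm_cexp_I, mul_one]

/-! ### Derivatives in the cylindrical frame -/

lemma polarPt_eq (r θ : ℝ) : polarPt r θ = r • (Real.cos θ • dir 0 + Real.sin θ • dir 1) := by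
  ext i; fin_cases i <;> simp [polarPt, dir]

lemma hasDerivAt_pol_fst (t θ : ℝ) : HasDerivAt (fun t => pol (t, θ))
    (rexp t • (Real.cos θ • dir 0 + Real.sin θ • dir 1)) t := by
  simp only [pol, polarPt_eq]
  exact (Real.hasDerivAt_exp t).smul_const (Real.cos θ • dir 0 + Real.sin θ • dir 1)

lemma hasDerivAt_pol_snd (t θ : ℝ) : HasDerivAt (fun θ => pol (t, θ))
    (rexp t • (-Real.sin θ • dir 0 + Real.cos θ • dir 1)) θ := by
  simp only [pol, polarPt_eq]
  exact (((Real.hasDerivAt_cos θ).smul_const (dir 0)).add ((Real.hasDerivAt_sin θ).smul_const (dir 1))).const_smul (rexp t)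

lemma pd_two (φ : VecField) (x : Plane) : pd 2 φ x = 0 := by simp [pd, dir]

lemma cylTen_grad_zero (φ : VecField) (k : Fin 3) (t θ : ℝ) : cylTen (grad φ) 0 k (rexp t) θ =
    ∑ j, frame θ k j * (Real.cos θ * pd 0 φ (pol (t, θ)) j + Real.sin θ * pd 1 φ (pol (t, θ)) j) := by
  simp only [cylTen, grad, Fin.sum_univ_three, pol]
  simp [frame, pd_two]
  ring

lemma cylTen_grad_one (φ : VecField) (k : Fin 3) (t θ : ℝ) : cylTen (grad φ) 1 k (rexp t) θ =
    ∑ j, frame θ k j * (-Real.sin θ * pd 0 φ (pol (t, θ)) j + Real.cos θ * pd 1 φ (pol (t, θ)) j) := by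
  simp only [cylTen, grad, Fin.sum_univ_three, pol]
  simp [frame, pd_two]
  ring

lemma cylTen_grad_two (φ : VecField) (k : Fin 3) (r θ : ℝ) : cylTen (grad φ) 2 k r θ = 0 := by
  simp only [cylTen, grad, Fin.sum_univ_three]
  simp [frame, pd_two]

lemma hasDerivAt_component {φ : VecField} {c : ℝ → Plane} {c' : Plane} {s : ℝ}
    (hφ : DifferentiableAt ℝ φ (c s)) (hc : HasDerivAt c c' s) (j : Fin 3) :
    HasDerivAt (fun s => φ (c s) j) (fderiv ℝ φ (c s) c' j) s :=
  ((EuclideanSpace.proj (𝕜 := ℝ) j : Vec ℝ →L[ℝ] ℝ).hasFDerivAt.comp_hasDerivAt s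
    (hφ.hasFDerivAt.comp_hasDerivAt s hc))

/-- The radial derivatives of the cylindrical components of a field. -/
lemma hasDerivAt_cylVec_fst {φ : VecField} {t θ : ℝ} (hφ : DifferentiableAt ℝ φ (pol (t, θ))) (k : Fin 3) :
    HasDerivAt (fun t => cylVec φ k (rexp t) θ) (rexp t * cylTen (grad φ) 0 k (rexp t) θ) t := by
  have h := HasDerivAt.fun_sum (u := Finset.univ) fun j (_ : j ∈ Finset.univ) =>
    (hasDerivAt_component (c := fun t => pol (t, θ)) hφ (hasDerivAt_pol_fst t θ) j).const_mul (frame θ k j)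
  refine h.congr_deriv ?_
  rw [cylTen_grad_zero, mul_sum]
  refine sum_congr rfl fun j _ => ?_
  simp [pd]; ring

lemma hasDerivAt_frame (θ : ℝ) (k j : Fin 3) : HasDerivAt (fun θ => frame θ k j)
    ((![frame θ 1, -frame θ 0, 0] : Fin 3 → Fin 3 → ℝ) k j) θ := by
  have hs := Real.hasDerivAt_sin θ
  have hc := Real.hasDerivAt_cos θ
  have h0 := hasDerivAt_const θ (0:ℝ)
  have h1 := hasDerivAt_const θ (1:ℝ)
  fin_cases k <;> fin_cases j <;> simp [frame]
  exacts [hc, hs, h0, hs.fun_neg, hc, h0, h0, h0, h1]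

/-- The angular derivatives of the cylindrical components of a field. -/
lemma hasDerivAt_cylVec_snd {φ : VecField} {t θ : ℝ} (hφ : DifferentiableAt ℝ φ (pol (t, θ))) (k : Fin 3) :
    HasDerivAt (fun θ => cylVec φ k (rexp t) θ) (rexp t * cylTen (grad φ) 1 k (rexp t) θ +
      (![cylVec φ 1 (rexp t) θ, -cylVec φ 0 (rexp t) θ, 0] : Fin 3 → ℝ) k) θ := by
  have h := HasDerivAt.fun_sum (u := Finset.univ) fun j (_ : j ∈ Finset.univ) =>
    (hasDerivAt_frame θ k j).fun_mul (hasDerivAt_component (c := fun θ => pol (t, θ)) hφ (hasDerivAt_pol_snd t θ) j)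
  refine h.congr_deriv ?_
  rw [Finset.sum_add_distrib, cylTen_grad_one, mul_sum, add_comm]
  congr 1
  · refine sum_congr rfl fun j _ => ?_
    simp [pd]; ring
  · fin_cases k
    · rfl
    · simp [cylVec]; rfl
    · simp

lemma divh_eq_trace (φ : VecField) (t θ : ℝ) : divh φ (pol (t, θ)) =
    cylTen (grad φ) 0 0 (rexp t) θ + cylTen (grad φ) 1 1 (rexp t) θ := by
  have h := sin_sq_add_cos_sq θ
  rw [cylTen_grad_zero, cylTen_grad_one, divh]
  simp [Fin.sum_univ_three, frame]
  linear_combination (-(pd 0 φ (pol (t, θ)) 0 + pd 1 φ (pol (t, θ)) 1)) * h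

lemma sum_frame_mul (θ : ℝ) (a b : Fin 3 → ℝ) :
    ∑ k, (∑ j, frame θ k j * a j) * (∑ j, frame θ k j * b j) = ∑ j, a j * b j := by
  have h := sin_sq_add_cos_sq θ
  simp [Fin.sum_univ_three, frame]
  linear_combination (a 0 * b 0 + a 1 * b 1) * h

lemma inner_vec (v w : VecField) (t θ : ℝ) : inner ℝ (v (pol (t, θ))) (w (pol (t, θ))) =
    ∑ k, cylVec v k (rexp t) θ * cylVec w k (rexp t) θ := by
  simp only [cylVec]
  rw [sum_frame_mul]
  simp [PiLp.inner_apply, pol, mul_comm]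

lemma cylTen_eq (F : TenField) (k l : Fin 3) (r θ : ℝ) : cylTen F k l r θ =
    ∑ j, frame θ l j * ∑ i, frame θ k i * F (polarPt r θ) (i, j) := by
  rw [cylTen, sum_comm]
  refine sum_congr rfl fun j _ => ?_
  rw [mul_sum]
  exact sum_congr rfl fun i _ => by ring

lemma inner_ten (F H : TenField) (t θ : ℝ) : inner ℝ (F (pol (t, θ))) (H (pol (t, θ))) =
    ∑ k, ∑ l, cylTen F k l (rexp t) θ * cylTen H k l (rexp t) θ := by
  simp only [cylTen_eq, sum_frame_mul]
  rw [sum_comm]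
  simp only [sum_frame_mul]
  rw [PiLp.inner_apply, Fintype.sum_prod_type, sum_comm]
  simp [pol, mul_comm]

lemma hasDerivAt_fc {c c' : ℝ × ℝ → ℝ} (hc : Continuous c) (hc' : Continuous c')
    (h : ∀ t θ, HasDerivAt (fun t => c (t, θ)) (c' (t, θ)) t) (n : ℤ) (t : ℝ) :
    HasDerivAt (fun t => fc n fun θ => c (t, θ)) (fc n fun θ => c' (t, θ)) t := by
  obtain ⟨M, hM⟩ := (isCompact_Icc.prod isCompact_Icc).exists_bound_of_continuousOn
    (s := Icc (t - 1) (t + 1) ×ˢ Icc (0:ℝ) (2 * π)) hc'.continuousOn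
  have hm : ∀ {g : ℝ × ℝ → ℝ}, Continuous g → ∀ t, Continuous fun θ : ℝ =>
      (g (t, θ) : ℂ) * cexp (-(I * n * θ)) := fun hg t =>
    (continuous_ofReal.comp (hg.comp (by fun_prop))).mul (continuous_cexp_neg_I n)
  have key := hasDerivAt_integral_of_dominated_loc_of_deriv_le (μ := circ) (𝕜 := ℝ) (x₀ := t)
    (F := fun t θ => (c (t, θ) : ℂ) * cexp (-(I * n * θ)))
    (F' := fun t θ => (c' (t, θ) : ℂ) * cexp (-(I * n * θ))) (bound := fun _ => M)
    (s := Metric.ball t 1) (Metric.ball_mem_nhds t one_pos)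
    (Eventually.of_forall fun s => (hm hc s).aestronglyMeasurable)
    ((hm hc t).integrableOn_Icc.mono_set Ioc_subset_Icc_self)
    (hm hc' t).aestronglyMeasurable ?_ (integrable_const _) ?_
  · exact key.2.const_mul _
  · refine (ae_restrict_iff' measurableSet_Ioc).2 (ae_of_all _ fun θ hθ s hs => ?_)
    rw [norm_mul, norm_cexp_neg_I, mul_one, norm_real]
    rw [Real.ball_eq_Ioo] at hs
    exact hM (s, θ) ⟨Ioo_subset_Icc_self hs, Ioc_subset_Icc_self hθ⟩
  · exact ae_of_all _ fun θ s _ => ((h s θ).ofReal_comp).mul_const _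

lemma contDiff_fc {c : ℝ × ℝ → ℝ} (hc : ContDiff ℝ ∞ c) (n : ℤ) :
    ContDiff ℝ ∞ fun t => fc n fun θ => c (t, θ) := by
  have hd : ∀ {c : ℝ × ℝ → ℝ}, ContDiff ℝ ∞ c → ContDiff ℝ ∞ (fun p => fderiv ℝ c p (1, 0)) ∧
      ∀ t, HasDerivAt (fun t => fc n fun θ => c (t, θ)) (fc n fun θ => fderiv ℝ c (t, θ) (1, 0)) t := by
    intro c hc
    have h1 : ContDiff ℝ ∞ (fun p => fderiv ℝ c p (1, 0)) :=
      (hc.fderiv_right (m := ∞) (by simp)).clm_apply contDiff_const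
    refine ⟨h1, fun t => hasDerivAt_fc hc.continuous h1.continuous (fun t θ => ?_) n t⟩
    have h2 : HasDerivAt (fun t : ℝ => (t, θ)) ((1:ℝ), (0:ℝ)) t := (hasDerivAt_id t).prodMk (hasDerivAt_const t θ)
    exact ((hc.differentiable (by simp)) (t, θ)).hasFDerivAt.comp_hasDerivAt t h2
  rw [contDiff_infty]
  intro m
  induction m generalizing c with
  | zero =>
    rw [Nat.cast_zero, contDiff_zero]
    exact continuous_iff_continuousAt.2 fun t => ((hd hc).2 t).continuousAt
  | succ m ih =>
    rw [Nat.cast_succ, contDiff_succ_iff_deriv]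
    refine ⟨fun t => ((hd hc).2 t).differentiableAt, by simp, ?_⟩
    rw [funext fun t => ((hd hc).2 t).deriv]
    exact ih (hd hc).1

/-- Fourier coefficients of a derivative. -/
lemma fc_of_hasDerivAt {a a' : ℝ → ℝ} (h : ∀ θ, HasDerivAt a (a' θ) θ) (hc : Continuous a')
    (hp : a (2 * π) = a 0) (n : ℤ) : fc n a' = I * n * fc n a := by
  have hE : ∀ θ : ℝ, HasDerivAt (fun θ : ℝ => cexp (-(I * n * θ)))
      (-(I * n) * cexp (-(I * n * θ))) θ := fun θ => by
    have := hasDerivAt_cexp_mul (-(I * n)) θ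
    simpa only [neg_mul] using this
  have hac : Continuous a := continuous_iff_continuousAt.2 fun θ => (h θ).continuousAt
  have hF : ∀ θ : ℝ, HasDerivAt (fun θ : ℝ => (a θ : ℂ) * cexp (-(I * n * θ)))
      ((a' θ : ℂ) * cexp (-(I * n * θ)) +
        (a θ : ℂ) * (-(I * n) * cexp (-(I * n * θ)))) θ := fun θ =>
    (h θ).ofReal_comp.fun_mul (hE θ)
  have c1 : Continuous fun θ : ℝ => (a' θ : ℂ) * cexp (-(I * n * θ)) :=
    (continuous_ofReal.comp hc).mul (continuous_cexp_neg_I n)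
  have c2 : Continuous fun θ : ℝ => (a θ : ℂ) * (-(I * n) * cexp (-(I * n * θ))) :=
    (continuous_ofReal.comp hac).mul (continuous_const.mul (continuous_cexp_neg_I n))
  have h1 := intervalIntegral.integral_eq_sub_of_hasDerivAt (fun θ _ => hF θ)
    ((c1.add c2).intervalIntegrable 0 (2 * π))
  have e1 : cexp (-(I * n * ((2 * π : ℝ) : ℂ))) = 1 := by
    rw [Complex.exp_eq_one_iff]
    exact ⟨-n, by push_cast; ring⟩
  rw [e1, hp] at h1
  simp only [Complex.ofReal_zero, mul_zero, neg_zero, Complex.exp_zero, sub_self] at h1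
  rw [intervalIntegral.integral_add (c1.intervalIntegrable _ _) (c2.intervalIntegrable _ _)] at h1
  rw [fc, fc, ← intervalIntegral.integral_of_le Real.two_pi_pos.le,
    ← intervalIntegral.integral_of_le Real.two_pi_pos.le]
  have e2 : ∫ θ in (0:ℝ)..(2 * π), (a θ : ℂ) * (-(I * n) * cexp (-(I * n * θ))) =
      -(I * n) * ∫ θ in (0:ℝ)..(2 * π), (a θ : ℂ) * cexp (-(I * n * θ)) := by
    rw [← intervalIntegral.integral_const_mul]
    refine intervalIntegral.integral_congr fun θ _ => ?_
    ring
  rw [e2] at h1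
  linear_combination ((1 / (2 * π) : ℝ) : ℂ) * h1

/-! ### Modes of smooth fields -/

/-- The cylindrical components of the `n`-th mode of a vector field, in terms of `t = log |x|`. -/
noncomputable def vm (v : VecField) (n : ℤ) (k : Fin 3) (t : ℝ) : ℂ := fc n (cylVec v k (rexp t))

/-- The cylindrical components of the `n`-th mode of a tensor field, in terms of `t = log |x|`. -/
noncomputable def tm (F : TenField) (n : ℤ) (k l : Fin 3) (t : ℝ) : ℂ := fc n (cylTen F k l (rexp t))

lemma BM.of_continuous {a : ℝ → ℝ} (ha : Continuous a) : ∃ M, BM M a := by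
  obtain ⟨M, hM⟩ := isCompact_Icc.exists_bound_of_continuousOn (s := Icc 0 (2 * π)) ha.continuousOn
  exact ⟨M, ha.aestronglyMeasurable, (ae_restrict_iff' measurableSet_Ioc).2
    (ae_of_all _ fun θ hθ => hM θ (Ioc_subset_Icc_self hθ))⟩

lemma continuous_slice {c : ℝ × ℝ → ℝ} (hc : Continuous c) (t : ℝ) : Continuous fun θ => c (t, θ) :=
  hc.comp (by fun_prop)

lemma contDiff_polarPt : ContDiff ℝ ∞ fun p : ℝ × ℝ => polarPt p.1 p.2 := by
  simp only [polarPt_eq]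
  exact contDiff_fst.smul (((Real.contDiff_cos.comp contDiff_snd).smul contDiff_const).add
    ((Real.contDiff_sin.comp contDiff_snd).smul contDiff_const))

lemma contDiff_pol : ContDiff ℝ ∞ pol :=
  contDiff_polarPt.comp ((Real.contDiff_exp.comp contDiff_fst).prodMk contDiff_snd)

lemma contDiff_frame (k j : Fin 3) : ContDiff ℝ ∞ fun θ => frame θ k j := by
  have hs := Real.contDiff_sin (n := ∞)
  have hc := Real.contDiff_cos (n := ∞)
  have h0 : ContDiff ℝ ∞ fun _ : ℝ => (0:ℝ) := contDiff_const
  have h1 : ContDiff ℝ ∞ fun _ : ℝ => (1:ℝ) := contDiff_const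
  fin_cases k <;> fin_cases j <;> simp [frame]
  exacts [hc, hs, h0, hs.neg, hc, h0, h0, h0, h1]

lemma contDiff_cylVec {φ : VecField} (h : ContDiff ℝ ∞ φ) (k : Fin 3) :
    ContDiff ℝ ∞ fun p : ℝ × ℝ => cylVec φ k (rexp p.1) p.2 := by
  refine ContDiff.sum fun j _ => ((contDiff_frame k j).comp contDiff_snd).mul ?_
  exact (EuclideanSpace.proj (𝕜 := ℝ) j : Vec ℝ →L[ℝ] ℝ).contDiff.comp (h.comp contDiff_pol)

lemma continuous_grad {φ : VecField} (h : ContDiff ℝ ∞ φ) : Continuous (grad φ) := by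
  refine (PiLp.continuous_toLp 2 _).comp (continuous_pi fun p => ?_)
  have h1 : Continuous fun x => fderiv ℝ φ x (dir p.1) := (h.continuous_fderiv (by simp)).clm_apply continuous_const
  exact (EuclideanSpace.proj (𝕜 := ℝ) p.2 : Vec ℝ →L[ℝ] ℝ).continuous.comp h1

lemma continuous_cylTen {F : TenField} (h : Continuous F) (k l : Fin 3) :
    Continuous fun p : ℝ × ℝ => cylTen F k l (rexp p.1) p.2 := by
  refine continuous_finsetSum _ fun i _ => continuous_finsetSum _ fun j _ => ?_
  refine (((contDiff_frame k i).continuous.comp continuous_snd).mul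
    ((contDiff_frame l j).continuous.comp continuous_snd)).mul ?_
  exact (EuclideanSpace.proj (𝕜 := ℝ) (i, j) : Ten ℝ →L[ℝ] ℝ).continuous.comp (h.comp continuous_pol)

lemma polarPt_two_pi (r : ℝ) : polarPt r (2 * π) = polarPt r 0 := by simp [polarPt]

lemma cylVec_two_pi (v : VecField) (k : Fin 3) (r : ℝ) : cylVec v k r (2 * π) = cylVec v k r 0 := by
  simp [cylVec, polarPt_two_pi, frame]

lemma hasDerivAt_vm {φ : VecField} (h : ContDiff ℝ ∞ φ) (n : ℤ) (k : Fin 3) (t : ℝ) :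
    HasDerivAt (vm φ n k) (cexp ((1:ℂ) * t) * tm (grad φ) n 0 k t) t := by
  have h1 := hasDerivAt_fc (contDiff_cylVec h k).continuous
    ((Real.continuous_exp.comp continuous_fst).mul (continuous_cylTen (continuous_grad h) 0 k))
    (fun t θ => hasDerivAt_cylVec_fst (h.differentiable (by simp) _) k) n t
  refine h1.congr_deriv ?_
  rw [one_mul, ← Complex.ofReal_exp]
  exact fc_const_mul (rexp t) (cylTen (grad φ) 0 k (rexp t)) n

/-- The modes of the gradient of a smooth field. -/
lemma tm_grad {φ : VecField} (h : ContDiff ℝ ∞ φ) (n : ℤ) (k l : Fin 3) (t : ℝ) :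
    tm (grad φ) n k l t = gradMode n (vm φ n) (fun k => deriv (vm φ n k)) k l t := by
  have e0 : cexp ((-1:ℂ) * t) * cexp ((1:ℂ) * t) = 1 := by
    rw [← Complex.exp_add]; simp
  have c1 : Continuous fun θ => cylTen (grad φ) 1 l (rexp t) θ :=
    continuous_slice (continuous_cylTen (continuous_grad h) 1 l) t
  have c2 : ∀ k, Continuous fun θ => cylVec φ k (rexp t) θ := fun k => continuous_slice (contDiff_cylVec h k).continuous t
  have c3 : Continuous fun θ => (![cylVec φ 1 (rexp t) θ, -cylVec φ 0 (rexp t) θ, 0] : Fin 3 → ℝ) l := by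
    fin_cases l
    · exact c2 1
    · exact (c2 0).neg
    · exact continuous_const
  have row1 : cexp ((1:ℂ) * t) * tm (grad φ) n 1 l t +
      (![vm φ n 1 t, -vm φ n 0 t, 0] : Fin 3 → ℂ) l = I * n * vm φ n l t := by
    show _ = I * n * fc n (fun θ => cylVec φ l (rexp t) θ)
    rw [← fc_of_hasDerivAt (fun θ => hasDerivAt_cylVec_snd (h.differentiable (by simp) _) l)
      ((continuous_const.mul c1).add c3) (cylVec_two_pi φ l _) n]
    obtain ⟨M, hM⟩ : ∃ M, BM M fun θ => rexp t * cylTen (grad φ) 1 l (rexp t) θ :=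
      BM.of_continuous (continuous_const.mul c1)
    obtain ⟨N, hN⟩ := BM.of_continuous c3
    rw [fc_add hM hN, fc_const_mul, one_mul, ← Complex.ofReal_exp]
    congr 1
    fin_cases l
    · rfl
    · show - fc n (cylVec φ 0 (rexp t)) = fc n (fun θ => - cylVec φ 0 (rexp t) θ)
      have := fc_const_mul (-1) (cylVec φ 0 (rexp t)) n
      simp only [neg_one_mul, Complex.ofReal_neg, Complex.ofReal_one] at this
      exact this.symm
    · show (0:ℂ) = fc n (fun θ => 0)
      simp [fc]
  fin_cases k
  · show _ = cexp ((-1:ℂ) * t) * _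
    have : tm (grad φ) n 0 l t = cexp ((-1:ℂ) * t) * deriv (vm φ n l) t := by
      rw [(hasDerivAt_vm h n l t).deriv, ← mul_assoc, e0, one_mul]
    refine this.trans ?_
    fin_cases l <;> rfl
  · have h1 : tm (grad φ) n 1 l t = cexp ((-1:ℂ) * t) * (I * n * vm φ n l t -
        (![vm φ n 1 t, -vm φ n 0 t, 0] : Fin 3 → ℂ) l) := by
      rw [← row1, add_sub_cancel_right, ← mul_assoc, e0, one_mul]
    refine h1.trans ?_
    fin_cases l <;> simp [gradMode]
  · have : tm (grad φ) n 2 l t = 0 := by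
      simp [tm, fc, cylTen_grad_two]
    refine this.trans ?_
    fin_cases l <;> simp [gradMode]

/-- A test function vanishes outside an annulus. -/
lemma exists_annulus {E : Type} [NormedAddCommGroup E] [NormedSpace ℝ E] {φ : Plane → E} (h : IsTest φ) :
    ∃ a b, 0 < a ∧ a < b ∧ ∀ t, t ∉ Icc a b → ∀ θ, pol (t, θ) ∉ tsupport φ := by
  have hK := h.2.1.isCompact
  rcases (tsupport φ).eq_empty_or_nonempty with he | hne
  · exact ⟨1, 2, one_pos, one_lt_two, fun t _ θ => by simp [he]⟩
  · obtain ⟨x, hx, hmin⟩ := hK.exists_isMinOn hne continuous_norm.continuousOn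
    obtain ⟨y, hy, hmax⟩ := hK.exists_isMaxOn hne continuous_norm.continuousOn
    have hx1 : 1 < ‖x‖ := h.2.2 hx
    have hxy : ‖x‖ ≤ ‖y‖ := hmax hx
    refine ⟨log ‖x‖, log ‖y‖ + 1, Real.log_pos hx1, ?_, fun t ht θ hmem => ht ⟨?_, ?_⟩⟩
    · have := Real.log_le_log (by linarith) hxy
      linarith
    · have h1 : ‖x‖ ≤ ‖pol (t, θ)‖ := hmin hmem
      rw [norm_pol] at h1
      exact (Real.log_le_iff_le_exp (by linarith)).2 h1
    · have h1 : ‖pol (t, θ)‖ ≤ ‖y‖ := hmax hmem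
      rw [norm_pol] at h1
      have := (Real.le_log_iff_exp_le (by linarith)).2 h1
      linarith

lemma grad_eq_zero {φ : VecField} {x : Plane} (h : x ∉ tsupport φ) : grad φ x = 0 := by
  have : fderiv ℝ φ x = 0 := image_eq_zero_of_notMem_tsupport fun hh => h (tsupport_fderiv_subset ℝ hh)
  ext p
  simp [grad, pd, this]

lemma vm_tst {φ : VecField} (h : IsTest φ) (n : ℤ) (k : Fin 3) : Tst (vm φ n k) := by
  obtain ⟨a, b, ha, hab, h0⟩ := exists_annulus h
  refine Tst.of_Icc (contDiff_fc (contDiff_cylVec h.1 k) n) ha (b := b) fun t ht => ?_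
  have : ∀ θ, cylVec φ k (rexp t) θ = 0 := fun θ => by
    have : φ (polarPt (rexp t) θ) = 0 := image_eq_zero_of_notMem_tsupport (h0 t ht θ)
    simp [cylVec, this]
  simp [vm, fc, this]

lemma vm_div {φ : VecField} (h : ContDiff ℝ ∞ φ) (hd : ∀ x, divh φ x = 0) (n : ℤ) (t : ℝ) :
    deriv (vm φ n 0) t + vm φ n 0 t + I * n * vm φ n 1 t = 0 := by
  have e0 : cexp ((-1:ℂ) * t) ≠ 0 := Complex.exp_ne_zero _
  have hB : ∀ k, Continuous fun θ => cylTen (grad φ) k k (rexp t) θ := fun k =>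
    continuous_slice (continuous_cylTen (continuous_grad h) k k) t
  obtain ⟨M, hM⟩ := BM.of_continuous (hB 0)
  obtain ⟨N, hN⟩ := BM.of_continuous (hB 1)
  have h1 := fc_add hM hN n
  have h2 : (fun θ => cylTen (grad φ) 0 0 (rexp t) θ + cylTen (grad φ) 1 1 (rexp t) θ) = fun _ => 0 :=
    funext fun θ => by rw [← divh_eq_trace, hd]
  have h3 : fc n (fun _ => 0) = 0 := by simp [fc]
  rw [h2, h3] at h1
  have h4 := tm_grad h n 0 0 t
  have h5 := tm_grad h n 1 1 t
  simp only [tm] at h4 h5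
  have h6 : fc n (fun θ => cylTen (grad φ) 0 0 (rexp t) θ) = _ := h4
  have h7 : fc n (fun θ => cylTen (grad φ) 1 1 (rexp t) θ) = _ := h5
  rw [h6, h7] at h1
  simp [gradMode, ← mul_add] at h1
  linear_combination h1

/-! ### Measurability and weighted norms of modes -/

lemma sum_cylVec_sq (v : VecField) (t θ : ℝ) :
    ∑ k, cylVec v k (rexp t) θ ^ 2 = ‖v (pol (t, θ))‖ ^ 2 := by
  rw [← real_inner_self_eq_norm_sq, inner_vec]
  simp only [sq]

lemma sum_cylTen_sq (F : TenField) (t θ : ℝ) :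
    ∑ k, ∑ l, cylTen F k l (rexp t) θ ^ 2 = ‖F (pol (t, θ))‖ ^ 2 := by
  rw [← real_inner_self_eq_norm_sq, inner_ten]
  simp only [sq]

lemma abs_cylVec_le (v : VecField) (k : Fin 3) (t θ : ℝ) :
    |cylVec v k (rexp t) θ| ≤ ‖v (pol (t, θ))‖ := by
  refine abs_le_of_sq_le_sq ?_ (norm_nonneg _)
  rw [← sum_cylVec_sq]
  exact single_le_sum (f := fun k => cylVec v k (rexp t) θ ^ 2) (fun _ _ => sq_nonneg _)
    (Finset.mem_univ k)

lemma abs_cylTen_le (F : TenField) (k l : Fin 3) (t θ : ℝ) :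
    |cylTen F k l (rexp t) θ| ≤ ‖F (pol (t, θ))‖ := by
  refine abs_le_of_sq_le_sq ?_ (norm_nonneg _)
  rw [← sum_cylTen_sq]
  refine le_trans ?_ (single_le_sum (f := fun k => ∑ l, cylTen F k l (rexp t) θ ^ 2)
    (fun _ _ => by positivity) (Finset.mem_univ k))
  exact single_le_sum (f := fun l => cylTen F k l (rexp t) θ ^ 2) (fun _ _ => sq_nonneg _)
    (Finset.mem_univ l)

lemma aestronglyMeasurable_cylVec {v : VecField} (hv : AEStronglyMeasurable v vol) (k : Fin 3) :
    AEStronglyMeasurable (fun p : ℝ × ℝ => cylVec v k (rexp p.1) p.2) hlc := by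
  have h1 := hv.comp_quasiMeasurePreserving quasiMeasurePreserving_pol
  unfold cylVec
  refine aestronglyMeasurable_fun_sum _ fun j _ => AEStronglyMeasurable.mul ?_ ?_
  · exact ((contDiff_frame k j).continuous.comp continuous_snd).aestronglyMeasurable
  · exact (EuclideanSpace.proj (𝕜 := ℝ) j : Vec ℝ →L[ℝ] ℝ).continuous.comp_aestronglyMeasurable h1

lemma aestronglyMeasurable_cylTen {F : TenField} (hF : AEStronglyMeasurable F vol) (k l : Fin 3) :
    AEStronglyMeasurable (fun p : ℝ × ℝ => cylTen F k l (rexp p.1) p.2) hlc := by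
  have h1 := hF.comp_quasiMeasurePreserving quasiMeasurePreserving_pol
  unfold cylTen
  refine aestronglyMeasurable_fun_sum _ fun i _ => aestronglyMeasurable_fun_sum _ fun j _ =>
    AEStronglyMeasurable.mul (AEStronglyMeasurable.mul ?_ ?_) ?_
  · exact ((contDiff_frame k i).continuous.comp continuous_snd).aestronglyMeasurable
  · exact ((contDiff_frame l j).continuous.comp continuous_snd).aestronglyMeasurable
  · exact (EuclideanSpace.proj (𝕜 := ℝ) (i, j) : Ten ℝ →L[ℝ] ℝ).continuous.comp_aestronglyMeasurable h1

lemma aestronglyMeasurable_fc {c : ℝ × ℝ → ℝ} (hc : AEStronglyMeasurable c hlc) (n : ℤ) :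
    AEStronglyMeasurable (fun t => fc n fun θ => c (t, θ)) hl := by
  refine AEStronglyMeasurable.const_mul ?_ _
  exact AEStronglyMeasurable.integral_prod_right'
    (f := fun p : ℝ × ℝ => (c p : ℂ) * cexp (-(I * n * p.2)))
    ((continuous_ofReal.comp_aestronglyMeasurable hc).mul (by fun_prop))

lemma aestronglyMeasurable_vm {v : VecField} (hv : AEStronglyMeasurable v vol) (n : ℤ) (k : Fin 3) :
    AEStronglyMeasurable (vm v n k) hl := aestronglyMeasurable_fc (aestronglyMeasurable_cylVec hv k) n

lemma aestronglyMeasurable_tm {F : TenField} (hF : AEStronglyMeasurable F vol) (n : ℤ) (k l : Fin 3) :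
    AEStronglyMeasurable (tm F n k l) hl := aestronglyMeasurable_fc (aestronglyMeasurable_cylTen hF k l) n

/-- Properties of almost every point hold at almost every angle on almost every circle. -/
lemma ae_ae_of_vol {P : Plane → Prop} (h : ∀ᵐ x ∂vol, P x) : ∀ᵐ t ∂hl, ∀ᵐ θ ∂circ, P (pol (t, θ)) :=
  Measure.ae_ae_of_ae_prod (quasiMeasurePreserving_pol.ae h)

lemma ae_of_vol_norm {P : ℝ → Prop} (h : ∀ᵐ x ∂vol, P ‖x‖) : ∀ᵐ t ∂hl, P (rexp t) := by
  filter_upwards [ae_ae_of_vol h] with t ht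
  obtain ⟨θ, hθ⟩ := ht.exists
  rwa [norm_pol] at hθ

lemma ae_bm_cylVec {v : VecField} {M : ℝ} (hv : AEStronglyMeasurable v vol) (h : ∀ᵐ x ∂vol, ‖v x‖ ≤ M)
    (k : Fin 3) : ∀ᵐ t ∂hl, BM M (cylVec v k (rexp t)) := by
  filter_upwards [(aestronglyMeasurable_cylVec hv k).prodMk_left, ae_ae_of_vol h] with t h1 h2
  refine ⟨h1, ?_⟩
  filter_upwards [h2] with θ hθ
  exact (abs_cylVec_le v k t θ).trans hθ

lemma ae_bm_cylTen {F : TenField} {M : ℝ} (hF : AEStronglyMeasurable F vol) (h : ∀ᵐ x ∂vol, ‖F x‖ ≤ M)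
    (k l : Fin 3) : ∀ᵐ t ∂hl, BM M (cylTen F k l (rexp t)) := by
  filter_upwards [(aestronglyMeasurable_cylTen hF k l).prodMk_left, ae_ae_of_vol h] with t h1 h2
  refine ⟨h1, ?_⟩
  filter_upwards [h2] with θ hθ
  exact (abs_cylTen_le F k l t θ).trans hθ

lemma wnorm_le_iff {E : Type} [NormedAddCommGroup E] {s A : ℝ} (hA : 0 ≤ A) {f : Plane → E} :
    wnorm s f ≤ ofReal A ↔ ∀ᵐ x ∂vol, ‖x‖ ^ s * ‖f x‖ ≤ A := by
  have key : ∀ x : Plane, ofReal (‖x‖ ^ s) * ‖f x‖ₑ ≤ ofReal A ↔ ‖x‖ ^ s * ‖f x‖ ≤ A := fun x => by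
    rw [← ofReal_norm, ← ENNReal.ofReal_mul (by positivity), ENNReal.ofReal_le_ofReal_iff hA]
  rw [wnorm]
  constructor
  · intro h
    filter_upwards [ENNReal.ae_le_essSup fun x => ofReal (‖x‖ ^ s) * ‖f x‖ₑ] with x hx
    exact (key x).1 (hx.trans h)
  · intro h
    refine essSup_le_of_ae_le _ ?_
    filter_upwards [h] with x hx
    exact (key x).2 hx

lemma exp_rpow (t s : ℝ) : rexp t ^ s = rexp (s * t) := by
  rw [← Real.exp_mul, mul_comm]

lemma le_exp_of_weighted {t s y A : ℝ} (h : rexp t ^ s * y ≤ A) : y ≤ A * rexp (-s * t) := by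
  rw [exp_rpow] at h
  calc y = rexp (s * t) * y * rexp (-s * t) := by
        rw [mul_right_comm, ← Real.exp_add]; simp
    _ ≤ _ := by gcongr

lemma bd_vm {v : VecField} (hv : AEStronglyMeasurable v vol) {s A : ℝ} (hA : 0 ≤ A) {n : ℤ}
    (h : wnorm s (projVec n v) ≤ ofReal A) (k : Fin 3) : Bd s A (vm v n k) := by
  refine ⟨aestronglyMeasurable_vm hv n k, ?_⟩
  have h1 : ∀ᵐ x ∂vol, ‖x‖ ^ s * ‖fourierMode n (cylVec v k) ‖x‖‖ ≤ A := by
    filter_upwards [(wnorm_le_iff hA).1 h] with x hx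
    refine le_trans ?_ hx
    gcongr
    exact norm_fourierMode_le_projVec n v x k
  filter_upwards [ae_of_vol_norm (P := fun r => r ^ s * ‖fourierMode n (cylVec v k) r‖ ≤ A) h1] with t ht
  rw [fourierMode_eq] at ht
  exact le_exp_of_weighted ht

lemma bd_tm {F : TenField} (hF : AEStronglyMeasurable F vol) {s A : ℝ} (hA : 0 ≤ A) {n : ℤ}
    (h : wnorm s (projTen n F) ≤ ofReal A) (k l : Fin 3) : Bd s A (tm F n k l) := by
  refine ⟨aestronglyMeasurable_tm hF n k l, ?_⟩
  have h1 : ∀ᵐ x ∂vol, ‖x‖ ^ s * ‖fourierMode n (cylTen F k l) ‖x‖‖ ≤ A := by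
    filter_upwards [(wnorm_le_iff hA).1 h] with x hx
    refine le_trans ?_ hx
    gcongr
    exact norm_fourierMode_le_projTen n F x k l
  filter_upwards [ae_of_vol_norm (P := fun r => r ^ s * ‖fourierMode n (cylTen F k l) r‖ ≤ A) h1] with t ht
  rw [fourierMode_eq] at ht
  exact le_exp_of_weighted ht

lemma weighted_le_of_exp {t s y A : ℝ} (h : y ≤ A * rexp (-s * t)) : rexp t ^ s * y ≤ A := by
  rw [exp_rpow]
  calc _ ≤ rexp (s * t) * (A * rexp (-s * t)) := by gcongr
    _ = A * (rexp (s * t) * rexp (-s * t)) := by ring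
    _ = A := by rw [← Real.exp_add]; simp

lemma norm_pos_of_log {x : Plane} (h0 : 0 < log ‖x‖) : 0 < ‖x‖ := by
  by_contra hh
  have : ‖x‖ = 0 := le_antisymm (not_lt.1 hh) (norm_nonneg _)
  simp [this] at h0

lemma wnorm_projVec_le {v : VecField} {s : ℝ} {A : Fin 3 → ℝ} {n : ℤ} (h : ∀ k, Bd s (A k) (vm v n k)) :
    wnorm s (projVec n v) ≤ ofReal (∑ k, A k) := by
  rw [wnorm_le_iff (sum_nonneg fun k _ => (h k).nonneg)]
  have h1 : ∀ᵐ t ∂hl, ∀ k, ‖vm v n k t‖ ≤ A k * rexp (-s * t) := ae_all_iff.2 fun k => (h k).2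
  filter_upwards [quasiMeasurePreserving_log_norm.ae h1, ae_vol_pos] with x hx h0
  have hx0 := norm_pos_of_log h0
  refine le_trans (mul_le_mul_of_nonneg_left (norm_projVec_le n v x) (by positivity)) ?_
  rw [mul_sum]
  refine sum_le_sum fun k _ => ?_
  have := weighted_le_of_exp (hx k)
  rwa [exp_log hx0, vm, exp_log hx0, ← fourierMode_eq] at this

lemma wnorm_projTen_le {F : TenField} {s : ℝ} {A : Fin 3 → Fin 3 → ℝ} {n : ℤ}
    (h : ∀ k l, Bd s (A k l) (tm F n k l)) :
    wnorm s (projTen n F) ≤ ofReal (∑ k, ∑ l, A k l) := by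
  rw [wnorm_le_iff (sum_nonneg fun k _ => sum_nonneg fun l _ => (h k l).nonneg)]
  have h1 : ∀ᵐ t ∂hl, ∀ k l, ‖tm F n k l t‖ ≤ A k l * rexp (-s * t) :=
    ae_all_iff.2 fun k => ae_all_iff.2 fun l => (h k l).2
  filter_upwards [quasiMeasurePreserving_log_norm.ae h1, ae_vol_pos] with x hx h0
  have hx0 := norm_pos_of_log h0
  refine le_trans (mul_le_mul_of_nonneg_left (norm_projTen_le n F x) (by positivity)) ?_
  rw [mul_sum]
  refine sum_le_sum fun k _ => ?_
  rw [mul_sum]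
  refine sum_le_sum fun l _ => ?_
  have := weighted_le_of_exp (hx k l)
  rwa [exp_log hx0, tm, exp_log hx0, ← fourierMode_eq] at this

/-- The pairing of a tensor field and a vector field with the gradient and the values of a test field. -/
noncomputable def pairing (T : TenField) (g φ : VecField) (x : Plane) : ℝ :=
  inner ℝ (T x) (grad φ x) - inner ℝ (g x) (φ x)

lemma integrable_inner_test {ι : Type} [Fintype ι] {T B : Plane → EuclideanSpace ℝ ι} {M : ℝ}
    (hT : AEStronglyMeasurable T vol) (hM : ∀ᵐ x ∂vol, ‖T x‖ ≤ M) (hB : Continuous B) (hc : HasCompactSupport B) :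
    Integrable (fun x => inner ℝ (T x) (B x)) vol := by
  have hBi : Integrable B vol := (hB.integrable_of_hasCompactSupport hc).restrict
  refine (hBi.norm.const_mul M).mono' (hT.inner hBi.1) ?_
  filter_upwards [hM] with x hx
  exact (norm_inner_le_norm _ _).trans (by gcongr)

lemma hasCompactSupport_grad {φ : VecField} (h : IsTest φ) : HasCompactSupport (grad φ) :=
  h.2.1.of_isClosed_subset (isClosed_tsupport _) (closure_minimal (fun x hx => by
    by_contra hh; exact hx (grad_eq_zero hh)) (isClosed_tsupport _)) |> fun h => h

lemma integrable_pairing {T : TenField} {g φ : VecField} {M : ℝ} (hT : AEStronglyMeasurable T vol)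
    (hTM : ∀ᵐ x ∂vol, ‖T x‖ ≤ M) (hg : AEStronglyMeasurable g vol) (hgM : ∀ᵐ x ∂vol, ‖g x‖ ≤ M)
    (hφ : IsTest φ) : Integrable (pairing T g φ) vol :=
  (integrable_inner_test hT hTM (continuous_grad hφ.1) (hasCompactSupport_grad hφ)).sub
    (integrable_inner_test hg hgM hφ.1.continuous hφ.2.1)

/-! ### The Parseval identity for test fields -/

lemma pairing_pol (T : TenField) (g φ : VecField) (t θ : ℝ) : pairing T g φ (pol (t, θ)) =
    ∑ k, ∑ l, cylTen T k l (rexp t) θ * cylTen (grad φ) k l (rexp t) θ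
      - ∑ k, cylVec g k (rexp t) θ * cylVec φ k (rexp t) θ := by
  rw [pairing, inner_ten, inner_vec]

/-- The integral of `pairing` over the angle, in terms of given products of Fourier coefficients. -/
lemma integral_pairing_circ {T : TenField} {g φ : VecField} {M : ℝ} {t : ℝ}
    (hT : ∀ k l, BM M (cylTen T k l (rexp t))) (hg : ∀ k, BM M (cylVec g k (rexp t)))
    (hφ : ContDiff ℝ ∞ φ) :
    ∫ θ, pairing T g φ (pol (t, θ)) ∂circ =
      ∑ k, ∑ l, ∫ θ, cylTen T k l (rexp t) θ * cylTen (grad φ) k l (rexp t) θ ∂circ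
      - ∑ k, ∫ θ, cylVec g k (rexp t) θ * cylVec φ k (rexp t) θ ∂circ := by
  have h1 : ∀ k l, Integrable (fun θ => cylTen T k l (rexp t) θ * cylTen (grad φ) k l (rexp t) θ) circ := by
    intro k l
    obtain ⟨N, hN⟩ := BM.of_continuous (continuous_slice (continuous_cylTen (continuous_grad hφ) k l) t)
    exact ((hT k l).mul hN).integrable
  have h2 : ∀ k, Integrable (fun θ => cylVec g k (rexp t) θ * cylVec φ k (rexp t) θ) circ := by
    intro k
    obtain ⟨N, hN⟩ := BM.of_continuous (continuous_slice (contDiff_cylVec hφ k).continuous t)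
    exact ((hg k).mul hN).integrable
  simp only [pairing_pol]
  rw [integral_sub (integrable_finsetSum _ fun k _ => integrable_finsetSum _ fun l _ => h1 k l)
    (integrable_finsetSum _ fun k _ => h2 k),
    integral_finsetSum _ (fun k _ => integrable_finsetSum _ fun l _ => h1 k l),
    integral_finsetSum _ (fun k _ => h2 k)]
  congr 1
  exact sum_congr rfl fun k _ => integral_finsetSum _ fun l _ => h1 k l

/-- The pairing of the `n`-th modes of `T` and `g` with the opposite modes of a test field. -/
noncomputable def pairMode (T : TenField) (g φ : VecField) (n : ℤ) (t : ℝ) : ℂ :=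
  ∑ k, ∑ l, tm T n k l t * tm (grad φ) (-n) k l t - ∑ k, vm g n k t * vm φ (-n) k t

lemma hasSum_pairMode {T : TenField} {g φ : VecField} {M : ℝ} {t : ℝ}
    (hT : ∀ k l, BM M (cylTen T k l (rexp t))) (hg : ∀ k, BM M (cylVec g k (rexp t)))
    (hφ : ContDiff ℝ ∞ φ) :
    HasSum (fun n => (pairMode T g φ n t).re) (1 / (2 * π) * ∫ θ, pairing T g φ (pol (t, θ)) ∂circ) := by
  rw [integral_pairing_circ hT hg hφ, mul_sub, mul_sum, mul_sum]
  simp only [mul_sum]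
  have h1 : ∀ k l, HasSum (fun n => (tm T n k l t * tm (grad φ) (-n) k l t).re) (1 / (2 * π) *
      ∫ θ, cylTen T k l (rexp t) θ * cylTen (grad φ) k l (rexp t) θ ∂circ) := by
    intro k l
    obtain ⟨N, hN⟩ := BM.of_continuous (continuous_slice (continuous_cylTen (continuous_grad hφ) k l) t)
    exact hasSum_fc_mul_fc (hT k l) hN
  have h2 : ∀ k, HasSum (fun n => (vm g n k t * vm φ (-n) k t).re) (1 / (2 * π) *
      ∫ θ, cylVec g k (rexp t) θ * cylVec φ k (rexp t) θ ∂circ) := by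
    intro k
    obtain ⟨N, hN⟩ := BM.of_continuous (continuous_slice (contDiff_cylVec hφ k).continuous t)
    exact hasSum_fc_mul_fc (hg k) hN
  have h3 := (hasSum_sum fun k (_ : k ∈ Finset.univ) => hasSum_sum fun l (_ : l ∈ Finset.univ) => h1 k l).sub
    (hasSum_sum fun k (_ : k ∈ Finset.univ) => h2 k)
  refine (congrArg (fun f => HasSum f _) (funext fun n => ?_)).mpr h3
  simp only [pairMode, Complex.sub_re, Complex.re_sum]

lemma norm_tm_le {F : TenField} {M t : ℝ} {k l : Fin 3} (h : ∀ x, ‖F x‖ ≤ M) (n : ℤ) : ‖tm F n k l t‖ ≤ M :=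
  norm_fc_le (ae_of_all _ fun θ => (abs_cylTen_le F k l t θ).trans (h _)) n

lemma norm_vm_le {v : VecField} {M t : ℝ} {k : Fin 3} (h : ∀ x, ‖v x‖ ≤ M) (n : ℤ) : ‖vm v n k t‖ ≤ M :=
  norm_fc_le (ae_of_all _ fun θ => (abs_cylVec_le v k t θ).trans (h _)) n

/-- Parseval's identity for the pairing with a test field. -/
lemma hasSum_pairing {T : TenField} {g φ : VecField} {M : ℝ} {A : ℤ → ℝ} (hT : AEStronglyMeasurable T vol)
    (hTM : ∀ᵐ x ∂vol, ‖T x‖ ≤ M) (hg : AEStronglyMeasurable g vol) (hgM : ∀ᵐ x ∂vol, ‖g x‖ ≤ M)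
    (hA : Summable A) (hTA : ∀ n k l, ∀ᵐ t ∂hl, ‖tm T n k l t‖ ≤ A n) (hgA : ∀ n k, ∀ᵐ t ∂hl, ‖vm g n k t‖ ≤ A n)
    (hφ : IsTest φ) :
    HasSum (fun n => ∫ t, rexp (2 * t) * (pairMode T g φ n t).re ∂hl)
      (1 / (2 * π) * ∫ x, pairing T g φ x ∂vol) := by
  obtain ⟨a, b, ha, hab, h0⟩ := exists_annulus hφ
  obtain ⟨N₁, hN₁⟩ := (continuous_grad hφ.1).bounded_above_of_compact_support (hasCompactSupport_grad hφ)
  obtain ⟨N₂, hN₂⟩ := hφ.1.continuous.bounded_above_of_compact_support hφ.2.1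
  have hN₁0 : 0 ≤ N₁ := (norm_nonneg _).trans (hN₁ 0)
  have hN₂0 : 0 ≤ N₂ := (norm_nonneg _).trans (hN₂ 0)
  have hout : ∀ n t, t ∉ Icc a b → pairMode T g φ n t = 0 := by
    intro n t ht
    have e1 : ∀ k θ, cylVec φ k (rexp t) θ = 0 := fun k θ => by
      have : φ (polarPt (rexp t) θ) = 0 := image_eq_zero_of_notMem_tsupport (h0 t ht θ)
      simp [cylVec, this]
    have e2 : ∀ k l θ, cylTen (grad φ) k l (rexp t) θ = 0 := fun k l θ => by
      have : grad φ (polarPt (rexp t) θ) = 0 := grad_eq_zero (h0 t ht θ)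
      simp [cylTen, this]
    simp [pairMode, tm, vm, fc, e1, e2]
  have hbd : ∀ n, ∀ᵐ t ∂hl, ‖rexp (2 * t) * (pairMode T g φ n t).re‖ ≤
      A n * (Icc a b).indicator (fun _ => rexp (2 * b) * (9 * N₁ + 3 * N₂)) t := by
    intro n
    filter_upwards [ae_all_iff.2 fun k => ae_all_iff.2 fun l => hTA n k l, ae_all_iff.2 fun k => hgA n k] with t h1 h2
    by_cases ht : t ∈ Icc a b
    · rw [indicator_of_mem ht, norm_eq_abs, abs_mul, abs_of_pos (exp_pos _)]
      have hAn : 0 ≤ A n := (norm_nonneg _).trans (h2 0)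
      have e1 : rexp (2 * t) ≤ rexp (2 * b) := Real.exp_le_exp.2 (by linarith [ht.2])
      have e2 : |(pairMode T g φ n t).re| ≤ A n * (9 * N₁ + 3 * N₂) := by
        refine (Complex.abs_re_le_norm _).trans ((norm_sub_le _ _).trans ?_)
        have e3 : ‖∑ k, ∑ l, tm T n k l t * tm (grad φ) (-n) k l t‖ ≤ ∑ _k : Fin 3, ∑ _l : Fin 3, A n * N₁ := by
          refine norm_sum_le_of_le _ fun k _ => norm_sum_le_of_le _ fun l _ => ?_
          rw [norm_mul]
          exact mul_le_mul (h1 k l) (norm_tm_le hN₁ _) (norm_nonneg _) hAn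
        have e4 : ‖∑ k, vm g n k t * vm φ (-n) k t‖ ≤ ∑ _k : Fin 3, A n * N₂ := by
          refine norm_sum_le_of_le _ fun k _ => ?_
          rw [norm_mul]
          exact mul_le_mul (h2 k) (norm_vm_le hN₂ _) (norm_nonneg _) hAn
        simp at e3 e4
        linarith
      calc _ ≤ rexp (2 * b) * (A n * (9 * N₁ + 3 * N₂)) := by gcongr
        _ = _ := by ring
    · rw [hout n t ht, indicator_of_notMem ht]; simp
  have hI : Integrable ((Icc a b).indicator fun _ => rexp (2 * b) * (9 * N₁ + 3 * N₂)) hl := by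
    refine (integrable_indicator_iff measurableSet_Icc).2 (integrableOn_const ?_)
    have : hl (Icc a b) ≤ volume (Icc a b) := Measure.restrict_apply_le _ _
    exact (this.trans_lt (by simp)).ne
  have key := hasSum_integral_of_dominated_convergence (μ := hl)
    (F := fun (n : ℤ) t => rexp (2 * t) * (pairMode T g φ n t).re)
    (f := fun t => rexp (2 * t) * (1 / (2 * π) * ∫ θ, pairing T g φ (pol (t, θ)) ∂circ))
    (fun n t => A n * (Icc a b).indicator (fun _ => rexp (2 * b) * (9 * N₁ + 3 * N₂)) t)
    (fun n => ?_) hbd (ae_of_all _ fun t => hA.mul_right _)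
    (by simp only [tsum_mul_right]; exact hI.const_mul _) ?_
  · have e : 1 / (2 * π) * ∫ x, pairing T g φ x ∂vol = ∫ t, rexp (2 * t) *
        (1 / (2 * π) * ∫ θ, pairing T g φ (pol (t, θ)) ∂circ) ∂hl := by
      rw [integral_vol (integrable_pairing hT hTM hg hgM hφ), ← integral_const_mul]
      refine integral_congr_ae (ae_of_all _ fun t => ?_)
      simp only; ring
    rw [e]; exact key
  · refine ((by fun_prop : Continuous fun t : ℝ => rexp (2 * t)).aestronglyMeasurable).mul
      (Complex.continuous_re.comp_aestronglyMeasurable ?_)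
    have hgr := (continuous_grad hφ.1).aestronglyMeasurable (μ := vol)
    have hφm := hφ.1.continuous.aestronglyMeasurable (μ := vol)
    refine AEStronglyMeasurable.sub ?_ ?_
    · exact aestronglyMeasurable_fun_sum _ fun k _ => aestronglyMeasurable_fun_sum _ fun l _ =>
        (aestronglyMeasurable_tm hT n k l).mul (aestronglyMeasurable_tm hgr (-n) k l)
    · exact aestronglyMeasurable_fun_sum _ fun k _ =>
        (aestronglyMeasurable_vm hg n k).mul (aestronglyMeasurable_vm hφm (-n) k)
  · filter_upwards [ae_all_iff.2 fun k => ae_all_iff.2 fun l => ae_bm_cylTen hT hTM k l,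
      ae_all_iff.2 fun k => ae_bm_cylVec hg hgM k] with t h1 h2
    exact (hasSum_pairMode h1 h2 hφ.1).mul_left _

/-! ### Fields on a single mode -/

/-- The vector field with cylindrical components `s k t θ`, where `t = log |x|`. -/
noncomputable def vecOf (s : Fin 3 → ℝ → ℝ → ℝ) (x : Plane) : Vec ℝ :=
  WithLp.toLp 2 fun j => ∑ k, frame (azimuth x) k j * s k (log ‖x‖) (azimuth x)

/-- The tensor field with cylindrical components `s k l t θ`, where `t = log |x|`. -/
noncomputable def tenOf (s : Fin 3 → Fin 3 → ℝ → ℝ → ℝ) (x : Plane) : Ten ℝ :=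
  WithLp.toLp 2 fun p => ∑ k, ∑ l, frame (azimuth x) k p.1 * frame (azimuth x) l p.2 *
    s k l (log ‖x‖) (azimuth x)

lemma periodic_azimuth {a : ℝ → ℝ} (ha : Function.Periodic a (2 * π)) {r : ℝ} (hr : 0 < r) (θ : ℝ) :
    a (azimuth (polarPt r θ)) = a θ := by
  obtain ⟨m, hm⟩ := azimuth_polarPt hr θ
  rw [hm]
  exact (ha.int_mul m) θ

lemma cylVec_vecOf {s : Fin 3 → ℝ → ℝ → ℝ} (hs : ∀ k t, Function.Periodic (s k t) (2 * π)) (k : Fin 3) (t θ : ℝ) :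
    cylVec (vecOf s) k (rexp t) θ = s k t θ := by
  have he := exp_pos t
  simp only [cylVec, vecOf, frame_azimuth he, periodic_azimuth (hs _ _) he, norm_polarPt he.le, Real.log_exp,
    mul_sum, ← mul_assoc]
  rw [sum_comm]
  simp only [← Finset.sum_mul, frame_mul_frame']
  simp

lemma cylTen_tenOf {s : Fin 3 → Fin 3 → ℝ → ℝ → ℝ} (hs : ∀ k l t, Function.Periodic (s k l t) (2 * π))
    (k l : Fin 3) (t θ : ℝ) : cylTen (tenOf s) k l (rexp t) θ = s k l t θ := by
  have he := exp_pos t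
  rw [cylTen_eq]
  simp only [tenOf, frame_azimuth he, periodic_azimuth (hs _ _ _) he, norm_polarPt he.le, Real.log_exp]
  have h1 : ∀ j, ∑ i, frame θ k i * ∑ k', ∑ l', frame θ k' i * frame θ l' j * s k' l' t θ =
      ∑ l', frame θ l' j * s k l' t θ := by
    intro j
    have : ∀ i, frame θ k i * ∑ k', ∑ l', frame θ k' i * frame θ l' j * s k' l' t θ =
        ∑ k', (frame θ k i * frame θ k' i) * ∑ l', frame θ l' j * s k' l' t θ := fun i => by
      rw [mul_sum]
      refine sum_congr rfl fun k' _ => ?_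
      rw [mul_sum, mul_sum]
      exact sum_congr rfl fun l' _ => by ring
    simp only [this]
    rw [sum_comm]
    simp only [← Finset.sum_mul, frame_mul_frame']
    simp
  refine (sum_congr rfl fun j _ => congrArg (frame θ l j * ·) (h1 j)).trans ?_
  simp only [mul_sum, ← mul_assoc]
  rw [sum_comm]
  simp only [← Finset.sum_mul, frame_mul_frame']
  simp

lemma pol_azimuth {x : Plane} (hx : 0 < ‖x‖) : pol (log ‖x‖, azimuth x) = x := by
  rw [pol, exp_log hx, polarPt_azimuth]

lemma norm_vecOf_le (s : Fin 3 → ℝ → ℝ → ℝ) (x : Plane) :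
    ‖vecOf s x‖ ≤ ∑ k, |s k (log ‖x‖) (azimuth x)| := by
  have h : ‖vecOf s x‖ ^ 2 = ∑ k, |s k (log ‖x‖) (azimuth x)| ^ 2 := by
    rw [EuclideanSpace.norm_sq_eq]
    have := sum_norm_sq_frame (azimuth x) fun k => (s k (log ‖x‖) (azimuth x) : ℂ)
    simp only [norm_real, norm_eq_abs] at this
    rw [← this]
    refine sum_congr rfl fun j _ => ?_
    rw [← norm_real]
    congr 2
    simp [vecOf, mul_comm]
  refine le_of_sq_le_sq ?_ (sum_nonneg fun _ _ => abs_nonneg _)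
  rw [h]
  exact sum_sq_le_sq_sum_of_nonneg fun _ _ => abs_nonneg _

/-- A tensor is bounded by the sum of its cylindrical components. -/
lemma norm_ten_le (F : TenField) {x : Plane} (hx : 0 < ‖x‖) :
    ‖F x‖ ≤ ∑ k, ∑ l, |cylTen F k l ‖x‖ (azimuth x)| := by
  have h := sum_cylTen_sq F (log ‖x‖) (azimuth x)
  rw [pol_azimuth hx, exp_log hx] at h
  refine le_of_sq_le_sq ?_ (sum_nonneg fun _ _ => sum_nonneg fun _ _ => abs_nonneg _)
  rw [← h]
  refine le_trans (sum_le_sum fun k _ => ?_)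
    (sum_sq_le_sq_sum_of_nonneg fun _ _ => sum_nonneg fun _ _ => abs_nonneg _)
  refine le_trans (le_of_eq ?_) (sum_sq_le_sq_sum_of_nonneg fun _ _ => abs_nonneg _)
  simp only [sq_abs]

lemma norm_vec_le (v : VecField) {x : Plane} (hx : 0 < ‖x‖) :
    ‖v x‖ ≤ ∑ k, |cylVec v k ‖x‖ (azimuth x)| := by
  have h := sum_cylVec_sq v (log ‖x‖) (azimuth x)
  rw [pol_azimuth hx, exp_log hx] at h
  refine le_of_sq_le_sq ?_ (sum_nonneg fun _ _ => abs_nonneg _)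
  rw [← h]
  refine le_trans (le_of_eq ?_) (sum_sq_le_sq_sum_of_nonneg fun _ _ => abs_nonneg _)
  simp only [sq_abs]

/-- The real field whose cylindrical components are the real parts of `η_k(log |x|) e^{inθ}`. -/
noncomputable def modeField (n : ℤ) (η : ModeVec) : VecField :=
  vecOf fun k t θ => (η k t * cexp (I * n * θ)).re

lemma periodic_cexp (n : ℤ) : Function.Periodic (fun θ : ℝ => cexp (I * n * θ)) (2 * π) := by
  intro θ
  simp only
  rw [Complex.exp_eq_exp_iff_exists_int]
  exact ⟨n, by push_cast; ring⟩

lemma cylVec_modeField (n : ℤ) (η : ModeVec) (k : Fin 3) (t θ : ℝ) :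
    cylVec (modeField n η) k (rexp t) θ = (η k t * cexp (I * n * θ)).re :=
  cylVec_vecOf (fun k t θ => by
    have := periodic_cexp n θ
    simp only at this ⊢
    rw [this]) k t θ

lemma contDiffAt_modeField {n : ℤ} {η : ModeVec} (hη : ∀ k, ContDiff ℝ ∞ (η k)) {x : Plane} (hx : x ≠ 0) :
    ContDiffAt ℝ ∞ (modeField n η) x := by
  have hn : ∀ᶠ y in 𝓝 x, y ≠ 0 := eventually_ne_nhds hx
  have hnorm : ContDiffAt ℝ ∞ (fun y : Plane => ‖y‖) x := contDiffAt_id.norm ℝ hx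
  have hx0 : ‖x‖ ≠ 0 := norm_ne_zero_iff.2 hx
  have hlog : ContDiffAt ℝ ∞ (fun y : Plane => log ‖y‖) x := hnorm.log hx0
  have hc : ∀ j : Fin 2, ContDiffAt ℝ ∞ (fun y : Plane => y j / ‖y‖) x := fun j =>
    ((EuclideanSpace.proj (𝕜 := ℝ) j : Plane →L[ℝ] ℝ).contDiff.contDiffAt).div hnorm hx0
  have hcs : ∀ y : Plane, y ≠ 0 → Real.cos (azimuth y) = y 0 / ‖y‖ ∧ Real.sin (azimuth y) = y 1 / ‖y‖ := by
    intro y hy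
    have hy0 : ‖y‖ ≠ 0 := norm_ne_zero_iff.2 hy
    have h := polarPt_azimuth y
    have h0 := congrArg (fun z : Plane => z 0) h
    have h1 := congrArg (fun z : Plane => z 1) h
    simp [polarPt] at h0 h1
    exact ⟨by rw [eq_div_iff hy0, mul_comm]; exact h0, by rw [eq_div_iff hy0, mul_comm]; exact h1⟩
  have hfr : ∀ k j, ContDiffAt ℝ ∞ (fun y : Plane => frame (azimuth y) k j) x := by
    intro k j
    have : (fun y : Plane => frame (azimuth y) k j) =ᶠ[𝓝 x] fun y => (!![y 0 / ‖y‖, y 1 / ‖y‖, 0;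
        -(y 1 / ‖y‖), y 0 / ‖y‖, 0; 0, 0, 1] : Matrix (Fin 3) (Fin 3) ℝ) k j := by
      filter_upwards [hn] with y hy
      rw [frame, (hcs y hy).1, (hcs y hy).2]
    refine ContDiffAt.congr_of_eventuallyEq ?_ this
    have h0 : ContDiffAt ℝ ∞ (fun _ : Plane => (0:ℝ)) x := contDiffAt_const
    have h1 : ContDiffAt ℝ ∞ (fun _ : Plane => (1:ℝ)) x := contDiffAt_const
    fin_cases k <;> fin_cases j
    exacts [hc 0, hc 1, h0, (hc 1).neg, hc 0, h0, h0, h0, h1]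
  have hz : ContDiffAt ℝ ∞ (fun y : Plane => ((y 0 / ‖y‖ : ℝ) : ℂ) + ((y 1 / ‖y‖ : ℝ) : ℂ) * I) x :=
    (Complex.ofRealCLM.contDiff.contDiffAt.comp x (hc 0)).add
      ((Complex.ofRealCLM.contDiff.contDiffAt.comp x (hc 1)).mul contDiffAt_const)
  have hze : ∀ y : Plane, y ≠ 0 → ((y 0 / ‖y‖ : ℝ) : ℂ) + ((y 1 / ‖y‖ : ℝ) : ℂ) * I =
      cexp (azimuth y * I) := fun y hy => by
    rw [Complex.exp_mul_I, ← (hcs y hy).1, ← (hcs y hy).2]; simp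
  have hexp : ContDiffAt ℝ ∞ (fun y : Plane => cexp (I * n * azimuth y)) x := by
    have : (fun y : Plane => cexp (I * n * azimuth y)) =ᶠ[𝓝 x]
        fun y => (((y 0 / ‖y‖ : ℝ) : ℂ) + ((y 1 / ‖y‖ : ℝ) : ℂ) * I) ^ n := by
      filter_upwards [hn] with y hy
      rw [hze y hy, ← Complex.exp_int_mul]
      congr 1; ring
    refine ContDiffAt.congr_of_eventuallyEq ?_ this
    have hp : ContDiffAt ℂ ∞ (fun z : ℂ => z ^ n) (((x 0 / ‖x‖ : ℝ) : ℂ) + ((x 1 / ‖x‖ : ℝ) : ℂ) * I) := by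
      refine (analyticAt_id.zpow ?_).contDiffAt
      rw [id, hze x hx]
      exact Complex.exp_ne_zero _
    exact (hp.restrict_scalars ℝ).comp x hz
  unfold modeField vecOf
  refine PiLp.contDiff_toLp.contDiffAt.comp x (contDiffAt_pi.2 fun j => ?_)
  refine ContDiffAt.sum fun k _ => (hfr k j).mul ?_
  exact Complex.reCLM.contDiff.contDiffAt.comp x (((hη k).contDiffAt.comp x hlog).mul hexp)

lemma modeField_eq_zero {n : ℤ} {η : ModeVec} {x : Plane} (h : ∀ k, η k (log ‖x‖) = 0) :
    modeField n η x = 0 := by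
  simp only [modeField, vecOf, h]
  ext j; simp

lemma isTest_modeField {n : ℤ} {η : ModeVec} (hη : ∀ k, Tst (η k)) : IsTest (modeField n η) := by
  choose a b ha hab h0 using fun k => (hη k).exists_Icc
  obtain ⟨a', ha'0, ha'⟩ : ∃ a', 0 < a' ∧ ∀ k, a' ≤ a k :=
    ⟨min (a 0) (min (a 1) (a 2)), by simp [ha], fun k => by fin_cases k <;> simp⟩
  obtain ⟨b', hb'⟩ : ∃ b', ∀ k, b k ≤ b' :=
    ⟨max (b 0) (max (b 1) (b 2)), fun k => by fin_cases k <;> simp⟩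
  have hz : ∀ x : Plane, x ∉ Metric.closedBall (0:Plane) (rexp b') ∩ {x | rexp a' ≤ ‖x‖} → modeField n η x = 0 := by
    intro x hx
    refine modeField_eq_zero fun k => ?_
    by_cases h1 : 0 < ‖x‖
    · refine h0 k _ fun hh => hx ⟨?_, ?_⟩
      · rw [mem_closedBall_zero_iff, ← Real.log_le_iff_le_exp h1]
        exact hh.2.trans (hb' k)
      · show rexp a' ≤ ‖x‖
        rw [← Real.le_log_iff_exp_le h1]
        exact (ha' k).trans hh.1
    · have : ‖x‖ = 0 := le_antisymm (not_lt.1 h1) (norm_nonneg _)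
      rw [this, Real.log_zero]
      exact (hη k).eq_zero_of_nonpos le_rfl
  have hcl : IsClosed {x : Plane | rexp a' ≤ ‖x‖} := isClosed_le continuous_const continuous_norm
  have hK : IsCompact (Metric.closedBall (0:Plane) (rexp b') ∩ {x | rexp a' ≤ ‖x‖}) :=
    (isCompact_closedBall _ _).inter_right hcl
  refine ⟨contDiff_iff_contDiffAt.2 fun x => ?_, HasCompactSupport.intro hK hz, ?_⟩
  · by_cases hx : x = 0
    · have : modeField n η =ᶠ[𝓝 x] fun _ => 0 := by
        filter_upwards [Metric.ball_mem_nhds x one_pos] with y hy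
        refine hz y fun hh => ?_
        rw [hx, mem_ball_zero_iff] at hy
        have h1 : rexp a' ≤ ‖y‖ := hh.2
        have := Real.one_lt_exp_iff.2 ha'0
        linarith
      exact contDiffAt_const.congr_of_eventuallyEq this
    · exact contDiffAt_modeField (fun k => (hη k).smooth) hx
  · refine (closure_minimal (fun x hx => ?_) hK.isClosed).trans fun x hx => (Real.one_lt_exp_iff.2 ha'0).trans_le hx.2
    by_contra hh
    exact hx (hz x hh)

/-- The cylindrical components of the gradient of `modeField`. -/
lemma cylTen_grad_modeField {n : ℤ} {η : ModeVec} (hη : ∀ k, Tst (η k)) (k l : Fin 3) (t θ : ℝ) :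
    cylTen (grad (modeField n η)) k l (rexp t) θ =
      (gradMode n η (fun k => deriv (η k)) k l t * cexp (I * n * θ)).re := by
  have hd : DifferentiableAt ℝ (modeField n η) (pol (t, θ)) :=
    (isTest_modeField hη).1.differentiable (by simp) _
  have he : (rexp t) ≠ 0 := (exp_pos t).ne'
  have e1 : cexp ((-1:ℂ) * t) = ((rexp t)⁻¹ : ℝ) := by
    rw [← Real.exp_neg, Complex.ofReal_exp]; congr 1; push_cast; ring
  have e3 : ∀ z u : ℂ, ((((rexp t)⁻¹ : ℝ) : ℂ) * z * u).re = (rexp t)⁻¹ * (z * u).re := fun z u => by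
    rw [mul_assoc, re_ofReal_mul]
  have row0 : ∀ l, cylTen (grad (modeField n η)) 0 l (rexp t) θ =
      (rexp t)⁻¹ * (deriv (η l) t * cexp (I * n * θ)).re := by
    intro l
    have h1 := hasDerivAt_cylVec_fst hd l
    simp only [cylVec_modeField] at h1
    have h2 : HasDerivAt (fun t => (η l t * cexp (I * n * θ)).re)
        ((deriv (η l) t * cexp (I * n * θ)).re) t :=
      (Complex.reCLM.hasFDerivAt.comp_hasDerivAt t (((hη l).hasDerivAt t).mul_const _))
    rw [← h1.unique h2, inv_mul_cancel_left₀ he]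
  have row1 : ∀ l, cylTen (grad (modeField n η)) 1 l (rexp t) θ =
      (rexp t)⁻¹ * ((I * n * η l t * cexp (I * n * θ)).re -
        (![(η 1 t * cexp (I * n * θ)).re, -(η 0 t * cexp (I * n * θ)).re, 0] :
          Fin 3 → ℝ) l) := by
    intro l
    have h1 := hasDerivAt_cylVec_snd hd l
    simp only [cylVec_modeField] at h1
    have h2 : HasDerivAt (fun θ : ℝ => (η l t * cexp (I * n * θ)).re)
        ((I * n * η l t * cexp (I * n * θ)).re) θ := by
      have h3 : HasDerivAt (fun θ : ℝ => η l t * cexp (I * n * θ))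
          (η l t * (cexp (I * n * θ) * (I * n))) θ := by
        refine HasDerivAt.const_mul _ ?_
        have h4 : HasDerivAt (fun θ : ℝ => I * n * (θ:ℂ)) (I * n) θ := by
          simpa using (Complex.ofRealCLM.hasDerivAt (x := θ)).const_mul (I * (n:ℂ))
        exact h4.cexp
      refine (Complex.reCLM.hasFDerivAt.comp_hasDerivAt θ h3).congr_deriv ?_
      simp only [Complex.reCLM_apply]
      congr 1; ring
    rw [← h1.unique h2, add_sub_cancel_right, inv_mul_cancel_left₀ he]
  fin_cases k
  · refine (row0 l).trans ?_
    rw [gradMode, e1, e3]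
    fin_cases l <;> simp
  · refine (row1 l).trans ?_
    rw [gradMode, e1, e3]
    fin_cases l
    · simp; ring
    · simp; ring
    · simp
  · refine (cylTen_grad_two _ _ _ _).trans ?_
    rw [gradMode]
    fin_cases l <;> simp

lemma divh_modeField {n : ℤ} {η : ModeVec} (hη : ∀ k, Tst (η k))
    (hd : ∀ t, deriv (η 0) t + η 0 t + I * n * η 1 t = 0) (x : Plane) : divh (modeField n η) x = 0 := by
  by_cases hx : 0 < ‖x‖
  · rw [← pol_azimuth hx, divh_eq_trace, cylTen_grad_modeField hη, cylTen_grad_modeField hη, ← Complex.add_re,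
      ← add_mul]
    have : gradMode n η (fun k => deriv (η k)) 0 0 (log ‖x‖) + gradMode n η (fun k => deriv (η k)) 1 1 (log ‖x‖)
        = 0 := by
      simp only [gradMode]
      have := hd (log ‖x‖)
      simp only [Matrix.cons_val_zero, Matrix.cons_val_one]
      linear_combination cexp ((-1:ℂ) * (log ‖x‖)) * this
    rw [this]; simp
  · have h0 : x ∉ tsupport (modeField n η) := fun hh => by
      have : 1 < ‖x‖ := (isTest_modeField hη).2.2 hh
      linarith
    have := grad_eq_zero h0
    have h1 := congrArg (fun T : Ten ℝ => T (0, 0)) this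
    have h2 := congrArg (fun T : Ten ℝ => T (1, 1)) this
    simp [grad] at h1 h2
    simp [divh, h1, h2]

/-- The pairing with `modeField` singles out one mode. -/
lemma integral_mul_re (n : ℤ) {M : ℝ} {a : ℝ → ℝ} (ha : BM M a) (c : ℂ) :
    ∫ θ : ℝ, a θ * (c * cexp (I * (-n : ℤ) * θ)).re ∂circ = 2 * π * (fc n a * c).re := by
  have hi := ha.integrable_mul (continuous_cexp_neg_I n) (norm_cexp_neg_I n)
  have h1 : ∀ θ : ℝ, a θ * (c * cexp (I * (-n : ℤ) * θ)).re =
      (c * (a θ * cexp (-(I * n * θ)))).re := by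
    intro θ
    have : cexp (I * (-n : ℤ) * θ) = cexp (-(I * n * θ)) := by
      congr 1; push_cast; ring
    rw [this, mul_left_comm, re_ofReal_mul]
  simp only [h1]
  have h2 := integral_re (hi.const_mul c)
  simp only [RCLike.re_eq_complex_re] at h2
  rw [h2, integral_const_mul]
  have hpi : (π : ℂ) ≠ 0 := by exact_mod_cast Real.pi_ne_zero
  rw [← re_ofReal_mul, fc]
  congr 1
  push_cast
  field_simp

lemma integral_pairing_modeField {T : TenField} {g : VecField} {M : ℝ} (hT : AEStronglyMeasurable T vol)
    (hTM : ∀ᵐ x ∂vol, ‖T x‖ ≤ M) (hg : AEStronglyMeasurable g vol) (hgM : ∀ᵐ x ∂vol, ‖g x‖ ≤ M)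
    (n : ℤ) {η : ModeVec} (hη : ∀ k, Tst (η k)) :
    ∫ x, pairing T g (modeField (-n) η) x ∂vol = 2 * π * ∫ t, rexp (2 * t) *
      (∑ k, ∑ l, tm T n k l t * gradMode (-n) η (fun k => deriv (η k)) k l t - ∑ k, vm g n k t * η k t).re ∂hl := by
  have hφ := isTest_modeField (n := -n) hη
  rw [integral_vol (integrable_pairing hT hTM hg hgM hφ), ← integral_const_mul]
  refine integral_congr_ae ?_
  filter_upwards [ae_all_iff.2 fun k => ae_all_iff.2 fun l => ae_bm_cylTen hT hTM k l,
      ae_all_iff.2 fun k => ae_bm_cylVec hg hgM k] with t h1 h2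
  rw [integral_pairing_circ h1 h2 hφ.1]
  simp only [cylTen_grad_modeField hη, cylVec_modeField]
  have e1 : ∀ k l, ∫ θ : ℝ, cylTen T k l (rexp t) θ * (gradMode (-n) η (fun k => deriv (η k)) k l t *
      cexp (I * (-n : ℤ) * θ)).re ∂circ = 2 * π *
      (tm T n k l t * gradMode (-n) η (fun k => deriv (η k)) k l t).re := fun k l => integral_mul_re n (h1 k l) _
  have e2 : ∀ k, ∫ θ : ℝ, cylVec g k (rexp t) θ * (η k t *
      cexp (I * (-n : ℤ) * θ)).re ∂circ = 2 * π * (vm g n k t * η k t).re :=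
    fun k => integral_mul_re n (h2 k) _
  simp only [Complex.sub_re, Complex.re_sum, mul_sub, mul_sum]
  congr 1
  · refine sum_congr rfl fun k _ => sum_congr rfl fun l _ => ?_
    rw [e1]; ring
  · refine sum_congr rfl fun k _ => ?_
    rw [e2]; ring

/-! ### Square norms and measurability in polar coordinates -/

/-- The `L²` norm on the exterior disk of a radial function. -/
lemma eLpNorm_radial {f : ℝ → ℝ} (hf : AEStronglyMeasurable f hl) :
    eLpNorm (fun x : Plane => f (log ‖x‖)) 2 vol =
      ofReal (2 * π) ^ (1 / 2 : ℝ) * eLpNorm (fun t => rexp t * f t) 2 hl := by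
  have e1 : eLpNorm (fun x : Plane => f (log ‖x‖)) 2 vol = eLpNorm (fun x : Plane => hf.mk f (log ‖x‖)) 2 vol :=
    eLpNorm_congr_ae (quasiMeasurePreserving_log_norm.ae_eq_comp hf.ae_eq_mk)
  have e2 : eLpNorm (fun t => rexp t * f t) 2 hl = eLpNorm (fun t => rexp t * hf.mk f t) 2 hl := by
    refine eLpNorm_congr_ae ?_
    filter_upwards [hf.ae_eq_mk] with t ht
    rw [ht]
  have hm : Measurable (hf.mk f) := hf.stronglyMeasurable_mk.measurable
  rw [e1, e2, eLpNorm_eq_lintegral_rpow_enorm_toReal two_ne_zero (by simp),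
    eLpNorm_eq_lintegral_rpow_enorm_toReal two_ne_zero (by simp)]
  simp only [ENNReal.toReal_ofNat]
  rw [← ENNReal.mul_rpow_of_nonneg _ _ (by simp)]
  congr 1
  have hm2 : Measurable fun x : Plane => ‖hf.mk f (log ‖x‖)‖ₑ ^ (2:ℝ) :=
    (hm.comp measurable_log_norm).enorm.pow_const _
  rw [lintegral_vol _ hm2]
  simp only [log_norm_pol, lintegral_const, circ_univ]
  rw [hlw, lintegral_withDensity_eq_lintegral_mul _ (by fun_prop) ((hm.enorm.pow_const _).mul_const _),
    ← lintegral_const_mul _ (by fun_prop)]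
  refine lintegral_congr fun t => ?_
  simp only [Pi.mul_apply, enorm_mul, ENNReal.mul_rpow_of_nonneg _ _ (zero_le_two : (0:ℝ) ≤ 2)]
  have : ‖rexp t‖ₑ ^ (2:ℝ) = ofReal (rexp (2 * t)) := by
    rw [← ofReal_norm, ENNReal.ofReal_rpow_of_nonneg (norm_nonneg _) zero_le_two, norm_eq_abs, abs_exp, exp_rpow]
  rw [this]; ring

lemma measurable_azimuth : Measurable azimuth := by
  unfold azimuth
  refine Complex.measurable_arg.comp ?_
  have : Continuous fun x : Plane => (⟨x 0, x 1⟩ : ℂ) := by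
    have h : (fun x : Plane => (⟨x 0, x 1⟩ : ℂ)) = fun x => (x 0 : ℂ) + (x 1 : ℂ) * I :=
      funext fun x => Complex.mk_eq_add_mul_I _ _
    rw [h]; fun_prop
  exact this.measurable

lemma measurable_frame_azimuth (k j : Fin 3) : Measurable fun x : Plane => frame (azimuth x) k j :=
  (contDiff_frame k j).continuous.measurable.comp measurable_azimuth

lemma aestronglyMeasurable_toLp {ι : Type} [Fintype ι] {f : Plane → ι → ℝ}
    (hf : ∀ i, AEStronglyMeasurable (fun x => f x i) vol) :
    AEStronglyMeasurable (fun x => (WithLp.toLp 2 (f x) : EuclideanSpace ℝ ι)) vol :=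
  (PiLp.continuous_toLp 2 _).comp_aestronglyMeasurable
    (aemeasurable_pi_lambda f fun i => (hf i).aemeasurable).aestronglyMeasurable

lemma aestronglyMeasurable_vecOf {s : Fin 3 → ℝ → ℝ → ℝ}
    (h : ∀ k, AEStronglyMeasurable (fun x : Plane => s k (log ‖x‖) (azimuth x)) vol) :
    AEStronglyMeasurable (vecOf s) vol :=
  aestronglyMeasurable_toLp fun j => aestronglyMeasurable_fun_sum _ fun k _ =>
    (measurable_frame_azimuth k j).aestronglyMeasurable.mul (h k)

lemma aestronglyMeasurable_tenOf {s : Fin 3 → Fin 3 → ℝ → ℝ → ℝ}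
    (h : ∀ k l, AEStronglyMeasurable (fun x : Plane => s k l (log ‖x‖) (azimuth x)) vol) :
    AEStronglyMeasurable (tenOf s) vol :=
  aestronglyMeasurable_toLp fun p => aestronglyMeasurable_fun_sum _ fun k _ =>
    aestronglyMeasurable_fun_sum _ fun l _ =>
      ((measurable_frame_azimuth k p.1).mul (measurable_frame_azimuth l p.2)).aestronglyMeasurable.mul (h k l)

lemma aestronglyMeasurable_synth {c : ℤ → ℝ → ℂ} (hc : ∀ n, AEStronglyMeasurable (c n) hl)
    (hs : ∀ᵐ t ∂hl, Summable fun n => ‖c n t‖) :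
    AEStronglyMeasurable (fun x : Plane => synth (fun n => c n (log ‖x‖)) (azimuth x)) vol := by
  refine Complex.continuous_re.comp_aestronglyMeasurable ?_
  refine aestronglyMeasurable_of_tendsto_ae (u := (atTop : Filter (Finset ℤ)))
    (f := fun (S : Finset ℤ) (x : Plane) => ∑ n ∈ S, c n (log ‖x‖) * cexp (I * n * azimuth x))
    (fun S => ?_) ?_
  · refine aestronglyMeasurable_fun_sum _ fun n _ => AEStronglyMeasurable.mul
      ((hc n).comp_quasiMeasurePreserving quasiMeasurePreserving_log_norm) ?_
    exact ((by fun_prop : Continuous fun θ : ℝ => cexp (I * n * θ)).measurable.comp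
      measurable_azimuth).aestronglyMeasurable
  · filter_upwards [quasiMeasurePreserving_log_norm.ae hs] with x hx
    exact (summable_synth hx (azimuth x)).hasSum

lemma periodic_synth (c : ℤ → ℂ) : Function.Periodic (synth c) (2 * π) := by
  intro θ
  simp only [synth]
  congr 1
  refine tsum_congr fun n => ?_
  have := periodic_cexp n θ
  simp only at this
  rw [this]

/-- The error of a partial sum whose terms are perturbed. -/
lemma abs_synth_sub_le {c : ℤ → ℂ} (hc : Summable fun m => ‖c m‖) (S : Finset ℤ) (η : ℤ → ℂ) (θ : ℝ) :
    |synth c θ - ∑ n ∈ S, (η n * cexp (I * n * θ)).re| ≤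
      ∑ n ∈ S, ‖c n - η n‖ + ∑' n : ↑(S : Set ℤ)ᶜ, ‖c n‖ := by
  have h1 := (summable_synth hc θ).sum_add_tsum_compl (s := S)
  have h2 : synth c θ - ∑ n ∈ S, (η n * cexp (I * n * θ)).re =
      (∑ n ∈ S, (c n - η n) * cexp (I * n * θ) +
        ∑' n : ↑(S : Set ℤ)ᶜ, c n * cexp (I * (n : ℤ) * θ)).re := by
    rw [synth, ← h1]
    simp only [Complex.add_re, Complex.re_sum, sub_mul, Complex.sub_re, Finset.sum_sub_distrib]
    ring
  rw [h2]
  refine (Complex.abs_re_le_norm _).trans ((norm_add_le _ _).trans (add_le_add ?_ ?_))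
  · refine norm_sum_le_of_le _ fun n _ => ?_
    rw [norm_mul, norm_cexp_I, mul_one]
  · have hs : Summable fun n : ↑(S : Set ℤ)ᶜ => ‖c n * cexp (I * (n : ℤ) * θ)‖ := by
      simp only [norm_mul, norm_cexp_I, mul_one]
      exact hc.subtype _
    refine (norm_tsum_le_tsum_norm hs).trans (le_of_eq ?_)
    simp only [norm_mul, norm_cexp_I, mul_one]

/-- Square norms of fields that are dominated by radial functions. -/
lemma eLpNorm_le_radial {E ι : Type} [NormedAddCommGroup E] [Fintype ι] {v : Plane → E} {S : Finset ℤ}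
    {d : ι → ℤ → ℝ → ℂ} (hd : ∀ i n, AEStronglyMeasurable (d i n) hl) {K : ℝ} (hK : 0 ≤ K) {r : ℝ → ℝ}
    (hr : AEStronglyMeasurable r hl)
    (h : ∀ᵐ x ∂vol, ‖v x‖ ≤ ∑ i, (∑ n ∈ S, ‖d i n (log ‖x‖)‖ + K * r (log ‖x‖))) :
    eLpNorm v 2 vol ≤ ofReal (2 * π) ^ (1 / 2 : ℝ) *
      ∑ i, (∑ n ∈ S, eLpNorm (fun t : ℝ => cexp ((1:ℂ) * t) * d i n t) 2 hl +
        ofReal K * eLpNorm (fun t => rexp t * r t) 2 hl) := by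
  have hc : Continuous rexp := Real.continuous_exp
  refine (eLpNorm_mono_ae_real h).trans ?_
  have hm : AEStronglyMeasurable (fun t => ∑ i, (∑ n ∈ S, ‖d i n t‖ + K * r t)) hl :=
    aestronglyMeasurable_fun_sum _ fun i _ => AEStronglyMeasurable.add
      (aestronglyMeasurable_fun_sum _ fun n _ => (hd i n).norm) (hr.const_mul K)
  rw [eLpNorm_radial hm]
  gcongr
  have e : (fun t => rexp t * ∑ i, (∑ n ∈ S, ‖d i n t‖ + K * r t)) =
      ∑ i, ((∑ n ∈ S, fun t => rexp t * ‖d i n t‖) + fun t => K * (rexp t * r t)) := by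
    ext t
    simp only [Finset.sum_apply, Pi.add_apply, mul_sum, mul_add]
    refine sum_congr rfl fun i _ => ?_
    congr 1; ring
  have m1 : ∀ i n, AEStronglyMeasurable (fun t => rexp t * ‖d i n t‖) hl := fun i n =>
    hc.aestronglyMeasurable.mul (hd i n).norm
  have m2 : AEStronglyMeasurable (fun t => K * (rexp t * r t)) hl := (hc.aestronglyMeasurable.mul hr).const_mul K
  have m3 : ∀ i, AEStronglyMeasurable (∑ n ∈ S, fun t => rexp t * ‖d i n t‖) hl := fun i =>
    Finset.aestronglyMeasurable_sum _ fun n _ => m1 i n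
  rw [e]
  refine (eLpNorm_sum_le (fun i _ => (m3 i).add m2) one_le_two).trans (sum_le_sum fun i _ => ?_)
  refine (eLpNorm_add_le (m3 i) m2 one_le_two).trans (add_le_add ?_ ?_)
  · refine (eLpNorm_sum_le (fun n _ => m1 i n) one_le_two).trans (sum_le_sum fun n _ => ?_)
    refine eLpNorm_mono fun t => ?_
    rw [norm_mul, norm_mul, norm_norm, Complex.norm_exp, norm_eq_abs, abs_exp]
    simp
  · have e2 := eLpNorm_const_smul K (fun t => rexp t * r t) 2 hl
    simp only [Pi.smul_def, smul_eq_mul] at e2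
    rw [e2, ← ofReal_norm, Real.norm_of_nonneg hK]

/-! ### Fields with prescribed modes -/

/-- A family of modes of a real field, with absolutely summable weighted bounds. -/
structure RealModes (ρ : ℝ) (w p : ℤ → ModeVec) (B : ℤ → ℝ) : Prop where
  summ : Summable B
  bdw : ∀ n k, Bd (ρ - 1) (B n) (w n k)
  bdn : ∀ n k, Bd (ρ - 1) (B n) (fun t => n * w n k t)
  bdp : ∀ n k, Bd (ρ - 1) (B n) (p n k)
  hconj : ∀ n k t, w (-n) k t = conj (w n k t)
  pconj : ∀ n k, ∀ᵐ t ∂hl, p (-n) k t = conj (p n k t)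

/-- The field with the modes `w`. -/
noncomputable def fieldOf (w : ℤ → ModeVec) : VecField :=
  vecOf fun k t θ => synth (fun n => w n k t) θ

/-- The gradient of the field with the modes `w`, whose derivatives in `t` are `p`. -/
noncomputable def gradOf (w p : ℤ → ModeVec) : TenField :=
  tenOf fun k l t θ => synth (fun n => gradMode n (w n) (p n) k l t) θ

lemma Bd.gradMode {ρ A : ℝ} {n : ℤ} {w p : ModeVec} (hw : ∀ k, Bd (ρ - 1) A (w k))
    (hn : ∀ k, Bd (ρ - 1) A (fun t => n * w k t)) (hp : ∀ k, Bd (ρ - 1) A (p k)) (k l : Fin 3) :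
    Bd ρ (2 * A) (gradMode n w p k l) := by
  have hA : 0 ≤ A := (hw 0).nonneg
  have hI : ∀ k, Bd (ρ - 1) A (fun t => I * n * w k t) := fun k => by
    have := (hn k).const_mul I
    simpa [mul_assoc] using this
  have h0 : Bd (ρ - 1) 0 (fun _ => 0) := ⟨aestronglyMeasurable_const, by simp⟩
  have key : Bd (ρ - 1) (2 * A) (fun t => (![![p 0 t, p 1 t, p 2 t],
    ![I * n * w 0 t - w 1 t, I * n * w 1 t + w 0 t, I * n * w 2 t],
    ![0, 0, 0]] : Fin 3 → Fin 3 → ℂ) k l) := by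
    have m : ∀ {A' f}, Bd (ρ - 1) A' f → A' ≤ 2 * A → Bd (ρ - 1) (2 * A) f := fun h h' =>
      h.mono le_rfl h' (by positivity)
    fin_cases k <;> fin_cases l
    · exact m (hp 0) (by linarith)
    · exact m (hp 1) (by linarith)
    · exact m (hp 2) (by linarith)
    · exact m ((hI 0).sub (hw 1)) (by linarith)
    · exact m ((hI 1).add (hw 0)) (by linarith)
    · exact m (hI 2) (by linarith)
    · exact m h0 (by linarith)
    · exact m h0 (by linarith)
    · exact m h0 (by linarith)
  exact key.of_exp (-1) (by simp)

namespace RealModes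

variable {ρ : ℝ} {w p : ℤ → ModeVec} {B : ℤ → ℝ}

lemma nonneg (h : RealModes ρ w p B) (n : ℤ) : 0 ≤ B n := (h.bdw n 0).nonneg

lemma bdg (h : RealModes ρ w p B) (n : ℤ) (k l : Fin 3) : Bd ρ (2 * B n) (gradMode n (w n) (p n) k l) :=
  Bd.gradMode (h.bdw n) (h.bdn n) (h.bdp n) k l

lemma ae_w (h : RealModes ρ w p B) : ∀ᵐ t ∂hl, ∀ n k, ‖w n k t‖ ≤ B n * rexp (-(ρ - 1) * t) :=
  ae_all_iff.2 fun n => ae_all_iff.2 fun k => (h.bdw n k).2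

lemma ae_g (h : RealModes ρ w p B) :
    ∀ᵐ t ∂hl, ∀ n k l, ‖gradMode n (w n) (p n) k l t‖ ≤ 2 * B n * rexp (-ρ * t) :=
  ae_all_iff.2 fun n => ae_all_iff.2 fun k => ae_all_iff.2 fun l => (h.bdg n k l).2

lemma ae_gconj (h : RealModes ρ w p B) :
    ∀ᵐ t ∂hl, ∀ n k l, gradMode (-n) (w (-n)) (p (-n)) k l t = conj (gradMode n (w n) (p n) k l t) := by
  filter_upwards [ae_all_iff.2 fun n => ae_all_iff.2 fun k => h.pconj n k] with t ht n k l
  have e : conj (cexp ((-1:ℂ) * t)) = cexp ((-1:ℂ) * t) := by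
    rw [← Complex.exp_conj]; simp
  simp only [gradMode, map_mul, e]
  congr 1
  fin_cases k <;> fin_cases l <;> simp [ht, h.hconj]

lemma summable_w (h : RealModes ρ w p B) : ∀ᵐ t ∂hl, ∀ k, Summable fun n => ‖w n k t‖ := by
  filter_upwards [h.ae_w] with t ht k
  exact Summable.of_nonneg_of_le (fun _ => norm_nonneg _) (fun n => ht n k) (h.summ.mul_right _)

lemma summable_g (h : RealModes ρ w p B) :
    ∀ᵐ t ∂hl, ∀ k l, Summable fun n => ‖gradMode n (w n) (p n) k l t‖ := by
  filter_upwards [h.ae_g] with t ht k l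
  exact Summable.of_nonneg_of_le (fun _ => norm_nonneg _) (fun n => ht n k l) ((h.summ.mul_left 2).mul_right _)

lemma cylVec_fieldOf (w : ℤ → ModeVec) (k : Fin 3) (t θ : ℝ) :
    cylVec (fieldOf w) k (rexp t) θ = synth (fun n => w n k t) θ :=
  cylVec_vecOf (fun _ _ => periodic_synth _) k t θ

lemma cylTen_gradOf (w p : ℤ → ModeVec) (k l : Fin 3) (t θ : ℝ) :
    cylTen (gradOf w p) k l (rexp t) θ = synth (fun n => gradMode n (w n) (p n) k l t) θ :=
  cylTen_tenOf (fun _ _ _ => periodic_synth _) k l t θ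

lemma hasSum_cylVec (h : RealModes ρ w p B) : ∀ᵐ t ∂hl, ∀ k (θ : ℝ),
    HasSum (fun n : ℤ => w n k t * cexp (I * n * θ)) (cylVec (fieldOf w) k (rexp t) θ : ℂ) := by
  filter_upwards [h.summable_w] with t ht k θ
  rw [cylVec_fieldOf]
  exact hasSum_synth (ht k) (fun n => h.hconj n k t) θ

lemma hasSum_cylTen (h : RealModes ρ w p B) : ∀ᵐ t ∂hl, ∀ k l (θ : ℝ),
    HasSum (fun n : ℤ => gradMode n (w n) (p n) k l t * cexp (I * n * θ))
      (cylTen (gradOf w p) k l (rexp t) θ : ℂ) := by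
  filter_upwards [h.summable_g, h.ae_gconj] with t ht hc k l θ
  rw [cylTen_gradOf]
  exact hasSum_synth (ht k l) (fun n => hc n k l) θ

lemma vm_fieldOf (h : RealModes ρ w p B) : ∀ᵐ t ∂hl, ∀ n k, vm (fieldOf w) n k t = w n k t := by
  filter_upwards [h.hasSum_cylVec, h.summable_w] with t ht hs n k
  exact fc_of_hasSum (hs k) (ae_of_all _ (ht k)) n

lemma tm_gradOf (h : RealModes ρ w p B) :
    ∀ᵐ t ∂hl, ∀ n k l, tm (gradOf w p) n k l t = gradMode n (w n) (p n) k l t := by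
  filter_upwards [h.hasSum_cylTen, h.summable_g] with t ht hs n k l
  exact fc_of_hasSum (hs k l) (ae_of_all _ (ht k l)) n

lemma aestronglyMeasurable_fieldOf (h : RealModes ρ w p B) : AEStronglyMeasurable (fieldOf w) vol := by
  refine aestronglyMeasurable_vecOf fun k => aestronglyMeasurable_synth (fun n => (h.bdw n k).1) ?_
  filter_upwards [h.summable_w] with t ht using ht k

lemma aestronglyMeasurable_gradOf (h : RealModes ρ w p B) : AEStronglyMeasurable (gradOf w p) vol := by
  refine aestronglyMeasurable_tenOf fun k l => aestronglyMeasurable_synth (fun n => (h.bdg n k l).1) ?_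
  filter_upwards [h.summable_g] with t ht using ht k l

lemma norm_fieldOf_le (h : RealModes ρ w p B) :
    ∀ᵐ x ∂vol, ‖fieldOf w x‖ ≤ 3 * (∑' n, B n) * rexp (-(ρ - 1) * log ‖x‖) := by
  filter_upwards [quasiMeasurePreserving_log_norm.ae (h.ae_w.and h.summable_w)] with x hx
  refine (norm_vecOf_le _ x).trans ?_
  have : ∀ k, |synth (fun n => w n k (log ‖x‖)) (azimuth x)| ≤ (∑' n, B n) * rexp (-(ρ - 1) * log ‖x‖) :=
    fun k => by
      refine (abs_synth_le (hx.2 k) _).trans ?_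
      rw [← tsum_mul_right]
      exact (hx.2 k).tsum_le_tsum (fun n => hx.1 n k) (h.summ.mul_right _)
  refine (sum_le_sum fun k _ => this k).trans (le_of_eq ?_)
  simp; ring

lemma memL1Vec_fieldOf (h : RealModes ρ w p B) :
    MemL1Vec (ρ - 1) (fieldOf w) ∧ l1normVec (ρ - 1) (fieldOf w) ≤ ofReal (3 * ∑' n, B n) := by
  have hbd : ∀ n k, Bd (ρ - 1) (B n) (vm (fieldOf w) n k) := fun n k => (h.bdw n k).congr (by
    filter_upwards [h.vm_fieldOf] with t ht using (ht n k).symm)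
  have hle : l1normVec (ρ - 1) (fieldOf w) ≤ ofReal (3 * ∑' n, B n) := by
    rw [← tsum_mul_left, ENNReal.ofReal_tsum_of_nonneg (fun n => by have := h.nonneg n; positivity) (h.summ.mul_left 3)]
    refine ENNReal.tsum_le_tsum fun n => (wnorm_projVec_le (hbd n)).trans (le_of_eq ?_)
    simp
  refine ⟨⟨h.aestronglyMeasurable_fieldOf, ?_, hle.trans_lt ENNReal.ofReal_lt_top⟩, hle⟩
  filter_upwards [quasiMeasurePreserving_log_norm.ae (h.hasSum_cylVec.and h.vm_fieldOf), ae_vol_pos] with x hx h0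
  have hx0 := norm_pos_of_log h0
  have e : ∀ n, projVec n (fieldOf w) x = WithLp.toLp 2 fun j => ∑ k, w n k (log ‖x‖) *
      cexp (I * n * azimuth x) * (frame (azimuth x) k j : ℂ) := by
    intro n
    simp only [projVec]
    congr 1; ext j
    refine sum_congr rfl fun k _ => ?_
    rw [← hx.2 n k, vm, exp_log hx0, fourierMode_eq]
  simp only [e]
  have key : HasSum (fun n : ℤ => fun j : Fin 3 => ∑ k, w n k (log ‖x‖) *
      cexp (I * n * azimuth x) * (frame (azimuth x) k j : ℂ)) (fun j => (fieldOf w x j : ℂ)) := by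
    refine Pi.hasSum.2 fun j => ?_
    have h1 := hasSum_sum fun k (_ : k ∈ Finset.univ) => (hx.1 k (azimuth x)).mul_right (frame (azimuth x) k j : ℂ)
    have h2 : (fieldOf w x j : ℂ) = ∑ k, (cylVec (fieldOf w) k (rexp (log ‖x‖)) (azimuth x) : ℂ) *
        (frame (azimuth x) k j : ℂ) := by
      simp only [cylVec_fieldOf]
      simp only [fieldOf, vecOf]
      push_cast
      exact sum_congr rfl fun k _ => mul_comm _ _
    rw [h2]; exact h1
  exact key.mapL (PiLp.continuousLinearEquiv 2 ℂ (fun _ : Fin 3 => ℂ)).symm.toContinuousLinearMap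

lemma memL1Ten_gradOf (h : RealModes ρ w p B) :
    MemL1Ten ρ (gradOf w p) ∧ l1normTen ρ (gradOf w p) ≤ ofReal (18 * ∑' n, B n) := by
  have hbd : ∀ n k l, Bd ρ (2 * B n) (tm (gradOf w p) n k l) := fun n k l => (h.bdg n k l).congr (by
    filter_upwards [h.tm_gradOf] with t ht using (ht n k l).symm)
  have hle : l1normTen ρ (gradOf w p) ≤ ofReal (18 * ∑' n, B n) := by
    rw [← tsum_mul_left, ENNReal.ofReal_tsum_of_nonneg (fun n => by have := h.nonneg n; positivity) (h.summ.mul_left 18)]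
    refine ENNReal.tsum_le_tsum fun n => (wnorm_projTen_le (hbd n)).trans (le_of_eq ?_)
    congr 1; simp; ring
  refine ⟨⟨h.aestronglyMeasurable_gradOf, ?_, hle.trans_lt ENNReal.ofReal_lt_top⟩, hle⟩
  filter_upwards [quasiMeasurePreserving_log_norm.ae (h.hasSum_cylTen.and h.tm_gradOf), ae_vol_pos] with x hx h0
  have hx0 := norm_pos_of_log h0
  have e : ∀ n, projTen n (gradOf w p) x = WithLp.toLp 2 fun q => ∑ k, ∑ l, gradMode n (w n) (p n) k l (log ‖x‖) *
      cexp (I * n * azimuth x) * (frame (azimuth x) k q.1 : ℂ) * (frame (azimuth x) l q.2 : ℂ) := by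
    intro n
    simp only [projTen]
    congr 1; ext j
    refine sum_congr rfl fun k _ => sum_congr rfl fun l _ => ?_
    rw [← hx.2 n k l, tm, exp_log hx0, fourierMode_eq]
  simp only [e]
  have key : HasSum (fun n : ℤ => fun q : Fin 3 × Fin 3 => ∑ k, ∑ l, gradMode n (w n) (p n) k l (log ‖x‖) *
      cexp (I * n * azimuth x) * (frame (azimuth x) k q.1 : ℂ) * (frame (azimuth x) l q.2 : ℂ))
      (fun q => (gradOf w p x q : ℂ)) := by
    refine Pi.hasSum.2 fun q => ?_
    have h1 := hasSum_sum fun k (_ : k ∈ Finset.univ) => hasSum_sum fun l (_ : l ∈ Finset.univ) =>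
      ((hx.1 k l (azimuth x)).mul_right (frame (azimuth x) k q.1 : ℂ)).mul_right (frame (azimuth x) l q.2 : ℂ)
    have h2 : (gradOf w p x q : ℂ) = ∑ k, ∑ l, (cylTen (gradOf w p) k l (rexp (log ‖x‖)) (azimuth x) : ℂ) *
        (frame (azimuth x) k q.1 : ℂ) * (frame (azimuth x) l q.2 : ℂ) := by
      simp only [cylTen_gradOf]
      simp only [gradOf, tenOf]
      push_cast
      exact sum_congr rfl fun k _ => sum_congr rfl fun l _ => by ring
    rw [h2]; exact h1
  exact key.mapL (PiLp.continuousLinearEquiv 2 ℂ (fun _ : Fin 3 × Fin 3 => ℂ)).symm.toContinuousLinearMap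

end RealModes

/-! ### Approximation of fields with prescribed modes -/

lemma cylVec_sub (v w : VecField) (k : Fin 3) (r θ : ℝ) :
    cylVec (fun x => v x - w x) k r θ = cylVec v k r θ - cylVec w k r θ := by
  simp [cylVec, mul_sub, Finset.sum_sub_distrib]

lemma cylTen_sub (F H : TenField) (k l : Fin 3) (r θ : ℝ) :
    cylTen (fun x => F x - H x) k l r θ = cylTen F k l r θ - cylTen H k l r θ := by
  simp [cylTen, mul_sub, Finset.sum_sub_distrib]

lemma cylVec_sum (v : ℤ → VecField) (S : Finset ℤ) (k : Fin 3) (r θ : ℝ) :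
    cylVec (fun x => ∑ n ∈ S, v n x) k r θ = ∑ n ∈ S, cylVec (v n) k r θ := by
  simp only [cylVec]
  rw [sum_comm (s := S)]
  refine sum_congr rfl fun j _ => ?_
  rw [← mul_sum]; simp

lemma cylTen_sum (F : ℤ → TenField) (S : Finset ℤ) (k l : Fin 3) (r θ : ℝ) :
    cylTen (fun x => ∑ n ∈ S, F n x) k l r θ = ∑ n ∈ S, cylTen (F n) k l r θ := by
  simp only [cylTen]
  rw [sum_comm (s := S)]
  refine sum_congr rfl fun i _ => ?_
  rw [sum_comm (s := S)]
  refine sum_congr rfl fun j _ => ?_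
  rw [← mul_sum]; simp

lemma pd_sum {φ : ℤ → VecField} (S : Finset ℤ) (h : ∀ n, Differentiable ℝ (φ n)) (i : Fin 3) (x : Plane) :
    pd i (fun x => ∑ n ∈ S, φ n x) x = ∑ n ∈ S, pd i (φ n) x := by
  simp only [pd]
  rw [fderiv_fun_sum fun n _ => (h n) x]
  simp

lemma grad_sum {φ : ℤ → VecField} (S : Finset ℤ) (h : ∀ n, Differentiable ℝ (φ n)) :
    grad (fun x => ∑ n ∈ S, φ n x) = fun x => ∑ n ∈ S, grad (φ n) x := by
  ext x p
  simp [grad, pd_sum S h]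

lemma divh_sum {φ : ℤ → VecField} (S : Finset ℤ) (h : ∀ n, Differentiable ℝ (φ n)) (x : Plane) :
    divh (fun x => ∑ n ∈ S, φ n x) x = ∑ n ∈ S, divh (φ n) x := by
  simp [divh, pd_sum S h, Finset.sum_add_distrib]

lemma IsTest.sum {φ : ℤ → VecField} (S : Finset ℤ) (h : ∀ n, IsTest (φ n)) : IsTest (fun x => ∑ n ∈ S, φ n x) := by
  refine ⟨ContDiff.sum fun n _ => (h n).1, ?_⟩
  have hK : IsCompact (⋃ n ∈ S, tsupport (φ n)) := S.isCompact_biUnion fun n _ => (h n).2.1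
  have hz : ∀ x ∉ ⋃ n ∈ S, tsupport (φ n), ∑ n ∈ S, φ n x = 0 := fun x hx =>
    Finset.sum_eq_zero fun n hn => image_eq_zero_of_notMem_tsupport fun hh => hx (mem_biUnion hn hh)
  refine ⟨HasCompactSupport.intro hK hz, ?_⟩
  refine (closure_minimal (fun x hx => ?_) hK.isClosed).trans (iUnion₂_subset fun n _ => (h n).2.2)
  by_contra hh
  exact hx (hz x hh)

lemma eLpNorm_le_exp_mul {f : ℝ → ℂ} : eLpNorm f 2 hl ≤ eLpNorm (fun t : ℝ => cexp ((1:ℂ) * t) * f t) 2 hl := by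
  refine eLpNorm_mono_ae ?_
  filter_upwards [hl_pos] with t ht
  rw [norm_mul, Complex.norm_exp]
  simp only [one_mul, Complex.ofReal_re]
  exact le_mul_of_one_le_left (norm_nonneg _) (Real.one_le_exp ht.le)

/-- Square norms of the components of a gradient, in terms of the components of the field and their derivatives. -/
lemma eLpNorm_gradMode_le {n : ℤ} {w p : ModeVec} (hw : ∀ k, AEStronglyMeasurable (w k) hl) {e : ℝ≥0∞}
    (h1 : ∀ k, eLpNorm (fun t : ℝ => cexp ((1:ℂ) * t) * w k t) 2 hl ≤ e) (h2 : ∀ k, eLpNorm (p k) 2 hl ≤ e)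
    (k l : Fin 3) :
    eLpNorm (fun t : ℝ => cexp ((1:ℂ) * t) * gradMode n w p k l t) 2 hl ≤ (‖(n:ℂ)‖ₑ + 1) * e := by
  have h3 : ∀ k, eLpNorm (w k) 2 hl ≤ e := fun k => eLpNorm_le_exp_mul.trans (h1 k)
  have h4 : ∀ k, eLpNorm (fun t => I * n * w k t) 2 hl ≤ ‖(n:ℂ)‖ₑ * e := fun k => by
    have e2 := eLpNorm_const_smul (I * (n:ℂ)) (w k) 2 hl
    simp only [Pi.smul_def, smul_eq_mul] at e2
    rw [e2, enorm_mul]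
    have : ‖I‖ₑ = 1 := by rw [← ofReal_norm]; simp
    rw [this, one_mul]
    gcongr
    exact h3 k
  have e0 : e ≤ (‖(n:ℂ)‖ₑ + 1) * e := by
    rw [add_mul, one_mul]; exact le_add_self
  have e1 : ‖(n:ℂ)‖ₑ * e + e ≤ (‖(n:ℂ)‖ₑ + 1) * e := by rw [add_mul, one_mul]
  have e2 : ‖(n:ℂ)‖ₑ * e ≤ (‖(n:ℂ)‖ₑ + 1) * e := by rw [add_mul, one_mul]; exact le_self_add
  have hs : (fun t : ℝ => cexp ((1:ℂ) * t) * gradMode n w p k l t) = (![![p 0, p 1, p 2],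
      ![fun t => I * n * w 0 t - w 1 t, fun t => I * n * w 1 t + w 0 t, fun t => I * n * w 2 t],
      ![0, 0, 0]] : ModeTen) k l := by
    ext t
    rw [gradMode, ← mul_assoc, ← Complex.exp_add]
    fin_cases k <;> fin_cases l <;> simp
  have hm : ∀ k, AEStronglyMeasurable (fun t => I * n * w k t) hl := fun k => (hw k).const_mul _
  rw [hs]
  fin_cases k <;> fin_cases l
  · exact (h2 0).trans e0
  · exact (h2 1).trans e0
  · exact (h2 2).trans e0
  · exact ((eLpNorm_sub_le (hm 0) (hw 1) one_le_two).trans (add_le_add (h4 0) (h3 1))).trans e1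
  · exact ((eLpNorm_add_le (hm 1) (hw 0) one_le_two).trans (add_le_add (h4 1) (h3 0))).trans e1
  · exact (h4 2).trans e2
  · simp
  · simp
  · simp

lemma gradMode_sub (n : ℤ) (w p w' p' : ModeVec) (k l : Fin 3) (t : ℝ) :
    gradMode n w p k l t - gradMode n w' p' k l t =
      gradMode n (fun k t => w k t - w' k t) (fun k t => p k t - p' k t) k l t := by
  simp only [gradMode, ← mul_sub]
  congr 1
  fin_cases k <;> fin_cases l <;> simp <;> ring

lemma Tst.gr {η : ℝ → ℂ} (h : Tst η) : Gr η := by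
  obtain ⟨C, hC⟩ := h.smooth.continuous.bounded_above_of_compact_support h.compact
  exact ⟨0, C, h.smooth.continuous.aestronglyMeasurable, ae_of_all _ fun t => by simpa using hC t⟩

namespace RealModes

variable {ρ : ℝ} {w p : ℤ → ModeVec} {B : ℤ → ℝ}

/-- The tail of the series of bounds. -/
lemma tsum_tail_le {c : ℤ → ℂ} {B : ℤ → ℝ} (hB : Summable B) {a : ℝ} (h : ∀ n, ‖c n‖ ≤ B n * a) (S : Finset ℤ) :
    ∑' n : ↑(S : Set ℤ)ᶜ, ‖c n‖ ≤ (∑' n : ↑(S : Set ℤ)ᶜ, B n) * a := by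
  have h1 : Summable fun n => ‖c n‖ := Summable.of_nonneg_of_le (fun _ => norm_nonneg _) h (hB.mul_right _)
  rw [← tsum_mul_right]
  exact (h1.subtype _).tsum_le_tsum (fun n => h n) ((hB.subtype _).mul_right a)

lemma eLpNorm_exp_lt_top {ρ : ℝ} (hρ : 2 < ρ) : eLpNorm (fun t => rexp t * rexp (-(ρ - 1) * t)) 2 hl < ⊤ := by
  have h : Bd (ρ - 2) 1 (fun t : ℝ => cexp ((-(ρ - 2) : ℝ) * t)) := by
    refine ⟨by fun_prop, ae_of_all _ fun t => ?_⟩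
    rw [Complex.norm_exp]; simp
  refine lt_of_le_of_lt (eLpNorm_mono fun t => ?_) (h.memLp (by linarith)).2
  rw [← Real.exp_add, Complex.norm_exp, norm_eq_abs, abs_exp]
  refine Real.exp_le_exp.2 (le_of_eq ?_)
  simp; ring

lemma exists_test_approx (h : RealModes ρ w p B) (hρ : 2 < ρ)
    (happ : ∀ (n : ℤ) (ε : ℝ≥0∞), ε ≠ 0 → ∃ η : ModeVec, (∀ k, Tst (η k)) ∧
      (∀ t, deriv (η 0) t + η 0 t + I * n * η 1 t = 0) ∧
      ∀ k, eLpNorm (fun t : ℝ => cexp ((1:ℂ) * t) * (η k t - w n k t)) 2 hl ≤ ε ∧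
        eLpNorm (fun t => deriv (η k) t - p n k t) 2 hl ≤ ε) {ε : ℝ≥0∞} (hε : ε ≠ 0) :
    ∃ φ : VecField, IsTest φ ∧ (∀ x, divh φ x = 0) ∧ eLpNorm (fun x => φ x - fieldOf w x) 2 vol ≤ ε ∧
      eLpNorm (fun x => grad φ x - gradOf w p x) 2 vol ≤ ε := by
  set P : ℝ≥0∞ := ofReal (2 * π) ^ (1 / 2 : ℝ) with hP
  set L : ℝ≥0∞ := eLpNorm (fun t => rexp t * rexp (-(ρ - 1) * t)) 2 hl with hL
  have hPt : P ≠ ⊤ := ENNReal.rpow_ne_top_of_nonneg (by norm_num) ENNReal.ofReal_ne_top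
  have hLt : L ≠ ⊤ := (eLpNorm_exp_lt_top hρ).ne
  -- The error `e n` of the mode `n` is divided by `1 + |n|`, as the angular derivative multiplies it by `n`.
  obtain ⟨e, he0, hes⟩ := ENNReal.exists_pos_sum_of_countable' (ε := ε / (18 * P)) (ENNReal.div_pos hε (ENNReal.mul_ne_top (by simp) hPt)).ne' ℤ
  have hne : ∀ n : ℤ, e n / (‖(n:ℂ)‖ₑ + 1) ≠ 0 := fun n =>
    (ENNReal.div_pos (he0 n).ne' (ENNReal.add_ne_top.2 ⟨by simp, by simp⟩)).ne'
  choose η hη hdiv happ' using fun n => happ n _ (hne n)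
  obtain ⟨S, hS⟩ : ∃ S : Finset ℤ, P * (9 * (ofReal (2 * ∑' n : ↑(S : Set ℤ)ᶜ, B n) * L)) ≤ ε / 2 := by
    have h1 : Tendsto (fun S : Finset ℤ => ∑' n : ↑(S : Set ℤ)ᶜ, B n) atTop (𝓝 0) := tendsto_tsum_compl_atTop_zero B
    have h2 : Tendsto (fun S : Finset ℤ => P * (9 * (ofReal (2 * ∑' n : ↑(S : Set ℤ)ᶜ, B n) * L))) atTop (𝓝 0) := by
      have h3 := ENNReal.tendsto_ofReal (h1.const_mul 2)
      rw [mul_zero, ENNReal.ofReal_zero] at h3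
      have h4 := ENNReal.Tendsto.mul_const h3 (Or.inr hLt)
      have h5 := ENNReal.Tendsto.const_mul (a := 9) h4 (Or.inr (by simp))
      have h6 := ENNReal.Tendsto.const_mul (a := P) h5 (Or.inr hPt)
      simpa using h6
    exact (h2.eventually_le_const (ENNReal.half_pos hε)).exists
  have hτ : 0 ≤ ∑' n : ↑(S : Set ℤ)ᶜ, B n := tsum_nonneg fun n => h.nonneg n
  have hexp : AEStronglyMeasurable (fun t => rexp (-(ρ - 1) * t)) hl := by fun_prop
  have htst : ∀ n, IsTest (modeField n (η n)) := fun n => isTest_modeField (hη n)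
  have hdiff : ∀ n, Differentiable ℝ (modeField n (η n)) := fun n => (htst n).1.differentiable (by simp)
  have hsum : ∑ n ∈ S, e n ≤ ε / (18 * P) := (ENNReal.sum_le_tsum S).trans hes.le
  have hPe : P * (9 * (ε / (18 * P))) ≤ ε / 2 := by
    have hP0 : P ≠ 0 := by
      rw [hP]
      exact (ENNReal.rpow_pos (ENNReal.ofReal_pos.2 two_pi_pos) ENNReal.ofReal_ne_top).ne'
    calc P * (9 * (ε / (18 * P))) = (9 * P) * ε / ((9 * P) * 2) := by
          rw [show (18 : ℝ≥0∞) * P = 9 * P * 2 by ring, ENNReal.div_eq_inv_mul, ENNReal.div_eq_inv_mul]; ring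
      _ = ε / 2 := ENNReal.mul_div_mul_left _ _ (mul_ne_zero (by simp) hP0) (ENNReal.mul_ne_top (by simp) hPt)
      _ ≤ _ := le_rfl
  -- The number `9` bounds the number of components, and the factor `2` the gradient by `w`, `n w` and `p`.
  have final : ∀ (N : ℕ) (T : ℝ≥0∞) (d : ℤ → ℝ≥0∞), N ≤ 9 → (∀ n, d n ≤ e n) →
      T ≤ ofReal (2 * ∑' n : ↑(S : Set ℤ)ᶜ, B n) →
      P * (N * (∑ n ∈ S, d n + T * L)) ≤ ε := by
    intro N T d hN hd hT
    have hN' : (N : ℝ≥0∞) ≤ 9 := by exact_mod_cast hN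
    calc P * (N * (∑ n ∈ S, d n + T * L))
        ≤ P * (9 * (ε / (18 * P) + ofReal (2 * ∑' n : ↑(S : Set ℤ)ᶜ, B n) * L)) := by
          gcongr
          exact (sum_le_sum fun n _ => hd n).trans hsum
      _ ≤ ε / 2 + ε / 2 := by
          rw [mul_add, mul_add]; exact add_le_add hPe hS
      _ = ε := ENNReal.add_halves ε
  have hscale : ∀ n : ℤ, (‖(n:ℂ)‖ₑ + 1) * (e n / (‖(n:ℂ)‖ₑ + 1)) ≤ e n := fun n => ENNReal.mul_div_le
  have hsmall : ∀ n : ℤ, e n / (‖(n:ℂ)‖ₑ + 1) ≤ e n := fun n =>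
    ENNReal.div_le_of_le_mul (by rw [mul_add, mul_one]; exact le_add_self)
  refine ⟨fun x => ∑ n ∈ S, modeField n (η n) x, IsTest.sum S htst, fun x => ?_, ?_, ?_⟩
  · rw [divh_sum S hdiff]
    exact Finset.sum_eq_zero fun n _ => divh_modeField (hη n) (hdiv n) x
  · refine (eLpNorm_le_radial (ι := Fin 3) (S := S) (d := fun k n t => η n k t - w n k t)
      (fun k n => (hη n k).smooth.continuous.aestronglyMeasurable.sub (h.bdw n k).1) hτ hexp ?_).trans ?_
    · filter_upwards [quasiMeasurePreserving_log_norm.ae (h.ae_w.and h.summable_w), ae_vol_pos] with x hx h0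
      have hx0 := norm_pos_of_log h0
      refine (norm_vec_le (fun x => ∑ n ∈ S, modeField n (η n) x - fieldOf w x) hx0).trans (sum_le_sum fun k _ => ?_)
      have h1 := abs_synth_sub_le (hx.2 k) S (fun n => η n k (log ‖x‖)) (azimuth x)
      have h2 := tsum_tail_le h.summ (fun n => hx.1 n k) S
      rw [cylVec_sub, cylVec_sum, ← exp_log hx0]
      simp only [cylVec_modeField, cylVec_fieldOf]
      rw [abs_sub_comm, exp_log hx0]
      refine h1.trans (add_le_add (le_of_eq ?_) h2)
      exact sum_congr rfl fun n _ => norm_sub_rev _ _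
    · refine le_trans ?_ (final 3 (ofReal (∑' n : ↑(S : Set ℤ)ᶜ, B n)) e (by norm_num) (fun n => le_rfl)
        (ENNReal.ofReal_le_ofReal (by linarith)))
      refine mul_le_mul_right (le_trans (Finset.sum_le_card_nsmul Finset.univ _
        (∑ n ∈ S, e n + ofReal (∑' n : ↑(S : Set ℤ)ᶜ, B n) * L) fun k _ => ?_) (by
          simp only [Finset.card_univ, Fintype.card_fin, nsmul_eq_mul]; exact le_rfl)) P
      gcongr with n hn
      exact ((happ' n k).1).trans (hsmall n)
  · have hm : ∀ n k, AEStronglyMeasurable (fun t => η n k t - w n k t) hl := fun n k =>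
      (hη n k).smooth.continuous.aestronglyMeasurable.sub (h.bdw n k).1
    refine (eLpNorm_le_radial (ι := Fin 3 × Fin 3) (S := S)
      (d := fun i n t => gradMode n (η n) (fun k => deriv (η n k)) i.1 i.2 t - gradMode n (w n) (p n) i.1 i.2 t)
      (r := fun t => rexp (-(ρ - 1) * t)) (K := 2 * ∑' n : ↑(S : Set ℤ)ᶜ, B n)
      (fun i n => ?_) (by positivity) hexp ?_).trans ?_
    · obtain ⟨_, _, hg⟩ := gradMode_gr (n := n) (w := η n) (p := fun k => deriv (η n k))
        (fun k => (hη n k).gr) (fun k => (hη n k).deriv.gr) i.1 i.2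
      exact hg.1.sub (h.bdg n i.1 i.2).1
    · filter_upwards [quasiMeasurePreserving_log_norm.ae (h.ae_g.and h.summable_g), ae_vol_pos] with x hx h0
      have hx0 := norm_pos_of_log h0
      rw [grad_sum S hdiff]
      refine (norm_ten_le (fun x => ∑ n ∈ S, grad (modeField n (η n)) x - gradOf w p x) hx0).trans ?_
      rw [Fintype.sum_prod_type]
      refine sum_le_sum fun k _ => sum_le_sum fun l _ => ?_
      have h1 := abs_synth_sub_le (hx.2 k l) S (fun n => gradMode n (η n) (fun k => deriv (η n k)) k l (log ‖x‖)) (azimuth x)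
      have h2 := tsum_tail_le (h.summ.mul_left 2) (fun n => hx.1 n k l) S
      rw [cylTen_sub, cylTen_sum, ← exp_log hx0]
      simp only [cylTen_grad_modeField (hη _), cylTen_gradOf]
      rw [abs_sub_comm, exp_log hx0]
      refine h1.trans (add_le_add (le_of_eq ?_) (h2.trans ?_))
      · exact sum_congr rfl fun n _ => norm_sub_rev _ _
      · rw [tsum_mul_left]
        gcongr
        linarith
    · refine le_trans ?_ (final 9 (ofReal (2 * ∑' n : ↑(S : Set ℤ)ᶜ, B n)) e le_rfl (fun n => le_rfl) le_rfl)
      refine mul_le_mul_right (le_trans (Finset.sum_le_card_nsmul Finset.univ _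
        (∑ n ∈ S, e n + ofReal (2 * ∑' n : ↑(S : Set ℤ)ᶜ, B n) * L) fun i _ => ?_) (by
          simp only [Finset.card_univ, Fintype.card_prod, Fintype.card_fin, nsmul_eq_mul]; exact le_rfl)) P
      gcongr with n hn
      simp only [gradMode_sub]
      exact (eLpNorm_gradMode_le (hm n) (fun k => (happ' n k).1) (fun k => (happ' n k).2) i.1 i.2).trans (hscale n)

end RealModes

/-! ### Weak gradients -/

lemma isOpen_Ω : IsOpen Ω := isOpen_lt continuous_const continuous_norm

lemma measurableSet_Ω : MeasurableSet Ω := isOpen_Ω.measurableSet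

lemma ae_vol_mem : ∀ᵐ x ∂vol, x ∈ Ω := ae_restrict_mem measurableSet_Ω

instance : IsLocallyFiniteMeasure vol := by unfold vol; infer_instance

lemma integral_vol_eq {f : Plane → ℝ} (h : ∀ x, x ∉ Ω → f x = 0) : ∫ x, f x ∂vol = ∫ x, f x :=
  setIntegral_eq_integral_of_forall_compl_eq_zero h

lemma IsTest.eq_zero {E : Type} [NormedAddCommGroup E] [NormedSpace ℝ E] {φ : Plane → E} (h : IsTest φ) {x : Plane}
    (hx : x ∉ Ω) : φ x = 0 := image_eq_zero_of_notMem_tsupport fun hh => hx (h.2.2 hh)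

lemma isTest_pd {φ : Plane → ℝ} (h : IsTest φ) (i : Fin 3) : IsTest (pd i φ) := by
  have hs : tsupport (pd i φ) ⊆ tsupport φ := tsupport_fderiv_apply_subset ℝ (dir i)
  refine ⟨?_, h.2.1.of_isClosed_subset (isClosed_tsupport _) hs, hs.trans h.2.2⟩
  exact (h.1.fderiv_right (m := ∞) (by simp)).clm_apply contDiff_const

lemma IsTest.memLp {E : Type} [NormedAddCommGroup E] [NormedSpace ℝ E] {φ : Plane → E} (h : IsTest φ)
    (p : ℝ≥0∞) : MemLp φ p vol :=
  (h.1.continuous.memLp_of_hasCompactSupport h.2.1).restrict _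

lemma memLp_grad {φ : VecField} (h : IsTest φ) (p : ℝ≥0∞) : MemLp (grad φ) p vol :=
  ((continuous_grad h.1).memLp_of_hasCompactSupport (hasCompactSupport_grad h)).restrict _

lemma memLp_apply {ι : Type} [Fintype ι] {f : Plane → EuclideanSpace ℝ ι} {p : ℝ≥0∞} {μ : Measure Plane}
    (h : MemLp f p μ) (i : ι) : MemLp (fun x => f x i) p μ :=
  h.mono ((EuclideanSpace.proj (𝕜 := ℝ) i : EuclideanSpace ℝ ι →L[ℝ] ℝ).continuous.comp_aestronglyMeasurable h.1)
    (ae_of_all _ fun x => PiLp.norm_apply_le (f x) i)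

/-- Pairings with square integrable functions pass to limits in `L²`. -/
lemma tendsto_integral_mul {ι : Type} [Fintype ι] {f : ℕ → Plane → EuclideanSpace ℝ ι} {u : Plane → EuclideanSpace ℝ ι}
    (hf : ∀ k, MemLp (f k) 2 vol) (hu : MemLp u 2 vol)
    (h : Tendsto (fun k => eLpNorm (fun x => f k x - u x) 2 vol) atTop (𝓝 0)) (i : ι) {ψ : Plane → ℝ}
    (hψ : MemLp ψ 2 vol) :
    Tendsto (fun k => ∫ x, f k x i * ψ x ∂vol) atTop (𝓝 (∫ x, u x i * ψ x ∂vol)) := by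
  refine tendsto_integral_of_L1' _ ((memLp_apply hu i).1.mul hψ.1)
    (Eventually.of_forall fun k => (memLp_apply (hf k) i).integrable_mul hψ) ?_
  have h1 : Tendsto (fun k => eLpNorm (fun x => f k x - u x) 2 vol * eLpNorm ψ 2 vol) atTop (𝓝 0) := by
    have := ENNReal.Tendsto.mul_const (b := eLpNorm ψ 2 vol) h (Or.inr hψ.2.ne)
    rwa [zero_mul] at this
  refine tendsto_zero_of_le h1 fun k => ?_
  have hm : AEStronglyMeasurable (fun x => f k x i - u x i) vol := (memLp_apply (hf k) i).1.sub (memLp_apply hu i).1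
  calc _ = eLpNorm ((fun x => f k x i - u x i) • ψ) 1 vol := by
        congr 1; ext x; simp [sub_mul]
    _ ≤ eLpNorm (fun x => f k x i - u x i) 2 vol * eLpNorm ψ 2 vol := eLpNorm_smul_le_mul_eLpNorm hψ.1 hm
    _ ≤ _ := by
        gcongr
        refine eLpNorm_mono fun x => ?_
        exact PiLp.norm_apply_le (f k x - u x) i

/-- Integration by parts against a test function. -/
lemma integral_mul_pd {φ : VecField} (hφ : ContDiff ℝ ∞ φ) {ψ : Plane → ℝ} (hψ : IsTest ψ) (i j : Fin 3) :
    ∫ x, φ x j * pd i ψ x ∂vol = - ∫ x, grad φ x (i, j) * ψ x ∂vol := by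
  have hψi := isTest_pd hψ i
  rw [integral_vol_eq (fun x hx => by rw [hψi.eq_zero hx, mul_zero]),
    integral_vol_eq (fun x hx => by rw [hψ.eq_zero hx, mul_zero])]
  have hc : ContDiff ℝ ∞ fun x => φ x j := (EuclideanSpace.proj (𝕜 := ℝ) j : Vec ℝ →L[ℝ] ℝ).contDiff.comp hφ
  have hd : ∀ x, fderiv ℝ (fun x => φ x j) x (dir i) = grad φ x (i, j) := fun x => by
    have := ((EuclideanSpace.proj (𝕜 := ℝ) j : Vec ℝ →L[ℝ] ℝ).hasFDerivAt.comp x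
      (hφ.differentiable (by simp) x).hasFDerivAt).fderiv
    have h2 : fderiv ℝ (fun x => φ x j) x = _ := this
    rw [h2]; rfl
  have hgc : Continuous fun x => grad φ x (i, j) :=
    (EuclideanSpace.proj (𝕜 := ℝ) (i, j) : Ten ℝ →L[ℝ] ℝ).continuous.comp (continuous_grad hφ)
  have := integral_mul_fderiv_eq_neg_fderiv_mul_of_integrable (μ := (volume : Measure Plane)) (f := fun x => φ x j) (g := ψ)
    (v := dir i) ?_ ?_ ?_ (fun x _ => hc.differentiable (by simp) x) (fun x _ => hψ.1.differentiable (by simp) x)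
  · simp only [hd] at this
    exact this
  · simp only [hd]
    exact (hgc.mul hψ.1.continuous).integrable_of_hasCompactSupport hψ.2.1.mul_left
  · exact (hc.continuous.mul hψi.1.continuous).integrable_of_hasCompactSupport hψi.2.1.mul_left
  · exact (hc.continuous.mul hψ.1.continuous).integrable_of_hasCompactSupport hψ.2.1.mul_left

lemma isWeakGrad_of_contDiff {φ : VecField} (hφ : ContDiff ℝ ∞ φ) : IsWeakGrad φ (grad φ) :=
  ⟨hφ.continuous.locallyIntegrable.locallyIntegrableOn _, (continuous_grad hφ).locallyIntegrable.locallyIntegrableOn _,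
    fun _ hψ i j => integral_mul_pd hφ hψ i j⟩

lemma locallyIntegrableOn_of_memLp {E : Type} [NormedAddCommGroup E] {f : Plane → E} (h : MemLp f 2 vol) :
    LocallyIntegrableOn f Ω :=
  locallyIntegrableOn_of_locallyIntegrable_restrict (h.locallyIntegrable one_le_two)

lemma isWeakGrad_of_tendsto {φ : ℕ → VecField} (hφ : ∀ k, IsTest (φ k)) {w : VecField} {Dw : TenField}
    (hw : MemLp w 2 vol) (hD : MemLp Dw 2 vol)
    (h1 : Tendsto (fun k => eLpNorm (fun x => φ k x - w x) 2 vol) atTop (𝓝 0))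
    (h2 : Tendsto (fun k => eLpNorm (fun x => grad (φ k) x - Dw x) 2 vol) atTop (𝓝 0)) : IsWeakGrad w Dw := by
  refine ⟨locallyIntegrableOn_of_memLp hw, locallyIntegrableOn_of_memLp hD, fun ψ hψ i j => ?_⟩
  have a := tendsto_integral_mul (fun k => (hφ k).memLp 2) hw h1 j ((isTest_pd hψ i).memLp 2)
  have b := tendsto_integral_mul (fun k => memLp_grad (hφ k) 2) hD h2 (i, j) (hψ.memLp 2)
  simp only [integral_mul_pd (hφ _).1 hψ] at a
  exact tendsto_nhds_unique a b.neg

lemma integrable_apply {ι : Type} [Fintype ι] {f : Plane → EuclideanSpace ℝ ι} {μ : Measure Plane} (h : Integrable f μ)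
    (i : ι) : Integrable (fun x => f x i) μ :=
  (EuclideanSpace.proj (𝕜 := ℝ) i : EuclideanSpace ℝ ι →L[ℝ] ℝ).integrable_comp h

lemma integrable_mul_test {ι : Type} [Fintype ι] {f : Plane → EuclideanSpace ℝ ι} (hf : LocallyIntegrableOn f Ω)
    {ψ : Plane → ℝ} (hψ : IsTest ψ) (i : ι) : Integrable (fun x => f x i * ψ x) vol := by
  have h1 : IntegrableOn f (tsupport ψ) := hf.integrableOn_compact_subset hψ.2.2 hψ.2.1
  have h2 : IntegrableOn (fun x => f x i) (tsupport ψ) := integrable_apply h1 i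
  obtain ⟨C, hC⟩ := hψ.1.continuous.bounded_above_of_compact_support hψ.2.1
  have h3 : IntegrableOn (fun x => f x i * ψ x) (tsupport ψ) :=
    h2.mul_bdd (c := C) hψ.1.continuous.aestronglyMeasurable (ae_of_all _ hC)
  refine ((integrableOn_iff_integrable_of_support_subset ?_).1 h3).restrict
  intro x hx
  by_contra hh
  exact hx (by simp [image_eq_zero_of_notMem_tsupport hh])

lemma ae_eq_zero_of_integral_mul {f : Plane → ℝ} (hf : LocallyIntegrableOn f Ω)
    (h : ∀ ψ : Plane → ℝ, IsTest ψ → ∫ x, f x * ψ x ∂vol = 0) : ∀ᵐ x ∂vol, f x = 0 := by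
  have := IsOpen.ae_eq_zero_of_integral_contDiff_smul_eq_zero isOpen_Ω hf fun ψ h1 h2 h3 => by
    have hψ : IsTest ψ := ⟨h1, h2, h3⟩
    have h4 := h ψ hψ
    rw [integral_vol_eq fun x hx => by rw [hψ.eq_zero hx, mul_zero]] at h4
    rw [← h4]
    refine integral_congr_ae (ae_of_all _ fun x => ?_)
    simp [mul_comm]
  rw [vol, ae_restrict_iff' measurableSet_Ω]
  exact this

lemma locallyIntegrableOn_apply {ι : Type} [Fintype ι] {f : Plane → EuclideanSpace ℝ ι} (hf : LocallyIntegrableOn f Ω)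
    (i : ι) : LocallyIntegrableOn (fun x => f x i) Ω := by
  intro x hx
  obtain ⟨t, ht, h⟩ := hf x hx
  exact ⟨t, ht, integrable_apply h i⟩

namespace IsWeakGrad

lemma sub {u u' : VecField} {D D' : TenField} (h : IsWeakGrad u D) (h' : IsWeakGrad u' D') :
    IsWeakGrad (fun x => u x - u' x) (fun x => D x - D' x) := by
  refine ⟨h.1.sub h'.1, h.2.1.sub h'.2.1, fun ψ hψ i j => ?_⟩
  have hi := isTest_pd hψ i
  simp only [PiLp.sub_apply, sub_mul]
  rw [integral_sub (integrable_mul_test h.1 hi j) (integrable_mul_test h'.1 hi j),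
    integral_sub (integrable_mul_test h.2.1 hψ (i, j)) (integrable_mul_test h'.2.1 hψ (i, j)), h.2.2 ψ hψ, h'.2.2 ψ hψ]
  ring

lemma add {u u' : VecField} {D D' : TenField} (h : IsWeakGrad u D) (h' : IsWeakGrad u' D') :
    IsWeakGrad (fun x => u x + u' x) (fun x => D x + D' x) := by
  refine ⟨h.1.add h'.1, h.2.1.add h'.2.1, fun ψ hψ i j => ?_⟩
  have hi := isTest_pd hψ i
  simp only [PiLp.add_apply, add_mul]
  rw [integral_add (integrable_mul_test h.1 hi j) (integrable_mul_test h'.1 hi j),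
    integral_add (integrable_mul_test h.2.1 hψ (i, j)) (integrable_mul_test h'.2.1 hψ (i, j)), h.2.2 ψ hψ, h'.2.2 ψ hψ]
  ring

lemma congr {u u' : VecField} {D D' : TenField} (h : IsWeakGrad u D) (hu : u =ᵐ[vol] u')
    (hD : D =ᵐ[vol] D') : IsWeakGrad u' D' := by
  refine ⟨h.1.congr hu, h.2.1.congr hD, fun ψ hψ i j => ?_⟩
  have e1 : ∫ x, u' x j * pd i ψ x ∂vol = ∫ x, u x j * pd i ψ x ∂vol := by
    refine integral_congr_ae ?_
    filter_upwards [hu] with x hx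
    rw [hx]
  have e2 : ∫ x, D' x (i, j) * ψ x ∂vol = ∫ x, D x (i, j) * ψ x ∂vol := by
    refine integral_congr_ae ?_
    filter_upwards [hD] with x hx
    rw [hx]
  rw [e1, e2, h.2.2 ψ hψ i j]

/-- A weak gradient is unique. -/
lemma unique {u : VecField} {D D' : TenField} (h : IsWeakGrad u D) (h' : IsWeakGrad u D') :
    ∀ᵐ x ∂vol, D x = D' x := by
  have h1 := h.sub h'
  have h2 : ∀ᵐ x ∂vol, ∀ q, (D x - D' x) q = 0 := by
    refine ae_all_iff.2 fun q => ?_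
    refine ae_eq_zero_of_integral_mul (locallyIntegrableOn_apply h1.2.1 q) fun ψ hψ => ?_
    have := h1.2.2 ψ hψ q.1 q.2
    simp only [sub_self, PiLp.zero_apply, zero_mul, integral_zero] at this
    linarith
  filter_upwards [h2] with x hx
  ext q
  have := hx q
  rw [PiLp.sub_apply] at this
  linarith

/-- The trace of the weak gradient of a divergence-free field vanishes. -/
lemma trace_eq_zero {u : VecField} {D : TenField} (h : IsWeakGrad u D) (hu : WeakDivFree u) :
    ∀ᵐ x ∂vol, D x (0, 0) + D x (1, 1) = 0 := by
  refine ae_eq_zero_of_integral_mul ((locallyIntegrableOn_apply h.2.1 (0, 0)).add (locallyIntegrableOn_apply h.2.1 (1, 1)))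
    fun ψ hψ => ?_
  have h0 := hu ψ hψ
  rw [integral_add (integrable_mul_test h.1 (isTest_pd hψ 0) 0) (integrable_mul_test h.1 (isTest_pd hψ 1) 1),
    h.2.2 ψ hψ, h.2.2 ψ hψ] at h0
  simp only [add_mul]
  rw [integral_add (integrable_mul_test h.2.1 hψ _) (integrable_mul_test h.2.1 hψ _)]
  linarith

lemma weakDivFree {u : VecField} {D : TenField} (h : IsWeakGrad u D)
    (hD : ∀ᵐ x ∂vol, D x (0, 0) + D x (1, 1) = 0) : WeakDivFree u := by
  intro ψ hψ
  rw [integral_add (integrable_mul_test h.1 (isTest_pd hψ 0) 0) (integrable_mul_test h.1 (isTest_pd hψ 1) 1),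
    h.2.2 ψ hψ, h.2.2 ψ hψ, ← neg_add, ← integral_add (integrable_mul_test h.2.1 hψ _) (integrable_mul_test h.2.1 hψ _),
    neg_eq_zero]
  refine integral_eq_zero_of_ae ?_
  filter_upwards [hD] with x hx
  simp only [← add_mul, hx, zero_mul, Pi.zero_apply]

end IsWeakGrad

/-! ### Fields in the weighted spaces -/

section Amplitudes

variable {E : Type} [NormedAddCommGroup E] {s : ℝ} {f : ℤ → Plane → E}

/-- The weighted norms of the modes, as real numbers. -/
noncomputable def amp (s : ℝ) (f : ℤ → Plane → E) (n : ℤ) : ℝ := (wnorm s (f n)).toReal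

lemma amp_nonneg (s : ℝ) (f : ℤ → Plane → E) (n : ℤ) : 0 ≤ amp s f n := ENNReal.toReal_nonneg

lemma wnorm_le_amp (h : ∑' n, wnorm s (f n) < ⊤) (n : ℤ) : wnorm s (f n) ≤ ofReal (amp s f n) := by
  rw [amp, ENNReal.ofReal_toReal (ENNReal.ne_top_of_tsum_ne_top h.ne n)]

lemma summable_amp (h : ∑' n, wnorm s (f n) < ⊤) : Summable (amp s f) := ENNReal.summable_toReal h.ne

lemma tsum_amp (h : ∑' n, wnorm s (f n) < ⊤) : ∑' n, amp s f n = (∑' n, wnorm s (f n)).toReal :=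
  (ENNReal.tsum_toReal_eq (ENNReal.ne_top_of_tsum_ne_top h.ne)).symm

lemma norm_le_of_hasSum [CompleteSpace E] (h : ∑' n, wnorm s (f n) < ⊤) {g : Plane → E}
    (hs : ∀ᵐ x ∂vol, HasSum (fun n => f n x) (g x)) :
    ∀ᵐ x ∂vol, ‖g x‖ ≤ (∑' n, amp s f n) * rexp (-s * log ‖x‖) := by
  have h1 : ∀ᵐ x ∂vol, ∀ n, ‖x‖ ^ s * ‖f n x‖ ≤ amp s f n :=
    ae_all_iff.2 fun n => (wnorm_le_iff (amp_nonneg s f n)).1 (wnorm_le_amp h n)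
  filter_upwards [hs, h1, ae_vol_pos] with x hx h1 h0
  have hx0 := norm_pos_of_log h0
  have h2 : ∀ n, ‖f n x‖ ≤ amp s f n * rexp (-s * log ‖x‖) := fun n =>
    le_exp_of_weighted (by rw [exp_log hx0]; exact h1 n)
  have h3 : Summable fun n => ‖f n x‖ :=
    Summable.of_nonneg_of_le (fun _ => norm_nonneg _) h2 ((summable_amp h).mul_right _)
  rw [← hx.tsum_eq, ← tsum_mul_right]
  exact (norm_tsum_le_tsum_norm h3).trans (h3.tsum_le_tsum h2 ((summable_amp h).mul_right _))

end Amplitudes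

lemma norm_toLp_ofReal {ι : Type} [Fintype ι] (a : EuclideanSpace ℝ ι) :
    ‖(WithLp.toLp 2 fun j => (a j : ℂ) : EuclideanSpace ℂ ι)‖ = ‖a‖ := by
  rw [EuclideanSpace.norm_eq, EuclideanSpace.norm_eq]; simp

namespace MemL1Vec

variable {s : ℝ} {v : VecField}

lemma norm_le (h : MemL1Vec s v) :
    ∀ᵐ x ∂vol, ‖v x‖ ≤ (∑' n, amp s (fun n => projVec n v) n) * rexp (-s * log ‖x‖) := by
  filter_upwards [norm_le_of_hasSum h.2.2 h.2.1] with x hx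
  rwa [norm_toLp_ofReal] at hx

lemma bd (h : MemL1Vec s v) (n : ℤ) (k : Fin 3) : Bd s (amp s (fun n => projVec n v) n) (vm v n k) :=
  bd_vm h.1 (amp_nonneg _ _ _) (wnorm_le_amp h.2.2 n) k

lemma hasSum_cylVec (h : MemL1Vec s v) : ∀ᵐ t ∂hl, ∀ᵐ θ : ℝ ∂circ, ∀ k,
    HasSum (fun n : ℤ => vm v n k t * cexp (I * n * θ)) (cylVec v k (rexp t) θ : ℂ) := by
  filter_upwards [ae_ae_of_vol h.2.1] with t ht
  filter_upwards [ht] with θ hθ k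
  have he := exp_pos t
  have h1 := hasSum_sum fun j (_ : j ∈ Finset.univ) =>
    (hθ.mapL (EuclideanSpace.proj (𝕜 := ℂ) j : Vec ℂ →L[ℂ] ℂ)).mul_left (frame θ k j : ℂ)
  have e1 : ∀ n : ℤ, ∑ j, (frame θ k j : ℂ) * (EuclideanSpace.proj (𝕜 := ℂ) j : Vec ℂ →L[ℂ] ℂ) (projVec n v (pol (t, θ))) =
      vm v n k t * cexp (I * n * θ) := by
    intro n
    have e2 : ∀ j, (EuclideanSpace.proj (𝕜 := ℂ) j : Vec ℂ →L[ℂ] ℂ) (projVec n v (pol (t, θ))) =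
        ∑ l, vm v n l t * cexp (I * n * θ) * (frame θ l j : ℂ) := fun j => by
      simp only [projVec, norm_pol]
      rw [pol, frame_azimuth he, cexp_azimuth he]
      simp only [fourierMode_eq, vm]
      rfl
    simp only [e2, mul_sum]
    rw [sum_comm]
    have e3 : ∀ l, ∑ j, (frame θ k j : ℂ) * (vm v n l t * cexp (I * n * θ) * (frame θ l j : ℂ)) =
        (if k = l then 1 else 0) * (vm v n l t * cexp (I * n * θ)) := fun l => by
      have : ∑ j, (frame θ k j : ℂ) * (frame θ l j : ℂ) = if k = l then 1 else 0 := by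
        have := congrArg (fun a : ℝ => (a : ℂ)) (frame_mul_frame' θ k l)
        split_ifs at this ⊢ with hkl <;> simpa using this
      rw [← this, Finset.sum_mul]
      exact sum_congr rfl fun j _ => by ring
    simp only [e3]
    simp
  have e4 : ∑ j, (frame θ k j : ℂ) * (EuclideanSpace.proj (𝕜 := ℂ) j : Vec ℂ →L[ℂ] ℂ)
      (WithLp.toLp 2 fun j => (v (pol (t, θ)) j : ℂ)) = (cylVec v k (rexp t) θ : ℂ) := by
    simp [cylVec, pol]
  rw [e4] at h1
  exact (congrArg (fun f => HasSum f _) (funext e1)).mp h1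

lemma ae_vm_le (h : MemL1Vec s v) (hs : 0 ≤ s) :
    ∀ᵐ t ∂hl, ∀ n k, ‖vm v n k t‖ ≤ amp s (fun n => projVec n v) n := by
  filter_upwards [ae_all_iff.2 fun n => ae_all_iff.2 fun k => (h.bd n k).2, hl_pos] with t ht h0 n k
  refine (ht n k).trans (mul_le_of_le_one_right (amp_nonneg _ _ _) (exp_le_one_iff.2 ?_))
  nlinarith

lemma cylTen_tensorSq (v : VecField) (k l : Fin 3) (r θ : ℝ) :
    cylTen (fun x => tensorSq (v x)) k l r θ = cylVec v k r θ * cylVec v l r θ := by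
  simp only [cylTen, cylVec, tensorSq, Finset.sum_mul_sum]
  exact sum_congr rfl fun i _ => sum_congr rfl fun j _ => by ring

lemma norm_le_const (h : MemL1Vec s v) (hs : 0 ≤ s) :
    ∀ᵐ x ∂vol, ‖v x‖ ≤ ∑' n, amp s (fun n => projVec n v) n := by
  filter_upwards [h.norm_le, ae_vol_pos] with x hx h0
  refine hx.trans (mul_le_of_le_one_right (tsum_nonneg fun n => amp_nonneg _ _ _) (exp_le_one_iff.2 ?_))
  nlinarith

/-- The modes of `v ⊗ v` are the convolutions of those of `v`. -/
lemma tm_tensorSq (h : MemL1Vec s v) (hs : 0 ≤ s) :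
    ∀ᵐ t ∂hl, ∀ n k l, tm (fun x => tensorSq (v x)) n k l t = conv (vm v) (vm v) n k l t := by
  filter_upwards [h.hasSum_cylVec, h.ae_vm_le hs, ae_all_iff.2 fun k => ae_bm_cylVec h.1 (h.norm_le_const hs) k]
    with t h1 h2 h3 n k l
  have hsum : Summable fun m => ‖vm v m k t‖ :=
    Summable.of_nonneg_of_le (fun _ => norm_nonneg _) (fun n => h2 n k) (summable_amp h.2.2)
  have := hasSum_fc_mul hsum (by filter_upwards [h1] with θ hθ using hθ k) (h3 l) n
  rw [conv, tm, funext (cylTen_tensorSq v k l (rexp t))]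
  exact this.tsum_eq.symm

end MemL1Vec

lemma MemL1Ten.norm_le_const {s : ℝ} {F : TenField} (h : MemL1Ten s F) (hs : 0 ≤ s) :
    ∀ᵐ x ∂vol, ‖F x‖ ≤ ∑' n, amp s (fun n => projTen n F) n := by
  filter_upwards [norm_le_of_hasSum h.2.2 h.2.1, ae_vol_pos] with x hx h0
  rw [norm_toLp_ofReal] at hx
  refine hx.trans (mul_le_of_le_one_right (tsum_nonneg fun n => amp_nonneg _ _ _) (exp_le_one_iff.2 ?_))
  nlinarith

lemma summable_mul_shift {B : ℤ → ℝ} (hB : Summable B) (h0 : ∀ n, 0 ≤ B n) :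
    (∀ n, Summable fun m => B m * B (n - m)) ∧ Summable fun n => ∑' m, B m * B (n - m) := by
  have h1 : Summable fun q : ℤ × ℤ => B q.1 * B q.2 := hB.mul_of_nonneg hB h0 h0
  let e : ℤ × ℤ ≃ ℤ × ℤ := ⟨fun q => (q.2, q.1 - q.2), fun q => (q.1 + q.2, q.1), fun q => by simp, fun q => by simp⟩
  have h2 : Summable fun q : ℤ × ℤ => B q.2 * B (q.1 - q.2) := (e.summable_iff (f := fun q : ℤ × ℤ => B q.1 * B q.2)).2 h1
  exact ⟨fun n => h2.prod_factor n, h2.prod⟩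

lemma norm_conv_le {B : ℤ → ℝ} (hB : Summable B) (h0 : ∀ n, 0 ≤ B n) {w : ℤ → ModeVec} {t : ℝ}
    (h : ∀ n k, ‖w n k t‖ ≤ B n) (n : ℤ) (k l : Fin 3) : ‖conv w w n k l t‖ ≤ ∑' m, B m * B (n - m) := by
  have h1 : ∀ m, ‖w m k t * w (n - m) l t‖ ≤ B m * B (n - m) := fun m => by
    rw [norm_mul]
    exact mul_le_mul (h m k) (h _ l) (norm_nonneg _) (h0 m)
  exact tsum_of_norm_bounded ((summable_mul_shift hB h0).1 n).hasSum h1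

/-- Square integrability of fields that decay like `|x|^{-s}`, `s > 1`. -/
lemma memLp_of_decay {E : Type} [NormedAddCommGroup E] {v : Plane → E} (hv : AEStronglyMeasurable v vol) {s C : ℝ}
    (hs : 1 < s) (h : ∀ᵐ x ∂vol, ‖v x‖ ≤ C * rexp (-s * log ‖x‖)) : MemLp v 2 vol := by
  refine ⟨hv, ?_⟩
  refine lt_of_le_of_lt (eLpNorm_mono_ae_real h) ?_
  rw [eLpNorm_radial (f := fun t => C * rexp (-s * t)) (by fun_prop)]
  refine ENNReal.mul_lt_top (ENNReal.rpow_lt_top_of_nonneg (by norm_num) ENNReal.ofReal_ne_top) ?_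
  have hb : Bd (s - 1) |C| (fun t : ℝ => C * cexp ((-(s - 1) : ℝ) * t)) := by
    refine ⟨by fun_prop, ae_of_all _ fun t => ?_⟩
    rw [norm_mul, Complex.norm_exp]; simp
  refine lt_of_le_of_lt (eLpNorm_mono fun t => ?_) (hb.memLp (by linarith)).2
  rw [norm_mul, norm_mul, norm_mul, Complex.norm_exp, norm_eq_abs, norm_eq_abs, norm_eq_abs,
    abs_exp, abs_exp, norm_real, norm_eq_abs, mul_left_comm, ← Real.exp_add]
  refine le_of_eq ?_
  congr 2
  simp; ring

/-! ### The Hamel flow -/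

/-- A smooth field on the plane that coincides with the Hamel flow outside the unit disk. -/
noncomputable def hamelExt (α γ : ℝ) (x : Plane) : Vec ℝ := smoothTransition (2 * ‖x‖ ^ 2 - 1) • hamel α γ x

lemma hamelExt_eq (α γ : ℝ) {x : Plane} (hx : 1 ≤ ‖x‖) : hamelExt α γ x = hamel α γ x := by
  rw [hamelExt, Real.smoothTransition.one_of_one_le (by nlinarith), one_smul]

lemma contDiff_hamelExt (α γ : ℝ) : ContDiff ℝ ∞ (hamelExt α γ) := by
  have hn : ContDiff ℝ ∞ fun x : Plane => ‖x‖ ^ 2 := contDiff_norm_sq ℝ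
  refine contDiff_iff_contDiffAt.2 fun x => ?_
  by_cases hx : x = 0
  · have : hamelExt α γ =ᶠ[𝓝 x] fun _ => 0 := by
      filter_upwards [Metric.ball_mem_nhds x (by norm_num : (0:ℝ) < 1 / 2)] with y hy
      rw [hx, mem_ball_zero_iff] at hy
      rw [hamelExt, Real.smoothTransition.zero_of_nonpos (by nlinarith [norm_nonneg y]), zero_smul]
    exact contDiffAt_const.congr_of_eventuallyEq this
  · have h0 : ‖x‖ ^ 2 ≠ 0 := pow_ne_zero 2 (norm_ne_zero_iff.2 hx)
    have hc : ∀ j : Fin 2, ContDiffAt ℝ ∞ (fun y : Plane => y j / ‖y‖ ^ 2) x := fun j =>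
      ((EuclideanSpace.proj (𝕜 := ℝ) j : Plane →L[ℝ] ℝ).contDiff.contDiffAt).div hn.contDiffAt h0
    have hc' : ContDiffAt ℝ ∞ (fun y : Plane => -y 1 / ‖y‖ ^ 2) x :=
      ((EuclideanSpace.proj (𝕜 := ℝ) (1 : Fin 2) : Plane →L[ℝ] ℝ).contDiff.contDiffAt).neg.div hn.contDiffAt h0
    have hs : ContDiffAt ℝ ∞ (fun x : Plane => smoothTransition (2 * ‖x‖ ^ 2 - 1)) x :=
      (Real.smoothTransition.contDiff.comp ((contDiff_const.mul hn).sub contDiff_const)).contDiffAt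
    have hh : ContDiffAt ℝ ∞ (hamel α γ) x := by
      refine PiLp.contDiff_toLp.contDiffAt.comp x (contDiffAt_pi.2 fun j => ?_)
      fin_cases j
      · exact (contDiffAt_const.mul hc').sub (contDiffAt_const.mul (hc 0))
      · exact (contDiffAt_const.mul (hc 0)).sub (contDiffAt_const.mul (hc 1))
      · exact contDiffAt_const
    exact hs.smul hh

lemma cylVec_hamel (α γ : ℝ) (k : Fin 3) (t θ : ℝ) :
    cylVec (hamel α γ) k (rexp t) θ = rexp (-t) * (![-γ, α, 0] : Fin 3 → ℝ) k := by
  have he : rexp t ≠ 0 := (exp_pos t).ne'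
  have h := sin_sq_add_cos_sq θ
  simp only [cylVec, hamel, norm_polarPt (exp_pos t).le, Real.exp_neg, Fin.sum_univ_three]
  fin_cases k
  · simp [frame, polarPt]
    field_simp
    linear_combination (-γ) * h
  · simp [frame, polarPt]
    field_simp
    linear_combination α * h
  · simp [frame]

lemma cylVec_hamelExt (α γ : ℝ) (k : Fin 3) {t : ℝ} (ht : 0 ≤ t) (θ : ℝ) :
    cylVec (hamelExt α γ) k (rexp t) θ = rexp (-t) * (![-γ, α, 0] : Fin 3 → ℝ) k := by
  rw [← cylVec_hamel α γ k t θ]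
  simp only [cylVec]
  rw [hamelExt_eq]
  rw [norm_polarPt (exp_pos t).le]
  exact Real.one_le_exp ht

/-- The cylindrical components of the gradient of the Hamel flow. -/
lemma cylTen_grad_hamelExt (α γ : ℝ) (k l : Fin 3) {t : ℝ} (ht : 0 < t) (θ : ℝ) :
    cylTen (grad (hamelExt α γ)) k l (rexp t) θ =
      rexp (-2 * t) * (![![γ, -α, 0], ![-α, -γ, 0], ![0, 0, 0]] : Fin 3 → Fin 3 → ℝ) k l := by
  have hd : DifferentiableAt ℝ (hamelExt α γ) (pol (t, θ)) := (contDiff_hamelExt α γ).differentiable (by simp) _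
  have he : rexp t ≠ 0 := (exp_pos t).ne'
  have e1 : rexp (-2 * t) = rexp (-t) * (rexp t)⁻¹ := by
    rw [← Real.exp_neg, ← Real.exp_add]; congr 1; ring
  fin_cases k
  · have h1 := hasDerivAt_cylVec_fst hd l
    have h2 : HasDerivAt (fun t => cylVec (hamelExt α γ) l (rexp t) θ)
        (rexp (-t) * (-1) * (![-γ, α, 0] : Fin 3 → ℝ) l) t := by
      have h3 : HasDerivAt (fun t => rexp (-t) * (![-γ, α, 0] : Fin 3 → ℝ) l)
          (rexp (-t) * (-1) * (![-γ, α, 0] : Fin 3 → ℝ) l) t := (hasDerivAt_neg t).exp.mul_const _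
      refine h3.congr_of_eventuallyEq ?_
      filter_upwards [lt_mem_nhds ht] with s hs
      exact cylVec_hamelExt α γ l hs.le θ
    have h4 := h1.unique h2
    have h5 : cylTen (grad (hamelExt α γ)) 0 l (rexp t) θ =
        (rexp t)⁻¹ * (rexp (-t) * (-1) * (![-γ, α, 0] : Fin 3 → ℝ) l) := by
      rw [← h4, inv_mul_cancel_left₀ he]
    refine h5.trans ?_
    rw [e1]
    fin_cases l <;> simp <;> ring
  · have h1 := hasDerivAt_cylVec_snd hd l
    simp only [cylVec_hamelExt α γ _ ht.le] at h1
    have h4 := h1.unique (hasDerivAt_const θ _)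
    have h5 : cylTen (grad (hamelExt α γ)) 1 l (rexp t) θ =
        (rexp t)⁻¹ * -((![rexp (-t) * (![-γ, α, 0] : Fin 3 → ℝ) 1, -(rexp (-t) * (![-γ, α, 0] : Fin 3 → ℝ) 0), 0] :
          Fin 3 → ℝ) l) := by
      rw [← eq_neg_of_add_eq_zero_left h4, inv_mul_cancel_left₀ he]
    refine h5.trans ?_
    rw [e1]
    fin_cases l <;> simp <;> ring
  · refine (cylTen_grad_two _ _ _ _).trans ?_
    fin_cases l <;> simp

lemma ae_hamelExt (α γ : ℝ) : hamelExt α γ =ᵐ[vol] hamel α γ := by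
  filter_upwards [ae_vol_mem] with x hx
  exact hamelExt_eq α γ (le_of_lt hx)

lemma isWeakGrad_hamel (α γ : ℝ) : IsWeakGrad (hamel α γ) (grad (hamelExt α γ)) :=
  (isWeakGrad_of_contDiff (contDiff_hamelExt α γ)).congr (ae_hamelExt α γ) (ae_eq_refl _)

lemma aestronglyMeasurable_hamel (α γ : ℝ) : AEStronglyMeasurable (hamel α γ) vol :=
  ((contDiff_hamelExt α γ).continuous.aestronglyMeasurable).congr (ae_hamelExt α γ)

lemma aestronglyMeasurable_grad_hamelExt (α γ : ℝ) : AEStronglyMeasurable (grad (hamelExt α γ)) vol :=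
  (continuous_grad (contDiff_hamelExt α γ)).aestronglyMeasurable

lemma norm_hamel_le (α γ : ℝ) : ∀ᵐ x ∂vol, ‖hamel α γ x‖ ≤ |γ| + |α| := by
  filter_upwards [ae_vol_pos] with x h0
  have hx := norm_pos_of_log h0
  refine (norm_vec_le _ hx).trans ?_
  rw [← exp_log hx]
  simp only [cylVec_hamel, Fin.sum_univ_three, abs_mul, abs_exp]
  simp only [Matrix.cons_val_zero, Matrix.cons_val_one, Matrix.cons_val, abs_neg, abs_zero, mul_zero, add_zero, ← mul_add]
  exact mul_le_of_le_one_left (by positivity) (exp_le_one_iff.2 (by linarith))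

lemma norm_grad_hamelExt_le (α γ : ℝ) :
    ∀ᵐ x ∂vol, ‖grad (hamelExt α γ) x‖ ≤ (2 * |γ| + 2 * |α|) * rexp (-2 * log ‖x‖) := by
  filter_upwards [ae_vol_pos] with x h0
  have hx := norm_pos_of_log h0
  refine (norm_ten_le _ hx).trans ?_
  rw [← exp_log hx]
  simp only [cylTen_grad_hamelExt α γ _ _ h0, Real.log_exp, Fin.sum_univ_three, abs_mul, abs_exp]
  refine le_of_eq ?_
  simp; ring

lemma memLp_grad_hamelExt (α γ : ℝ) : MemLp (grad (hamelExt α γ)) 2 vol :=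
  memLp_of_decay (aestronglyMeasurable_grad_hamelExt α γ) one_lt_two (norm_grad_hamelExt_le α γ)

lemma trace_grad_hamelExt (α γ : ℝ) :
    ∀ᵐ x ∂vol, grad (hamelExt α γ) x (0, 0) + grad (hamelExt α γ) x (1, 1) = 0 := by
  filter_upwards [ae_vol_pos] with x h0
  have h := divh_eq_trace (hamelExt α γ) (log ‖x‖) (azimuth x)
  rw [pol_azimuth (norm_pos_of_log h0), cylTen_grad_hamelExt α γ _ _ h0, cylTen_grad_hamelExt α γ _ _ h0] at h
  simp at h
  exact h

lemma fc_const (n : ℤ) (c : ℝ) : fc n (fun _ => c) = if n = 0 then (c : ℂ) else 0 := by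
  have := fc_const_mul c (fun _ => 1) n
  simp only [mul_one] at this
  rw [this, fc_one]
  split_ifs <;> simp

/-- The Hamel flow solves the homogeneous equations. -/
lemma integral_hamel_test (α γ : ℝ) {φ : VecField} (hφ : IsTest φ) (hd : ∀ x, divh φ x = 0) :
    ∫ x, inner ℝ (grad (hamelExt α γ) x - tensorSq (hamel α γ x)) (grad φ x) ∂vol = 0 := by
  set T : TenField := fun x => grad (hamelExt α γ) x - tensorSq (hamel α γ x) with hT
  set c : Fin 3 → Fin 3 → ℝ := fun k l => (![![γ, -α, 0], ![-α, -γ, 0], ![0, 0, 0]] : Fin 3 → Fin 3 → ℝ) k l -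
    (![-γ, α, 0] : Fin 3 → ℝ) k * (![-γ, α, 0] : Fin 3 → ℝ) l with hc
  have hcyl : ∀ k l t, 0 < t → ∀ θ, cylTen T k l (rexp t) θ = rexp (-2 * t) * c k l := by
    intro k l t ht θ
    rw [hT, cylTen_sub, cylTen_grad_hamelExt α γ k l ht, MemL1Vec.cylTen_tensorSq, cylVec_hamel, cylVec_hamel, hc]
    have : rexp (-2 * t) = rexp (-t) * rexp (-t) := by rw [← Real.exp_add]; congr 1; ring
    rw [this]; ring
  have htm : ∀ n k l t, 0 < t → tm T n k l t = if n = 0 then ((rexp (-2 * t) * c k l : ℝ) : ℂ) else 0 := by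
    intro n k l t ht
    rw [tm, funext (hcyl k l t ht), fc_const]
  have hTm : AEStronglyMeasurable T vol := by
    refine (aestronglyMeasurable_grad_hamelExt α γ).sub ?_
    have hq : Continuous (tensorSq : Vec ℝ → Ten ℝ) := by
      unfold tensorSq; fun_prop
    exact hq.comp_aestronglyMeasurable (aestronglyMeasurable_hamel α γ)
  set M : ℝ := ∑ k, ∑ l, |c k l| with hM
  have hcM : ∀ k l, |c k l| ≤ M := fun k l =>
    (single_le_sum (f := fun l => |c k l|) (fun _ _ => abs_nonneg _) (Finset.mem_univ l)).trans
      (single_le_sum (f := fun k => ∑ l, |c k l|) (fun _ _ => sum_nonneg fun _ _ => abs_nonneg _) (Finset.mem_univ k))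
  have hTM : ∀ᵐ x ∂vol, ‖T x‖ ≤ M := by
    filter_upwards [ae_vol_pos] with x h0
    have hx := norm_pos_of_log h0
    refine (norm_ten_le T hx).trans ?_
    rw [← exp_log hx]
    simp only [hcyl _ _ _ h0, abs_mul, abs_exp]
    refine sum_le_sum fun k _ => sum_le_sum fun l _ => ?_
    exact mul_le_of_le_one_left (abs_nonneg _) (exp_le_one_iff.2 (by linarith))
  have key := hasSum_pairing (g := fun _ => 0) (A := fun n => if n = 0 then M else 0) hTm hTM
    aestronglyMeasurable_const (ae_of_all _ fun x => by
      rw [norm_zero]; exact sum_nonneg fun _ _ => sum_nonneg fun _ _ => abs_nonneg _)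
    (summable_of_ne_finset_zero (s := {0}) fun n hn => by simp at hn; simp [hn]) (fun n k l => by
      filter_upwards [hl_pos] with t ht
      rw [htm n k l t ht]
      split_ifs
      · rw [norm_real, norm_eq_abs, abs_mul, abs_exp]
        exact (mul_le_of_le_one_left (abs_nonneg _) (exp_le_one_iff.2 (by linarith))).trans (hcM k l)
      · simp) (fun n k => ae_of_all _ fun t => by
        have : vm (fun _ => (0 : Vec ℝ)) n k t = 0 := by simp [vm, fc, cylVec]
        rw [this, norm_zero]
        split_ifs
        · exact sum_nonneg fun _ _ => sum_nonneg fun _ _ => abs_nonneg _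
        · exact le_rfl) hφ
  -- the mode of index zero
  have hη := fun k => vm_tst hφ 0 k
  have hη0 : ∀ t, vm φ 0 0 t = 0 := by
    have h1 : ∀ t : ℝ, HasDerivAt (fun t : ℝ => cexp ((1:ℂ) * t) * vm φ 0 0 t) 0 t := fun t => by
      refine (hasDerivAt_exp_mul 1 ((hη 0).hasDerivAt t)).congr_deriv ?_
      have := vm_div hφ.1 hd 0 t
      simp only [Int.cast_zero, mul_zero, zero_mul, add_zero] at this
      linear_combination cexp ((1:ℂ) * t) * this
    intro t
    have h2 := is_const_of_deriv_eq_zero (fun t => (h1 t).differentiableAt) (fun t => (h1 t).deriv) t 0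
    rw [(hη 0).eq_zero_of_nonpos le_rfl, mul_zero] at h2
    exact (mul_eq_zero.1 h2).resolve_left (Complex.exp_ne_zero _)
  have hzero : ∀ n : ℤ, ∫ t, rexp (2 * t) * (pairMode T (fun _ => 0) φ n t).re ∂hl = 0 := by
    intro n
    have hv0 : ∀ n k t, vm (fun _ => (0 : Vec ℝ)) n k t = 0 := fun n k t => by simp [vm, fc, cylVec]
    rcases eq_or_ne n 0 with rfl | hn
    · set χ : ℝ → ℂ := fun t => ((γ * α - α : ℝ) : ℂ) * (cexp ((-1:ℂ) * t) * vm φ 0 1 t) with hχ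
      have hχt : Tst χ := ((hη 1).exp_mul (-1)).const_mul _
      have hχd : ∀ t : ℝ, deriv χ t = ((γ * α - α : ℝ) : ℂ) * (-1 * (cexp ((-1:ℂ) * t) * vm φ 0 1 t) +
          cexp ((-1:ℂ) * t) * deriv (vm φ 0 1) t) := fun t => by
        refine HasDerivAt.deriv ?_
        refine ((hasDerivAt_exp_mul (-1) ((hη 1).hasDerivAt t)).const_mul _).congr_deriv ?_
        ring
      have h1 : ∀ᵐ t ∂hl, rexp (2 * t) * (pairMode T (fun _ => 0) φ 0 t).re = (deriv χ t).re := by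
        filter_upwards [hl_pos] with t ht
        rw [← re_ofReal_mul, hχd]
        congr 1
        have h0' : deriv (vm φ 0 0) t = 0 := by
          have : vm φ 0 0 = fun _ => 0 := funext hη0
          rw [this]; simp
        have e2 : ((rexp (2 * t) : ℝ) : ℂ) * ((rexp (-2 * t) : ℝ) : ℂ) = 1 := by
          rw [← Complex.ofReal_mul, ← Real.exp_add]; simp
        simp only [pairMode, neg_zero, hv0, tm_grad hφ.1, htm _ _ _ t ht, if_true, Fin.sum_univ_three, gradMode, hη0, h0']
        simp [hc]
        simp only [Complex.ofReal_exp] at e2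
        push_cast [neg_mul] at e2
        linear_combination (((γ:ℂ) * α - α) * (cexp (-(t:ℂ)) * deriv (vm φ 0 1) t -
          cexp (-(t:ℂ)) * vm φ 0 1 t)) * e2
      rw [integral_congr_ae h1]
      have h2 := integral_re hχt.deriv.integrable
      simp only [RCLike.re_eq_complex_re] at h2
      rw [h2, hχt.integral_deriv]; simp
    · refine integral_eq_zero_of_ae ?_
      filter_upwards [hl_pos] with t ht
      simp [pairMode, htm _ _ _ t ht, hn, hv0]
  have h1 := key.unique (by simp only [hzero]; exact hasSum_zero)
  have h2 : ∫ x, pairing T (fun _ => 0) φ x ∂vol = 0 := by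
    have := Real.two_pi_pos.ne'
    simpa [Real.pi_ne_zero] using h1
  simpa [pairing] using h2

/-! ### The equations for the perturbation of the Hamel flow -/

/-- The tensor `a ⊗ b`. -/
noncomputable def outer (a b : Vec ℝ) : Ten ℝ := WithLp.toLp 2 fun p => a p.1 * b p.2

/-- The flux `∇w - V ⊗ w - w ⊗ V - w ⊗ w + F` of the equations for the perturbation `w` of the Hamel flow `V`. -/
noncomputable def flux (α γ : ℝ) (w : VecField) (Dw F : TenField) (x : Plane) : Ten ℝ :=
  Dw x - outer (hamel α γ x) (w x) - outer (w x) (hamel α γ x) - tensorSq (w x) + F x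

lemma cylTen_outer (v w : VecField) (k l : Fin 3) (r θ : ℝ) :
    cylTen (fun x => outer (v x) (w x)) k l r θ = cylVec v k r θ * cylVec w l r θ := by
  simp only [cylTen, cylVec, outer, Finset.sum_mul_sum]
  exact sum_congr rfl fun i _ => sum_congr rfl fun j _ => by ring

lemma cylTen_add (F H : TenField) (k l : Fin 3) (r θ : ℝ) :
    cylTen (fun x => F x + H x) k l r θ = cylTen F k l r θ + cylTen H k l r θ := by
  simp [cylTen, mul_add, Finset.sum_add_distrib]

lemma norm_outer (a b : Vec ℝ) : ‖outer a b‖ = ‖a‖ * ‖b‖ := by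
  rw [EuclideanSpace.norm_eq, EuclideanSpace.norm_eq, EuclideanSpace.norm_eq, ← Real.sqrt_mul (by positivity),
    Finset.sum_mul_sum, Fintype.sum_prod_type]
  congr 1
  refine sum_congr rfl fun i _ => sum_congr rfl fun j _ => ?_
  simp [outer, mul_pow]

lemma tensorSq_eq (a : Vec ℝ) : tensorSq a = outer a a := rfl

lemma aestronglyMeasurable_outer {v w : VecField} (hv : AEStronglyMeasurable v vol) (hw : AEStronglyMeasurable w vol) :
    AEStronglyMeasurable (fun x => outer (v x) (w x)) vol := by
  have hc : Continuous fun p : Vec ℝ × Vec ℝ => outer p.1 p.2 := by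
    unfold outer; fun_prop
  exact hc.comp_aestronglyMeasurable (hv.prodMk hw)

lemma aestronglyMeasurable_flux (α γ : ℝ) {w : VecField} {Dw F : TenField} (hw : AEStronglyMeasurable w vol)
    (hD : AEStronglyMeasurable Dw vol) (hF : AEStronglyMeasurable F vol) : AEStronglyMeasurable (flux α γ w Dw F) vol :=
  (((hD.sub (aestronglyMeasurable_outer (aestronglyMeasurable_hamel α γ) hw)).sub
    (aestronglyMeasurable_outer hw (aestronglyMeasurable_hamel α γ))).sub (aestronglyMeasurable_outer hw hw)).add hF

lemma norm_flux_le (α γ : ℝ) {w : VecField} {Dw F : TenField} {M : ℝ} (hM : 0 ≤ M)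
    (hw : ∀ᵐ x ∂vol, ‖w x‖ ≤ M) (hD : ∀ᵐ x ∂vol, ‖Dw x‖ ≤ M) (hF : ∀ᵐ x ∂vol, ‖F x‖ ≤ M) :
    ∀ᵐ x ∂vol, ‖flux α γ w Dw F x‖ ≤ M + 2 * ((|γ| + |α|) * M) + M * M + M := by
  filter_upwards [hw, hD, hF, norm_hamel_le α γ] with x h1 h2 h3 h4
  refine (norm_add_le _ _).trans (add_le_add ((norm_sub_le _ _).trans (add_le_add
    ((norm_sub_le _ _).trans ?_) ?_)) h3)
  · rw [norm_outer]
    have h5 := norm_sub_le (Dw x) (outer (hamel α γ x) (w x))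
    rw [norm_outer] at h5
    have h6 : ‖hamel α γ x‖ * ‖w x‖ ≤ (|γ| + |α|) * M := by gcongr
    linarith [mul_comm ‖w x‖ ‖hamel α γ x‖]
  · rw [tensorSq_eq, norm_outer]; gcongr

lemma cylTen_flux (α γ : ℝ) (w : VecField) (Dw F : TenField) (k l : Fin 3) (t θ : ℝ) :
    cylTen (flux α γ w Dw F) k l (rexp t) θ = cylTen Dw k l (rexp t) θ +
      (-(rexp (-t) * (![-γ, α, 0] : Fin 3 → ℝ) k) * cylVec w l (rexp t) θ +
      (-(rexp (-t) * (![-γ, α, 0] : Fin 3 → ℝ) l) * cylVec w k (rexp t) θ +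
      ((-1) * cylTen (fun x => tensorSq (w x)) k l (rexp t) θ + cylTen F k l (rexp t) θ))) := by
  have h : cylTen (flux α γ w Dw F) k l (rexp t) θ = cylTen Dw k l (rexp t) θ -
      cylVec (hamel α γ) k (rexp t) θ * cylVec w l (rexp t) θ -
      cylVec w k (rexp t) θ * cylVec (hamel α γ) l (rexp t) θ -
      cylTen (fun x => tensorSq (w x)) k l (rexp t) θ + cylTen F k l (rexp t) θ := by
    rw [← cylTen_outer (hamel α γ) w, ← cylTen_outer w (hamel α γ), ← cylTen_sub, ← cylTen_sub, ← cylTen_sub, ← cylTen_add]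
    rfl
  rw [h, cylVec_hamel, cylVec_hamel]
  ring

lemma BM.const_mul {M : ℝ} {a : ℝ → ℝ} (c : ℝ) (h : BM M a) : BM (|c| * M) (fun θ => c * a θ) := (BM.const c).mul h

lemma hamelMode_eq (α γ : ℝ) (k : Fin 3) (t : ℝ) :
    hamelMode α γ k t = ((rexp (-t) * (![-γ, α, 0] : Fin 3 → ℝ) k : ℝ) : ℂ) := by
  rw [hamelMode]
  push_cast
  congr 1
  · congr 1; ring
  · fin_cases k <;> simp

/-- The modes of the flux. -/
lemma tm_flux (α γ : ℝ) {w : VecField} {Dw F : TenField} {s M : ℝ} (hs : 0 ≤ s) (h : MemL1Vec s w)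
    (hD : AEStronglyMeasurable Dw vol) (hF : AEStronglyMeasurable F vol)
    (hDM : ∀ᵐ x ∂vol, ‖Dw x‖ ≤ M) (hFM : ∀ᵐ x ∂vol, ‖F x‖ ≤ M) :
    ∀ᵐ t ∂hl, ∀ n k l, tm (flux α γ w Dw F) n k l t = tm Dw n k l t - hamelMode α γ k t * vm w n l t
      - vm w n k t * hamelMode α γ l t - conv (vm w) (vm w) n k l t + tm F n k l t := by
  have hwM := h.norm_le_const hs
  filter_upwards [h.tm_tensorSq hs, ae_all_iff.2 fun k => ae_bm_cylVec h.1 hwM k,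
    ae_all_iff.2 fun k => ae_all_iff.2 fun l => ae_bm_cylTen hD hDM k l,
    ae_all_iff.2 fun k => ae_all_iff.2 fun l => ae_bm_cylTen hF hFM k l] with t h1 h2 h3 h4 n k l
  have h5 := ((h2 k).mul (h2 l))
  obtain ⟨K, h6⟩ : ∃ K, BM K (cylTen (fun x => tensorSq (w x)) k l (rexp t)) := by
    rw [funext (MemL1Vec.cylTen_tensorSq w k l (rexp t))]; exact ⟨_, h5⟩
  have b1 := (h6.const_mul (-1)).add (h4 k l)
  have b2 := ((h2 k).const_mul (-(rexp (-t) * (![-γ, α, 0] : Fin 3 → ℝ) l))).add b1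
  have b3 := ((h2 l).const_mul (-(rexp (-t) * (![-γ, α, 0] : Fin 3 → ℝ) k))).add b2
  have e0 : tm (flux α γ w Dw F) n k l t = _ := congrArg (fc n) (funext (cylTen_flux α γ w Dw F k l t))
  rw [e0, fc_add (h3 k l) b3, fc_add ((h2 l).const_mul _) b2, fc_add ((h2 k).const_mul _) b1,
    fc_add (h6.const_mul (-1)) (h4 k l)]
  have e1 := fc_const_mul (-(rexp (-t) * (![-γ, α, 0] : Fin 3 → ℝ) k)) (cylVec w l (rexp t)) n
  have e2 := fc_const_mul (-(rexp (-t) * (![-γ, α, 0] : Fin 3 → ℝ) l)) (cylVec w k (rexp t)) n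
  have e3 := fc_const_mul (-1) (cylTen (fun x => tensorSq (w x)) k l (rexp t)) n
  rw [e1, e2, e3, hamelMode_eq, hamelMode_eq]
  have e4 := h1 n k l
  simp only [tm, vm] at e4 ⊢
  rw [e4]
  push_cast
  ring

/-- The pairing of the flux with a mode of a test field is the weak form of the equations for the modes. -/
lemma pairing_eq_modeInt (α γ : ℝ) {w g : VecField} {Dw F : TenField} {s M : ℝ} (hs : 0 ≤ s) (h : MemL1Vec s w)
    (hD : AEStronglyMeasurable Dw vol) (hF : AEStronglyMeasurable F vol)
    (hDM : ∀ᵐ x ∂vol, ‖Dw x‖ ≤ M) (hFM : ∀ᵐ x ∂vol, ‖F x‖ ≤ M) {W P : ℤ → ModeVec}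
    (hW : ∀ᵐ t ∂hl, ∀ n k, vm w n k t = W n k t)
    (hP : ∀ᵐ t ∂hl, ∀ n k l, tm Dw n k l t = gradMode n (W n) (P n) k l t) :
    ∀ᵐ t : ℝ ∂hl, ∀ (n : ℤ) (η : ModeVec), cexp ((2:ℂ) * t) * (∑ k, ∑ l, tm (flux α γ w Dw F) n k l t *
      gradMode (-n) η (fun k => deriv (η k)) k l t - ∑ k, vm g n k t * η k t) =
      modeInt α γ n (vm g n) (fun k l t => tm F n k l t - conv W W n k l t) (W n) (P n) η t := by
  filter_upwards [tm_flux α γ hs h hD hF hDM hFM, hW, hP] with t h1 h2 h3 n η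
  have hconv : ∀ k l, conv (vm w) (vm w) n k l t = conv W W n k l t := fun k l => by
    simp only [conv, h2]
  rw [modeInt]
  congr 2
  refine sum_congr rfl fun k _ => sum_congr rfl fun l _ => ?_
  rw [h1, h3, h2, h2, hconv]
  ring

/-- The weak form of the equations in terms of the perturbation of the Hamel flow. -/
lemma weak_iff (α γ : ℝ) {w g : VecField} {Dw F Du : TenField} {u : VecField} {M : ℝ} (hM : 0 ≤ M)
    (hwm : AEStronglyMeasurable w vol)
    (hD : AEStronglyMeasurable Dw vol) (hF : AEStronglyMeasurable F vol) (hg : AEStronglyMeasurable g vol)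
    (hwM : ∀ᵐ x ∂vol, ‖w x‖ ≤ M) (hDM : ∀ᵐ x ∂vol, ‖Dw x‖ ≤ M) (hFM : ∀ᵐ x ∂vol, ‖F x‖ ≤ M) (hgM : ∀ᵐ x ∂vol, ‖g x‖ ≤ M)
    (hu : ∀ᵐ x ∂vol, u x = hamel α γ x + w x) (hDu : ∀ᵐ x ∂vol, Du x = grad (hamelExt α γ) x + Dw x)
    {φ : VecField} (hφ : IsTest φ) (hd : ∀ x, divh φ x = 0) :
    (∫ x, inner ℝ (Du x) (grad φ x) ∂vol = ∫ x, inner ℝ (tensorSq (u x)) (grad φ x) ∂vol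
          + ∫ x, inner ℝ (g x) (φ x) ∂vol - ∫ x, inner ℝ (F x) (grad φ x) ∂vol) ↔
      ∫ x, pairing (flux α γ w Dw F) g φ x ∂vol = 0 := by
  have hcg := continuous_grad hφ.1
  have hsg := hasCompactSupport_grad hφ
  have hVm := aestronglyMeasurable_hamel α γ
  have hVM := norm_hamel_le α γ
  have hGm := aestronglyMeasurable_grad_hamelExt α γ
  have hGM : ∀ᵐ x ∂vol, ‖grad (hamelExt α γ) x‖ ≤ 2 * |γ| + 2 * |α| := by
    filter_upwards [norm_grad_hamelExt_le α γ, ae_vol_pos] with x hx h0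
    exact hx.trans (mul_le_of_le_one_right (by positivity) (exp_le_one_iff.2 (by linarith)))
  have i1 : Integrable (fun x => inner ℝ (Du x) (grad φ x)) vol := by
    refine integrable_inner_test (M := 2 * |γ| + 2 * |α| + M) ((hGm.add hD).congr ?_) ?_ hcg hsg
    · filter_upwards [hDu] with x hx
      rw [hx]; rfl
    · filter_upwards [hDu, hGM, hDM] with x hx h1 h2
      rw [hx]
      exact (norm_add_le _ _).trans (add_le_add h1 h2)
  have hum : AEStronglyMeasurable u vol := (hVm.add hwm).congr (by
    filter_upwards [hu] with x hx
    rw [hx]; rfl)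
  have i2 : Integrable (fun x => inner ℝ (tensorSq (u x)) (grad φ x)) vol := by
    refine integrable_inner_test (M := (|γ| + |α| + M) * (|γ| + |α| + M)) (aestronglyMeasurable_outer hum hum) ?_ hcg hsg
    filter_upwards [hu, hVM, hwM] with x hx h1 h2
    have : ‖u x‖ ≤ |γ| + |α| + M := by rw [hx]; exact (norm_add_le _ _).trans (add_le_add h1 h2)
    rw [tensorSq_eq, norm_outer]
    gcongr
  have i3 := integrable_inner_test hg hgM hφ.1.continuous hφ.2.1
  have i4 := integrable_inner_test hF hFM hcg hsg
  have i5 : Integrable (fun x => inner ℝ (grad (hamelExt α γ) x - tensorSq (hamel α γ x)) (grad φ x)) vol := by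
    refine integrable_inner_test (M := 2 * |γ| + 2 * |α| + (|γ| + |α|) * (|γ| + |α|))
      (hGm.sub (aestronglyMeasurable_outer hVm hVm)) ?_ hcg hsg
    filter_upwards [hGM, hVM] with x h1 h2
    refine (norm_sub_le _ _).trans (add_le_add h1 ?_)
    rw [tensorSq_eq, norm_outer]
    gcongr
  have e1 : ∫ x, pairing (flux α γ w Dw F) g φ x ∂vol = ∫ x, inner ℝ (Du x) (grad φ x) ∂vol -
      ∫ x, inner ℝ (tensorSq (u x)) (grad φ x) ∂vol - ∫ x, inner ℝ (g x) (φ x) ∂vol + ∫ x, inner ℝ (F x) (grad φ x) ∂vol := by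
    have h0 := integral_hamel_test α γ hφ hd
    have i6 : Integrable (pairing (flux α γ w Dw F) g φ) vol := integrable_pairing (M := max (M + 2 * ((|γ| + |α|) * M) + M * M + M) M) (aestronglyMeasurable_flux α γ hwm hD hF)
        (by filter_upwards [norm_flux_le α γ hM hwM hDM hFM] with x hx using hx.trans (le_max_left _ _)) hg
        (by filter_upwards [hgM] with x hx using hx.trans (le_max_right _ _)) hφ
    rw [← integral_sub i1 i2, ← integral_sub (f := fun x => _ - _) (i1.sub i2) i3,
      ← integral_add (f := fun x => _ - _ - _) ((i1.sub i2).sub i3) i4]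
    rw [← add_zero (∫ x, pairing (flux α γ w Dw F) g φ x ∂vol), ← h0, ← integral_add i6 i5]
    refine integral_congr_ae ?_
    filter_upwards [hu, hDu] with x hx hx'
    have : tensorSq (u x) = tensorSq (hamel α γ x) + outer (hamel α γ x) (w x) + outer (w x) (hamel α γ x) + tensorSq (w x) := by
      rw [hx]
      ext p
      simp [tensorSq, outer]; ring
    rw [this, hx', pairing, flux]
    simp only [inner_add_left, inner_sub_left]
    ring
  rw [e1]
  constructor
  · intro h; linarith
  · intro h; linarith

/-! ### From the modes to the field -/

/-- The weak derivative of a function of one variable is unique. -/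
lemma WD.unique {f f' g' : ℝ → ℂ} (h : WD f f') (h' : WD f g') : f' =ᵐ[hl] g' := by
  have h1 := h.sub h'
  have h2 := ae_zero_of_integral_tst h1.gr' fun η hη => by
    have := h1.eq η hη
    simpa using this
  filter_upwards [h2] with t ht
  exact sub_eq_zero.1 ht

section Data

variable {ρ ε : ℝ} {g : VecField} {F : TenField}

lemma MemWeighted.norm_le {E : Type} [NormedAddCommGroup E] {s : ℝ} {f : Plane → E} (h : MemWeighted s f) (hs : 0 ≤ s) :
    ∃ M, 0 ≤ M ∧ ∀ᵐ x ∂vol, ‖f x‖ ≤ M := by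
  refine ⟨(wnorm s f).toReal, ENNReal.toReal_nonneg, ?_⟩
  have h1 := (wnorm_le_iff (s := s) (f := f) (A := (wnorm s f).toReal) ENNReal.toReal_nonneg).1
    (by rw [ENNReal.ofReal_toReal h.2.ne])
  filter_upwards [h1, ae_vol_mem] with x hx hm
  have : 1 ≤ ‖x‖ ^ s := Real.one_le_rpow (le_of_lt hm) hs
  exact (le_mul_of_one_le_left (norm_nonneg _) this).trans hx

/-- Bounds for the modes of the data. -/
lemma exists_data (hε : 0 ≤ ε) (hg : AEStronglyMeasurable g vol) (hF : AEStronglyMeasurable F vol)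
    (h : ∑' n : ℤ, (wnorm (2 * ρ - 1) (projVec n g) + wnorm (2 * (ρ - 1)) (projTen n F)) ≤ ofReal ε) :
    ∃ A : ℤ → ℝ, Summable A ∧ ∑' n, A n ≤ ε ∧ (∀ n k, Bd (2 * ρ - 1) (A n) (vm g n k)) ∧
      ∀ n k l, Bd (2 * (ρ - 1)) (A n) (tm F n k l) := by
  have ht : ∑' n : ℤ, (wnorm (2 * ρ - 1) (projVec n g) + wnorm (2 * (ρ - 1)) (projTen n F)) ≠ ⊤ :=
    (h.trans_lt ENNReal.ofReal_lt_top).ne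
  have hn := ENNReal.ne_top_of_tsum_ne_top ht
  refine ⟨fun n => (wnorm (2 * ρ - 1) (projVec n g) + wnorm (2 * (ρ - 1)) (projTen n F)).toReal,
    ENNReal.summable_toReal ht, ?_, fun n k => ?_, fun n k l => ?_⟩
  · rw [← ENNReal.tsum_toReal_eq hn]
    exact ENNReal.toReal_le_of_le_ofReal hε h
  · refine bd_vm hg ENNReal.toReal_nonneg ?_ k
    rw [ENNReal.ofReal_toReal (hn n)]
    exact le_self_add
  · refine bd_tm hF ENNReal.toReal_nonneg ?_ k l
    rw [ENNReal.ofReal_toReal (hn n)]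
    exact le_add_self

end Data

lemma norm_horiz_sub_le (a b : Vec ℝ) : ‖horiz a - horiz b‖ ≤ ‖a - b‖ := by
  rw [EuclideanSpace.norm_eq, EuclideanSpace.norm_eq]
  refine Real.sqrt_le_sqrt ?_
  simp only [horiz, Fin.sum_univ_three]
  simp
  positivity

lemma memLp_horiz {w : VecField} (hw : MemLp w 2 vol) : MemLp (fun x => horiz (w x)) 2 vol := by
  have hc : Continuous horiz := by
    unfold horiz
    refine (PiLp.continuous_toLp 2 _).comp (continuous_pi fun i => ?_)
    fin_cases i <;> simp <;> fun_prop
  refine hw.mono (hc.comp_aestronglyMeasurable hw.1) (ae_of_all _ fun x => ?_)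
  have := norm_horiz_sub_le (w x) 0
  have h0 : horiz 0 = 0 := by ext i; fin_cases i <;> simp [horiz]
  simpa [h0] using this

/-- Fields whose horizontal part belongs to `L²_σ` are divergence free. -/
lemma HorizMemL2sigma.weakDivFree {w : VecField} (hw : MemLp w 2 vol) (h : HorizMemL2sigma w) : WeakDivFree w := by
  obtain ⟨-, ψ, hψ, ht⟩ := h
  intro χ hχ
  have l : ∀ (i : Fin 3), Tendsto (fun k => ∫ x, horiz (ψ k x) i * pd i χ x ∂vol) atTop (𝓝 (∫ x, horiz (w x) i * pd i χ x ∂vol)) :=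
    fun i => tendsto_integral_mul (fun k => memLp_horiz ((hψ k).1.memLp 2)) (memLp_horiz hw) ht i ((isTest_pd hχ i).memLp 2)
  have hi : ∀ {v : VecField}, MemLp v 2 vol → ∀ i, Integrable (fun x => v x i * pd i χ x) vol := fun hv i =>
    (memLp_apply hv i).integrable_mul ((isTest_pd hχ i).memLp 2)
  have l2 := (l 0).add (l 1)
  rw [integral_add (hi hw 0) (hi hw 1)]
  refine tendsto_nhds_unique l2 (tendsto_const_nhds.congr fun k => ?_)
  have h0 := (isWeakGrad_of_contDiff (hψ k).1.1).weakDivFree (ae_of_all _ (hψ k).2) χ hχ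
  rw [integral_add (hi ((hψ k).1.memLp 2) 0) (hi ((hψ k).1.memLp 2) 1)] at h0
  exact h0.symm

lemma NonlinSol.realModes {α γ ρ : ℝ} {G : ℤ → ModeVec} {F : ℤ → ModeTen}
    {w p : ℤ → ModeVec} (h : NonlinSol α γ ρ G F w p) (hc : ∀ n k t, w (-n) k t = conj (w n k t))
    {B : ℤ → ℝ} (hB : Summable B) (hb : ∀ n k, Bd (ρ - 1) (B n) (w n k) ∧
      Bd (ρ - 1) (B n) (fun t => n * w n k t) ∧ Bd (ρ - 1) (B n) (p n k)) : RealModes ρ w p B := by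
  refine ⟨hB, fun n k => (hb n k).1, fun n k => (hb n k).2.1, fun n k => (hb n k).2.2, hc, fun n k => ?_⟩
  have h1 := ((h n).wd k).conj
  have h2 := (h (-n)).wd k
  rw [funext (hc n k)] at h2
  exact h2.unique h1

namespace RealModes

variable {α γ ρ : ℝ} {w p : ℤ → ModeVec} {B : ℤ → ℝ}

lemma memLp_fieldOf (h : RealModes ρ w p B) (hρ : 2 < ρ) : MemLp (fieldOf w) 2 vol :=
  memLp_of_decay h.aestronglyMeasurable_fieldOf (by linarith) h.norm_fieldOf_le

lemma memLp_gradOf (h : RealModes ρ w p B) (hρ : 2 < ρ) : MemLp (gradOf w p) 2 vol := by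
  have h1 := h.memL1Ten_gradOf.1
  refine memLp_of_decay h1.1 (s := ρ) (by linarith) (C := ∑' n, amp ρ (fun n => projTen n (gradOf w p)) n) ?_
  filter_upwards [norm_le_of_hasSum h1.2.2 h1.2.1] with x hx
  rwa [norm_toLp_ofReal] at hx

/-- Approximation of the field by divergence-free test fields. -/
lemma exists_seq {G : ℤ → ModeVec} {F : ℤ → ModeTen} (h : RealModes ρ w p B) (hρ : 2 < ρ)
    (hs : NonlinSol α γ ρ G F w p) :
    ∃ φ : ℕ → VecField, (∀ k, IsTest (φ k)) ∧ (∀ k x, divh (φ k) x = 0) ∧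
      Tendsto (fun k => eLpNorm (fun x => φ k x - fieldOf w x) 2 vol) atTop (𝓝 0) ∧
      Tendsto (fun k => eLpNorm (fun x => grad (φ k) x - gradOf w p x) 2 vol) atTop (𝓝 0) := by
  have hk : ∀ k : ℕ, ((k : ℝ≥0∞))⁻¹ ≠ 0 := fun k => ENNReal.inv_ne_zero.2 (ENNReal.natCast_ne_top k)
  choose φ h1 h2 h3 h4 using fun k : ℕ =>
    h.exists_test_approx hρ (fun n ε hε => (hs n).exists_approx hρ hε) (hk k)
  exact ⟨φ, h1, h2, tendsto_zero_of_le ENNReal.tendsto_inv_nat_nhds_zero h3, tendsto_zero_of_le ENNReal.tendsto_inv_nat_nhds_zero h4⟩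

lemma memW120_sigma {G : ℤ → ModeVec} {F : ℤ → ModeTen} (h : RealModes ρ w p B) (hρ : 2 < ρ)
    (hs : NonlinSol α γ ρ G F w p) : MemW120 (fieldOf w) (gradOf w p) ∧ HorizMemL2sigma (fieldOf w) := by
  obtain ⟨φ, h1, h2, h3, h4⟩ := h.exists_seq hρ hs
  have hw := h.memLp_fieldOf hρ
  have hD := h.memLp_gradOf hρ
  exact ⟨⟨isWeakGrad_of_tendsto h1 hw hD h3 h4, hw, hD, φ, h1, h3, h4⟩, memLp_horiz hw, φ, fun k => ⟨h1 k, h2 k⟩,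
    tendsto_zero_of_le h3
      fun k => eLpNorm_mono fun x => norm_horiz_sub_le _ _⟩

lemma inBall {G : ℤ → ModeVec} {F : ℤ → ModeTen} (h : RealModes ρ w p B) (hρ : 2 < ρ)
    (hs : NonlinSol α γ ρ G F w p) {δ : ℝ} (hδ : 21 * ∑' n, B n ≤ δ) : InBall ρ δ (fieldOf w) := by
  obtain ⟨hW, hS⟩ := h.memW120_sigma hρ hs
  refine ⟨gradOf w p, hW, hS, h.memL1Vec_fieldOf.1, h.memL1Ten_gradOf.1,
    (add_le_add h.memL1Vec_fieldOf.2 h.memL1Ten_gradOf.2).trans ?_⟩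
  have hB0 : 0 ≤ ∑' n, B n := tsum_nonneg h.nonneg
  rw [← ENNReal.ofReal_add (by positivity) (by positivity)]
  exact ENNReal.ofReal_le_ofReal (by linarith)

/-- The solution of the equations on the modes is a weak solution. -/
lemma integral_pairing_eq_zero {g : VecField} {F : TenField} (h : RealModes ρ w p B) (hρ : 2 < ρ)
    (hs : NonlinSol α γ ρ (vm g) (tm F) w p) {A : ℤ → ℝ} (hA : Summable A) {M : ℝ} (hM : 0 ≤ M)
    (hg : AEStronglyMeasurable g vol) (hF : AEStronglyMeasurable F vol)
    (hgM : ∀ᵐ x ∂vol, ‖g x‖ ≤ M) (hFM : ∀ᵐ x ∂vol, ‖F x‖ ≤ M)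
    (hgA : ∀ n k, Bd (2 * ρ - 1) (A n) (vm g n k)) (hFA : ∀ n k l, Bd (2 * (ρ - 1)) (A n) (tm F n k l))
    (hwM : ∀ᵐ x ∂vol, ‖fieldOf w x‖ ≤ M) (hDM : ∀ᵐ x ∂vol, ‖gradOf w p x‖ ≤ M)
    {φ : VecField} (hφ : IsTest φ) (hd : ∀ x, divh φ x = 0) :
    ∫ x, pairing (flux α γ (fieldOf w) (gradOf w p) F) g φ x ∂vol = 0 := by
  have hL := h.memL1Vec_fieldOf.1
  have hLT := h.memL1Ten_gradOf.1
  have hle : ∀ {s A : ℝ} {f : ℝ → ℂ}, 0 ≤ s → Bd s A f → ∀ᵐ t ∂hl, ‖f t‖ ≤ A := fun {s A f} hs hb => by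
    filter_upwards [hb.2, hl_pos] with t ht h0
    refine ht.trans (mul_le_of_le_one_right hb.nonneg (exp_le_one_iff.2 ?_))
    nlinarith
  have hwB : ∀ᵐ t ∂hl, ∀ n k, ‖w n k t‖ ≤ B n :=
    ae_all_iff.2 fun n => ae_all_iff.2 fun k => hle (by linarith) (h.bdw n k)
  have hgB : ∀ᵐ t ∂hl, ∀ n k l, ‖gradMode n (w n) (p n) k l t‖ ≤ 2 * B n :=
    ae_all_iff.2 fun n => ae_all_iff.2 fun k => ae_all_iff.2 fun l => hle (by linarith) (h.bdg n k l)
  have hVn : ∀ᵐ t ∂hl, ∀ k, ‖hamelMode α γ k t‖ ≤ |γ| + |α| := by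
    filter_upwards [hl_pos] with t ht k
    rw [hamelMode_eq, norm_real, norm_eq_abs, abs_mul, abs_exp]
    refine (mul_le_of_le_one_left (abs_nonneg _) (exp_le_one_iff.2 (by linarith))).trans ?_
    fin_cases k <;> simp
    positivity
  have hB0 := h.nonneg
  have hA0 : ∀ n, 0 ≤ A n := fun n => (hgA n 0).nonneg
  set S : ℤ → ℝ := fun n => 2 * B n + 2 * ((|γ| + |α|) * B n) + ∑' m, B m * B (n - m) + A n with hS
  have hSs : Summable S := (((h.summ.mul_left 2).add ((h.summ.mul_left _).mul_left 2)).add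
    (summable_mul_shift h.summ hB0).2).add hA
  have hsh0 : ∀ n, 0 ≤ ∑' m, B m * B (n - m) := fun n => tsum_nonneg fun m => mul_nonneg (hB0 m) (hB0 _)
  have hTS : ∀ n k l, ∀ᵐ t ∂hl, ‖tm (flux α γ (fieldOf w) (gradOf w p) F) n k l t‖ ≤ S n := by
    intro n k l
    filter_upwards [tm_flux α γ (by linarith) hL hLT.1 hF hDM hFM, h.vm_fieldOf, h.tm_gradOf, hwB, hgB, hVn,
      hle (by linarith) (hFA n k l)] with t h1 h2 h3 h4 h5 h6 h7
    have hc : conv (vm (fieldOf w)) (vm (fieldOf w)) n k l t = conv w w n k l t := by simp only [conv, h2]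
    rw [h1, h2, h2, h3, hc]
    refine (norm_add_le _ _).trans (add_le_add ((norm_sub_le _ _).trans (add_le_add ?_ (norm_conv_le h.summ hB0 h4 n k l))) h7)
    have e1 : ‖hamelMode α γ k t * w n l t‖ ≤ (|γ| + |α|) * B n := by
      rw [norm_mul]; exact mul_le_mul (h6 k) (h4 n l) (norm_nonneg _) (by positivity)
    have e2 : ‖w n k t * hamelMode α γ l t‖ ≤ (|γ| + |α|) * B n := by
      rw [norm_mul, mul_comm]; exact mul_le_mul (h6 l) (h4 n k) (norm_nonneg _) (by positivity)
    have e3 := norm_sub_le (gradMode n (w n) (p n) k l t - hamelMode α γ k t * w n l t) (w n k t * hamelMode α γ l t)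
    have e4 := norm_sub_le (gradMode n (w n) (p n) k l t) (hamelMode α γ k t * w n l t)
    linarith [h5 n k l]
  have hgS : ∀ n k, ∀ᵐ t ∂hl, ‖vm g n k t‖ ≤ S n := by
    intro n k
    filter_upwards [hle (by linarith) (hgA n k)] with t ht
    refine ht.trans ?_
    have := mul_nonneg (show 0 ≤ |γ| + |α| by positivity) (hB0 n)
    have := hsh0 n
    have := hB0 n
    simp only [hS]
    linarith
  have hTM := norm_flux_le α γ hM hwM hDM hFM
  have key := hasSum_pairing (M := max (M + 2 * ((|γ| + |α|) * M) + M * M + M) M)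
    (aestronglyMeasurable_flux α γ hL.1 hLT.1 hF)
    (by filter_upwards [hTM] with x hx using hx.trans (le_max_left _ _)) hg
    (by filter_upwards [hgM] with x hx using hx.trans (le_max_right _ _)) hSs hTS hgS hφ
  -- The opposite mode of `φ` is an admissible test field for the equation on the mode `n`.
  have hzero : ∀ n : ℤ, ∫ t, rexp (2 * t) *
      (pairMode (flux α γ (fieldOf w) (gradOf w p) F) g φ n t).re ∂hl = 0 := by
    intro n
    have hη : ∀ k, Tst (vm φ (-n) k) := fun k => vm_tst hφ (-n) k
    have hdiv : ∀ t, deriv (vm φ (-n) 0) t + vm φ (-n) 0 t - I * n * vm φ (-n) 1 t = 0 := fun t => by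
      have := vm_div hφ.1 hd (-n) t
      push_cast at this
      linear_combination this
    have h1 := (hs n).eq _ hη hdiv
    have h2 : ∀ᵐ t ∂hl, rexp (2 * t) * (pairMode (flux α γ (fieldOf w) (gradOf w p) F) g φ n t).re =
        (modeInt α γ n (vm g n) (fun k l t => tm F n k l t - conv w w n k l t) (w n) (p n) (vm φ (-n)) t).re := by
      filter_upwards [pairing_eq_modeInt (g := g) α γ (by linarith) hL hLT.1 hF hDM hFM h.vm_fieldOf h.tm_gradOf] with t ht
      rw [← ht n (vm φ (-n)), ← re_ofReal_mul, pairMode]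
      simp only [tm_grad hφ.1]
      congr 2
      push_cast; rfl
    rw [integral_congr_ae h2]
    have hI : Integrable (modeInt α γ n (vm g n) (fun k l t => tm F n k l t - conv w w n k l t) (w n) (p n)
        (vm φ (-n))) hl :=
      modeInt_integrable (hs n).grG (hs n).grH (fun k => ((hs n).wd k).gr) (fun k => ((hs n).wd k).gr') hη
    have h3 := integral_re hI
    simp only [RCLike.re_eq_complex_re] at h3
    rw [h3, h1]; simp
  have h1 := key.unique (by simp only [hzero]; exact hasSum_zero)
  simpa [Real.pi_ne_zero] using h1

end RealModes

/-! ### Weak solutions near the Hamel flow -/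

lemma grad_add {φ ψ : VecField} (hφ : ContDiff ℝ ∞ φ) (hψ : ContDiff ℝ ∞ ψ) (x : Plane) :
    grad (fun x => φ x + ψ x) x = grad φ x + grad ψ x := by
  ext p
  simp [grad, pd, fderiv_fun_add (hφ.differentiable (by simp) x) (hψ.differentiable (by simp) x)]

lemma hasTrace_hamel_add (α γ : ℝ) {w : VecField} {Dw : TenField} (h : MemW120 w Dw) :
    HasTrace (fun x => hamel α γ x + w x) (fun x => grad (hamelExt α γ) x + Dw x) (bdry α γ) := by
  obtain ⟨-, -, -, φ, h1, h2, h3⟩ := h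
  have hle : volume.restrict (Ω ∩ Metric.ball (0 : Plane) 2) ≤ vol := Measure.restrict_mono inter_subset_left le_rfl
  refine ⟨fun k x => hamelExt α γ x + φ k x, fun k => (contDiff_hamelExt α γ).add (h1 k).1, ?_, ?_, ?_⟩
  · refine tendsto_zero_of_le h2 fun k => ?_
    refine (eLpNorm_mono_measure _ hle).trans (eLpNorm_congr_ae ?_).le
    filter_upwards [ae_hamelExt α γ] with x hx
    rw [hx]; abel
  · refine tendsto_zero_of_le h3 fun k => ?_
    refine (eLpNorm_mono_measure _ hle).trans (eLpNorm_congr_ae (ae_of_all _ fun x => ?_)).le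
    simp only [grad_add (contDiff_hamelExt α γ) (h1 k).1]
    abel
  · refine tendsto_const_nhds.congr fun k => ?_
    have : (fun t : ℝ => hamelExt α γ (polarPt 1 t) + φ k (polarPt 1 t) - bdry α γ (polarPt 1 t)) = 0 := by
      funext t
      have hn : ‖polarPt 1 t‖ = 1 := by
        have := norm_pol (0, t)
        simpa [pol] using this
      have h0 : φ k (polarPt 1 t) = 0 := (h1 k).eq_zero (by simp [Ω, hn])
      rw [hamelExt_eq α γ hn.ge, h0]
      ext i
      fin_cases i <;> simp [hamel, bdry, hn]
    rw [this, eLpNorm_zero]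

/-- A perturbation of the Hamel flow that vanishes at the boundary and satisfies the perturbed equations
is a weak solution. -/
lemma isWeakSolution_hamel_add (α γ : ℝ) {w g : VecField} {Dw F : TenField} {M : ℝ} (hM : 0 ≤ M)
    (h : MemW120 w Dw) (hs : HorizMemL2sigma w) (hF : AEStronglyMeasurable F vol) (hg : AEStronglyMeasurable g vol)
    (hwM : ∀ᵐ x ∂vol, ‖w x‖ ≤ M) (hDM : ∀ᵐ x ∂vol, ‖Dw x‖ ≤ M) (hFM : ∀ᵐ x ∂vol, ‖F x‖ ≤ M) (hgM : ∀ᵐ x ∂vol, ‖g x‖ ≤ M)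
    (he : ∀ φ : VecField, IsTest φ → (∀ x, divh φ x = 0) → ∫ x, pairing (flux α γ w Dw F) g φ x ∂vol = 0) :
    IsWeakSolution (bdry α γ) g F (fun x => hamel α γ x + w x) := by
  have hG := (isWeakGrad_hamel α γ).add h.1
  have htr := h.1.trace_eq_zero (hs.weakDivFree h.2.1)
  refine ⟨fun x => grad (hamelExt α γ) x + Dw x, hG, fun R => ?_, (memLp_grad_hamelExt α γ).add h.2.2.1,
    hG.weakDivFree ?_, hasTrace_hamel_add α γ h, fun φ hφ hd => (weak_iff α γ hM h.2.1.1 h.2.2.1.1 hF hg hwM hDM hFM hgM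
      (ae_of_all _ fun x => rfl) (ae_of_all _ fun x => rfl) hφ hd).2 (he φ hφ hd)⟩
  · have hle : volume.restrict (Ω ∩ Metric.ball (0 : Plane) R) ≤ vol := Measure.restrict_mono inter_subset_left le_rfl
    have : IsFiniteMeasure (volume.restrict (Ω ∩ Metric.ball (0 : Plane) R)) := ⟨by
      rw [Measure.restrict_apply_univ]
      exact (measure_mono inter_subset_right).trans_lt measure_ball_lt_top⟩
    exact (MemLp.of_bound ((aestronglyMeasurable_hamel α γ).mono_measure hle) _ (ae_mono hle (norm_hamel_le α γ))).add
      (h.2.1.mono_measure hle)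
  · filter_upwards [htr, trace_grad_hamelExt α γ] with x h1 h2
    simp only [PiLp.add_apply]
    linarith

/-! ### Modes of fields with zero trace -/

lemma fc_sub {M N : ℝ} {a b : ℝ → ℝ} (ha : BM M a) (hb : BM N b) (n : ℤ) :
    fc n (fun θ => a θ - b θ) = fc n a - fc n b := by
  have h1 := fc_add ha (hb.const_mul (-1)) n
  have h2 := fc_const_mul (-1) b n
  rw [h2] at h1
  simpa [sub_eq_add_neg] using h1

/-- The constant in the bound of the modes in `L¹(dt)` by the `L²` norm of the field. -/
noncomputable def modeConst : ℝ≥0∞ := eLpNorm (fun x : Plane => rexp (-2 * log ‖x‖)) 2 vol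

lemma modeConst_lt_top : modeConst < ⊤ :=
  (memLp_of_decay (s := 2) (C := 1) (Real.measurable_exp.comp (measurable_log_norm.const_mul (-2))).aestronglyMeasurable
    one_lt_two (ae_of_all _ fun x => by simp)).2

lemma enorm_fc_le (n : ℤ) (a : ℝ → ℝ) : ‖fc n a‖ₑ ≤ ∫⁻ θ, ‖a θ‖ₑ ∂circ := by
  have h1 : ‖((1 / (2 * π) : ℝ) : ℂ)‖ₑ ≤ 1 := by
    rw [← ofReal_norm, ENNReal.ofReal_le_one, norm_real, norm_eq_abs, abs_of_pos (by positivity),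
      div_le_one two_pi_pos]
    nlinarith [Real.pi_gt_three]
  rw [fc, enorm_mul]
  refine (mul_le_of_le_one_left zero_le h1).trans ((enorm_integral_le_lintegral_enorm _).trans (le_of_eq ?_))
  refine lintegral_congr fun θ => ?_
  rw [← ofReal_norm, ← ofReal_norm, norm_mul, norm_cexp_neg_I, mul_one, norm_real]

lemma lintegral_fc_le {E : Type} [NormedAddCommGroup E] [NormedSpace ℝ E] {v : Plane → E} (hv : AEStronglyMeasurable v vol)
    {c : ℝ → ℝ → ℝ} (hc : ∀ t θ, |c t θ| ≤ ‖v (pol (t, θ))‖) (n : ℤ) :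
    ∫⁻ t, ‖fc n (c t)‖ₑ ∂hl ≤ modeConst * eLpNorm v 2 vol := by
  have hl0 : Measurable fun x : Plane => rexp (-2 * log ‖x‖) :=
    Real.measurable_exp.comp (measurable_log_norm.const_mul (-2))
  have h0 : StronglyMeasurable (hv.mk v) := hv.stronglyMeasurable_mk
  have hm : Measurable fun x => ‖rexp (-2 * log ‖x‖)‖ₑ * ‖hv.mk v x‖ₑ := hl0.enorm.mul h0.enorm
  calc ∫⁻ t, ‖fc n (c t)‖ₑ ∂hl ≤ ∫⁻ t, ∫⁻ θ, ‖hv.mk v (pol (t, θ))‖ₑ ∂circ ∂hl := by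
        refine lintegral_mono_ae ?_
        filter_upwards [ae_ae_of_vol hv.ae_eq_mk] with t ht
        refine (enorm_fc_le n (c t)).trans (lintegral_mono_ae ?_)
        filter_upwards [ht] with θ hθ
        rw [← hθ, ← ofReal_norm, ← ofReal_norm]
        exact ENNReal.ofReal_le_ofReal (hc t θ)
    _ = ∫⁻ x, ‖rexp (-2 * log ‖x‖)‖ₑ * ‖hv.mk v x‖ₑ ∂vol := by
        rw [lintegral_vol _ hm, hlw, lintegral_withDensity_eq_lintegral_mul _ (by fun_prop)]
        · refine lintegral_congr fun t => ?_
          simp only [log_norm_pol, Pi.mul_apply]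
          rw [lintegral_const_mul' _ _ enorm_ne_top, ← mul_assoc, ← ofReal_norm, norm_eq_abs, abs_exp, ← ENNReal.ofReal_mul (exp_pos _).le, ← Real.exp_add]
          simp
        · exact Measurable.lintegral_prod_right' (f := fun p : ℝ × ℝ => ‖rexp (-2 * log ‖pol p‖)‖ₑ *
            ‖hv.mk v (pol p)‖ₑ) (hm.comp continuous_pol.measurable)
    _ = eLpNorm ((fun x : Plane => rexp (-2 * log ‖x‖)) • hv.mk v) 1 vol := by
        rw [eLpNorm_one_eq_lintegral_enorm]
        exact lintegral_congr fun x => (enorm_smul _ _).symm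
    _ ≤ modeConst * eLpNorm (hv.mk v) 2 vol :=
        eLpNorm_smul_le_mul_eLpNorm h0.aestronglyMeasurable hl0.aestronglyMeasurable
    _ = _ := by rw [eLpNorm_congr_ae hv.ae_eq_mk.symm]

lemma lintegral_vm_sub_le {v w : VecField} {M N : ℝ} (hv : AEStronglyMeasurable v vol) (hw : AEStronglyMeasurable w vol)
    (hvM : ∀ᵐ x ∂vol, ‖v x‖ ≤ M) (hwM : ∀ᵐ x ∂vol, ‖w x‖ ≤ N) (n : ℤ) (k : Fin 3) :
    ∫⁻ t, ‖vm v n k t - vm w n k t‖ₑ ∂hl ≤ modeConst * eLpNorm (fun x => v x - w x) 2 vol := by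
  refine le_trans (le_of_eq (lintegral_congr_ae ?_)) (lintegral_fc_le (hv.sub hw)
    (fun t θ => abs_cylVec_le (fun x => v x - w x) k t θ) n)
  filter_upwards [ae_bm_cylVec hv hvM k, ae_bm_cylVec hw hwM k] with t h1 h2
  rw [vm, vm, ← fc_sub h1 h2, ← funext (cylVec_sub v w k (rexp t))]

lemma lintegral_tm_sub_le {F H : TenField} {M N : ℝ} (hF : AEStronglyMeasurable F vol) (hH : AEStronglyMeasurable H vol)
    (hFM : ∀ᵐ x ∂vol, ‖F x‖ ≤ M) (hHM : ∀ᵐ x ∂vol, ‖H x‖ ≤ N) (n : ℤ) (k l : Fin 3) :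
    ∫⁻ t, ‖tm F n k l t - tm H n k l t‖ₑ ∂hl ≤ modeConst * eLpNorm (fun x => F x - H x) 2 vol := by
  refine le_trans (le_of_eq (lintegral_congr_ae ?_)) (lintegral_fc_le (hF.sub hH)
    (fun t θ => abs_cylTen_le (fun x => F x - H x) k l t θ) n)
  filter_upwards [ae_bm_cylTen hF hFM k l, ae_bm_cylTen hH hHM k l] with t h1 h2
  rw [tm, tm, ← fc_sub h1 h2, ← funext (cylTen_sub F H k l (rexp t))]

lemma ae_tendsto_of_tsum {f : ℕ → ℝ → ℂ} {g : ℝ → ℂ} {e : ℕ → ℝ≥0∞} (hf : ∀ j, AEStronglyMeasurable (f j) hl)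
    (hg : AEStronglyMeasurable g hl) (h : ∀ j, ∫⁻ t, ‖f j t - g t‖ₑ ∂hl ≤ modeConst * e j) (he : ∑' j, e j ≠ ⊤) :
    ∀ᵐ t ∂hl, Tendsto (fun j => f j t) atTop (𝓝 (g t)) := by
  have hm : ∀ j, AEMeasurable (fun t => ‖f j t - g t‖ₑ) hl := fun j => ((hf j).sub hg).enorm
  have h1 : ∫⁻ t, ∑' j, ‖f j t - g t‖ₑ ∂hl ≠ ⊤ := by
    rw [lintegral_tsum hm]
    refine ((ENNReal.tsum_le_tsum h).trans_lt ?_).ne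
    rw [ENNReal.tsum_mul_left]
    exact ENNReal.mul_lt_top modeConst_lt_top he.lt_top
  filter_upwards [ae_lt_top' (AEMeasurable.tsum hm) h1] with t ht
  rw [tendsto_iff_edist_tendsto_0]
  simpa only [edist_eq_enorm_sub] using ENNReal.tendsto_atTop_zero_of_tsum_ne_top ht.ne

lemma exists_seq_tsum {e e' : ℕ → ℝ≥0∞} (h : Tendsto e atTop (𝓝 0)) (h' : Tendsto e' atTop (𝓝 0)) :
    ∃ s : ℕ → ℕ, ∑' j, e (s j) ≠ ⊤ ∧ ∑' j, e' (s j) ≠ ⊤ := by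
  have h0 : ∀ j : ℕ, (0 : ℝ≥0∞) < 2⁻¹ ^ j := fun j => ENNReal.pow_pos (by simp) j
  choose s hs using fun j => ((h.eventually (ge_mem_nhds (h0 j))).and (h'.eventually (ge_mem_nhds (h0 j)))).exists
  have ht : ∑' j : ℕ, (2⁻¹ : ℝ≥0∞) ^ j < ⊤ := by
    rw [ENNReal.tsum_geometric, ENNReal.one_sub_inv_two, inv_inv]; simp
  exact ⟨s, ((ENNReal.tsum_le_tsum fun j => (hs j).1).trans_lt ht).ne, ((ENNReal.tsum_le_tsum fun j => (hs j).2).trans_lt ht).ne⟩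

lemma vm_eq_integral {φ : VecField} (h : IsTest φ) (n : ℤ) (k : Fin 3) (t : ℝ) :
    vm φ n k t = ∫ s in (0:ℝ)..t, cexp ((1:ℂ) * s) * tm (grad φ) n 0 k s := by
  have ht := vm_tst h n k
  have hd : deriv (vm φ n k) = fun s : ℝ => cexp ((1:ℂ) * s) * tm (grad φ) n 0 k s :=
    funext fun s => (hasDerivAt_vm h.1 n k s).deriv
  rw [intervalIntegral.integral_eq_sub_of_hasDerivAt (fun s _ => hasDerivAt_vm h.1 n k s)
    ((hd ▸ ht.deriv.smooth.continuous).intervalIntegrable _ _), ht.eq_zero_of_nonpos le_rfl, sub_zero]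

lemma exists_norm_le_of_test {E : Type} [NormedAddCommGroup E] {f : Plane → E} (h : Continuous f) (hc : HasCompactSupport f) :
    ∃ M, ∀ᵐ x ∂vol, ‖f x‖ ≤ M := by
  obtain ⟨M, hM⟩ := h.bounded_above_of_compact_support hc
  exact ⟨M, ae_of_all _ hM⟩

lemma continuous_gradMode_apply (n : ℤ) (k l : Fin 3) (t : ℝ) :
    Continuous fun q : (Fin 3 → ℂ) × (Fin 3 → ℂ) => gradMode n (fun j _ => q.1 j) (fun j _ => q.2 j) k l t := by
  unfold gradMode
  fin_cases k <;> fin_cases l <;> simp <;> fun_prop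

/-- The modes of a field in `W^{1,2}_0` are primitives, from the boundary, of the modes of its radial derivative. -/
lemma MemW120.modes {w : VecField} {Dw : TenField} (h : MemW120 w Dw) {M : ℝ}
    (hwM : ∀ᵐ x ∂vol, ‖w x‖ ≤ M) (hDM : ∀ᵐ x ∂vol, ‖Dw x‖ ≤ M) :
    ∀ᵐ t : ℝ ∂hl, ∀ n : ℤ, (∀ k, vm w n k t = ∫ s in (0:ℝ)..t, cexp ((1:ℂ) * s) * tm Dw n 0 k s) ∧
      ∀ k l, tm Dw n k l t = gradMode n (vm w n) (fun j t => cexp ((1:ℂ) * t) * tm Dw n 0 j t) k l t := by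
  obtain ⟨-, hw, hD, φ, h1, h2, h3⟩ := h
  obtain ⟨s, hs, hs'⟩ := exists_seq_tsum h2 h3
  have hcg : ∀ j, Continuous (grad (φ j)) := fun j => continuous_grad (h1 j).1
  choose N hN using fun j => exists_norm_le_of_test (h1 j).1.continuous (h1 j).2.1
  choose N' hN' using fun j => exists_norm_le_of_test (hcg j) (hasCompactSupport_grad (h1 j))
  -- The `L²` errors are summable along the indices `s j`, so that all modes converge almost everywhere.
  have bv := fun j n k => lintegral_vm_sub_le (h1 (s j)).1.continuous.aestronglyMeasurable hw.1 (hN (s j)) hwM n k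
  have bt := fun j n k l => lintegral_tm_sub_le (hcg (s j)).aestronglyMeasurable hD.1 (hN' (s j)) hDM n k l
  have mt := fun j n k l => aestronglyMeasurable_tm (hcg j).aestronglyMeasurable n k l
  have cv : ∀ᵐ t ∂hl, ∀ n k, Tendsto (fun j => vm (φ (s j)) n k t) atTop (𝓝 (vm w n k t)) :=
    ae_all_iff.2 fun n => ae_all_iff.2 fun k => ae_tendsto_of_tsum
      (fun j => aestronglyMeasurable_vm (h1 (s j)).1.continuous.aestronglyMeasurable n k)
      (aestronglyMeasurable_vm hw.1 n k) (fun j => bv j n k) hs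
  have ct : ∀ᵐ t ∂hl, ∀ n k l, Tendsto (fun j => tm (grad (φ (s j))) n k l t) atTop (𝓝 (tm Dw n k l t)) :=
    ae_all_iff.2 fun n => ae_all_iff.2 fun k => ae_all_iff.2 fun l => ae_tendsto_of_tsum
      (fun j => mt (s j) n k l) (aestronglyMeasurable_tm hD.1 n k l) (fun j => bt j n k l) hs'
  filter_upwards [cv, ct, hl_pos] with t hv ht h0 n
  refine ⟨fun k => tendsto_nhds_unique (hv n k) ?_, fun k l => tendsto_nhds_unique (ht n k l) ?_⟩
  · simp only [vm_eq_integral (h1 _), intervalIntegral.integral_of_le h0.le]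
    have hle : volume.restrict (Ioc 0 t) ≤ hl := Measure.restrict_mono Ioc_subset_Ioi_self le_rfl
    have hm : ∀ {f : ℝ → ℂ}, AEStronglyMeasurable f hl →
        AEStronglyMeasurable (fun s : ℝ => cexp ((1:ℂ) * s) * f s) (volume.restrict (Ioc 0 t)) := fun hf =>
      (continuous_cexp_mul 1).aestronglyMeasurable.mul (hf.mono_measure hle)
    have hb : ∀ {H : TenField} {K : ℝ}, AEStronglyMeasurable H vol → (∀ᵐ x ∂vol, ‖H x‖ ≤ K) →
        Bd 0 K (tm H n 0 k) := fun hH hK => ⟨aestronglyMeasurable_tm hH n 0 k, by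
      filter_upwards [ae_bm_cylTen hH hK 0 k] with s hs
      rw [neg_zero, zero_mul, Real.exp_zero, mul_one]
      exact norm_fc_le hs.2 n⟩
    refine tendsto_integral_of_L1' _ (hm (aestronglyMeasurable_tm hD.1 n 0 k)) (Eventually.of_forall fun j =>
      ((hb (hcg (s j)).aestronglyMeasurable (hN' (s j))).gr.exp_mul 1).integrableOn t) ?_
    have hz := ENNReal.Tendsto.const_mul (a := ofReal (rexp t) * modeConst)
      (ENNReal.tendsto_atTop_zero_of_tsum_ne_top hs') (Or.inr (ENNReal.mul_lt_top ENNReal.ofReal_lt_top modeConst_lt_top).ne)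
    rw [mul_zero] at hz
    refine tendsto_zero_of_le hz fun j => ?_
    simp only [eLpNorm_one_eq_lintegral_enorm, mul_assoc]
    refine le_trans ?_ (mul_le_mul_right (bt j n 0 k) _)
    rw [← lintegral_const_mul' _ _ ENNReal.ofReal_ne_top]
    refine le_trans (setLIntegral_mono' measurableSet_Ioc fun r hr => ?_) (lintegral_mono' hle le_rfl)
    rw [Pi.sub_apply, ← mul_sub, enorm_mul]
    gcongr
    rw [← ofReal_norm, norm_cexp_mul]
    exact ENNReal.ofReal_le_ofReal (Real.exp_le_exp.2 (by simpa using hr.2))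
  · have e1 : ∀ j, tm (grad (φ (s j))) n k l t = gradMode n (fun i _ => vm (φ (s j)) n i t)
        (fun i _ => cexp ((1:ℂ) * t) * tm (grad (φ (s j))) n 0 i t) k l t := fun j => by
      rw [tm_grad (h1 (s j)).1]
      simp only [gradMode, (hasDerivAt_vm (h1 (s j)).1 n _ t).deriv]
    simp only [e1]
    have hc := (tendsto_pi_nhds.2 fun i => hv n i).prodMk_nhds
      (tendsto_pi_nhds.2 fun i => (ht n 0 i).const_mul (cexp ((1:ℂ) * t)))
    have hd := ((continuous_gradMode_apply n k l t).tendsto _).comp hc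
    simp only [gradMode, Function.comp_def] at hd ⊢
    exact hd

/-! ### From a weak solution to its modes -/

lemma cylTen_trace (F : TenField) (r θ : ℝ) :
    cylTen F 0 0 r θ + cylTen F 1 1 r θ = F (polarPt r θ) (0, 0) + F (polarPt r θ) (1, 1) := by
  have h := sin_sq_add_cos_sq θ
  simp [cylTen, Fin.sum_univ_three, frame]
  linear_combination (F (polarPt r θ) (0, 0) + F (polarPt r θ) (1, 1)) * h

lemma tm_trace {F : TenField} {M : ℝ} (hF : AEStronglyMeasurable F vol) (hM : ∀ᵐ x ∂vol, ‖F x‖ ≤ M)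
    (h : ∀ᵐ x ∂vol, F x (0, 0) + F x (1, 1) = 0) : ∀ᵐ t ∂hl, ∀ n, tm F n 0 0 t + tm F n 1 1 t = 0 := by
  filter_upwards [ae_bm_cylTen hF hM 0 0, ae_bm_cylTen hF hM 1 1, ae_ae_of_vol h] with t h0 h1 h2 n
  rw [tm, tm, ← fc_add h0 h1, fc_congr (b := fun _ => 0), fc_const]
  · split_ifs <;> simp
  · filter_upwards [h2] with θ hθ
    rw [cylTen_trace]
    exact hθ

lemma modeInt_const_mul (α γ : ℝ) (n : ℤ) (G : ModeVec) (H : ModeTen) (w p : ModeVec)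
    {η : ModeVec} (hη : ∀ k, Tst (η k)) (c : ℂ) (t : ℝ) :
    modeInt α γ n G H w p (fun k t => c * η k t) t = c * modeInt α γ n G H w p η t := by
  have hd : ∀ k, deriv (fun t => c * η k t) t = c * deriv (η k) t := fun k =>
    deriv_const_mul c ((hη k).differentiable t)
  simp only [modeInt_eq, horInt, verInt, hd]
  ring

section Uniqueness

variable {α γ ρ δ : ℝ} {g : VecField} {F : TenField} {A : ℤ → ℝ} {M : ℝ}

/-- The modes of a weak solution near the Hamel flow solve the equations for the modes. -/
lemma IsWeakSolution.exists_nonlinSol (hρ : 2 < ρ) (hδ : 0 ≤ δ) (hg : AEStronglyMeasurable g vol)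
    (hF : AEStronglyMeasurable F vol) (hM : 0 ≤ M) (hgM : ∀ᵐ x ∂vol, ‖g x‖ ≤ M) (hFM : ∀ᵐ x ∂vol, ‖F x‖ ≤ M)
    (hgA : ∀ n k, Bd (2 * ρ - 1) (A n) (vm g n k)) (hFA : ∀ n k l, Bd (2 * (ρ - 1)) (A n) (tm F n k l))
    {u : VecField} (hu : IsWeakSolution (bdry α γ) g F u) (hb : InBall ρ δ fun x => u x - hamel α γ x) :
    ∃ W P : ℤ → ModeVec, NonlinSol α γ ρ (vm g) (tm F) W P ∧
      (∃ B : ℤ → ℝ, Summable B ∧ ∑' n, B n ≤ δ ∧ ∀ n k, Bd (ρ - 1) (B n) (W n k)) ∧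
      ∀ᵐ t ∂hl, ∀ n k, vm (fun x => u x - hamel α γ x) n k t = W n k t := by
  obtain ⟨Dw, hW, hS, hL, hT, hn⟩ := hb
  obtain ⟨Du, hG, -, -, -, -, he⟩ := hu
  set w : VecField := fun x => u x - hamel α γ x with hwdef
  have hs0 : 0 ≤ ρ - 1 := by linarith
  have hDm := hT.1
  have hDu : ∀ᵐ x ∂vol, Du x = grad (hamelExt α γ) x + Dw x := by
    refine hG.unique (((isWeakGrad_hamel α γ).add hW.1).congr (ae_of_all _ fun x => ?_) (ae_eq_refl _))
    simp [w]
  have hwK := hL.norm_le_const hs0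
  have hDK := hT.norm_le_const (by linarith)
  set K₁ := ∑' n, amp (ρ - 1) (fun n => projVec n w) n
  set K₂ := ∑' n, amp ρ (fun n => projTen n Dw) n
  have hK₁ : 0 ≤ K₁ := tsum_nonneg fun n => amp_nonneg _ _ _
  have hK₂ : 0 ≤ K₂ := tsum_nonneg fun n => amp_nonneg _ _ _
  set K := M + K₁ + K₂
  have hwK' : ∀ᵐ x ∂vol, ‖w x‖ ≤ K := by filter_upwards [hwK] with x hx using hx.trans (by simp only [K]; linarith)
  have hDK' : ∀ᵐ x ∂vol, ‖Dw x‖ ≤ K := by filter_upwards [hDK] with x hx using hx.trans (by simp only [K]; linarith)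
  have hgK : ∀ᵐ x ∂vol, ‖g x‖ ≤ K := by filter_upwards [hgM] with x hx using hx.trans (by simp only [K]; linarith)
  have hFK : ∀ᵐ x ∂vol, ‖F x‖ ≤ K := by filter_upwards [hFM] with x hx using hx.trans (by simp only [K]; linarith)
  have hK : 0 ≤ K := by positivity
  set P : ℤ → ModeVec := fun n k t => cexp ((1:ℂ) * t) * tm Dw n 0 k t with hP
  have hPb : ∀ n k, Bd (ρ - 1) (amp ρ (fun n => projTen n Dw) n) (P n k) := fun n k =>
    (bd_tm hDm (amp_nonneg _ _ _) (wnorm_le_amp hT.2.2 n) 0 k).of_exp 1 (by simp)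
  -- `W` is the continuous representative of the modes of `w`, the primitive of those of `∂_t w`.
  set W : ℤ → ModeVec := fun n k => solveFwd 0 0 (P n k) with hWdef
  have hmodes := hW.modes hwK' hDK'
  have hWeq : ∀ᵐ t ∂hl, ∀ n k, vm w n k t = W n k t := by
    filter_upwards [hmodes, hl_pos] with t ht h0 n k
    rw [(ht n).1 k, hWdef]
    simp only [solveFwd, zero_mul, neg_zero, Complex.exp_zero, one_mul, zero_add]
    rw [intervalIntegral.integral_of_le h0.le, intervalIntegral.integral_of_le h0.le]
    refine setIntegral_congr_fun measurableSet_Ioc fun s hs => ?_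
    rw [indicator_of_mem (show s ∈ Ioi (0:ℝ) from hs.1)]
    simp [hP]
  have hPeq : ∀ᵐ t ∂hl, ∀ n k l, tm Dw n k l t = gradMode n (W n) (P n) k l t := by
    filter_upwards [hmodes, hWeq] with t ht h1 n k l
    rw [(ht n).2 k l]
    simp only [gradMode, h1, hP]
  have hWb : ∀ n k, Bd (ρ - 1) (amp (ρ - 1) (fun n => projVec n w) n) (W n k) := fun n k =>
    (hL.bd n k).congr (by filter_upwards [hWeq] with t ht using ht n k)
  have hconv : ∀ n k l, Gr (conv W W n k l) := by
    intro n k l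
    have h1 : Bd 0 (K * K) (tm (fun x => tensorSq (w x)) n k l) := by
      refine ⟨aestronglyMeasurable_tm (aestronglyMeasurable_outer hL.1 hL.1) n k l, ?_⟩
      have : ∀ᵐ x ∂vol, ‖tensorSq (w x)‖ ≤ K * K := by
        filter_upwards [hwK'] with x hx
        rw [tensorSq_eq, norm_outer]
        gcongr
      filter_upwards [ae_bm_cylTen (aestronglyMeasurable_outer hL.1 hL.1) this k l] with t ht
      rw [neg_zero, zero_mul, Real.exp_zero, mul_one]
      exact norm_fc_le ht.2 n
    refine h1.gr.congr ?_
    filter_upwards [hL.tm_tensorSq hs0, hWeq] with t h2 h3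
    rw [h2]
    simp only [conv, h3]
  have hwd : ∀ n k, WD (W n k) (P n k) := fun n k => by
    have := solveFwd_wd (lam := 0) (c := 0) (hPb n k).gr
    simpa using this
  have hgrG : ∀ n k, Gr (vm g n k) := fun n k => (hgA n k).gr
  have hgrH : ∀ n k l, Gr (fun t => tm F n k l t - conv W W n k l t) := fun n k l => (hFA n k l).gr.sub (hconv n k l)
  -- Testing with the real part of a mode gives the real part of the mode equation.
  have hre : ∀ (n : ℤ) (η : ModeVec), (∀ k, Tst (η k)) → (∀ t, deriv (η 0) t + η 0 t - I * n * η 1 t = 0) →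
      (∫ t, modeInt α γ n (vm g n) (fun k l t => tm F n k l t - conv W W n k l t) (W n) (P n) η t ∂hl).re = 0 := by
    intro n η hη hd
    have hφ := isTest_modeField (n := -n) hη
    have hφd := divh_modeField (n := -n) hη fun t => by
      have := hd t
      push_cast
      linear_combination this
    have h1 := (weak_iff α γ hK hL.1 hDm hF hg hwK' hDK' hFK hgK
      (ae_of_all _ fun x => by simp [w]) hDu hφ hφd).1 (he _ hφ hφd)
    rw [integral_pairing_modeField (M := max (K + 2 * ((|γ| + |α|) * K) + K * K + K) K)
      (aestronglyMeasurable_flux α γ hL.1 hDm hF)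
      (by filter_upwards [norm_flux_le α γ hK hwK' hDK' hFK] with x hx using hx.trans (le_max_left _ _)) hg
      (by filter_upwards [hgK] with x hx using hx.trans (le_max_right _ _)) n hη] at h1
    have h2 := (mul_eq_zero.1 h1).resolve_left (by positivity)
    have hI : Integrable (modeInt α γ n (vm g n) (fun k l t => tm F n k l t - conv W W n k l t) (W n) (P n) η) hl :=
      modeInt_integrable (hgrG n) (hgrH n) (fun k => (hwd n k).gr) (fun k => (hwd n k).gr') hη
    have h3 := integral_re hI
    simp only [RCLike.re_eq_complex_re] at h3
    rw [← h3, ← h2]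
    refine integral_congr_ae ?_
    filter_upwards [pairing_eq_modeInt (g := g) α γ hs0 hL hDm hF hDK' hFK hWeq hPeq] with t ht
    rw [← ht n η, ← re_ofReal_mul]
    congr 2
    push_cast; rfl
  refine ⟨W, P, fun n => ⟨hgrG n, hgrH n, fun k => solveFwd_continuous (hPb n k).gr, fun k t ht => ?_, hwd n, ?_,
    ⟨max (amp (ρ - 1) (fun n => projVec n w) n) (amp ρ (fun n => projTen n Dw) n), fun k =>
      ⟨(hWb n k).mono le_rfl (le_max_left _ _) ((amp_nonneg _ _ _).trans (le_max_left _ _)),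
        (hPb n k).mono le_rfl (le_max_right _ _) ((amp_nonneg _ _ _).trans (le_max_left _ _))⟩⟩, fun η hη hd => ?_⟩,
    ⟨_, summable_amp hL.2.2, ?_, hWb⟩, hWeq⟩
  · change solveFwd 0 0 (P n k) t = 0
    rw [solveFwd, intervalIntegral.integral_symm, intervalIntegral.integral_of_le ht,
      setIntegral_eq_zero_of_forall_eq_zero fun s hs => indicator_of_notMem (by simpa using hs.2) _]
    simp
  · filter_upwards [tm_trace hDm hDK (hW.1.trace_eq_zero (hS.weakDivFree hW.2.1)), hPeq] with t h1 h2
    have h3 := h1 n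
    rw [h2, h2] at h3
    simp only [gradMode, ← mul_add] at h3
    have := (mul_eq_zero.1 h3).resolve_left (Complex.exp_ne_zero _)
    simp at this
    linear_combination this
  · have h1 := hre n η hη hd
    -- The test field `-I η` gives the imaginary part.
    have h2 := hre n (fun k t => -I * η k t) (fun k => (hη k).const_mul _) fun t => by
      rw [deriv_const_mul _ ((hη 0).differentiable t)]
      linear_combination (-I) * hd t
    simp only [modeInt_const_mul α γ n _ _ _ _ hη, integral_const_mul] at h2
    refine Complex.ext h1 ?_
    simpa using h2
  · rw [tsum_amp hL.2.2]
    exact ENNReal.toReal_le_of_le_ofReal hδ (le_self_add.trans hn)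

/-- Fields with the same modes are equal. -/
lemma MemL1Vec.ae_eq {s s' : ℝ} {v w : VecField} (hv : MemL1Vec s v) (hw : MemL1Vec s' w)
    (h : ∀ᵐ t ∂hl, ∀ n k, vm v n k t = vm w n k t) : v =ᵐ[vol] w := by
  filter_upwards [hv.2.1, hw.2.1, quasiMeasurePreserving_log_norm.ae h, ae_vol_pos] with x h1 h2 h3 h0
  have e : ∀ n k, fourierMode n (cylVec v k) ‖x‖ = fourierMode n (cylVec w k) ‖x‖ := fun n k => by
    have := h3 n k
    rwa [vm, vm, exp_log (norm_pos_of_log h0), ← fourierMode_eq, ← fourierMode_eq] at this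
  have e2 : (fun n => projVec n v x) = fun n => projVec n w x := funext fun n => by simp only [projVec, e]
  rw [e2] at h1
  have := h1.unique h2
  ext j
  exact Complex.ofReal_injective (congrArg (fun a : Vec ℂ => a j) this)

end Uniqueness

end ExtNS

theorem theorem1p1 (α γ ρ : ℝ) (hγ : 2 < γ) (hρ : 2 < ρ) (hρ3 : ρ < 3) (hργ : ρ ≤ γ) :
    ∃ ε : ℝ, 0 < ε ∧ ∃ δ : ℝ, 0 < δ ∧
      ∀ (g : ExtNS.Plane → ExtNS.Vec ℝ) (F : ExtNS.Plane → ExtNS.Ten ℝ),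
        ExtNS.MemWeighted (2 * ρ - 1) g → ExtNS.MemWeighted (2 * (ρ - 1)) F →
        ∑' n : ℤ, (ExtNS.wnorm (2 * ρ - 1) (ExtNS.projVec n g)
          + ExtNS.wnorm (2 * (ρ - 1)) (ExtNS.projTen n F)) ≤ ENNReal.ofReal ε →
        ∃ u : ExtNS.Plane → ExtNS.Vec ℝ,
          ExtNS.IsWeakSolution (ExtNS.bdry α γ) g F u ∧
          ExtNS.InBall ρ δ (fun x => u x - ExtNS.hamel α γ x) ∧
          (∀ u' : ExtNS.Plane → ExtNS.Vec ℝ,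
            ExtNS.IsWeakSolution (ExtNS.bdry α γ) g F u' →
            ExtNS.InBall ρ δ (fun x => u' x - ExtNS.hamel α γ x) →
            u' =ᵐ[ExtNS.vol] u) ∧
          (fun x => u x - ExtNS.hamel α γ x)
            =O[Bornology.cobounded ExtNS.Plane ⊓ ae ExtNS.vol]
              (fun x => ‖x‖ ^ (-ρ + 1)) := by
  open ExtNS in
  obtain ⟨C, hC1, hC⟩ := exists_nonlinSol α γ ρ hγ hρ hρ3 hργ
  -- `r` is so small that the ball of radius `δ = r / 3` contains the solution, whose norm is at most
  -- `21 * (2 * C * r ^ 2)`, and lies in the ball of uniqueness.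
  set r : ℝ := 1 / (126 * C) with hr
  have hr0 : 0 < r := by positivity
  have hCr : 126 * C * r = 1 := by rw [hr]; field_simp
  refine ⟨r ^ 2, by positivity, r / 3, by positivity, fun g F hg hF hε => ?_⟩
  obtain ⟨A, hA, hAr, hgA, hFA⟩ := exists_data (by positivity) hg.1 hF.1 hε
  obtain ⟨⟨w, p, hsol, hconj, B, hB, hBr, hb⟩, huniq⟩ := hC r hr0 (by linarith) (vm g) (tm F) A hA hAr hgA hFA
    (fun n k t => fc_neg _ n) (fun n k l t => fc_neg _ n)
  have hm := hsol.realModes hconj hB hb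
  have hball : InBall ρ (r / 3) (fieldOf w) := hm.inBall hρ hsol (by nlinarith)
  obtain ⟨hW, hS⟩ := hm.memW120_sigma hρ hsol
  obtain ⟨M₁, hM₁, hgM⟩ := hg.norm_le (by linarith)
  obtain ⟨M₂, hM₂, hFM⟩ := hF.norm_le (by linarith)
  have hL := hm.memL1Vec_fieldOf.1
  have hT := hm.memL1Ten_gradOf.1
  obtain ⟨M, hM, hgM, hFM, hwM, hDM⟩ : ∃ M, 0 ≤ M ∧ (∀ᵐ x ∂vol, ‖g x‖ ≤ M) ∧ (∀ᵐ x ∂vol, ‖F x‖ ≤ M) ∧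
      (∀ᵐ x ∂vol, ‖fieldOf w x‖ ≤ M) ∧ ∀ᵐ x ∂vol, ‖gradOf w p x‖ ≤ M := by
    obtain ⟨M₃, h3⟩ : ∃ M, ∀ᵐ x ∂vol, ‖fieldOf w x‖ ≤ M := ⟨_, hL.norm_le_const (by linarith)⟩
    obtain ⟨M₄, h4⟩ : ∃ M, ∀ᵐ x ∂vol, ‖gradOf w p x‖ ≤ M := ⟨_, hT.norm_le_const (by linarith)⟩
    refine ⟨max (max M₁ M₂) (max M₃ M₄), le_max_of_le_left (le_max_of_le_left hM₁), ?_, ?_, ?_, ?_⟩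
    · filter_upwards [hgM] with x hx using hx.trans ((le_max_left _ _).trans (le_max_left _ _))
    · filter_upwards [hFM] with x hx using hx.trans ((le_max_right _ _).trans (le_max_left _ _))
    · filter_upwards [h3] with x hx using hx.trans ((le_max_left _ _).trans (le_max_right _ _))
    · filter_upwards [h4] with x hx using hx.trans ((le_max_right _ _).trans (le_max_right _ _))
  have hu : IsWeakSolution (bdry α γ) g F (fun x => hamel α γ x + fieldOf w x) :=
    isWeakSolution_hamel_add α γ hM hW hS hF.1 hg.1 hwM hDM hFM hgM fun φ hφ hd =>
      hm.integral_pairing_eq_zero hρ hsol hA hM hg.1 hF.1 hgM hFM hgA hFA hwM hDM hφ hd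
  have hsub : (fun x => hamel α γ x + fieldOf w x - hamel α γ x) = fieldOf w := funext fun x => add_sub_cancel_left _ _
  have hball' : InBall ρ (r / 3) (fun x => hamel α γ x + fieldOf w x - hamel α γ x) := by rw [hsub]; exact hball
  refine ⟨fun x => hamel α γ x + fieldOf w x, hu, hball', fun u' hu' hb' => ?_, ?_⟩
  · obtain ⟨W, P, hWP, ⟨b, hb1, hb2, hb3⟩, hv⟩ :=
      hu.exists_nonlinSol hρ (by positivity) hg.1 hF.1 hM hgM hFM hgA hFA hball'
    obtain ⟨W', P', hWP', ⟨b', hb1', hb2', hb3'⟩, hv'⟩ :=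
      hu'.exists_nonlinSol hρ (by positivity) hg.1 hF.1 hM hgM hFM hgA hFA hb'
    have hWW : W = W' := huniq W P W' P' hWP hWP' ⟨b, hb1, by linarith, hb3⟩ ⟨b', hb1', by linarith, hb3'⟩
    obtain ⟨D', -, -, hL', -⟩ := hb'
    have h := hL'.ae_eq hL (by
      rw [hsub] at hv
      filter_upwards [hv, hv'] with t h1 h2 n k
      rw [h1, h2, hWW])
    filter_upwards [h] with x hx
    rw [← hx, add_sub_cancel]
  · rw [hsub]
    refine Asymptotics.IsBigO.of_bound (3 * ∑' n, B n) (Eventually.filter_mono inf_le_right ?_)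
    filter_upwards [hm.norm_fieldOf_le, ae_vol_pos] with x hx h0
    refine hx.trans (le_of_eq ?_)
    rw [Real.norm_of_nonneg (Real.rpow_nonneg (norm_nonneg _) _), Real.rpow_def_of_pos (norm_pos_of_log h0)]
    congr 2
    ring
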